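/- **Setting.** Let $\mathfrak K:\mathbb R^2\to[0,1]$ be a rotation invariant $C^2$ function supported in the ball of radius $3$ with $\int\mathfrak K=1$, $\int\mathfrak K(x)|x|^2dx=4$. For $0<\gamma<\frac13$ put $\delta=\gamma$ and, in the *first regime*, $N=\lfloor\gamma^{-2}\rfloor$, $\alpha=\gamma^2$; in the *second regime*, $N=\lfloor\gamma^{-3}\rfloor$, $\alpha=\gamma^4$; in both $\varepsilon=\frac2{2N+1}$. Let $\Lambda_N=\mathbb Z^2/(2N+1)\mathbb Z^2$, $\Lambda_\varepsilon=\varepsilon\Lambda_N\subset\mathbb T^2=[-1,1]^2$, $\kappa_\gamma(0)=0$ and $\kappa_\gamma(k)=\mathfrak K(\gamma k)/\sum_{j\ne0}\mathfrak K(\gamma j)$ for $k\neq 0$. The Glauber dynamics $\sigma(t)\in\{-1,0,1\}^{\Lambda_N}$ is the càdlàg Markov jump process with arbitrary initial configuration in which the spin at $j$ is updated to $\bar\sigma\in\{-1,0,1\}$ at rate $$c_\gamma(\sigma,j,\bar\sigma)=\frac{e^{\bar\sigma\beta h_\gamma(\sigma,j)+\bar\sigma^2\theta}}{\sum_{b\in\{-1,0,1\}}e^{b\beta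 h_\gamma(\sigma,j)+b^2\theta}},\qquad h_\gamma(\sigma,k)=\sum_j\kappa_\gamma(k-j)\sigma(j);$$ $\mathscr L_\gamma$ is its generator and $a=e^\theta$. Let $X_\gamma(t,x)=\delta^{-1}h_\gamma(\sigma(t/\alpha),x/\varepsilon)$, $X^0_\gamma=X_\gamma(0)$, and $M_\gamma(t,x)=\delta^{-1}m_\gamma(t/\alpha,x/\varepsilon)$ with $m_\gamma(t,k)=h_\gamma(\sigma(t),k)-h_\gamma(\sigma(0),k)-\int_0^t\mathscr L_\gamma h_\gamma(\sigma(s),k)\,ds$. Put $K_\gamma(x)=\varepsilon^{-2}\kappa_\gamma(x/\varepsilon)$, $f\star_\varepsilon g(x)=\sum_{z\in\Lambda_\varepsilon}\varepsilon^2f(x-z)g(z)$, $\hat K_\gamma(\omega)=\sum_{x\in\Lambda_\varepsilon}\varepsilon^2K_\gamma(x)e^{-i\pi\omega\cdot x}$, and let $P^\gamma_t$ have the Fourier coefficients $\exp(t\alpha^{-1}(\hat K_\gamma(\omega)-1))$, $\omega\in\{-N,\dots,N\}^2$. Functions on $\Lambda_\varepsilon$ (including the kernels) are extended to $\mathbb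 T^2$ as trigonometric polynomials of degree $\le N$, with the same notation; $\star$ is convolution on $\mathbb T^2$. For $s\le t$ let $R_{\gamma,t}(s,\cdot)=\int_0^sP^\gamma_{t-r}\,dM_\gamma(r,\cdot)$, $Z_\gamma(t)=R_{\gamma,t}(t)$, and for $x\in\Lambda_\varepsilon$ let $[R_{\gamma,t}(\cdot,x)]_s$ and $\langle R_{\gamma,t}(\cdot,x)\rangle_s$ be its quadratic variation (the sum of its squared jumps up to $s$) and its predictable quadratic variation (the time integral of squared jumps weighted with their rates), $Q_{\gamma,t}(s,x)=[R_{\gamma,t}(\cdot,x)]_s-\langle R_{\gamma,t}(\cdot,x)\rangle_s$, and $$\tilde E_t(s,x)=\int_0^s\sum_{z\in\Lambda_\varepsilon}\varepsilon^2\big(P^\gamma_{t-r}\star_\varepsilon K_\gamma\big)^2(z-x)\Big(\sum_{\bar\sigma\in\{-1,0,1\}}(\bar\sigma-\sigma(\tfrac r\alpha,\tfrac z\varepsilon))^2c_\gamma(\sigma(\tfrac r\alpha),\tfrac z\varepsilon,\bar\sigma)-\frac2{\beta_c}\Big)dr .$$ On $\Lambda_\varepsilon$ let $\tilde E(s,x)=\tilde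 E_s(s,x)$ and $\mathfrak c_\gamma(s,x)=[R_{\gamma,s}(\cdot,x)]_s$ (both then extended to $\mathbb T^2$). Let $$\mathfrak c_\gamma=\frac1{4\beta_c}\sum_{0\ne\omega\in\{-N,\dots,N\}^2}\frac{|\hat K_\gamma(\omega)|^2}{\alpha^{-1}(1-\hat K_\gamma(\omega))},\qquad \bar{\mathfrak c}(s)=\frac s{2\beta_c}-\frac1{\beta_c}\sum_{0\ne\omega\in\mathbb Z^2}\frac{e^{-2s\pi^2|\omega|^2}}{4\pi^2|\omega|^2}.$$ With $\delta_k$, $k\ge-1$, the Littlewood–Paley blocks of a smooth radial dyadic partition of unity (block $k\ge0$ supported in $\frac34 2^k\le|\omega|\le\frac83 2^k$, block $-1$ in $|\omega|\le\frac43$), put $\|f\|_{\mathcal C^{-\nu}}=\sup_{k\ge-1}2^{-\nu k}\|\delta_kf\|_{L^\infty}$ and $X_\gamma^{\mathrm{high}}=\sum_{2^k\ge N/20}\delta_kX_\gamma$. **Parameters.** *First regime:* $a_c>0$ and $\beta_c$ satisfy $\frac{2a_c}{2a_c+1}\beta_c=1$, $\mathfrak a_1\in\mathbb R$, $a=a(\gamma)$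 with $a-a_c=O(\gamma^2)$, and, for small $\gamma$, $\beta=\beta(\gamma)$ satisfies $\frac{2a}{2a+1}\beta-1=\gamma^2\big(\frac{a_c(4a_c-1)}{(2a_c+1)^2}\beta_c^3\,\mathfrak c_\gamma+\mathfrak a_1\big)$. Put $\mathfrak a_1(s)=\mathfrak a_1-\frac{a_c(4a_c-1)\beta_c^3}{(2a_c+1)^2}\bar{\mathfrak c}(s)$. *Second regime:* $\beta_c=3$, $\mathfrak a_1,\mathfrak a_3\in\mathbb R$, and $$a=\tfrac14-\gamma^2\big(\tfrac98\mathfrak c_\gamma+\tfrac{\mathfrak a_3}4\big)+\tfrac5{48}\gamma^4\big(81\mathfrak c_\gamma^2+36\mathfrak c_\gamma\mathfrak a_3+4\mathfrak a_3^2\big)+O(\gamma^5),$$ $$\beta=3+\gamma^2(9\mathfrak c_\gamma+2\mathfrak a_3)+\gamma^4\big(-\tfrac{189}4\mathfrak c_\gamma^2+3\mathfrak a_1-21\mathfrak c_\gamma\mathfrak a_3-\tfrac43\mathfrak a_3^2\big)+O(\gamma^5).$$ Put $\mathfrak a_3(s)=\mathfrak a_3-\frac92\bar{\mathfrak c}(s)$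 and $\mathfrak a_1(s)=\mathfrak a_1+3\mathfrak a_3\bar{\mathfrak c}(s)-\frac{27}4\bar{\mathfrak c}(s)^2$. **Lemma.** There is a function $\mathrm{Err}_1(s,x)$ of the trajectory, continuous in $x$, such that for every $0<\gamma<\frac13$ and $t\ge0$ one has on $\mathbb T^2$, in the first regime, $$X_\gamma(t)=P^\gamma_tX^0_\gamma+\int_0^tP^\gamma_{t-s}K_\gamma\star\Big(-\tfrac{a_c(4a_c-1)\beta_c^3}{3(2a_c+1)^2}\big(X_\gamma^3-3\mathfrak c_\gamma(s)X_\gamma\big)+\mathfrak a_1(s)X_\gamma+\mathrm{Err}_1\Big)(s)\,ds+Z_\gamma(t),$$ and in the second regime $$X_\gamma(t)=P^\gamma_tX^0_\gamma+\int_0^tP^\gamma_{t-s}K_\gamma\star\Big(-\tfrac9{20}\big(X_\gamma^5-10\mathfrak c_\gamma(s)X_\gamma^3+15\mathfrak c_\gamma(s)^2X_\gamma\big)+\mathfrak a_3(s)\big(X_\gamma^3-3\mathfrak c_\gamma(s)X_\gamma\big)+\mathfrak a_1(s)X_\gamma+\mathrm{Err}_1\Big)(s)\,ds+Z_\gamma(t),$$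 and such that the following holds. Write $q(s)=\|Q_{\gamma,s}(s,\cdot)\|_{L^\infty(\Lambda_\varepsilon)}$. For all $\nu\in(0,\frac12)$, $\kappa>0$ and $T>0$ there are $C$ and $\gamma_0>0$, depending only on $T,\kappa,\nu$ and on the fixed data ($\mathfrak K$, the partition of unity, $a_c$, $\beta_c$, the $\mathfrak a_i$ and the families $a(\gamma),\beta(\gamma)$), such that for all $0<\gamma<\gamma_0$, every trajectory, all $0<s\le T$ and $x\in\mathbb T^2$, in the first regime $$|\mathrm{Err}_1(s,x)|\le C\gamma^{-30\nu-\kappa}\big(\|X_\gamma(s)\|_{\mathcal C^{-\nu}}^7+1\big)\Big(\gamma^{\frac23}s^{-\frac13}+\|X_\gamma^{\mathrm{high}}(s)\|_{L^\infty(\mathbb T^2)}+q(s)+|\tilde E(s,x)|\Big),$$ and in the second regime the same bound holds with $q(s)$ replaced by $q(s)\max\{1,q(s)\}$ (so it is the same bound whenever $q(s)\le1$). -/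

import Mathlib

open MeasureTheory ProbabilityTheory Filter Topology Asymptotics
open scoped NNReal

noncomputable section

namespace BlumeCapel

/-! ### The torus, frequencies, convolution -/

/-- Functions on the torus `𝕋² = [-1,1]²` are handled as functions on the plane
(of period `2` in each coordinate). -/
abbrev Plane := EuclideanSpace ℝ (Fin 2)

abbrev Freq := Fin 2 → ℤ

def Freq.toPlane (w : Freq) : Plane := WithLp.toLp 2 fun i => (w i : ℝ)

/-- The scalar product `ω · x`. -/
def phase (w : Freq) (x : Plane) : ℝ := ∑ i, (w i : ℝ) * x i

/-- The fundamental domain `[-1,1]²`. -/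
def square : Set Plane := {y | ∀ i, y i ∈ Set.Icc (-1 : ℝ) 1}

/-- Period `2` in each coordinate. -/
def IsPeriodic (f : Plane → ℝ) : Prop :=
  ∀ (x : Plane) (w : Freq), f (x + (2 : ℝ) • w.toPlane) = f x

/-- Convolution on the torus. -/
def torusConv (p f : Plane → ℝ) (x : Plane) : ℝ := ∫ y in square, p (x - y) * f y

/-- The supremum norm over the torus (used for continuous functions only). -/
def supNorm (f : Plane → ℝ) : ℝ := ⨆ x, |f x|

/-! ### Littlewood-Paley blocks and the Besov norm -/

/-- A smooth radial dyadic partition of unity. -/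
structure DyadicPartition where
  low : Plane → ℝ
  ann : Plane → ℝ
  low_smooth : ContDiff ℝ (⊤ : ℕ∞) low
  ann_smooth : ContDiff ℝ (⊤ : ℕ∞) ann
  low_mem : ∀ z, low z ∈ Set.Icc (0 : ℝ) 1
  ann_mem : ∀ z, ann z ∈ Set.Icc (0 : ℝ) 1
  low_radial : ∀ z z', ‖z‖ = ‖z'‖ → low z = low z'
  ann_radial : ∀ z z', ‖z‖ = ‖z'‖ → ann z = ann z'
  low_supp : ∀ z, 4 / 3 ≤ ‖z‖ → low z = 0
  ann_supp : ∀ z, ‖z‖ ≤ 3 / 4 ∨ 8 / 3 ≤ ‖z‖ → ann z = 0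
  sum_eq_one : ∀ z, low z + ∑' k : ℕ, ann (((2 : ℝ) ^ k)⁻¹ • z) = 1

namespace DyadicPartition

variable (D : DyadicPartition)

/-- The cutoffs `χ_k`, `k ≥ -1`; the index `j : ℕ` stands for `k = j - 1`. -/
def cutoff : ℕ → Plane → ℝ
  | 0, z => D.low z
  | k + 1, z => D.ann (((2 : ℝ) ^ k)⁻¹ • z)

/-- The Littlewood-Paley block `δ_k f`, `k = j - 1`: the Fourier multiplier `χ_k(ω)`.
The multiplier is even, so the kernel is a sum of cosines. -/
def block (j : ℕ) (f : Plane → ℝ) : Plane → ℝ :=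
  torusConv (fun x => 1 / 4 * ∑' w : Freq, D.cutoff j w.toPlane * Real.cos (Real.pi * phase w x)) f

/-- The norm of `𝒞^{-ν} = B^{-ν}_{∞,∞}`, namely `sup_{k ≥ -1} 2^{-νk} ‖δ_k f‖_∞`. -/
def besovNorm (ν : ℝ) (f : Plane → ℝ) : ℝ :=
  ⨆ j : ℕ, (2 : ℝ) ^ (-ν * ((j : ℝ) - 1)) * supNorm (D.block j f)

/-- The high frequency part `∑_{2^k ≥ N/20} δ_k f`. -/
def high (N : ℕ) (f : Plane → ℝ) (x : Plane) : ℝ :=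
  ∑' j : ℕ, if (N : ℝ) / 20 ≤ (2 : ℝ) ^ ((j : ℤ) - 1) then D.block j f x else 0

end DyadicPartition

/-! ### The time dependent coefficients of the limiting equation -/

/-- `𝔠_ε`. -/
def cEps (βc ε : ℝ) : ℝ :=
  βc⁻¹ * ∑' w : Freq, if 0 < ‖w.toPlane‖ ∧ ‖w.toPlane‖ < ε⁻¹ then
    1 / (4 * Real.pi ^ 2 * ‖w.toPlane‖ ^ 2) else 0

/-- `𝔠_ε(t)`. -/
def cEpsTime (βc ε t : ℝ) : ℝ :=
  t / (2 * βc) + βc⁻¹ * ∑' w : Freq, if 0 < ‖w.toPlane‖ ∧ ‖w.toPlane‖ < ε⁻¹ then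
    1 / (4 * Real.pi ^ 2 * ‖w.toPlane‖ ^ 2)
      * (1 - Real.exp (-2 * t * Real.pi ^ 2 * ‖w.toPlane‖ ^ 2)) else 0

/-- `lim_{ε → 0} (𝔠_ε(s) - 𝔠_ε)`, which exists for `s > 0`. -/
def cBar (βc s : ℝ) : ℝ :=
  limUnder (𝓝[>] (0 : ℝ)) fun ε => cEpsTime βc ε s - cEps βc ε

/-! ### Paths -/

/-- The jump of a càdlàg path. -/
def jump (f : ℝ → ℝ) (r : ℝ) : ℝ := f r - Function.leftLim f r

/-- The quadratic variation `[f]_s = ∑_{0 < r ≤ s} (Δf(r))²` of a càdlàg path of finite variation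
with finitely many jumps. -/
def quadVar (f : ℝ → ℝ) (s : ℝ) : ℝ := ∑ᶠ r ∈ Set.Ioc 0 s, jump f r ^ 2

/-! ### The model -/

/-- The two scaling regimes (with a cubic, resp. quintic limiting equation). -/
inductive Regime
  | first
  | second

/-- The profile of the Kac interaction. -/
structure IsKacProfile (𝔎 : Plane → ℝ) : Prop where
  mem_Icc : ∀ x, 𝔎 x ∈ Set.Icc (0 : ℝ) 1
  contDiff : ContDiff ℝ 2 𝔎
  radial : ∀ x y, ‖x‖ = ‖y‖ → 𝔎 x = 𝔎 y
  supp : ∀ x, 3 < ‖x‖ → 𝔎 x = 0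
  integral_eq : ∫ x, 𝔎 x = 1
  second_moment : ∫ x, 𝔎 x * ‖x‖ ^ 2 = 4

/-- All parameters of the microscopic model: `γ` is the inverse interaction range, `β` the inverse
temperature, `θ` (with `a = e^θ`) the chemical potential; `βc` is the critical value of `β`. -/
structure Model where
  regime : Regime
  𝔎 : Plane → ℝ
  βc : ℝ
  γ : ℝ
  β : ℝ
  θ : ℝ

/-- The discrete torus `ℤ² / (2N+1) ℤ²`. -/
abbrev Lattice (N : ℕ) := Fin 2 → ZMod (2 * N + 1)

/-- The point `c k` of the plane, for the representative `k ∈ {-N,…,N}²` of a lattice site. -/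
def site {N : ℕ} (c : ℝ) (k : Lattice N) : Plane :=
  WithLp.toLp 2 fun i => c * ((k i).valMinAbs : ℝ)

namespace Model

variable (m : Model)

def N : ℕ :=
  match m.regime with
  | .first => ⌊(m.γ ^ 2)⁻¹⌋₊
  | .second => ⌊(m.γ ^ 3)⁻¹⌋₊

/-- The lattice spacing after rescaling of space. -/
def ε : ℝ := 2 / (2 * (m.N : ℝ) + 1)

/-- The time scale. -/
def α : ℝ :=
  match m.regime with
  | .first => m.γ ^ 2
  | .second => m.γ ^ 4

/-- The scale of the field. -/
def δ : ℝ := m.γ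

/-- Sites `k` of the discrete torus; also used for the rescaled lattice `Λ_ε`, the site `k` being
identified with the point `ε k`. -/
abbrev Site := Lattice m.N

/-- Spin configurations with values in `{-1, 0, 1}`. -/
abbrev Config := m.Site → SignType

/-- The Kac kernel `κ_γ`. -/
def κ (k : m.Site) : ℝ :=
  if k = 0 then 0 else
    m.γ ^ 2 * m.𝔎 (site m.γ k) / ∑ j ∈ Finset.univ.erase (0 : m.Site), m.γ ^ 2 * m.𝔎 (site m.γ j)

/-- The locally averaged field `h_γ(σ, k)`. -/
def h (σ : m.Config) (k : m.Site) : ℝ := ∑ j, m.κ (k - j) * (σ j : ℝ)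

/-- The normalisation `𝒩_{β,θ}`. -/
def normConst (u : ℝ) : ℝ := Real.exp (-m.β * u + m.θ) + 1 + Real.exp (m.β * u + m.θ)

/-- The rate `c_γ(σ, j, σ̄)` at which the spin at `j` is updated to the value `b`. -/
def rate (σ : m.Config) (j : m.Site) (b : SignType) : ℝ :=
  Real.exp ((b : ℝ) * m.β * m.h σ j + (b : ℝ) ^ 2 * m.θ) / m.normConst (m.h σ j)

/-- The generator of the Glauber dynamics. -/
def gen (f : m.Config → ℝ) (σ : m.Config) : ℝ :=
  ∑ j, ∑ b : SignType, m.rate σ j b * (f (Function.update σ j b) - f σ)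

/-- `σ` is a Glauber dynamics: a càdlàg process (in microscopic time `t ≥ 0`) that solves the
martingale problem for the generator. The initial law is arbitrary. -/
structure IsGlauber {Ω : Type*} [mΩ : MeasurableSpace Ω] (P : Measure Ω)
    (σ : ℝ → Ω → m.Config) : Prop where
  right_cont : ∀ ω, ∀ t, 0 ≤ t → ∀ᶠ u in 𝓝[>] t, σ u ω = σ t ω
  left_lim : ∀ ω, ∀ t, 0 < t → ∃ c, ∀ᶠ u in 𝓝[<] t, σ u ω = c
  martingale : ∃ ℱ : Filtration ℝ≥0 mΩ,
    (∀ (t : ℝ≥0) (c : m.Config), MeasurableSet[ℱ t] {ω | σ t ω = c}) ∧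
    ∀ f : m.Config → ℝ,
      Martingale (fun (t : ℝ≥0) ω =>
        f (σ t ω) - f (σ 0 ω) - ∫ s in (0 : ℝ)..t, m.gen f (σ s ω)) ℱ P

/-! ### Lattice convolution, Fourier transform, heat kernel, extension to the torus -/

/-- The rescaled kernel `K_γ(εk) = ε⁻² κ_γ(k)`. -/
def K (k : m.Site) : ℝ := (m.ε ^ 2)⁻¹ * m.κ k

/-- The convolution `⋆_ε` on `Λ_ε`. -/
def conv (f g : m.Site → ℝ) (k : m.Site) : ℝ := ∑ z, m.ε ^ 2 * f (k - z) * g z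

/-- The frequencies `{-N,…,N}²`. -/
def box : Finset Freq := Fintype.piFinset fun _ => Finset.Icc (-(m.N : ℤ)) (m.N : ℤ)

/-- The Fourier transform of `K_γ`; it is real because `K_γ` is even. -/
def Khat (w : Freq) : ℝ :=
  ∑ k : m.Site, m.ε ^ 2 * m.K k * Real.cos (Real.pi * phase w (site m.ε k))

/-- The extension of a lattice function to a trigonometric polynomial of degree at most `N` on the
torus (the sines cancel under `ω ↦ -ω`). -/
def Ex (Y : m.Site → ℝ) (x : Plane) : ℝ :=
  1 / 4 * ∑ w ∈ m.box, ∑ k : m.Site,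
    m.ε ^ 2 * Real.cos (Real.pi * phase w (x - site m.ε k)) * Y k

/-- The kernel of `P_t^γ = exp(t Δ_γ)`, where `Δ_γ = α⁻¹ (K_γ ⋆ - 1)`: the trigonometric polynomial
with Fourier coefficients `exp(t α⁻¹ (Khat(ω) - 1))`, `ω ∈ {-N,…,N}²`. -/
def heat (t : ℝ) (x : Plane) : ℝ :=
  1 / 4 * ∑ w ∈ m.box, Real.exp (t * m.α⁻¹ * (m.Khat w - 1)) * Real.cos (Real.pi * phase w x)

/-- The restriction of the heat kernel to `Λ_ε`. -/
def heatLat (t : ℝ) (k : m.Site) : ℝ := m.heat t (site m.ε k)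

/-- The kernel of `P_t^γ K_γ` on the torus (the extension of the lattice kernel). -/
def heatK (t : ℝ) : Plane → ℝ := m.Ex (m.conv (m.heatLat t) m.K)

/-- The renormalisation constant `𝔠_γ` (the time independent one). -/
def c : ℝ :=
  1 / (4 * m.βc) * ∑ w ∈ m.box.erase 0, |m.Khat w| ^ 2 / (m.α⁻¹ * (1 - m.Khat w))

/-! ### The rescaled field, the martingale, the stochastic convolution

Here `σ : ℝ → m.Config` is a trajectory in microscopic time. -/

variable (σ : ℝ → m.Config)

/-- `X_γ(t, εk) = δ⁻¹ h_γ(t/α, k)`. -/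
def X (t : ℝ) (k : m.Site) : ℝ := m.δ⁻¹ * m.h (σ (t / m.α)) k

/-- `X_γ(t, ·)` extended to the torus. -/
def XT (t : ℝ) : Plane → ℝ := m.Ex (m.X σ t)

/-- The unscaled martingale: `h_γ(t,k) = h_γ(0,k) + ∫₀ᵗ 𝓛 h_γ(s,k) ds + m_γ(t,k)`. -/
def mart (t : ℝ) (k : m.Site) : ℝ :=
  m.h (σ t) k - m.h (σ 0) k - ∫ s in (0 : ℝ)..t, m.gen (fun η => m.h η k) (σ s)

/-- `M_γ(t, εk) = δ⁻¹ m_γ(t/α, k)`. -/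
def M (t : ℝ) (k : m.Site) : ℝ := m.δ⁻¹ * m.mart σ (t / m.α) k

/-- `R_{γ,t}(s, ·) = ∫₀ˢ P^γ_{t-r} dM_γ(r, ·)` on `Λ_ε`. The martingale has finite variation: it is
the sum of its jumps and of the absolutely continuous part with density
`-(δα)⁻¹ 𝓛 h_γ(σ(r/α), ·)`. -/
def R (t s : ℝ) (k : m.Site) : ℝ :=
  (∑ᶠ r ∈ Set.Ioc 0 s, m.conv (m.heatLat (t - r)) (fun z => jump (fun u => m.M σ u z) r) k)
    - ∫ r in (0 : ℝ)..s, m.conv (m.heatLat (t - r))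
        (fun z => (m.δ * m.α)⁻¹ * m.gen (fun η => m.h η z) (σ (r / m.α))) k

/-- The stochastic convolution `Z_γ(t, ·) = R_{γ,t}(t, ·)`, extended to the torus. -/
def Z (t : ℝ) : Plane → ℝ := m.Ex (m.R σ t t)

/-- `∑_σ̄ (σ̄ - σ(r/α, z))² C_γ(r, z, σ̄)`. -/
def jumpRate (r : ℝ) (z : m.Site) : ℝ :=
  ∑ b : SignType, ((b : ℝ) - (σ (r / m.α) z : ℝ)) ^ 2 * m.rate (σ (r / m.α)) z b

/-- The predictable quadratic variation `⟨R_{γ,t}(·, x)⟩_s`. An update of the spin at `z` to the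
value `σ̄` at the (macroscopic) time `r`, which happens at rate `α⁻¹ c_γ(σ, z, σ̄)`, changes
`R_{γ,t}(·, x)` by `ε² δ⁻¹ (P^γ_{t-r} ⋆ K_γ)(x - z) (σ̄ - σ(z))`; this is the time integral of the
squared jumps weighted with their rates. -/
def predQuadVar (t s : ℝ) (k : m.Site) : ℝ :=
  ∫ r in (0 : ℝ)..s, ∑ z, ∑ b : SignType, m.α⁻¹ * m.rate (σ (r / m.α)) z b *
    (m.ε ^ 2 * m.δ⁻¹ * m.conv (m.heatLat (t - r)) m.K (k - z)
      * ((b : ℝ) - (σ (r / m.α) z : ℝ))) ^ 2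

/-- `Q_{γ,t}(s, x) = [R_{γ,t}(·, x)]_s - ⟨R_{γ,t}(·, x)⟩_s`. -/
def Q (t s : ℝ) (k : m.Site) : ℝ :=
  quadVar (fun r => m.R σ t r k) s - m.predQuadVar σ t s k

/-- `‖Q_{γ,s}(s, ·)‖_{L^∞(Λ_ε)}`. -/
def QNorm (s : ℝ) : ℝ := ⨆ k : m.Site, |m.Q σ s s k|

/-- The averaging error `Ẽ_t(s, x)` on `Λ_ε`. -/
def Etilde (t s : ℝ) (k : m.Site) : ℝ :=
  (∫ r in (0 : ℝ)..s, ∑ z, m.ε ^ 2 * m.conv (m.heatLat (t - r)) m.K (z - k) ^ 2 * m.jumpRate σ r z)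
    - 2 / m.βc *
      ∫ r in (0 : ℝ)..s, ∑ z, m.ε ^ 2 * m.conv (m.heatLat (t - r)) m.K (z - k) ^ 2

/-- `Ẽ(s, ·) = Ẽ_s(s, ·)`, extended to the torus. -/
def EtildeT (s : ℝ) : Plane → ℝ := m.Ex (m.Etilde σ s s)

/-- The time dependent renormalisation constant `𝔠_γ(s, ·)`, i.e. `[R_{γ,s}(·, x)]_s`, extended to
the torus. -/
def cTime (s : ℝ) : Plane → ℝ := m.Ex fun k => quadVar (fun r => m.R σ s r k) s

/-! ### The renormalised nonlinearities -/

/-- `-(ac (4 ac - 1) βc³) / (3 (2 ac + 1)²) (X³ - 3 𝔠_γ(s) X) + 𝔞₁(s) X`, where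
`𝔞₁(s) = 𝔞₁ - ac (4 ac - 1) βc³ / (2 ac + 1)² · lim_{ε → 0} (𝔠_ε(s) - 𝔠_ε)`. -/
def cubicDrift (ac 𝔞₁ : ℝ) (s : ℝ) (x : Plane) : ℝ :=
  (-(ac * (4 * ac - 1) * m.βc ^ 3) / (3 * (2 * ac + 1) ^ 2))
      * (m.XT σ s x ^ 3 - 3 * m.cTime σ s x * m.XT σ s x)
    + (𝔞₁ - ac * (4 * ac - 1) * m.βc ^ 3 / (2 * ac + 1) ^ 2 * cBar m.βc s) * m.XT σ s x

/-- `-(9/20) (X⁵ - 10 𝔠_γ(s) X³ + 15 𝔠_γ(s)² X) + 𝔞₃(s) (X³ - 3 𝔠_γ(s) X) + 𝔞₁(s) X`, where, with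
`c̄(s) = lim_{ε → 0} (𝔠_ε(s) - 𝔠_ε)`, `𝔞₃(s) = 𝔞₃ - (9/2) c̄(s)` and
`𝔞₁(s) = 𝔞₁ + 3 𝔞₃ c̄(s) - (27/4) c̄(s)²`. -/
def quinticDrift (𝔞₁ 𝔞₃ : ℝ) (s : ℝ) (x : Plane) : ℝ :=
  (-9 / 20) * (m.XT σ s x ^ 5 - 10 * m.cTime σ s x * m.XT σ s x ^ 3
      + 15 * m.cTime σ s x ^ 2 * m.XT σ s x)
    + (𝔞₃ - 9 / 2 * cBar m.βc s) * (m.XT σ s x ^ 3 - 3 * m.cTime σ s x * m.XT σ s x)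
    + (𝔞₁ + 3 * 𝔞₃ * cBar m.βc s - 27 / 4 * cBar m.βc s ^ 2) * m.XT σ s x

/-- `F + Err` is a drift of the mild equation for `X_γ` on the torus: for all `t ≥ 0`,
`X_γ(t) = P_t^γ X_γ(0) + ∫₀ᵗ P_{t-s}^γ K_γ ⋆ (F(s) + Err(s)) ds + Z_γ(t)`,
where all integrals converge. -/
structure MildEquation (F Err : ℝ → Plane → ℝ) : Prop where
  continuous : ∀ s, 0 < s → Continuous (F s) ∧ Continuous (Err s)
  periodic : ∀ s, 0 < s → IsPeriodic (Err s)
  integrable : ∀ t, 0 ≤ t → ∀ x, IntervalIntegrable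
    (fun s => torusConv (m.heatK (t - s)) (fun y => F s y + Err s y) x) volume 0 t
  eq : ∀ t, 0 ≤ t → ∀ x, m.XT σ t x =
    torusConv (m.heat t) (m.XT σ 0) x
      + (∫ s in (0 : ℝ)..t, torusConv (m.heatK (t - s)) (fun y => F s y + Err s y) x)
      + m.Z σ t x

end Model

end BlumeCapel

end

/-!
The generator applied to the local field `h` gives `κ ⋆ φ(h) - h`, where the response
`φ(h) = 2a sinh(βh) / (1 + 2a cosh(βh))` is the mean of the updated spin. Writing this as
`(κ ⋆ h - h) + κ ⋆ (φ(h) - h)` splits it, on the rescaled field, into the generator of the discrete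
heat semigroup and the convolution of the kernel with the drift `(δα)⁻¹ (φ(δX) - δX)`. Variation of constants, which along a path with finitely many jumps is a
summation by parts over the jump times (`R_eq`), therefore gives the mild equation exactly, with the
drift in place of the nonlinearity. Hence it holds for *every* nonlinearity `F` with the error
`Err₁ = drift - F` (`mildEquation`), and all that remains is to bound this difference.

* **Taylor expansion.** To order five or seven, `φ` is a polynomial
  (`exists_abs_drift_sub_le_five`, `exists_abs_drift_sub_le_seven`). Near criticality the rescaled
  coefficients are those of the limiting nonlinearity, up to the divergent constant `𝔠`, with errors
  of order `γ` (`exists_cubic_coeff_le`, `exists_quintic_coeff_le`).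
* **Lattice against torus.** The drift is a polynomial in the field on the lattice, extended to the
  torus afterwards, whereas the nonlinearity is a polynomial in the extended field. The low
  frequency part of the field has degree at most `2N / 15`, so its powers up to the seventh are
  reproduced by the extension, and the difference is controlled by the high frequency part
  (`abs_Ex_pow_sub_pow_le`). The extension costs a Lebesgue constant, which is logarithmic and hence
  smaller than `γ ^ (-κ)` (`exists_abs_Ex_le`); the field itself is bounded by its Besov norm times
  `N ^ ν` up to constants (`exists_abs_sum_block_le`).
* **Renormalisation.** The nonlinearity is renormalised with the quadratic variation `𝔠(s)`, the
  expansion with `𝔠`. By `cTime_sub` the difference `𝔠(s) - 𝔠 - 𝔠̄(s)` consists of the fluctuation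
  `Q` of the quadratic variation, a multiple of the averaging error `Ẽ`, and the difference of the
  heat kernel sums on the lattice and on the torus. The latter is `O(γ ^ (2p - κ) s ^ (-p))`
  (`exists_abs_rawTail_sub_tailSum_le`) because the symbol of the Kac kernel has the Laplacian as its
  leading term and a spectral gap (`exists_symbolBounds`). The choice `p = 1 / 3` serves for linear
  occurrences of the difference and `p = 1 / 6` for quadratic ones.

All these bounds at a point of space-time are collected in `FieldBounds`, from which
`FieldBounds.abs_sub_cubicDrift_le` and `FieldBounds.abs_sub_quinticDrift_le` derive the estimates.
-/

namespace BlumeCapel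

/-! ### Characters -/

lemma phase_sub (w : Freq) (x y : Plane) : phase w (x - y) = phase w x - phase w y := by
  simp [phase, mul_sub, Finset.sum_sub_distrib]

lemma phase_add_left (w v : Freq) (x : Plane) : phase (w + v) x = phase w x + phase v x := by
  simp [phase, add_mul, Finset.sum_add_distrib]

lemma phase_sub_left (w v : Freq) (x : Plane) : phase (w - v) x = phase w x - phase v x := by
  simp [phase, sub_mul, Finset.sum_sub_distrib]

lemma phase_neg_left (w : Freq) (x : Plane) : phase (-w) x = -phase w x := by
  simp [phase]

@[simp] lemma phase_zero_left (x : Plane) : phase 0 x = 0 := by simp [phase]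

@[simp] lemma phase_zero (w : Freq) : phase w 0 = 0 := by simp [phase]

@[fun_prop] lemma continuous_phase (w : Freq) : Continuous (phase w) := by
  unfold phase; fun_prop

lemma exp_phase_site {N : ℕ} (w : Freq) (k : Lattice N) :
    Complex.exp ((Real.pi * phase w (site (2 / (2 * (N : ℝ) + 1)) k) : ℝ) * Complex.I)
      = ∏ i, ZMod.stdAddChar ((w i : ZMod (2 * N + 1)) * k i) := by
  have h : ∀ i, ZMod.stdAddChar ((w i : ZMod (2 * N + 1)) * k i)
      = Complex.exp ((Real.pi * ((w i : ℝ) * (2 / (2 * (N : ℝ) + 1) * ((k i).valMinAbs : ℝ))) : ℝ)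
          * Complex.I) := by
    intro i
    have : (w i : ZMod (2 * N + 1)) * k i = ((w i * (k i).valMinAbs : ℤ) : ZMod (2 * N + 1)) := by
      rw [Int.cast_mul, ZMod.coe_valMinAbs]
    rw [this, ZMod.stdAddChar_coe]
    congr 1
    push_cast
    ring
  simp_rw [h, ← Complex.exp_sum]
  congr 1
  simp only [phase, site, Fin.sum_univ_two]
  push_cast
  ring

/-- The average of a character over the lattice: it vanishes unless the frequency is a multiple
of `2N+1`. -/
lemma sum_cos_site {N : ℕ} (w : Freq) (θ : ℝ) :
    ∑ k : Lattice N, Real.cos (θ + Real.pi * phase w (site (2 / (2 * (N : ℝ) + 1)) k))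
      = if ∀ i, (w i : ZMod (2 * N + 1)) = 0 then (2 * (N : ℝ) + 1) ^ 2 * Real.cos θ else 0 := by
  have key : ∑ k : Lattice N, Complex.exp ((θ + Real.pi *
      phase w (site (2 / (2 * (N : ℝ) + 1)) k) : ℝ) * Complex.I)
      = if ∀ i, (w i : ZMod (2 * N + 1)) = 0 then
        ((2 * (N : ℝ) + 1) ^ 2 : ℝ) * Complex.exp (θ * Complex.I) else 0 := by
    have h1 : ∀ k : Lattice N, Complex.exp ((θ + Real.pi *
        phase w (site (2 / (2 * (N : ℝ) + 1)) k) : ℝ) * Complex.I)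
        = Complex.exp (θ * Complex.I) * ∏ i, ZMod.stdAddChar ((w i : ZMod (2 * N + 1)) * k i) := by
      intro k
      rw [← exp_phase_site, ← Complex.exp_add]
      congr 1
      push_cast
      ring
    simp_rw [h1, ← Finset.mul_sum]
    rw [show (∑ k : Lattice N, ∏ i, ZMod.stdAddChar ((w i : ZMod (2 * N + 1)) * k i))
      = ∏ i, ∑ z : ZMod (2 * N + 1), ZMod.stdAddChar ((w i : ZMod (2 * N + 1)) * z) by
        rw [Finset.prod_univ_sum, Fintype.piFinset_univ]]
    have h2 : ∀ i, ∑ z : ZMod (2 * N + 1), ZMod.stdAddChar ((w i : ZMod (2 * N + 1)) * z)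
        = if (w i : ZMod (2 * N + 1)) = 0 then (2 * (N : ℂ) + 1) else 0 := by
      intro i
      have := AddChar.sum_mulShift (w i : ZMod (2 * N + 1)) (ZMod.isPrimitive_stdAddChar (2 * N + 1))
      simp_rw [mul_comm _ (w i : ZMod (2 * N + 1))] at this
      rw [this]
      split_ifs <;> simp [ZMod.card]
    simp_rw [h2, Fin.prod_univ_two, Fin.forall_fin_two]
    by_cases h0 : (w 0 : ZMod (2 * N + 1)) = 0 <;> by_cases h1 : (w 1 : ZMod (2 * N + 1)) = 0 <;>
      simp [h0, h1]
    ring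
  have := congrArg Complex.re key
  simp only [Complex.re_sum, Complex.exp_ofReal_mul_I_re] at this
  rw [this]
  split_ifs
  · rw [Complex.re_ofReal_mul, Complex.exp_ofReal_mul_I_re]
  · simp

/-- Shifting a lattice site shifts the phase, modulo the period. -/
lemma cos_phase_site_add {N : ℕ} (w : Freq) (k l : Lattice N) (θ : ℝ) :
    Real.cos (Real.pi * phase w (site (2 / (2 * (N : ℝ) + 1)) (k + l)) + θ)
      = Real.cos (Real.pi * phase w (site (2 / (2 * (N : ℝ) + 1)) k)
          + Real.pi * phase w (site (2 / (2 * (N : ℝ) + 1)) l) + θ) := by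
  have h : Complex.exp ((Real.pi * phase w (site (2 / (2 * (N : ℝ) + 1)) (k + l)) + θ : ℝ)
      * Complex.I) = Complex.exp ((Real.pi * phase w (site (2 / (2 * (N : ℝ) + 1)) k)
          + Real.pi * phase w (site (2 / (2 * (N : ℝ) + 1)) l) + θ : ℝ) * Complex.I) := by
    rw [Complex.ofReal_add, Complex.ofReal_add (_ + _), Complex.ofReal_add (Real.pi * _),
      add_mul, add_mul, add_mul, Complex.exp_add, Complex.exp_add, Complex.exp_add,
      exp_phase_site, exp_phase_site, exp_phase_site, ← Finset.prod_mul_distrib]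
    congr 2
    ext i
    rw [← AddChar.map_add_eq_mul, Pi.add_apply, mul_add]
  simpa only [Complex.exp_ofReal_mul_I_re] using congrArg Complex.re h

lemma cos_phase_site_neg {N : ℕ} (w : Freq) (k : Lattice N) (θ : ℝ) :
    Real.cos (Real.pi * phase w (site (2 / (2 * (N : ℝ) + 1)) (-k)) + θ)
      = Real.cos (-(Real.pi * phase w (site (2 / (2 * (N : ℝ) + 1)) k)) + θ) := by
  have := cos_phase_site_add w (-k) k
    (-(Real.pi * phase w (site (2 / (2 * (N : ℝ) + 1)) k)) + θ)
  have h0 : phase w (site (2 / (2 * (N : ℝ) + 1)) (-k + k)) = 0 := by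
    simp [site, phase]
  rw [h0] at this
  rw [mul_zero, zero_add] at this
  rw [this]
  congr 1
  ring

lemma isCompact_square : IsCompact square := by
  have : square = (EuclideanSpace.equiv (Fin 2) ℝ).toHomeomorph ⁻¹'
      (Set.univ.pi fun _ => Set.Icc (-1 : ℝ) 1) := by
    ext y
    simp [square, Pi.le_def, forall_and]
  rw [this, Homeomorph.isCompact_preimage]
  exact isCompact_univ_pi fun _ => isCompact_Icc

lemma Continuous.integrableOn_square {E : Type*} [NormedAddCommGroup E] {f : Plane → E}
    (hf : Continuous f) : IntegrableOn f square :=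
  hf.continuousOn.integrableOn_compact isCompact_square

/-- The average of a character over the torus. -/
lemma integral_cos_phase (w : Freq) (θ : ℝ) :
    ∫ y in square, Real.cos (θ + Real.pi * phase w y) = if w = 0 then 4 * Real.cos θ else 0 := by
  have hsq : square = (MeasurableEquiv.toLp 2 (Fin 2 → ℝ)).symm ⁻¹'
      (Set.univ.pi fun _ => Set.Icc (-1 : ℝ) 1) := by
    ext y
    simp [square, Pi.le_def, forall_and]
  have hmp := EuclideanSpace.volume_preserving_symm_measurableEquiv_toLp (Fin 2)
  have h1 : ∀ (f : (Fin 2 → ℝ) → ℂ), ∫ y in square, f ((MeasurableEquiv.toLp 2 (Fin 2 → ℝ)).symm y)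
      = ∫ y in (Set.univ.pi fun _ => Set.Icc (-1 : ℝ) 1), f y := by
    intro f
    rw [hsq]
    exact hmp.setIntegral_preimage_emb (MeasurableEquiv.measurableEmbedding _) f _
  have key : ∫ y in square, Complex.exp ((θ + Real.pi * phase w y : ℝ) * Complex.I)
      = if w = 0 then ((4 : ℝ) : ℂ) * Complex.exp (θ * Complex.I) else 0 := by
    have := h1 (fun y => Complex.exp (θ * Complex.I) *
      ∏ i, Complex.exp ((Real.pi * (w i) * Complex.I : ℂ) * (y i : ℝ)))
    have h2 : ∀ y : Plane, Complex.exp (θ * Complex.I) *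
      ∏ i, Complex.exp ((Real.pi * (w i) * Complex.I : ℂ) *
        (((MeasurableEquiv.toLp 2 (Fin 2 → ℝ)).symm y i : ℝ) : ℂ))
        = Complex.exp ((θ + Real.pi * phase w y : ℝ) * Complex.I) := by
      intro y
      rw [← Complex.exp_sum, ← Complex.exp_add]
      congr 1
      simp only [phase, Fin.sum_univ_two]
      push_cast
      simp
      ring
    simp_rw [h2] at this
    rw [this, integral_const_mul, volume_pi, Measure.restrict_pi_pi,
      integral_fintype_prod_eq_prod (𝕜 := ℂ) (fun i (y : ℝ) =>
        Complex.exp ((Real.pi * (w i) * Complex.I : ℂ) * (y : ℂ)))]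
    have h3 : ∀ i, ∫ y in Set.Icc (-1 : ℝ) 1, Complex.exp ((Real.pi * (w i) * Complex.I : ℂ) * (y : ℂ))
        = if w i = 0 then 2 else 0 := by
      intro i
      rw [integral_Icc_eq_integral_Ioc, ← intervalIntegral.integral_of_le (by norm_num)]
      split_ifs with h
      · simp only [h, Int.cast_zero, mul_zero, zero_mul, Complex.exp_zero,
          intervalIntegral.integral_const]
        norm_num
      · rw [integral_exp_mul_complex]
        · have : Complex.exp (Real.pi * (w i) * Complex.I * ((1 : ℝ) : ℂ))
            = Complex.exp (Real.pi * (w i) * Complex.I * ((-1 : ℝ) : ℂ)) := by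
            rw [Complex.exp_eq_exp_iff_exists_int]
            exact ⟨w i, by push_cast; ring⟩
          rw [this, sub_self, zero_div]
        · simp [h, Real.pi_ne_zero]
    simp_rw [h3, Fin.prod_univ_two]
    have : w = 0 ↔ w 0 = 0 ∧ w 1 = 0 := by
      rw [funext_iff, Fin.forall_fin_two]; rfl
    simp only [this]
    by_cases h0 : w 0 = 0 <;> by_cases h1 : w 1 = 0 <;> simp [h0, h1]
    ring
  have hint : IntegrableOn (fun y => Complex.exp ((θ + Real.pi * phase w y : ℝ) * Complex.I))
      square := by
    apply Continuous.integrableOn_square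
    fun_prop
  have := congrArg Complex.re key
  rw [← Complex.reCLM_apply, ← ContinuousLinearMap.integral_comp_comm _ hint] at this
  simp only [Complex.reCLM_apply, Complex.exp_ofReal_mul_I_re] at this
  rw [this]
  split_ifs
  · rw [Complex.re_ofReal_mul, Complex.exp_ofReal_mul_I_re]
  · simp


namespace Model

variable (m : Model)

/-! ### Fourier multipliers on the lattice -/

lemma eps_pos : 0 < m.ε := by unfold ε; positivity

lemma eps_mul : m.ε * (2 * (m.N : ℝ) + 1) = 2 := by
  unfold ε; field_simp

lemma sum_cos (w : Freq) (θ : ℝ) :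
    ∑ k : m.Site, m.ε ^ 2 * Real.cos (θ + Real.pi * phase w (site m.ε k))
      = if ∀ i, (w i : ZMod (2 * m.N + 1)) = 0 then 4 * Real.cos θ else 0 := by
  rw [← Finset.mul_sum, ε, sum_cos_site]
  split_ifs
  · field_simp
    ring
  · simp

lemma mem_box {w : Freq} : w ∈ m.box ↔ ∀ i, |w i| ≤ m.N := by
  simp [box, abs_le]

lemma neg_mem_box {w : Freq} : -w ∈ m.box ↔ w ∈ m.box := by
  simp [mem_box]

lemma zero_mem_box : (0 : Freq) ∈ m.box := by simp [mem_box]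

lemma cast_sub_eq_zero_iff {v w : Freq} (hv : v ∈ m.box) (hw : w ∈ m.box) :
    (∀ i, ((v - w) i : ZMod (2 * m.N + 1)) = 0) ↔ v = w := by
  constructor
  · intro h
    ext i
    have h1 := (ZMod.intCast_zmod_eq_zero_iff_dvd _ _).1 (h i)
    have hvi := m.mem_box.1 hv i
    have hwi := m.mem_box.1 hw i
    have h2 : |(v - w) i| < ((2 * m.N + 1 : ℕ) : ℤ) := by
      rw [abs_le] at hvi hwi
      rw [Pi.sub_apply, abs_lt]
      push_cast
      constructor <;> linarith
    have := Int.eq_zero_of_abs_lt_dvd h1 h2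
    rw [Pi.sub_apply] at this
    linarith
  · rintro rfl i
    simp

/-- The Fourier multiplier with symbol `a`, restricted to frequencies in the box, applied to a
lattice function; the result is a trigonometric polynomial. -/
noncomputable def mult (a : Freq → ℝ) (f : m.Site → ℝ) (x : Plane) : ℝ :=
  1 / 4 * ∑ w ∈ m.box, a w * ∑ k : m.Site,
    m.ε ^ 2 * Real.cos (Real.pi * phase w (x - site m.ε k)) * f k

lemma Ex_eq_mult (f : m.Site → ℝ) : m.Ex f = m.mult (fun _ => 1) f := by
  ext x; simp [Ex, mult]

lemma mult_add (a : Freq → ℝ) (f g : m.Site → ℝ) (x : Plane) :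
    m.mult a (fun k => f k + g k) x = m.mult a f x + m.mult a g x := by
  simp only [mult, mul_add, Finset.sum_add_distrib]

lemma mult_const_mul (a : Freq → ℝ) (c : ℝ) (f : m.Site → ℝ) (x : Plane) :
    m.mult a (fun k => c * f k) x = c * m.mult a f x := by
  simp only [mult, Finset.mul_sum]
  refine Finset.sum_congr rfl fun w _ => Finset.sum_congr rfl fun k _ => ?_
  ring

lemma mult_sum {ι : Type*} (s : Finset ι) (a : Freq → ℝ) (c : ι → ℝ) (g : ι → m.Site → ℝ)
    (x : Plane) : m.mult a (fun k => ∑ i ∈ s, c i * g i k) x = ∑ i ∈ s, c i * m.mult a (g i) x := by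
  classical
  induction s using Finset.induction_on with
  | empty => simp [mult]
  | insert i s hi ih => simp only [Finset.sum_insert hi, mult_add, mult_const_mul, ih]

@[fun_prop] lemma continuous_mult (a : Freq → ℝ) (f : m.Site → ℝ) : Continuous (m.mult a f) := by
  unfold mult
  refine continuous_const.mul (continuous_finsetSum _ fun w _ => continuous_const.mul
    (continuous_finsetSum _ fun k _ => ?_))
  have := continuous_phase w
  fun_prop

lemma isPeriodic_mult (a : Freq → ℝ) (f : m.Site → ℝ) : IsPeriodic (m.mult a f) := by
  intro x v
  unfold mult
  congr 1
  refine Finset.sum_congr rfl fun w _ => ?_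
  congr 1
  refine Finset.sum_congr rfl fun k _ => ?_
  have : Real.pi * phase w (x + (2 : ℝ) • v.toPlane - site m.ε k)
      = Real.pi * phase w (x - site m.ε k) + (∑ i, w i * v i : ℤ) * (2 * Real.pi) := by
    simp only [phase, Freq.toPlane, Fin.sum_univ_two]
    push_cast
    simp
    ring
  rw [this, Real.cos_add_int_mul_two_pi]

/-- Orthogonality of the characters on the lattice. -/
lemma sum_cos_mul_cos {v w : Freq} (hv : v ∈ m.box) (hw : w ∈ m.box) (x : Plane) (θ : ℝ) :
    ∑ k : m.Site, m.ε ^ 2 * Real.cos (Real.pi * phase w (x - site m.ε k))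
        * Real.cos (Real.pi * phase v (site m.ε k) + θ)
      = 2 * ((if w = v then Real.cos (Real.pi * phase v x + θ) else 0)
        + if w = -v then Real.cos (Real.pi * phase v x + θ) else 0) := by
  have h : ∀ k : m.Site, m.ε ^ 2 * Real.cos (Real.pi * phase w (x - site m.ε k))
        * Real.cos (Real.pi * phase v (site m.ε k) + θ)
      = 1 / 2 * (m.ε ^ 2 * Real.cos ((Real.pi * phase w x + θ)
          + Real.pi * phase (v - w) (site m.ε k)))
        + 1 / 2 * (m.ε ^ 2 * Real.cos ((Real.pi * phase w x - θ)
          + Real.pi * phase (-v - w) (site m.ε k))) := by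
    intro k
    have := Real.two_mul_cos_mul_cos (Real.pi * phase w (x - site m.ε k))
      (Real.pi * phase v (site m.ε k) + θ)
    rw [phase_sub_left, phase_sub_left, phase_neg_left]
    rw [phase_sub] at this ⊢
    rw [show Real.pi * phase w x + θ + Real.pi * (phase v (site m.ε k) - phase w (site m.ε k))
      = Real.pi * (phase w x - phase w (site m.ε k)) + (Real.pi * phase v (site m.ε k) + θ) by ring,
      show Real.pi * phase w x - θ + Real.pi * (-phase v (site m.ε k) - phase w (site m.ε k))
      = Real.pi * (phase w x - phase w (site m.ε k)) - (Real.pi * phase v (site m.ε k) + θ) by ring]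
    linear_combination (m.ε ^ 2 / 2) * this
  have hs : ∀ (u : Freq) (η : ℝ), ∑ k : m.Site, 1 / 2 * (m.ε ^ 2 *
      Real.cos (η + Real.pi * phase u (site m.ε k)))
      = 1 / 2 * if ∀ i, (u i : ZMod (2 * m.N + 1)) = 0 then 4 * Real.cos η else 0 := by
    intro u η
    rw [← sum_cos, Finset.mul_sum]
  simp_rw [h, Finset.sum_add_distrib, hs, m.cast_sub_eq_zero_iff hv hw, m.cast_sub_eq_zero_iff (m.neg_mem_box.2 hv) hw]
  rw [mul_add]
  congr 1
  · by_cases h1 : w = v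
    · subst h1
      simp only [if_true]
      ring
    · simp [h1, Ne.symm h1]
  · by_cases h1 : w = -v
    · subst h1
      simp only [if_true, phase_neg_left]
      rw [← Real.cos_neg (Real.pi * -phase v x - θ)]
      ring_nf
    · simp [h1, Ne.symm h1]

/-- A multiplier with an even symbol acts diagonally on characters. -/
lemma mult_cos {a : Freq → ℝ} (ha : ∀ w, a (-w) = a w) {v : Freq} (hv : v ∈ m.box) (θ : ℝ)
    (x : Plane) :
    m.mult a (fun k => Real.cos (Real.pi * phase v (site m.ε k) + θ)) x
      = a v * Real.cos (Real.pi * phase v x + θ) := by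
  have h : m.mult a (fun k => Real.cos (Real.pi * phase v (site m.ε k) + θ)) x
      = 1 / 4 * ∑ w ∈ m.box, a w * (2 * ((if w = v then Real.cos (Real.pi * phase v x + θ) else 0)
        + if w = -v then Real.cos (Real.pi * phase v x + θ) else 0)) := by
    unfold mult
    congr 1
    exact Finset.sum_congr rfl fun w hw => by rw [m.sum_cos_mul_cos hv hw]
  rw [h]
  simp_rw [mul_add, Finset.sum_add_distrib, mul_ite, mul_zero]
  rw [Finset.sum_ite_eq' , Finset.sum_ite_eq', if_pos hv, if_pos (m.neg_mem_box.2 hv), ha]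
  ring

lemma mult_mult {a : Freq → ℝ} (ha : ∀ w, a (-w) = a w) (b : Freq → ℝ) (f : m.Site → ℝ)
    (x : Plane) :
    m.mult a (fun k => m.mult b f (site m.ε k)) x = m.mult (fun w => a w * b w) f x := by
  have h : ∀ k : m.Site, m.mult b f (site m.ε k) = ∑ p ∈ m.box ×ˢ (Finset.univ : Finset m.Site),
      (1 / 4 * (b p.1 * (m.ε ^ 2 * f p.2))) * Real.cos (Real.pi * phase p.1 (site m.ε k)
        + -(Real.pi * phase p.1 (site m.ε p.2))) := by
    intro k
    rw [mult, Finset.sum_product, Finset.mul_sum]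
    refine Finset.sum_congr rfl fun w _ => ?_
    rw [Finset.mul_sum, Finset.mul_sum]
    refine Finset.sum_congr rfl fun z _ => ?_
    rw [phase_sub, mul_sub, sub_eq_add_neg]
    ring
  simp_rw [h]
  rw [mult_sum, mult, Finset.sum_product, Finset.mul_sum]
  refine Finset.sum_congr rfl fun w hw => ?_
  rw [Finset.mul_sum, Finset.mul_sum]
  refine Finset.sum_congr rfl fun z _ => ?_
  rw [m.mult_cos ha hw, phase_sub, mul_sub, sub_eq_add_neg]
  ring

/-- The frequencies of the box represent the residue classes modulo `2N+1`. -/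
lemma sum_box (F : Freq → ℝ) :
    ∑ w ∈ m.box, F w = ∑ k : m.Site, F (fun i => (k i).valMinAbs) := by
  symm
  refine Finset.sum_nbij' (fun (k : m.Site) i => (k i).valMinAbs)
    (fun w i => (w i : ZMod (2 * m.N + 1))) ?_ ?_ ?_ ?_ ?_
  · intro k _
    rw [mem_box]
    intro i
    have := ZMod.valMinAbs_mem_Ioc (k i)
    rw [Set.mem_Ioc] at this
    push_cast at this
    rw [abs_le]
    constructor <;> linarith [this.1, this.2]
  · simp
  · intro k _
    ext i
    simp only [ZMod.coe_valMinAbs]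
  · intro w hw
    ext i
    have := m.mem_box.1 hw i
    rw [abs_le] at this
    rw [ZMod.valMinAbs_spec]
    refine ⟨rfl, ?_, ?_⟩ <;> push_cast <;> linarith [this.1, this.2]
  · simp

/-- The average of a character over the frequencies of the box. -/
lemma sum_box_cos (k : m.Site) : ∑ w ∈ m.box, Real.cos (Real.pi * phase w (site m.ε k))
    = if k = 0 then (2 * (m.N : ℝ) + 1) ^ 2 else 0 := by
  rw [sum_box]
  have h1 : ∀ l : m.Site, Real.cos (Real.pi * phase (fun i => (l i).valMinAbs) (site m.ε k))
      = Real.cos (0 + Real.pi * phase (fun i => (k i).valMinAbs) (site m.ε l)) := by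
    intro l
    rw [zero_add]
    congr 2
    simp only [phase, site, Fin.sum_univ_two]
    ring
  simp_rw [h1, ε, sum_cos_site]
  simp only [ZMod.coe_valMinAbs, Real.cos_zero, mul_one, funext_iff, Pi.zero_apply]

lemma cos_phase_sub (w : Freq) (k z : m.Site) :
    Real.cos (Real.pi * phase w (site m.ε (k - z)))
      = Real.cos (Real.pi * phase w (site m.ε k - site m.ε z)) := by
  have h1 := cos_phase_site_add w k (-z) 0
  have h2 := cos_phase_site_neg w z (Real.pi * phase w (site (2 / (2 * (m.N : ℝ) + 1)) k))
  simp only [add_zero] at h1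
  rw [add_comm, ← ε] at h2
  rw [← ε, h2] at h1
  rw [sub_eq_add_neg k z, h1, phase_sub]
  ring_nf

/-- A lattice function is recovered from its Fourier coefficients. -/
lemma mult_one_site (f : m.Site → ℝ) (k : m.Site) :
    m.mult (fun _ => 1) f (site m.ε k) = f k := by
  have h : ∀ z : m.Site, ∑ w ∈ m.box, Real.cos (Real.pi * phase w (site m.ε k - site m.ε z))
      = if z = k then (2 * (m.N : ℝ) + 1) ^ 2 else 0 := by
    intro z
    simp_rw [← cos_phase_sub, sum_box_cos, sub_eq_zero, eq_comm]
  simp only [mult, one_mul]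
  rw [Finset.sum_comm]
  simp_rw [← Finset.sum_mul, ← Finset.mul_sum, h]
  simp only [mul_ite, mul_zero, ite_mul, zero_mul, Finset.sum_ite_eq', Finset.mem_univ, if_true]
  have := m.eps_mul
  linear_combination (1 / 4 * f k) * (m.ε * (2 * (m.N : ℝ) + 1) + 2) * this

/-- The trigonometric polynomial with (even) Fourier coefficients `a`. -/
noncomputable def ker (a : Freq → ℝ) (x : Plane) : ℝ :=
  1 / 4 * ∑ w ∈ m.box, a w * Real.cos (Real.pi * phase w x)

lemma ker_eq_mult (a : Freq → ℝ) : m.ker a = m.mult a (Pi.single 0 (m.ε ^ 2)⁻¹) := by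
  ext x
  have := m.eps_pos
  simp only [ker, mult]
  congr 1
  refine Finset.sum_congr rfl fun w _ => ?_
  rw [Finset.sum_eq_single 0]
  · have h0 : site m.ε (0 : m.Site) = 0 := by ext; simp [site]
    rw [h0, Pi.single_eq_same, sub_zero]
    field_simp
  · intro k _ hk
    rw [Pi.single_eq_of_ne hk, mul_zero]
  · simp

lemma ker_neg_site (a : Freq → ℝ) (k : m.Site) :
    m.ker a (site m.ε (-k)) = m.ker a (site m.ε k) := by
  simp only [ker]
  congr 1
  refine Finset.sum_congr rfl fun w _ => ?_
  have := cos_phase_site_neg w k 0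
  simp only [add_zero, Real.cos_neg] at this
  rw [ε, this]

/-- Lattice convolution with a kernel is the corresponding multiplier. -/
lemma conv_ker (a : Freq → ℝ) (f : m.Site → ℝ) (k : m.Site) :
    m.conv (fun z => m.ker a (site m.ε z)) f k = m.mult a f (site m.ε k) := by
  simp only [conv, ker, mult, Finset.mul_sum, Finset.sum_mul]
  rw [Finset.sum_comm]
  refine Finset.sum_congr rfl fun w _ => Finset.sum_congr rfl fun z _ => ?_
  rw [cos_phase_sub]
  ring

lemma mult_ker {a : Freq → ℝ} (ha : ∀ w, a (-w) = a w) (b : Freq → ℝ) (x : Plane) :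
    m.mult a (fun k => m.ker b (site m.ε k)) x = m.ker (fun w => a w * b w) x := by
  rw [ker_eq_mult, m.mult_mult ha, ker_eq_mult]

/-- Parseval's identity for even kernels. -/
lemma sum_ker_sq {a : Freq → ℝ} (ha : ∀ w, a (-w) = a w) :
    ∑ k : m.Site, m.ε ^ 2 * m.ker a (site m.ε k) ^ 2 = 1 / 4 * ∑ w ∈ m.box, a w ^ 2 := by
  have h := m.conv_ker a (fun k => m.ker a (site m.ε k)) 0
  rw [m.mult_ker ha] at h
  have h0 : site m.ε (0 : m.Site) = 0 := by ext; simp [site]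
  rw [h0] at h
  simp only [conv, zero_sub, ker_neg_site] at h
  rw [ker] at h
  simp only [phase_zero, mul_zero, Real.cos_zero, mul_one, ← sq] at h
  rw [← h]
  refine Finset.sum_congr rfl fun k _ => ?_
  ring

lemma heat_eq (t : ℝ) : m.heat t = m.ker (fun w => Real.exp (t * m.α⁻¹ * (m.Khat w - 1))) := rfl

lemma Khat_neg (w : Freq) : m.Khat (-w) = m.Khat w := by
  simp [Khat, phase_neg_left]

lemma heat_symbol_neg (t : ℝ) (w : Freq) : Real.exp (t * m.α⁻¹ * (m.Khat (-w) - 1))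
    = Real.exp (t * m.α⁻¹ * (m.Khat w - 1)) := by rw [Khat_neg]

/-- The Kac kernel is even and has Fourier coefficients `Khat`. -/
lemma K_eq_ker (hκ : ∀ k, m.κ (-k) = m.κ k) (k : m.Site) : m.K k = m.ker m.Khat (site m.ε k) := by
  rw [← m.mult_one_site m.K k]
  simp only [mult, ker, one_mul]
  congr 1
  refine Finset.sum_congr rfl fun w _ => ?_
  have hs : ∀ z : m.Site, m.ε ^ 2 * Real.cos (Real.pi * phase w (site m.ε k - site m.ε z)) * m.K z
    = Real.cos (Real.pi * phase w (site m.ε k)) *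
        (m.ε ^ 2 * m.K z * Real.cos (Real.pi * phase w (site m.ε z)))
      + Real.sin (Real.pi * phase w (site m.ε k)) *
        (m.ε ^ 2 * m.K z * Real.sin (Real.pi * phase w (site m.ε z))) := by
    intro z
    rw [phase_sub, mul_sub, Real.cos_sub]
    ring
  have hsin : ∑ z : m.Site, m.ε ^ 2 * m.K z * Real.sin (Real.pi * phase w (site m.ε z)) = 0 := by
    have h1 : ∑ z : m.Site, m.ε ^ 2 * m.K z * Real.sin (Real.pi * phase w (site m.ε z))
        = ∑ z : m.Site, m.ε ^ 2 * m.K (-z) * Real.sin (Real.pi * phase w (site m.ε (-z))) :=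
      (Equiv.sum_comp (Equiv.neg m.Site)
        (fun z => m.ε ^ 2 * m.K z * Real.sin (Real.pi * phase w (site m.ε z)))).symm
    have h2 : ∀ z : m.Site, Real.sin (Real.pi * phase w (site m.ε (-z)))
        = -Real.sin (Real.pi * phase w (site m.ε z)) := by
      intro z
      have := cos_phase_site_neg w z (-(Real.pi / 2))
      rw [← sub_eq_add_neg, ← sub_eq_add_neg, Real.cos_sub_pi_div_two,
        Real.cos_sub_pi_div_two, Real.sin_neg] at this
      exact this
    simp only [h2, K, hκ, mul_neg, Finset.sum_neg_distrib] at h1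
    simp only [K]
    linarith
  simp_rw [hs, Finset.sum_add_distrib, ← Finset.mul_sum, hsin, mul_zero, add_zero]
  rw [mul_comm]
  rfl

lemma conv_heatLat (t : ℝ) (f : m.Site → ℝ) (k : m.Site) : m.conv (m.heatLat t) f k
    = m.mult (fun w => Real.exp (t * m.α⁻¹ * (m.Khat w - 1))) f (site m.ε k) :=
  m.conv_ker _ f k

lemma conv_K (hκ : ∀ k, m.κ (-k) = m.κ k) (f : m.Site → ℝ) (k : m.Site) :
    m.conv m.K f k = m.mult m.Khat f (site m.ε k) := by
  rw [← m.conv_ker, show m.K = _ from funext (m.K_eq_ker hκ)]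

lemma conv_heatLat_K (hκ : ∀ k, m.κ (-k) = m.κ k) (t : ℝ) (k : m.Site) :
    m.conv (m.heatLat t) m.K k
      = m.ker (fun w => Real.exp (t * m.α⁻¹ * (m.Khat w - 1)) * m.Khat w) (site m.ε k) := by
  rw [m.conv_heatLat, show m.K = _ from funext (m.K_eq_ker hκ), m.mult_ker (m.heat_symbol_neg t)]

lemma heatK_eq (hκ : ∀ k, m.κ (-k) = m.κ k) (t : ℝ) :
    m.heatK t = m.ker (fun w => Real.exp (t * m.α⁻¹ * (m.Khat w - 1)) * m.Khat w) := by
  ext x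
  rw [heatK, Ex_eq_mult, show m.conv (m.heatLat t) m.K = _ from funext (m.conv_heatLat_K hκ t),
    m.mult_ker (fun _ => rfl)]
  simp

lemma conv_heatLat_zero (f : m.Site → ℝ) (k : m.Site) : m.conv (m.heatLat 0) f k = f k := by
  rw [conv_heatLat]
  simp [m.mult_one_site]

/-! ### Convolution on the torus -/

lemma integral_cos_mul_cos (v w : Freq) (x : Plane) (θ : ℝ) :
    ∫ y in square, Real.cos (Real.pi * phase w (x - y)) * Real.cos (Real.pi * phase v y + θ)
      = 2 * ((if w = v then Real.cos (Real.pi * phase v x + θ) else 0)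
        + if w = -v then Real.cos (Real.pi * phase v x + θ) else 0) := by
  have h : ∀ y, Real.cos (Real.pi * phase w (x - y)) * Real.cos (Real.pi * phase v y + θ)
      = 1 / 2 * Real.cos ((Real.pi * phase w x + θ) + Real.pi * phase (v - w) y)
        + 1 / 2 * Real.cos ((Real.pi * phase w x - θ) + Real.pi * phase (-v - w) y) := by
    intro y
    have := Real.two_mul_cos_mul_cos (Real.pi * phase w (x - y)) (Real.pi * phase v y + θ)
    rw [phase_sub_left, phase_sub_left, phase_neg_left]
    rw [phase_sub] at this ⊢
    rw [show Real.pi * phase w x + θ + Real.pi * (phase v y - phase w y)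
      = Real.pi * (phase w x - phase w y) + (Real.pi * phase v y + θ) by ring,
      show Real.pi * phase w x - θ + Real.pi * (-phase v y - phase w y)
      = Real.pi * (phase w x - phase w y) - (Real.pi * phase v y + θ) by ring]
    linear_combination (1 / 2) * this
  simp_rw [h]
  rw [integral_add, integral_const_mul, integral_const_mul, integral_cos_phase, integral_cos_phase]
  · simp only [sub_eq_zero]
    rw [mul_add]
    congr 1
    · by_cases h1 : w = v
      · subst h1
        simp only [if_true]
        ring
      · simp [h1, Ne.symm h1]
    · by_cases h1 : w = -v
      · subst h1
        simp only [if_true, phase_neg_left]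
        rw [← Real.cos_neg (Real.pi * -phase v x - θ)]
        ring_nf
      · simp [h1, Ne.symm h1]
  all_goals
    apply Continuous.integrableOn_square
    fun_prop

/-- Convolution on the torus with a trigonometric polynomial acts as a multiplier. -/
lemma torusConv_mult {a : Freq → ℝ} (ha : ∀ w, a (-w) = a w) (S : Finset Freq)
    (hS : ∀ w, w ∈ m.box → w ∉ S → a w = 0) (b : Freq → ℝ) (f : m.Site → ℝ) (x : Plane) :
    torusConv (fun y => 1 / 4 * ∑ w ∈ S, a w * Real.cos (Real.pi * phase w y)) (m.mult b f) x
      = m.mult (fun w => a w * b w) f x := by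
  have h : ∀ y, (1 / 4 * ∑ w ∈ S, a w * Real.cos (Real.pi * phase w (x - y))) * m.mult b f y
      = ∑ v ∈ m.box, ∑ z : m.Site, ∑ w ∈ S, (1 / 4 * a w * (1 / 4 * (b v * (m.ε ^ 2 * f z)))) *
        (Real.cos (Real.pi * phase w (x - y)) * Real.cos (Real.pi * phase v y
        + -(Real.pi * phase v (site m.ε z)))) := by
    intro y
    rw [mult, mul_comm, mul_assoc, Finset.sum_mul, Finset.mul_sum]
    refine Finset.sum_congr rfl fun v _ => ?_
    rw [Finset.mul_sum, Finset.sum_mul, Finset.mul_sum]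
    refine Finset.sum_congr rfl fun z _ => ?_
    rw [Finset.mul_sum, Finset.mul_sum, Finset.mul_sum]
    refine Finset.sum_congr rfl fun w _ => ?_
    rw [phase_sub v, mul_sub, sub_eq_add_neg (Real.pi * phase v y)]
    ring
  unfold torusConv
  simp_rw [h]
  have hint : ∀ (v w : Freq) (θ c : ℝ), IntegrableOn (fun y => c *
      (Real.cos (Real.pi * phase w (x - y)) * Real.cos (Real.pi * phase v y + θ))) square := by
    intro v w θ c
    apply Continuous.integrableOn_square
    fun_prop
  have hsum : ∀ v ∈ m.box, ∀ F : ℝ, ∑ w ∈ S, a w * (2 * ((if w = v then F else 0)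
      + if w = -v then F else 0)) = 4 * a v * F := by
    intro v hv F
    simp_rw [mul_add, Finset.sum_add_distrib, mul_ite, mul_zero]
    rw [Finset.sum_ite_eq', Finset.sum_ite_eq']
    have h1 : (if v ∈ S then a v * (2 * F) else 0) = a v * (2 * F) := by
      split_ifs with h
      · rfl
      · rw [hS v hv h, zero_mul]
    have h2 : (if -v ∈ S then a (-v) * (2 * F) else 0) = a v * (2 * F) := by
      split_ifs with h
      · rw [ha]
      · rw [← ha v, hS (-v) (m.neg_mem_box.2 hv) h, zero_mul]
    rw [h1, h2]
    ring
  rw [integral_finsetSum _ fun v _ => integrable_finsetSum _ fun z _ =>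
    integrable_finsetSum _ fun w _ => hint v w _ _, mult, Finset.mul_sum]
  refine Finset.sum_congr rfl fun v hv => ?_
  rw [integral_finsetSum _ fun z _ => integrable_finsetSum _ fun w _ => hint v w _ _,
    Finset.mul_sum, Finset.mul_sum]
  refine Finset.sum_congr rfl fun z _ => ?_
  rw [integral_finsetSum _ fun w _ => hint v w _ _]
  simp_rw [integral_const_mul, integral_cos_mul_cos]
  rw [phase_sub, mul_sub, sub_eq_add_neg (Real.pi * phase v x)]
  have := hsum v hv (Real.cos (Real.pi * phase v x + -(Real.pi * phase v (site m.ε z))))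
  calc _ = (1 / 16 * (b v * (m.ε ^ 2 * f z))) * ∑ w ∈ S, a w * (2 * ((if w = v then
          Real.cos (Real.pi * phase v x + -(Real.pi * phase v (site m.ε z))) else 0)
      + if w = -v then Real.cos (Real.pi * phase v x + -(Real.pi * phase v (site m.ε z))) else 0)) := by
        rw [Finset.mul_sum]
        refine Finset.sum_congr rfl fun w _ => ?_
        ring
    _ = _ := by
      rw [this]
      ring

lemma torusConv_ker {a : Freq → ℝ} (ha : ∀ w, a (-w) = a w) (b : Freq → ℝ) (f : m.Site → ℝ)
    (x : Plane) : torusConv (m.ker a) (m.mult b f) x = m.mult (fun w => a w * b w) f x :=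
  m.torusConv_mult ha m.box (fun _ h h' => absurd h h') b f x

/-! ### Trigonometric polynomials -/

/-- Trigonometric polynomials of degree at most `d` (in each variable). -/
def trigPoly (d : ℕ) : Submodule ℝ (Plane → ℝ) :=
  Submodule.span ℝ {f | ∃ (w : Freq) (θ : ℝ), (∀ i, |w i| ≤ d) ∧
    f = fun x => Real.cos (Real.pi * phase w x + θ)}

lemma mul_mem_trigPoly {d e : ℕ} {f g : Plane → ℝ} (hf : f ∈ trigPoly d) (hg : g ∈ trigPoly e) :
    f * g ∈ trigPoly (d + e) := by
  induction hf using Submodule.span_induction with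
  | mem f hf =>
    obtain ⟨w, θ, hw, rfl⟩ := hf
    induction hg using Submodule.span_induction with
    | mem g hg =>
      obtain ⟨v, η, hv, rfl⟩ := hg
      have : ((fun x => Real.cos (Real.pi * phase w x + θ)) *
          fun x => Real.cos (Real.pi * phase v x + η))
          = (1 / 2 : ℝ) • (fun x => Real.cos (Real.pi * phase (w - v) x + (θ - η)))
            + (1 / 2 : ℝ) • fun x => Real.cos (Real.pi * phase (w + v) x + (θ + η)) := by
        ext x
        have := Real.two_mul_cos_mul_cos (Real.pi * phase w x + θ) (Real.pi * phase v x + η)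
        simp only [Pi.mul_apply, Pi.add_apply, Pi.smul_apply, smul_eq_mul, phase_sub_left,
          phase_add_left]
        rw [show Real.pi * (phase w x - phase v x) + (θ - η)
          = Real.pi * phase w x + θ - (Real.pi * phase v x + η) by ring,
          show Real.pi * (phase w x + phase v x) + (θ + η)
          = Real.pi * phase w x + θ + (Real.pi * phase v x + η) by ring]
        linear_combination (1 / 2) * this
      rw [this]
      refine Submodule.add_mem _ (Submodule.smul_mem _ _ (Submodule.subset_span ?_))
        (Submodule.smul_mem _ _ (Submodule.subset_span ?_))
      · refine ⟨w - v, θ - η, fun i => ?_, rfl⟩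
        push_cast
        exact (abs_sub _ _).trans (add_le_add (hw i) (hv i))
      · refine ⟨w + v, θ + η, fun i => ?_, rfl⟩
        push_cast
        exact (abs_add_le _ _).trans (add_le_add (hw i) (hv i))
    | zero => rw [mul_zero]; exact Submodule.zero_mem _
    | add _ _ _ _ h1 h2 => rw [mul_add]; exact Submodule.add_mem _ h1 h2
    | smul c _ _ h => rw [mul_smul_comm]; exact Submodule.smul_mem _ _ h
  | zero => rw [zero_mul]; exact Submodule.zero_mem _
  | add _ _ _ _ h1 h2 => rw [add_mul]; exact Submodule.add_mem _ h1 h2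
  | smul c _ _ h => rw [smul_mul_assoc]; exact Submodule.smul_mem _ _ h

lemma pow_mem_trigPoly {d : ℕ} {f : Plane → ℝ} (hf : f ∈ trigPoly d) (p : ℕ) :
    f ^ (p + 1) ∈ trigPoly ((p + 1) * d) := by
  induction p with
  | zero => simpa using hf
  | succ p ih =>
    rw [pow_succ, add_mul _ 1, one_mul]
    exact mul_mem_trigPoly ih hf

/-- The extension operator reproduces trigonometric polynomials of degree at most `N`. -/
lemma Ex_trigPoly {d : ℕ} (hd : d ≤ m.N) {f : Plane → ℝ} (hf : f ∈ trigPoly d) :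
    m.Ex (fun k => f (site m.ε k)) = f := by
  rw [Ex_eq_mult]
  induction hf using Submodule.span_induction with
  | mem f hf =>
    obtain ⟨w, θ, hw, rfl⟩ := hf
    ext x
    rw [m.mult_cos (fun _ => rfl) (m.mem_box.2 fun i => (hw i).trans (by exact_mod_cast hd)),
      one_mul]
  | zero => ext x; simp [mult]
  | add f g _ _ h1 h2 =>
    ext x
    simp only [Pi.add_apply]
    rw [m.mult_add, congrFun h1 x, congrFun h2 x]
  | smul c f _ h =>
    ext x
    simp only [Pi.smul_apply, smul_eq_mul]
    rw [m.mult_const_mul, congrFun h x]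

lemma mult_mem_trigPoly {d : ℕ} {a : Freq → ℝ} (ha : ∀ w ∈ m.box, a w ≠ 0 → ∀ i, |w i| ≤ d)
    (f : m.Site → ℝ) : m.mult a f ∈ trigPoly d := by
  have : m.mult a f = ∑ w ∈ m.box, ∑ k : m.Site, (1 / 4 * a w * m.ε ^ 2 * f k) •
      (fun x => Real.cos (Real.pi * phase w x + -(Real.pi * phase w (site m.ε k)))) := by
    ext x
    simp only [mult, Finset.sum_apply, Pi.smul_apply, smul_eq_mul, Finset.mul_sum]
    refine Finset.sum_congr rfl fun w _ => Finset.sum_congr rfl fun k _ => ?_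
    rw [phase_sub, mul_sub, sub_eq_add_neg (Real.pi * phase w x)]
    ring
  rw [this]
  refine Submodule.sum_mem _ fun w hw => Submodule.sum_mem _ fun k _ => ?_
  by_cases h : a w = 0
  · simp only [h, mul_zero, zero_mul, zero_smul]
    exact Submodule.zero_mem _
  · exact Submodule.smul_mem _ _ (Submodule.subset_span ⟨w, _, ha w hw h, rfl⟩)

end Model

/-! ### Paths with finitely many jumps -/

/-- A càdlàg path with values in a discrete space. -/
structure IsStepPath {S : Type*} (σ : ℝ → S) : Prop where
  right : ∀ t, 0 ≤ t → ∀ᶠ u in 𝓝[>] t, σ u = σ t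
  left : ∀ t, 0 < t → ∃ c, ∀ᶠ u in 𝓝[<] t, σ u = c

namespace IsStepPath

variable {S : Type*} {σ : ℝ → S}

lemma comp_div (hσ : IsStepPath σ) {α : ℝ} (hα : 0 < α) : IsStepPath fun r => σ (r / α) where
  right t ht := by
    have h : Tendsto (fun u : ℝ => u / α) (𝓝[>] t) (𝓝[>] (t / α)) := by
      refine tendsto_nhdsWithin_of_tendsto_nhds_of_eventually_within _ ?_ ?_
      · exact ((continuous_id.div_const α).tendsto t).mono_left nhdsWithin_le_nhds
      · filter_upwards [self_mem_nhdsWithin] with u hu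
        exact div_lt_div_of_pos_right hu hα
    exact h.eventually (hσ.right _ (by positivity))
  left t ht := by
    have h : Tendsto (fun u : ℝ => u / α) (𝓝[<] t) (𝓝[<] (t / α)) := by
      refine tendsto_nhdsWithin_of_tendsto_nhds_of_eventually_within _ ?_ ?_
      · exact ((continuous_id.div_const α).tendsto t).mono_left nhdsWithin_le_nhds
      · filter_upwards [self_mem_nhdsWithin] with u hu
        exact div_lt_div_of_pos_right hu hα
    obtain ⟨c, hc⟩ := hσ.left (t / α) (by positivity)
    exact ⟨c, h.eventually hc⟩

/-- By compactness, a step path is locally constant off a finite set. -/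
lemma finite_jumps (hσ : IsStepPath σ) (T : ℝ) :
    {r ∈ Set.Ioc 0 T | ¬ ∀ᶠ u in 𝓝 r, σ u = σ r}.Finite := by
  set B := {r : ℝ | ¬ ∀ᶠ u in 𝓝 r, σ u = σ r} with hB
  have key : (Set.Ioc 0 T ∩ B ∩ Set.Icc 0 T).Finite := by
    refine (isCompact_Icc (a := (0 : ℝ)) (b := T)).induction_on
      (p := fun s => (Set.Ioc 0 T ∩ B ∩ s).Finite) (by simp)
      (fun s t hst ht => ht.subset (Set.inter_subset_inter_right _ hst))
      (fun s t hs ht => by rw [Set.inter_union_distrib_left]; exact hs.union ht) ?_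
    intro t ht
    -- near `t` the path is constant on either side, so that only `t` itself can be a jump
    have hr : ∀ᶠ u in 𝓝[>] t, u ∉ B := by
      have h1 := hσ.right t ht.1
      filter_upwards [h1, eventually_eventually_nhdsWithin.2 h1, self_mem_nhdsWithin]
        with u hu huu hut
      rw [hB, Set.mem_ofPred_eq, not_not, hu]
      rwa [nhdsWithin_eq_nhds.2 (Ioi_mem_nhds hut)] at huu
    have hl : ∀ᶠ u in 𝓝[<] t, u ∉ Set.Ioc 0 T ∩ B := by
      rcases eq_or_lt_of_le ht.1 with h0 | h0
      · filter_upwards [self_mem_nhdsWithin] with u hu hmem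
        rw [Set.mem_Iio] at hu
        linarith [hmem.1.1]
      · obtain ⟨c, hc⟩ := hσ.left t h0
        filter_upwards [hc, eventually_eventually_nhdsWithin.2 hc, self_mem_nhdsWithin]
          with u hu huu hut hmem
        refine hmem.2 ?_
        rw [hu]
        rwa [nhdsWithin_eq_nhds.2 (Iio_mem_nhds hut)] at huu
    have hlr : ∀ᶠ u in 𝓝 t, u ≠ t → u ∉ Set.Ioc 0 T ∩ B := by
      have h : ∀ᶠ u in 𝓝[≠] t, u ∉ Set.Ioc 0 T ∩ B := by
        rw [← nhdsLT_sup_nhdsGT, Filter.eventually_sup]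
        exact ⟨hl, hr.mono fun u hu hmem => hu hmem.2⟩
      rw [eventually_nhdsWithin_iff] at h
      exact h
    refine ⟨_, mem_nhdsWithin_of_mem_nhds hlr, ?_⟩
    refine (Set.finite_singleton t).subset ?_
    rintro u ⟨hu, hu'⟩
    by_contra hne
    exact hu' hne hu
  refine key.subset ?_
  rintro r ⟨hr, hr'⟩
  exact ⟨⟨hr, hr'⟩, hr.1.le, hr.2⟩

lemma leftLim_eq (φ : S → ℝ) {t : ℝ} {c : S}
    (hc : ∀ᶠ u in 𝓝[<] t, σ u = c) : Function.leftLim (fun u => φ (σ u)) t = φ c := by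
  refine leftLim_eq_of_tendsto ?_
  refine tendsto_const_nhds.congr' ?_
  filter_upwards [hc] with u hu
  rw [hu]

lemma jump_eq_zero (φ : S → ℝ) {t : ℝ} (h : ∀ᶠ u in 𝓝 t, σ u = σ t) :
    jump (fun u => φ (σ u)) t = 0 := by
  rw [jump, leftLim_eq φ (h.filter_mono nhdsWithin_le_nhds), sub_self]

lemma aestronglyMeasurable (hσ : IsStepPath σ) (φ : S → ℝ) (t : ℝ) :
    AEStronglyMeasurable (fun r => φ (σ r)) (volume.restrict (Set.Ioc 0 t)) := by
  set J := {r ∈ Set.Ioc 0 t | ¬ ∀ᶠ u in 𝓝 r, σ u = σ r}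
  have hJ : J.Finite := hσ.finite_jumps t
  have h1 : volume.restrict (Set.Ioc 0 t) = volume.restrict (Set.Ioc 0 t \ J) := by
    refine Measure.restrict_congr_set ?_
    exact (sdiff_null_ae_eq_self (hJ.measure_zero _)).symm
  rw [h1]
  refine ContinuousOn.aestronglyMeasurable ?_ (measurableSet_Ioc.diff hJ.measurableSet)
  rintro r ⟨hr, hrJ⟩
  have : ∀ᶠ u in 𝓝 r, σ u = σ r := by
    by_contra h
    exact hrJ ⟨hr, h⟩
  refine ContinuousAt.continuousWithinAt ?_
  refine (continuousAt_const (y := φ (σ r))).congr ?_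
  filter_upwards [this] with u hu
  rw [hu]

lemma intervalIntegrable [Finite S] (hσ : IsStepPath σ) (φ : S → ℝ) {t : ℝ} (ht : 0 ≤ t) :
    IntervalIntegrable (fun r => φ (σ r)) volume 0 t := by
  rw [intervalIntegrable_iff_integrableOn_Ioc_of_le ht]
  obtain ⟨C, hC⟩ := (Set.finite_range fun s => ‖φ s‖).bddAbove
  exact Integrable.of_bound (hσ.aestronglyMeasurable φ t) C
    (Eventually.of_forall fun r => hC ⟨σ r, rfl⟩)

/-- Integration by parts along a step path. -/
lemma sum_jumps_add_integral [Finite S] (hσ : IsStepPath σ) (φ : S → ℝ) {w w' : ℝ → ℝ}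
    (hw : ∀ r, HasDerivAt w (w' r) r) (hw' : Continuous w') {t : ℝ} (ht : 0 ≤ t)
    {J : Finset ℝ} (hJ : ∀ r, r ∈ J ↔ r ∈ Set.Ioc 0 t ∧ ¬ ∀ᶠ u in 𝓝 r, σ u = σ r) :
    ∑ r ∈ J, w r * jump (fun u => φ (σ u)) r + ∫ r in (0 : ℝ)..t, w' r * φ (σ r)
      = w t * φ (σ t) - w 0 * φ (σ 0) := by
  set c : ℝ → ℝ := fun r => w r * jump (fun u => φ (σ u)) r with hc
  set G : ℝ → ℝ := fun u => w u * φ (σ u) - ∑ r ∈ J, if r ≤ u then c r else 0 with hG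
  have hwc : Continuous w := continuous_iff_continuousAt.2 fun r => (hw r).continuousAt
  have hright : ∀ u, 0 ≤ u → ContinuousWithinAt G (Set.Ioi u) u := by
    intro u hu
    refine ContinuousWithinAt.sub ?_ ?_
    · refine (hwc.continuousWithinAt.mul (continuousWithinAt_const (b := φ (σ u)))).congr_of_eventuallyEq
        ?_ rfl
      filter_upwards [hσ.right u hu] with v hv
      rw [hv, Pi.mul_apply]
    · refine tendsto_finsetSum _ fun r _ => ?_
      refine tendsto_const_nhds.congr' ?_
      by_cases hru : r ≤ u
      · filter_upwards [self_mem_nhdsWithin] with v hv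
        rw [if_pos hru, if_pos (hru.trans (le_of_lt hv))]
      · filter_upwards [nhdsWithin_le_nhds (Iio_mem_nhds (not_le.1 hru))] with v hv
        rw [if_neg hru, if_neg (not_le.2 hv)]
  have hleft : ∀ u, 0 < u → u ≤ t → ContinuousWithinAt G (Set.Iio u) u := by
    intro u hu hut
    obtain ⟨s, hs⟩ := hσ.left u hu
    have hlim : Tendsto G (𝓝[<] u) (𝓝 (w u * φ s - ∑ r ∈ J, if r < u then c r else 0)) := by
      refine Tendsto.sub ?_ ?_
      · refine Tendsto.congr' ?_ ((hwc.continuousAt.tendsto.mono_left nhdsWithin_le_nhds).mul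
          tendsto_const_nhds)
        filter_upwards [hs] with v hv
        rw [hv]
      · refine tendsto_finsetSum _ fun r _ => ?_
        refine tendsto_const_nhds.congr' ?_
        by_cases hru : r < u
        · filter_upwards [nhdsWithin_le_nhds (Ioi_mem_nhds hru)] with v hv
          rw [if_pos hru, if_pos (le_of_lt hv)]
        · filter_upwards [self_mem_nhdsWithin] with v hv
          rw [if_neg hru, if_neg]
          exact not_le.2 (lt_of_lt_of_le hv (not_lt.1 hru))
    have hGu : G u = w u * φ s - ∑ r ∈ J, if r < u then c r else 0 := by
      have h1 : ∑ r ∈ J, (if r ≤ u then c r else 0)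
          = (∑ r ∈ J, if r < u then c r else 0) + ∑ r ∈ J, if r = u then c u else 0 := by
        rw [← Finset.sum_add_distrib]
        refine Finset.sum_congr rfl fun r _ => ?_
        rcases lt_trichotomy r u with h | h | h
        · simp [h, h.le, h.ne]
        · simp [h]
        · simp [h.not_ge, h.not_gt, h.ne']
      rw [hG]
      simp only
      rw [h1, Finset.sum_ite_eq']
      have h2 : jump (fun u => φ (σ u)) u = φ (σ u) - φ s := by
        rw [jump, leftLim_eq φ hs]
      split_ifs with huJ
      · rw [hc]
        simp only
        rw [h2]
        ring
      · have h3 : ∀ᶠ v in 𝓝 u, σ v = σ u := by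
          by_contra h
          exact huJ ((hJ u).2 ⟨⟨hu, hut⟩, h⟩)
        have h4 := jump_eq_zero φ h3
        rw [h2] at h4
        linear_combination (w u) * h4
    rw [ContinuousWithinAt, hGu]
    exact hlim
  have hcont : ContinuousOn G (Set.Icc 0 t) := by
    intro u hu
    rcases eq_or_lt_of_le hu.1 with h0 | h0
    · subst h0
      exact (continuousWithinAt_Ioi_iff_Ici.1 (hright 0 le_rfl)).mono fun v hv => hv.1
    · exact (continuousAt_iff_continuous_left'_right'.2
        ⟨hleft u h0 hu.2, hright u hu.1⟩).continuousWithinAt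
  have hderiv : ∀ u ∈ Set.Ioo 0 t \ (J : Set ℝ), HasDerivAt G (w' u * φ (σ u)) u := by
    rintro u ⟨hu, huJ⟩
    have h3 : ∀ᶠ v in 𝓝 u, σ v = σ u := by
      by_contra h
      exact huJ ((hJ u).2 ⟨⟨hu.1, hu.2.le⟩, h⟩)
    have h4 : ∀ᶠ v in 𝓝 u, ∀ r ∈ J, (r ≤ v ↔ r ≤ u) := by
      rw [Filter.eventually_all_finset]
      intro r hr
      rcases lt_trichotomy r u with h | h | h
      · filter_upwards [Ioi_mem_nhds h] with v hv
        exact ⟨fun _ => h.le, fun _ => le_of_lt hv⟩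
      · exact absurd (h ▸ hr) huJ
      · filter_upwards [Iio_mem_nhds h] with v hv
        exact ⟨fun h' => absurd h' (not_le.2 hv), fun h' => absurd h' (not_le.2 h)⟩
    refine (((hw u).mul_const (φ (σ u))).sub_const
      (∑ r ∈ J, if r ≤ u then c r else 0)).congr_of_eventuallyEq ?_
    filter_upwards [h3, h4] with v hv hv'
    rw [hG]
    simp only
    rw [hv]
    congr 1
    refine Finset.sum_congr rfl fun r hr => ?_
    simp only [hv' r hr]
  have hint : IntervalIntegrable (fun r => w' r * φ (σ r)) volume 0 t :=
    (hσ.intervalIntegrable φ ht).continuousOn_mul hw'.continuousOn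
  rw [integral_eq_of_hasDerivAt_off_countable_of_le G _ ht J.countable_toSet hcont hderiv hint]
  have hG0 : G 0 = w 0 * φ (σ 0) := by
    rw [hG]
    simp only
    rw [Finset.sum_eq_zero, sub_zero]
    intro r hr
    rw [if_neg (not_le.2 ((hJ r).1 hr).1.1)]
  have hGt : G t = w t * φ (σ t) - ∑ r ∈ J, c r := by
    rw [hG]
    simp only
    congr 1
    refine Finset.sum_congr rfl fun r hr => ?_
    rw [if_pos ((hJ r).1 hr).1.2]
  rw [hG0, hGt]
  ring

end IsStepPath

namespace Model

variable (m : Model)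

/-! ### The generator applied to the local field -/

lemma site_neg {N : ℕ} (c : ℝ) (k : Lattice N) : site c (-k) = -site c k := by
  ext i
  have : (-(k i)).valMinAbs = -(k i).valMinAbs := by
    apply ZMod.valMinAbs_neg_of_ne_half
    intro h
    have hlt := ZMod.val_lt (k i)
    omega
  simp [site, this]

lemma κ_neg (h𝔎 : ∀ x y, ‖x‖ = ‖y‖ → m.𝔎 x = m.𝔎 y) (k : m.Site) : m.κ (-k) = m.κ k := by
  unfold κ
  rw [site_neg, h𝔎 (-site m.γ k) (site m.γ k) (norm_neg _)]
  simp

/-- The mean of the updated spin in the local field `u`. -/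
noncomputable def response (u : ℝ) : ℝ :=
  (Real.exp (m.β * u + m.θ) - Real.exp (-m.β * u + m.θ)) / m.normConst u

lemma normConst_pos (u : ℝ) : 0 < m.normConst u := by unfold normConst; positivity

lemma sum_signType (f : SignType → ℝ) : ∑ b : SignType, f b = f 0 + f (-1) + f 1 := by
  rw [show (Finset.univ : Finset SignType) = {0, -1, 1} from rfl]
  rw [Finset.sum_insert (by decide), Finset.sum_insert (by decide), Finset.sum_singleton, add_assoc]

lemma sum_rate (η : m.Config) (j : m.Site) : ∑ b : SignType, m.rate η j b = 1 := by
  rw [sum_signType]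
  unfold rate
  rw [← add_div, ← add_div, div_eq_one_iff_eq (m.normConst_pos _).ne', normConst]
  simp [SignType.coe_neg]
  ring

lemma sum_mul_rate (η : m.Config) (j : m.Site) :
    ∑ b : SignType, (b : ℝ) * m.rate η j b = m.response (m.h η j) := by
  rw [sum_signType]
  unfold rate response
  simp [SignType.coe_neg]
  ring

lemma h_eq_conv (η : m.Config) (k : m.Site) : m.h η k = m.conv m.K (fun z => (η z : ℝ)) k := by
  have := m.eps_pos
  unfold h conv K
  refine Finset.sum_congr rfl fun j _ => ?_
  field_simp

/-- The generator relaxes the local field towards the averaged response. -/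
lemma gen_h (η : m.Config) (k : m.Site) : m.gen (fun η => m.h η k) η
    = m.conv m.K (fun z => m.response (m.h η z)) k - m.h η k := by
  rw [m.h_eq_conv]
  unfold gen conv
  rw [← Finset.sum_sub_distrib]
  refine Finset.sum_congr rfl fun j _ => ?_
  have h1 : ∀ b, m.h (Function.update η j b) k - m.h η k = m.κ (k - j) * ((b : ℝ) - η j) := by
    intro b
    unfold h
    rw [← Finset.sum_sub_distrib, Finset.sum_eq_single j]
    · rw [Function.update_self]
      ring
    · intro i _ hi
      rw [Function.update_of_ne hi, sub_self]
    · simp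
  simp_rw [h1]
  have h2 : ∑ b : SignType, m.rate η j b * (m.κ (k - j) * ((b : ℝ) - η j))
      = m.κ (k - j) * (∑ b : SignType, (b : ℝ) * m.rate η j b)
        - m.κ (k - j) * η j * ∑ b : SignType, m.rate η j b := by
    rw [Finset.mul_sum, Finset.mul_sum, ← Finset.sum_sub_distrib]
    refine Finset.sum_congr rfl fun b _ => ?_
    ring
  rw [h2, sum_rate, sum_mul_rate, K]
  have := m.eps_pos
  field_simp

/-- The drift of the rescaled field, before convolution with the kernel. -/
noncomputable def drift (η : m.Config) (z : m.Site) : ℝ :=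
  (m.δ * m.α)⁻¹ * (m.response (m.h η z) - m.h η z)

/-- The heat semigroup's symbol. -/
noncomputable def heatSymbol (t : ℝ) (w : Freq) : ℝ := Real.exp (t * m.α⁻¹ * (m.Khat w - 1))

lemma scaled_gen_h (hκ : ∀ k, m.κ (-k) = m.κ k) (η : m.Config) (k : m.Site) :
    (m.δ * m.α)⁻¹ * m.gen (fun η => m.h η k) η
      = m.mult (fun w => m.α⁻¹ * (m.Khat w - 1)) (fun z => m.δ⁻¹ * m.h η z) (site m.ε k)
        + m.mult m.Khat (m.drift η) (site m.ε k) := by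
  have h1 : m.mult (fun w => m.α⁻¹ * (m.Khat w - 1)) (fun z => m.δ⁻¹ * m.h η z) (site m.ε k)
      = m.α⁻¹ * (m.mult m.Khat (fun z => m.δ⁻¹ * m.h η z) (site m.ε k) - m.δ⁻¹ * m.h η k) := by
    rw [← m.mult_one_site (fun z => m.δ⁻¹ * m.h η z) k]
    simp only [mult]
    rw [← mul_sub, ← Finset.sum_sub_distrib, mul_left_comm]
    congr 1
    rw [Finset.mul_sum]
    refine Finset.sum_congr rfl fun w _ => ?_
    ring
  have h2 : m.conv m.K (fun z => m.response (m.h η z)) k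
      = m.mult m.Khat (fun z => m.response (m.h η z) - m.h η z) (site m.ε k)
        + m.mult m.Khat (m.h η) (site m.ε k) := by
    rw [← m.mult_add, m.conv_K hκ]
    simp
  rw [h1, gen_h, h2]
  unfold drift
  rw [m.mult_const_mul, m.mult_const_mul, mul_inv]
  ring

/-! ### The mild equation -/

variable {m}

lemma IsGlauber.isStepPath {Ω : Type*} [MeasurableSpace Ω] {P : Measure Ω}
    {σ : ℝ → Ω → m.Config} (h : m.IsGlauber P σ) (ω : Ω) : IsStepPath fun t => σ t ω :=
  ⟨h.right_cont ω, h.left_lim ω⟩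

variable {σ : ℝ → m.Config}

lemma jump_M (hσ : IsStepPath σ) (hα : 0 < m.α) (z : m.Site) {r : ℝ} (hr : 0 < r) :
    jump (fun u => m.M σ u z) r = jump (fun u => m.X σ u z) r := by
  have hσ' := hσ.comp_div hα
  obtain ⟨c, hc⟩ := hσ'.left r hr
  set I : ℝ → ℝ := fun u => ∫ s in (0 : ℝ)..u / m.α, m.gen (fun η => m.h η z) (σ s) with hI
  have hIcont : ContinuousAt I r := by
    have h1 : ContinuousOn (fun u => ∫ s in (0 : ℝ)..u, m.gen (fun η => m.h η z) (σ s))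
        (Set.uIcc 0 (r / m.α + 1)) := by
      apply intervalIntegral.continuousOn_primitive_interval'
        (hσ.intervalIntegrable (m.gen fun η => m.h η z) (by positivity))
      exact Set.left_mem_uIcc
    have h2 : ContinuousAt (fun u => ∫ s in (0 : ℝ)..u, m.gen (fun η => m.h η z) (σ s))
        (r / m.α) := by
      refine h1.continuousAt ?_
      rw [Set.uIcc_of_le (by positivity)]
      exact Icc_mem_nhds (by positivity) (by linarith)
    exact ContinuousAt.comp (f := fun u : ℝ => u / m.α) h2
      (continuous_id.div_const _).continuousAt
  have hM : ∀ u, m.M σ u z = m.X σ u z - m.δ⁻¹ * m.h (σ 0) z - m.δ⁻¹ * I u := by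
    intro u
    simp only [M, mart, X, hI]
    ring
  have hXleft : Tendsto (fun u => m.X σ u z) (𝓝[<] r) (𝓝 (m.δ⁻¹ * m.h c z)) := by
    refine tendsto_const_nhds.congr' ?_
    filter_upwards [hc] with u hu
    simp only [X]
    rw [hu]
  have hMleft : Tendsto (fun u => m.M σ u z) (𝓝[<] r)
      (𝓝 (m.δ⁻¹ * m.h c z - m.δ⁻¹ * m.h (σ 0) z - m.δ⁻¹ * I r)) := by
    simp_rw [hM]
    exact (hXleft.sub tendsto_const_nhds).sub
      ((hIcont.tendsto.mono_left nhdsWithin_le_nhds).const_mul _)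
  rw [jump, jump, leftLim_eq_of_tendsto hMleft, leftLim_eq_of_tendsto hXleft, hM]
  ring

lemma intervalIntegrable_mult_drift (hσ : IsStepPath σ) (hα : 0 < m.α) {t : ℝ} (ht : 0 ≤ t)
    (x : Plane) : IntervalIntegrable (fun r => m.mult (fun w => m.heatSymbol (t - r) w * m.Khat w)
        (m.drift (σ (r / m.α))) x) volume 0 t := by
  have h1 : (fun r => m.mult (fun w => m.heatSymbol (t - r) w * m.Khat w)
        (m.drift (σ (r / m.α))) x) = ∑ w ∈ m.box, ∑ k : m.Site, fun r =>
        (1 / 4 * (m.heatSymbol (t - r) w * m.Khat w) *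
          (m.ε ^ 2 * Real.cos (Real.pi * phase w (x - site m.ε k)))) *
          m.drift (σ (r / m.α)) k := by
    ext r
    simp only [mult, Finset.mul_sum, Finset.sum_apply]
    refine Finset.sum_congr rfl fun w _ => Finset.sum_congr rfl fun k _ => ?_
    ring
  rw [h1]
  refine IntervalIntegrable.sum _ fun w _ => IntervalIntegrable.sum _ fun k _ => ?_
  refine ((hσ.comp_div hα).intervalIntegrable (fun η => m.drift η k) ht).continuousOn_mul ?_
  unfold heatSymbol
  fun_prop

/-- The mild form of the evolution on the lattice: Duhamel's formula, where the jumps of the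
field are those of the martingale. -/
lemma R_eq (hσ : IsStepPath σ) (hα : 0 < m.α) (hκ : ∀ k, m.κ (-k) = m.κ k) {t : ℝ} (ht : 0 ≤ t)
    (k : m.Site) :
    m.R σ t t k = m.X σ t k - m.mult (m.heatSymbol t) (m.X σ 0) (site m.ε k)
      - ∫ r in (0 : ℝ)..t, m.mult (fun w => m.heatSymbol (t - r) w * m.Khat w)
        (m.drift (σ (r / m.α))) (site m.ε k) := by
  have hσ' := hσ.comp_div hα
  set J := (hσ'.finite_jumps t).toFinset with hJdef
  have hJ : ∀ r, r ∈ J ↔ r ∈ Set.Ioc 0 t ∧ ¬ ∀ᶠ u in 𝓝 r, σ (u / m.α) = σ (r / m.α) := by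
    intro r
    rw [hJdef, Set.Finite.mem_toFinset]
    rfl
  set w : m.Site → ℝ → ℝ := fun z r => m.ε ^ 2 * m.heatLat (t - r) (k - z) with hw
  set w' : m.Site → ℝ → ℝ := fun z r => -(m.ε ^ 2 *
    m.ker (fun v => m.α⁻¹ * (m.Khat v - 1) * m.heatSymbol (t - r) v) (site m.ε (k - z))) with hw'
  have hderiv : ∀ z r, HasDerivAt (w z) (w' z r) r := by
    intro z r
    have : HasDerivAt (fun r => m.ε ^ 2 * (1 / 4 * ∑ v ∈ m.box,
        Real.exp ((t - r) * m.α⁻¹ * (m.Khat v - 1)) *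
          Real.cos (Real.pi * phase v (site m.ε (k - z)))))
        (m.ε ^ 2 * (1 / 4 * ∑ v ∈ m.box,
        (Real.exp ((t - r) * m.α⁻¹ * (m.Khat v - 1)) * (-1 * m.α⁻¹ * (m.Khat v - 1))) *
          Real.cos (Real.pi * phase v (site m.ε (k - z))))) r := by
      refine (HasDerivAt.const_mul _ (HasDerivAt.fun_sum fun v _ => ?_)).const_mul _
      refine HasDerivAt.mul_const (HasDerivAt.exp ?_) _
      exact (((hasDerivAt_id r).const_sub t).mul_const _).mul_const _
    refine this.congr_deriv ?_
    simp only [hw', ker, heatSymbol]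
    rw [← mul_neg, ← mul_neg, ← Finset.sum_neg_distrib]
    congr 2
    refine Finset.sum_congr rfl fun v _ => ?_
    ring
  have hcont' : ∀ z, Continuous (w' z) := by
    intro z
    simp only [hw', ker, heatSymbol]
    fun_prop
  have hparts : ∀ z, ∑ r ∈ J, w z r * jump (fun u => m.X σ u z) r
      + ∫ r in (0 : ℝ)..t, w' z r * m.X σ r z = w z t * m.X σ t z - w z 0 * m.X σ 0 z := by
    intro z
    have := hσ'.sum_jumps_add_integral (fun η => m.δ⁻¹ * m.h η z) (hderiv z) (hcont' z) ht hJ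
    simp only [zero_div] at this
    simp only [X, zero_div]
    exact this
  have hint : ∀ z, IntervalIntegrable (fun r => w' z r * m.X σ r z) volume 0 t := fun z =>
    (hσ'.intervalIntegrable (fun η => m.δ⁻¹ * m.h η z) ht).continuousOn_mul (hcont' z).continuousOn
  have hjumps : (∑ᶠ r ∈ Set.Ioc 0 t, m.conv (m.heatLat (t - r))
      (fun z => jump (fun u => m.M σ u z) r) k)
      = ∑ z, ∑ r ∈ J, w z r * jump (fun u => m.X σ u z) r := by
    have h1 : ∀ r ∈ Set.Ioc 0 t, m.conv (m.heatLat (t - r))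
        (fun z => jump (fun u => m.M σ u z) r) k = ∑ z, w z r * jump (fun u => m.X σ u z) r := by
      intro r hr
      simp only [conv, hw]
      exact Finset.sum_congr rfl fun z _ => by rw [jump_M hσ hα z hr.1]
    rw [finsum_mem_congr rfl h1, finsum_mem_eq_sum_of_subset (t := J), Finset.sum_comm]
    · rintro r ⟨hr, hne⟩
      rw [Finset.mem_coe, hJ]
      refine ⟨hr, fun hloc => hne ?_⟩
      refine Finset.sum_eq_zero fun z _ => ?_
      have := IsStepPath.jump_eq_zero (fun η => m.δ⁻¹ * m.h η z) hloc
      simp only [X]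
      rw [this, mul_zero]
    · intro r hr
      exact ((hJ r).1 hr).1
  have hsum : ∑ z, w z t * m.X σ t z - ∑ z, w z 0 * m.X σ 0 z
      = m.X σ t k - m.mult (m.heatSymbol t) (m.X σ 0) (site m.ε k) := by
    congr 1
    · have := m.conv_heatLat_zero (m.X σ t) k
      simp only [hw, sub_self]
      exact this
    · have := m.conv_heatLat t (m.X σ 0) k
      simp only [hw, sub_zero]
      exact this
  have hgen : ∀ r, m.conv (m.heatLat (t - r))
        (fun z => (m.δ * m.α)⁻¹ * m.gen (fun η => m.h η z) (σ (r / m.α))) k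
      = -(∑ z, w' z r * m.X σ r z) + m.mult (fun w => m.heatSymbol (t - r) w * m.Khat w)
        (m.drift (σ (r / m.α))) (site m.ε k) := by
    intro r
    have h1 : -(∑ z, w' z r * m.X σ r z) = m.mult (fun v => m.heatSymbol (t - r) v *
        (m.α⁻¹ * (m.Khat v - 1))) (m.X σ r) (site m.ε k) := by
      rw [← m.conv_ker, conv, ← Finset.sum_neg_distrib]
      refine Finset.sum_congr rfl fun z _ => ?_
      simp only [hw', neg_mul, neg_neg]
      congr 2
      congr 1
      ext v
      ring
    rw [m.conv_heatLat, h1]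
    simp_rw [m.scaled_gen_h hκ]
    rw [m.mult_add, m.mult_mult (m.heat_symbol_neg _), m.mult_mult (m.heat_symbol_neg _)]
    rfl
  have hintD : IntervalIntegrable (fun r => m.mult (fun w => m.heatSymbol (t - r) w * m.Khat w)
        (m.drift (σ (r / m.α))) (site m.ε k)) volume 0 t :=
    intervalIntegrable_mult_drift hσ hα ht _
  rw [R, hjumps]
  simp_rw [hgen]
  rw [intervalIntegral.integral_add _ hintD, intervalIntegral.integral_neg,
    intervalIntegral.integral_finsetSum fun z _ => hint z]
  · have := Finset.sum_congr rfl fun z (_ : z ∈ Finset.univ) => hparts z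
    rw [Finset.sum_add_distrib, Finset.sum_sub_distrib, hsum] at this
    linarith
  · have := (IntervalIntegrable.sum Finset.univ fun z _ => hint z).neg
    refine this.congr ?_
    exact fun r _ => by simp

/-- The mild equation on the torus: subtracting a nonlinearity `F` from the drift leaves an
admissible error term. -/
theorem mildEquation (hσ : IsStepPath σ) (hα : 0 < m.α) (hκ : ∀ k, m.κ (-k) = m.κ k)
    {F : ℝ → Plane → ℝ} (hF : ∀ s, Continuous (F s)) (hF' : ∀ s, IsPeriodic (F s)) :
    m.MildEquation σ F fun s x => m.Ex (m.drift (σ (s / m.α))) x - F s x := by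
  have hconv : ∀ t s x, torusConv (m.heatK (t - s))
      (fun y => F s y + (m.Ex (m.drift (σ (s / m.α))) y - F s y)) x
      = m.mult (fun w => m.heatSymbol (t - s) w * m.Khat w) (m.drift (σ (s / m.α))) x := by
    intro t s x
    simp only [add_sub_cancel]
    change torusConv _ (m.Ex _) x = _
    rw [Ex_eq_mult, m.heatK_eq hκ, m.torusConv_ker]
    · simp only [mul_one]
      rfl
    · intro w
      rw [Khat_neg]
  refine ⟨fun s _ => ⟨hF s, ?_⟩, fun s _ x w => ?_, fun t ht x => ?_, fun t ht x => ?_⟩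
  · rw [Ex_eq_mult]
    exact (m.continuous_mult _ _).sub (hF s)
  · rw [hF', Ex_eq_mult, m.isPeriodic_mult]
  · simp_rw [hconv]
    exact intervalIntegrable_mult_drift hσ hα ht x
  · simp_rw [hconv]
    have h1 : torusConv (m.heat t) (m.XT σ 0) x = m.mult (m.heatSymbol t) (m.X σ 0) x := by
      rw [XT, Ex_eq_mult, m.heat_eq, m.torusConv_ker (m.heat_symbol_neg t)]
      simp only [mul_one]
      rfl
    have h2 : m.Z σ t x = m.XT σ t x - m.mult (m.heatSymbol t) (m.X σ 0) x
        - ∫ r in (0 : ℝ)..t, m.mult (fun w => m.heatSymbol (t - r) w * m.Khat w)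
          (m.drift (σ (r / m.α))) x := by
      have h3 : m.R σ t t = fun k => m.X σ t k
          + (-1) * m.mult (m.heatSymbol t) (m.X σ 0) (site m.ε k)
          + (-1) * ∫ r in (0 : ℝ)..t, m.mult (fun w => m.heatSymbol (t - r) w * m.Khat w)
            (m.drift (σ (r / m.α))) (site m.ε k) := by
        ext k
        rw [R_eq hσ hα hκ ht]
        ring
      have h4 : m.mult (fun _ => 1) (fun k => ∫ r in (0 : ℝ)..t,
          m.mult (fun w => m.heatSymbol (t - r) w * m.Khat w)
            (m.drift (σ (r / m.α))) (site m.ε k)) x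
          = ∫ r in (0 : ℝ)..t, m.mult (fun w => m.heatSymbol (t - r) w * m.Khat w)
            (m.drift (σ (r / m.α))) x := by
        have h5 : ∀ r, m.mult (fun w => m.heatSymbol (t - r) w * m.Khat w)
            (m.drift (σ (r / m.α))) x = m.mult (fun _ => 1) (fun k =>
              m.mult (fun w => m.heatSymbol (t - r) w * m.Khat w)
                (m.drift (σ (r / m.α))) (site m.ε k)) x := by
          intro r
          rw [m.mult_mult (fun _ => rfl)]
          simp only [one_mul]
        simp_rw [h5]
        simp only [mult.eq_1 m (fun _ => 1)]
        rw [intervalIntegral.integral_const_mul, intervalIntegral.integral_finsetSum]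
        · congr 1
          refine Finset.sum_congr rfl fun w _ => ?_
          rw [intervalIntegral.integral_const_mul, intervalIntegral.integral_finsetSum]
          · congr 1
            refine Finset.sum_congr rfl fun k _ => ?_
            rw [intervalIntegral.integral_const_mul]
          · exact fun k _ => (intervalIntegrable_mult_drift hσ hα ht _).const_mul _
        · intro w _
          refine IntervalIntegrable.const_mul ?_ _
          have := IntervalIntegrable.sum Finset.univ fun (k : m.Site) _ =>
            (intervalIntegrable_mult_drift hσ hα ht (site m.ε k)).const_mul
              (m.ε ^ 2 * Real.cos (Real.pi * phase w (x - site m.ε k)))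
          refine this.congr ?_
          exact fun r _ => by simp
      rw [Z, h3, Ex_eq_mult, m.mult_add, m.mult_add, m.mult_const_mul, m.mult_const_mul, h4,
        m.mult_mult (fun _ => rfl), XT, Ex_eq_mult]
      simp only [one_mul]
      ring
    rw [h1, h2]
    ring

end Model

/-! ### Riemann sums -/

/-- Riemann sums of a Lipschitz function of compact support, in dimension one. -/
lemma abs_riemann_sub_integral_le {f : ℝ → ℝ} {L : ℝ} (hf : ∀ x y, |f x - f y| ≤ L * |x - y|)
    (hsupp : ∀ x, 3 < |x| → f x = 0) {γ : ℝ} (hγ : 0 < γ) {M : ℕ} (hM : 3 < γ * M) :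
    |∑ a ∈ Finset.Icc (-(M : ℤ)) M, γ * f (γ * a) - ∫ x, f x| ≤ (2 * M + 1) * (L * γ ^ 2) := by
  have hcont : Continuous f := by
    have : LipschitzWith (Real.toNNReal L) f := LipschitzWith.of_dist_le' fun x y => by
      simpa [Real.dist_eq] using hf x y
    exact this.continuous
  have hL : 0 ≤ L := by
    have := (abs_nonneg _).trans (hf 0 1)
    simpa using this
  set x : ℕ → ℝ := fun i => γ * ((i : ℝ) - M) with hx
  have hstep : ∀ i, x (i + 1) = x i + γ := by
    intro i
    simp only [hx]
    push_cast
    ring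
  have hsum : ∑ a ∈ Finset.Icc (-(M : ℤ)) M, γ * f (γ * a)
      = ∑ i ∈ Finset.range (2 * M + 1), γ * f (x i) := by
    refine Finset.sum_nbij' (fun a => (a + M).toNat) (fun i => (i : ℤ) - M) ?_ ?_ ?_ ?_ ?_
    · intro a ha
      rw [Finset.mem_Icc] at ha
      rw [Finset.mem_range]
      omega
    · intro i hi
      rw [Finset.mem_range] at hi
      rw [Finset.mem_Icc]
      omega
    · intro a ha
      rw [Finset.mem_Icc] at ha
      omega
    · intro i hi
      simp
    · intro a ha
      rw [Finset.mem_Icc] at ha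
      simp only [hx]
      have : (((a + M).toNat : ℕ) : ℝ) = (a : ℝ) + M := by
        have h : (((a + M).toNat : ℕ) : ℤ) = a + M := Int.toNat_of_nonneg (by omega)
        exact_mod_cast h
      rw [this]
      congr 3
      ring
  have hint : ∫ x, f x = ∑ i ∈ Finset.range (2 * M + 1), ∫ y in x i..x (i + 1), f y := by
    rw [intervalIntegral.sum_integral_adjacent_intervals
      (fun k _ => hcont.intervalIntegrable _ _)]
    symm
    apply intervalIntegral.integral_eq_integral_of_support_subset
    intro y hy
    have hy3 : |y| ≤ 3 := by
      by_contra h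
      exact hy (hsupp y (not_le.1 h))
    rw [abs_le] at hy3
    simp only [hx, Set.mem_Ioc]
    push_cast
    constructor <;> nlinarith [hy3.1, hy3.2]
  rw [hsum, hint, ← Finset.sum_sub_distrib]
  refine (Finset.abs_sum_le_sum_abs _ _).trans ?_
  have hterm : ∀ i ∈ Finset.range (2 * M + 1),
      |γ * f (x i) - ∫ y in x i..x (i + 1), f y| ≤ L * γ ^ 2 := by
    intro i _
    have h1 : γ * f (x i) = ∫ y in x i..x (i + 1), f (x i) := by
      rw [intervalIntegral.integral_const, hstep]
      simp
    rw [h1, ← intervalIntegral.integral_sub (by simp) (hcont.intervalIntegrable _ _)]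
    have h2 := intervalIntegral.norm_integral_le_of_norm_le_const (a := x i) (b := x (i + 1))
      (f := fun y => f (x i) - f y) (C := L * γ) ?_
    · rw [Real.norm_eq_abs] at h2
      refine h2.trans (le_of_eq ?_)
      rw [hstep, add_sub_cancel_left, abs_of_pos hγ]
      ring
    · intro y hy
      rw [hstep, Set.uIoc_of_le (by linarith)] at hy
      refine (hf _ _).trans (mul_le_mul_of_nonneg_left ?_ hL)
      rw [abs_sub_comm, abs_of_pos (by linarith [hy.1])]
      linarith [hy.2]
  refine (Finset.sum_le_sum hterm).trans (le_of_eq ?_)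
  rw [Finset.sum_const, Finset.card_range]
  ring

lemma abs_apply_le_norm (x : Plane) (i : Fin 2) : |x i| ≤ ‖x‖ := by
  simpa using PiLp.norm_apply_le x i

lemma norm_sq_eq (x : Plane) : ‖x‖ ^ 2 = x 0 ^ 2 + x 1 ^ 2 := by
  rw [EuclideanSpace.norm_sq_eq]
  simp

/-- Riemann sums of a Lipschitz function of compact support on the plane. -/
lemma abs_riemann_sub_integral_plane_le {g : Plane → ℝ} {L : ℝ}
    (hg : ∀ x y, |g x - g y| ≤ L * ‖x - y‖)
    (hsupp : ∀ x, 3 < ‖x‖ → g x = 0) {γ : ℝ} (hγ : 0 < γ) (hγ1 : γ ≤ 1) {M : ℕ}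
    (hM : 3 < γ * M) (hM' : γ * M ≤ 4) :
    |∑ a ∈ Finset.Icc (-(M : ℤ)) M, ∑ b ∈ Finset.Icc (-(M : ℤ)) M,
        γ ^ 2 * g (!₂[γ * a, γ * b]) - ∫ x, g x| ≤ 200 * L * γ := by
  have hL : 0 ≤ L := by
    have h := (abs_nonneg _).trans (hg 0 (!₂[1, 0]))
    have h1 : (0 : ℝ) < ‖(0 : Plane) - !₂[1, 0]‖ := by
      rw [norm_pos_iff, sub_ne_zero]
      intro h
      have := congrArg (fun z : Plane => z 0) h
      simp at this
    exact nonneg_of_mul_nonneg_left h h1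
  have hcont : Continuous g := by
    have : LipschitzWith (Real.toNNReal L) g := LipschitzWith.of_dist_le' fun x y => by
      simpa [Real.dist_eq, dist_eq_norm] using hg x y
    exact this.continuous
  have hpair : Continuous fun p : ℝ × ℝ => g (!₂[p.1, p.2]) := by fun_prop
  have hsupp2 : ∀ a b : ℝ, 3 < |a| ∨ 3 < |b| → g (!₂[a, b]) = 0 := by
    intro a b h
    refine hsupp _ ?_
    rcases h with h | h
    · exact h.trans_le (by simpa using abs_apply_le_norm (!₂[a, b]) 0)
    · exact h.trans_le (by simpa using abs_apply_le_norm (!₂[a, b]) 1)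
  have hcs : HasCompactSupport fun p : ℝ × ℝ => g (!₂[p.1, p.2]) := by
    refine HasCompactSupport.intro (isCompact_Icc.prod isCompact_Icc :
      IsCompact (Set.Icc (-3 : ℝ) 3 ×ˢ Set.Icc (-3 : ℝ) 3)) ?_
    rintro ⟨a, b⟩ h
    refine hsupp2 a b ?_
    by_contra hcon
    push Not at hcon
    exact h ⟨abs_le.1 hcon.1, abs_le.1 hcon.2⟩
  set G : ℝ → ℝ := fun a => ∫ b, g (!₂[a, b]) with hG
  have hinteg : ∫ x, g x = ∫ a, G a := by
    have h1 := (EuclideanSpace.volume_preserving_symm_measurableEquiv_toLp (Fin 2)).symm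
    have h2 := (volume_preserving_finTwoArrow ℝ).symm
    rw [← h1.integral_comp (MeasurableEquiv.measurableEmbedding _),
      ← h2.integral_comp (MeasurableEquiv.measurableEmbedding _), Measure.volume_eq_prod,
      integral_prod]
    · rfl
    · exact hpair.integrable_of_hasCompactSupport hcs
  have hGint : ∀ a, G a = ∫ b in (-4 : ℝ)..4, g (!₂[a, b]) := by
    intro a
    symm
    apply intervalIntegral.integral_eq_integral_of_support_subset
    intro b hb
    have hy3 : |b| ≤ 3 := by
      by_contra h
      exact hb (hsupp2 a b (Or.inr (not_le.1 h)))
    rw [abs_le] at hy3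
    constructor <;> linarith [hy3.1, hy3.2]
  have hnorm1 : ∀ a a' b : ℝ, ‖(!₂[a, b] : Plane) - !₂[a', b]‖ = |a - a'| := by
    intro a a' b
    rw [← abs_of_nonneg (norm_nonneg _), ← sq_eq_sq_iff_abs_eq_abs, norm_sq_eq]
    simp
  have hnorm2 : ∀ a b b' : ℝ, ‖(!₂[a, b] : Plane) - !₂[a, b']‖ = |b - b'| := by
    intro a a' b
    rw [← abs_of_nonneg (norm_nonneg _), ← sq_eq_sq_iff_abs_eq_abs, norm_sq_eq]
    simp
  have hGlip : ∀ a a', |G a - G a'| ≤ (8 * L) * |a - a'| := by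
    intro a a'
    have hc : ∀ a, Continuous fun b : ℝ => g (!₂[a, b]) := fun a => by fun_prop
    rw [hGint, hGint, ← intervalIntegral.integral_sub ((hc a).intervalIntegrable _ _)
      ((hc a').intervalIntegrable _ _)]
    have h2 := intervalIntegral.norm_integral_le_of_norm_le_const (a := (-4 : ℝ)) (b := 4)
      (f := fun b => g (!₂[a, b]) - g (!₂[a', b])) (C := L * |a - a'|) ?_
    · rw [Real.norm_eq_abs] at h2
      refine h2.trans (le_of_eq ?_)
      norm_num
      ring
    · intro b _
      rw [Real.norm_eq_abs, ← hnorm1 a a' b]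
      exact hg _ _
  have hGsupp : ∀ a, 3 < |a| → G a = 0 := by
    intro a ha
    simp only [hG, hsupp2 a _ (Or.inl ha), integral_zero]
  have h1 := abs_riemann_sub_integral_le hGlip hGsupp hγ hM
  have h2 : ∀ a : ℤ, |∑ b ∈ Finset.Icc (-(M : ℤ)) M, γ * g (!₂[γ * a, γ * b]) - G (γ * a)|
      ≤ (2 * M + 1) * (L * γ ^ 2) := by
    intro a
    refine abs_riemann_sub_integral_le (f := fun b => g (!₂[γ * a, b])) ?_ ?_ hγ hM
    · intro b b'
      rw [← hnorm2 (γ * a) b b']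
      exact hg _ _
    · exact fun b hb => hsupp2 _ _ (Or.inr hb)
  have h3 : |∑ a ∈ Finset.Icc (-(M : ℤ)) M, ∑ b ∈ Finset.Icc (-(M : ℤ)) M,
        γ ^ 2 * g (!₂[γ * a, γ * b]) - ∑ a ∈ Finset.Icc (-(M : ℤ)) M, γ * G (γ * a)|
      ≤ (2 * M + 1) * (γ * ((2 * M + 1) * (L * γ ^ 2))) := by
    rw [← Finset.sum_sub_distrib]
    refine (Finset.abs_sum_le_sum_abs _ _).trans ?_
    have : ∀ a ∈ Finset.Icc (-(M : ℤ)) M, |∑ b ∈ Finset.Icc (-(M : ℤ)) M,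
        γ ^ 2 * g (!₂[γ * a, γ * b]) - γ * G (γ * a)| ≤ γ * ((2 * M + 1) * (L * γ ^ 2)) := by
      intro a _
      have h4 : ∑ b ∈ Finset.Icc (-(M : ℤ)) M, γ ^ 2 * g (!₂[γ * a, γ * b])
          = γ * ∑ b ∈ Finset.Icc (-(M : ℤ)) M, γ * g (!₂[γ * a, γ * b]) := by
        rw [Finset.mul_sum]
        exact Finset.sum_congr rfl fun b _ => by ring
      rw [h4, ← mul_sub, abs_mul, abs_of_pos hγ]
      exact mul_le_mul_of_nonneg_left (h2 a) hγ.le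
    refine (Finset.sum_le_sum this).trans (le_of_eq ?_)
    rw [Finset.sum_const, Int.card_Icc, nsmul_eq_mul]
    congr 1
    have : ((M : ℤ) + 1 - -(M : ℤ)).toNat = 2 * M + 1 := by omega
    rw [this]
    push_cast
    ring
  rw [hinteg]
  have h5 : (2 * M + 1) * γ ≤ 9 := by nlinarith
  have h6 : 0 ≤ (2 * M + 1) * γ := by positivity
  have h7 : (2 * (M : ℝ) + 1) * (γ * ((2 * M + 1) * (L * γ ^ 2))) ≤ 9 * 9 * (L * γ) := by
    have : (2 * (M : ℝ) + 1) * (γ * ((2 * M + 1) * (L * γ ^ 2)))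
      = ((2 * M + 1) * γ) * ((2 * M + 1) * γ) * (L * γ) := by ring
    rw [this]
    gcongr
  have h8 : (2 * (M : ℝ) + 1) * (8 * L * γ ^ 2) ≤ 9 * (8 * (L * γ)) := by
    have : (2 * (M : ℝ) + 1) * (8 * L * γ ^ 2) = ((2 * M + 1) * γ) * (8 * (L * γ)) := by ring
    rw [this]
    gcongr
  have h9 : 0 ≤ L * γ := by positivity
  have := (abs_sub_le _ (∑ a ∈ Finset.Icc (-(M : ℤ)) M, γ * G (γ * a)) (∫ a, G a)).trans
    (add_le_add h3 h1)
  linarith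

/-! ### The scaling relations -/

namespace Model

/-- The ratio of the Kac interaction range to the size of the system, so that `α = ρ²` and the
lattice spacing is close to `γ ρ`. -/
noncomputable def ρ (m : Model) : ℝ :=
  match m.regime with
  | .first => m.γ
  | .second => m.γ ^ 2

variable (m : Model)

lemma α_eq : m.α = m.ρ ^ 2 := by
  unfold α ρ
  cases m.regime
  · rfl
  · ring

lemma N_eq : m.N = ⌊(m.γ * m.ρ)⁻¹⌋₊ := by
  unfold N ρ
  cases m.regime
  · simp only
    rw [sq]
  · simp only
    congr 2
    ring

variable {m}

lemma ρ_pos (h : 0 < m.γ) : 0 < m.ρ := by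
  unfold ρ
  cases m.regime <;> simp only <;> positivity

lemma α_pos (h : 0 < m.γ) : 0 < m.α := by
  rw [α_eq]
  have := ρ_pos h
  positivity

lemma ρ_le (h : 0 < m.γ) (h1 : m.γ < 1) : m.ρ ≤ m.γ := by
  unfold ρ
  cases m.regime <;> simp only
  · exact le_rfl
  · nlinarith

lemma N_le (h : 0 < m.γ) : (m.N : ℝ) ≤ (m.γ * m.ρ)⁻¹ := by
  rw [N_eq]
  have := ρ_pos h
  exact Nat.floor_le (by positivity)

lemma lt_N : (m.γ * m.ρ)⁻¹ < m.N + 1 := by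
  rw [N_eq]
  exact Nat.lt_floor_add_one _

lemma abs_eps_div_sub_one_le (h : 0 < m.γ) (h1 : m.γ < 1) :
    |m.ε / (m.γ * m.ρ) - 1| ≤ m.γ * m.ρ := by
  have hρ := ρ_pos h
  have hρ1 := ρ_le h h1
  have hN1 := N_le h
  have hN2 := lt_N (m := m)
  set τ := m.γ * m.ρ with hτ
  have hτ0 : 0 < τ := by positivity
  have hτ1 : τ < 1 := by nlinarith
  have h2 : (m.N : ℝ) * τ ≤ 1 := by
    have := mul_le_mul_of_nonneg_right hN1 hτ0.le
    rwa [inv_mul_cancel₀ hτ0.ne'] at this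
  have h3 : 1 < ((m.N : ℝ) + 1) * τ := by
    have := mul_lt_mul_of_pos_right hN2 hτ0
    rwa [inv_mul_cancel₀ hτ0.ne'] at this
  have h4 : m.ε / τ = 2 / ((2 * m.N + 1) * τ) := by
    unfold ε
    field_simp
  rw [h4, abs_le]
  have h5 : 0 < (2 * (m.N : ℝ) + 1) * τ := by positivity
  constructor
  · rw [le_sub_iff_add_le, le_div_iff₀ h5]
    nlinarith
  · rw [sub_le_iff_le_add, div_le_iff₀ h5]
    nlinarith

lemma le_eps (h : 0 < m.γ) (h1 : m.γ < 1 / 2) : m.γ * m.ρ / 2 ≤ m.ε := by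
  have hρ := ρ_pos h
  have := (abs_le.1 (abs_eps_div_sub_one_le h (by linarith))).1
  have h2 : m.γ * m.ρ < 1 / 2 := by nlinarith [ρ_le h (by linarith)]
  have h3 : 1 / 2 ≤ m.ε / (m.γ * m.ρ) := by linarith
  rw [le_div_iff₀ (by positivity)] at h3
  linarith

/-- The system is much larger than the range of the interaction. -/
lemma four_lt_N (h : 0 < m.γ) (h1 : m.γ < 1 / 8) : 4 < m.γ * m.N := by
  have hρ := ρ_pos h
  have hN2 := lt_N (m := m)
  have hρ1 := ρ_le h (by linarith)
  have h2 : m.γ⁻¹ * m.γ⁻¹ ≤ (m.γ * m.ρ)⁻¹ := by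
    rw [← mul_inv]
    gcongr
  have h3 : 8 < m.γ⁻¹ := by
    rw [lt_inv_comm₀ (by norm_num) h]
    linarith
  have h4 : m.γ * m.γ⁻¹ = 1 := mul_inv_cancel₀ h.ne'
  have h5 : m.γ⁻¹ * m.γ⁻¹ < m.N + 1 := lt_of_le_of_lt h2 hN2
  have h6 := mul_lt_mul_of_pos_left h5 h
  rw [← mul_assoc, h4, one_mul] at h6
  linarith

end Model

/-! ### The normalisation of the Kac kernel -/

lemma sum_piFinset_two (I : Finset ℤ) (F : Freq → ℝ) :
    ∑ w ∈ Fintype.piFinset (fun _ : Fin 2 => I), F w = ∑ a ∈ I, ∑ b ∈ I, F ![a, b] := by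
  rw [← Finset.sum_product']
  refine Finset.sum_nbij' (fun w => (w 0, w 1)) (fun p => ![p.1, p.2]) ?_ ?_ ?_ ?_ ?_
  · intro w hw
    rw [Fintype.mem_piFinset] at hw
    exact Finset.mem_product.2 ⟨hw 0, hw 1⟩
  · intro p hp
    rw [Finset.mem_product] at hp
    rw [Fintype.mem_piFinset, Fin.forall_fin_two]
    exact hp
  · intro w _
    ext i
    fin_cases i <;> rfl
  · intro p _
    rfl
  · intro w _
    congr 1
    ext i
    fin_cases i <;> rfl

lemma abs_phase_le (w : Freq) (x : Plane) : |phase w x| ≤ ‖w.toPlane‖ * ‖x‖ := by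
  have h : phase w x = inner ℝ x w.toPlane := by
    rw [PiLp.inner_apply]
    simp [phase, Freq.toPlane]
  rw [h, mul_comm]
  exact abs_real_inner_le_norm _ _

lemma IsKacProfile.hasCompactSupport {𝔎 : Plane → ℝ} (h : IsKacProfile 𝔎) :
    HasCompactSupport 𝔎 := by
  refine HasCompactSupport.intro (isCompact_closedBall (0 : Plane) 3) fun x hx => h.supp x ?_
  rw [Metric.mem_closedBall, dist_zero_right] at hx
  exact not_le.1 hx

lemma IsKacProfile.lipschitz {𝔎 : Plane → ℝ} (h : IsKacProfile 𝔎) :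
    ∃ L, 0 ≤ L ∧ ∀ x y, |𝔎 x - 𝔎 y| ≤ L * ‖x - y‖ := by
  obtain ⟨L, hL⟩ := h.contDiff.lipschitzWith_of_hasCompactSupport h.hasCompactSupport (by norm_num)
  refine ⟨L, L.2, fun x y => ?_⟩
  simpa [Real.dist_eq, dist_eq_norm] using hL.dist_le_mul x y

lemma IsKacProfile.lipschitz_moment {𝔎 : Plane → ℝ} (h : IsKacProfile 𝔎) :
    ∃ L, 0 ≤ L ∧ ∀ x y, |𝔎 x * ‖x‖ ^ 2 - 𝔎 y * ‖y‖ ^ 2| ≤ L * ‖x - y‖ := by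
  have hc : ContDiff ℝ 2 fun x => 𝔎 x * ‖x‖ ^ 2 := h.contDiff.mul (contDiff_norm_sq ℝ)
  obtain ⟨L, hL⟩ := hc.lipschitzWith_of_hasCompactSupport
    h.hasCompactSupport.mul_right (by norm_num)
  refine ⟨L, L.2, fun x y => ?_⟩
  simpa [Real.dist_eq, dist_eq_norm] using hL.dist_le_mul x y

/-- The limit `γ → 0`, uniformly over all models with the Kac profile `𝔎`. -/
def kacLimit (𝔎 : Plane → ℝ) : Filter Model :=
  comap Model.γ (𝓝[>] 0) ⊓ 𝓟 {m | m.𝔎 = 𝔎}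

lemma eventually_kacLimit {𝔎 : Plane → ℝ} {γ₀ : ℝ} (h : 0 < γ₀) :
    ∀ᶠ m in kacLimit 𝔎, m.𝔎 = 𝔎 ∧ 0 < m.γ ∧ m.γ < γ₀ := by
  have h1 : ∀ᶠ m in kacLimit 𝔎, m.𝔎 = 𝔎 :=
    (eventually_principal.2 fun m hm => hm).filter_mono inf_le_right
  have h2 : ∀ᶠ m in kacLimit 𝔎, m.γ ∈ Set.Ioo 0 γ₀ :=
    ((tendsto_comap (f := Model.γ)).eventually (Ioo_mem_nhdsGT h)).filter_mono inf_le_left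
  filter_upwards [h1, h2] with m h1 h2
  exact ⟨h1, h2.1, h2.2⟩

namespace Model

variable {m : Model}

lemma sum_site_eq (g : Plane → ℝ) : ∑ k : m.Site, m.γ ^ 2 * g (site m.γ k)
    = ∑ w ∈ m.box, m.γ ^ 2 * g (!₂[m.γ * (w 0 : ℝ), m.γ * (w 1 : ℝ)]) := by
  rw [sum_box]
  refine Finset.sum_congr rfl fun k _ => ?_
  congr 2
  ext i
  fin_cases i <;> rfl

/-- Riemann sums over the lattice. -/
lemma abs_sum_site_sub_integral_le {g : Plane → ℝ} {L : ℝ}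
    (hg : ∀ x y, |g x - g y| ≤ L * ‖x - y‖)
    (hsupp : ∀ x, 3 < ‖x‖ → g x = 0) (h : 0 < m.γ) (h1 : m.γ < 1 / 8) :
    |∑ k : m.Site, m.γ ^ 2 * g (site m.γ k) - ∫ x, g x| ≤ 200 * L * m.γ := by
  set M := ⌊3 / m.γ⌋₊ + 1 with hM
  have hM1 : 3 < m.γ * M := by
    have := Nat.lt_floor_add_one (3 / m.γ)
    rw [div_lt_iff₀ h] at this
    rw [hM]
    push_cast
    linarith
  have hM2 : m.γ * M ≤ 4 := by
    have := Nat.floor_le (show 0 ≤ 3 / m.γ by positivity)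
    rw [le_div_iff₀ h] at this
    rw [hM]
    push_cast
    linarith
  have hMN : M ≤ m.N := by
    have := four_lt_N h h1
    have h2 : m.γ * (M : ℝ) < m.γ * m.N := by linarith
    exact_mod_cast (lt_of_mul_lt_mul_left h2 h.le).le
  have := abs_riemann_sub_integral_plane_le hg hsupp h (by linarith) hM1 hM2
  convert this using 3
  rw [sum_site_eq, box]
  have h3 := sum_piFinset_two (Finset.Icc (-(M : ℤ)) M)
    (fun w => m.γ ^ 2 * g (!₂[m.γ * (w 0 : ℝ), m.γ * (w 1 : ℝ)]))
  simp only [Matrix.cons_val_zero, Matrix.cons_val_one] at h3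
  rw [← h3]
  symm
  refine Finset.sum_subset ?_ ?_
  · refine Fintype.piFinset_subset _ _ fun _ => Finset.Icc_subset_Icc ?_ ?_ <;> omega
  · intro w _ hw
    have h4 : ∃ i, (M : ℤ) < |w i| := by
      by_contra hcon
      push Not at hcon
      refine hw (Fintype.mem_piFinset.2 fun i => ?_)
      rw [Finset.mem_Icc, ← abs_le]
      exact hcon i
    obtain ⟨i, hi⟩ := h4
    rw [hsupp, mul_zero]
    have h5 : (M : ℝ) < |(w i : ℝ)| := by exact_mod_cast hi
    have h6 := abs_apply_le_norm (!₂[m.γ * (w 0 : ℝ), m.γ * (w 1 : ℝ)]) i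
    have h7 : (!₂[m.γ * (w 0 : ℝ), m.γ * (w 1 : ℝ)] : Plane) i = m.γ * w i := by
      fin_cases i <;> rfl
    rw [h7, abs_mul, abs_of_pos h] at h6
    have h8 : m.γ * (M : ℝ) < m.γ * |(w i : ℝ)| := mul_lt_mul_of_pos_left h5 h
    linarith

variable {𝔎 : Plane → ℝ}

/-- The normalisation of the Kac kernel. -/
noncomputable def mass (m : Model) : ℝ :=
  ∑ j ∈ Finset.univ.erase (0 : m.Site), m.γ ^ 2 * m.𝔎 (site m.γ j)

lemma site_zero {N : ℕ} (c : ℝ) : site c (0 : Lattice N) = 0 := by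
  ext; simp [site]

lemma exists_abs_mass_sub_one_le (h𝔎 : IsKacProfile 𝔎) :
    ∃ C, 0 ≤ C ∧ ∀ᶠ m in kacLimit 𝔎, |m.mass - 1| ≤ C * m.γ := by
  obtain ⟨L, hL, hlip⟩ := h𝔎.lipschitz
  refine ⟨200 * L + 1, by positivity, ?_⟩
  filter_upwards [eventually_kacLimit (show (0 : ℝ) < 1 / 8 by norm_num)] with m hm
  obtain ⟨rfl, hγ, hγ1⟩ := hm
  have h1 := abs_sum_site_sub_integral_le hlip h𝔎.supp hγ hγ1
  rw [h𝔎.integral_eq, ← Finset.add_sum_erase _ _ (Finset.mem_univ (0 : m.Site)), ← mass,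
    site_zero] at h1
  have h2 := h𝔎.mem_Icc 0
  rw [abs_le] at h1 ⊢
  have h3 : m.γ ^ 2 * m.𝔎 0 ≤ m.γ := by nlinarith [h2.1, h2.2]
  have h4 : 0 ≤ m.γ ^ 2 * m.𝔎 0 := mul_nonneg (by positivity) h2.1
  constructor <;> nlinarith

lemma eventually_half_le_mass (h𝔎 : IsKacProfile 𝔎) : ∀ᶠ m in kacLimit 𝔎, 1 / 2 ≤ m.mass := by
  obtain ⟨C, hC, h⟩ := exists_abs_mass_sub_one_le h𝔎
  filter_upwards [h, eventually_kacLimit (𝔎 := 𝔎) (show 0 < 1 / (2 * C + 1) by positivity)]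
    with m h1 h2
  have h3 := h2.2.2
  rw [lt_div_iff₀ (by positivity)] at h3
  have := (abs_le.1 h1).1
  nlinarith [h2.2.1]

lemma κ_nonneg (h𝔎 : IsKacProfile m.𝔎) (k : m.Site) : 0 ≤ m.κ k := by
  unfold κ
  split_ifs
  · exact le_rfl
  · refine div_nonneg (mul_nonneg (by positivity) (h𝔎.mem_Icc _).1) ?_
    exact Finset.sum_nonneg fun j _ => mul_nonneg (by positivity) (h𝔎.mem_Icc _).1

lemma κ_eq (k : m.Site) : m.κ k = if k = 0 then 0 else m.γ ^ 2 * m.𝔎 (site m.γ k) / m.mass := rfl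

lemma sum_κ_mul (F : m.Site → ℝ) : ∑ k, m.κ k * F k
    = (∑ k ∈ Finset.univ.erase (0 : m.Site), m.γ ^ 2 * m.𝔎 (site m.γ k) * F k) / m.mass := by
  rw [← Finset.add_sum_erase _ _ (Finset.mem_univ (0 : m.Site)), Finset.sum_div]
  rw [κ_eq, if_pos rfl, zero_mul, zero_add]
  refine Finset.sum_congr rfl fun k hk => ?_
  rw [κ_eq, if_neg (Finset.ne_of_mem_erase hk)]
  ring

lemma sum_κ (h : m.mass ≠ 0) : ∑ k, m.κ k = 1 := by
  have := sum_κ_mul (m := m) fun _ => 1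
  simp only [mul_one] at this
  rw [this]
  exact div_self h

lemma κ_eq_zero (h𝔎 : IsKacProfile m.𝔎) {k : m.Site} (hk : 3 < ‖site m.γ k‖) : m.κ k = 0 := by
  rw [κ_eq, h𝔎.supp _ hk]
  simp

lemma κ_le (h𝔎 : IsKacProfile m.𝔎) (h : 1 / 2 ≤ m.mass) (k : m.Site) : m.κ k ≤ 2 * m.γ ^ 2 := by
  rw [κ_eq]
  split_ifs
  · positivity
  · rw [div_le_iff₀ (by linarith)]
    have := (h𝔎.mem_Icc (site m.γ k)).2
    nlinarith [sq_nonneg m.γ]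

/-- The second moment of the discrete kernel. -/
lemma exists_abs_second_moment_sub_le (h𝔎 : IsKacProfile 𝔎) :
    ∃ C, 0 ≤ C ∧ ∀ᶠ m in kacLimit 𝔎, |∑ k, m.κ k * ‖site m.γ k‖ ^ 2 - 4| ≤ C * m.γ := by
  obtain ⟨L, hL, hlip⟩ := h𝔎.lipschitz_moment
  obtain ⟨C, hC, hmass⟩ := exists_abs_mass_sub_one_le h𝔎
  refine ⟨2 * (200 * L + 4 * C), by positivity, ?_⟩
  filter_upwards [eventually_kacLimit (show (0 : ℝ) < 1 / 8 by norm_num), hmass,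
    eventually_half_le_mass h𝔎] with m hm h2 h3
  obtain ⟨rfl, hγ, hγ1⟩ := hm
  have h1 := abs_sum_site_sub_integral_le hlip (fun x hx => by rw [h𝔎.supp x hx, zero_mul]) hγ hγ1
  rw [h𝔎.second_moment, ← Finset.add_sum_erase _ _ (Finset.mem_univ (0 : m.Site)),
    site_zero, norm_zero] at h1
  rw [sum_κ_mul]
  simp_rw [mul_assoc]
  set S := ∑ k ∈ Finset.univ.erase (0 : m.Site), m.γ ^ 2 * (m.𝔎 (site m.γ k) * ‖site m.γ k‖ ^ 2)
  have h4 : |S - 4| ≤ 200 * L * m.γ := by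
    convert h1 using 2
    ring
  have h5 : S / m.mass - 4 = ((S - 4) - 4 * (m.mass - 1)) / m.mass := by
    field_simp
    ring
  rw [h5, abs_div, abs_of_pos (by linarith : 0 < m.mass), div_le_iff₀ (by linarith)]
  have h6 : |(S - 4) - 4 * (m.mass - 1)| ≤ 200 * L * m.γ + 4 * (C * m.γ) := by
    refine (abs_sub _ _).trans (add_le_add h4 ?_)
    rw [abs_mul, abs_of_pos (by norm_num : (0 : ℝ) < 4)]
    linarith
  refine h6.trans ?_
  have : 0 ≤ 2 * (200 * L + 4 * C) * m.γ := by positivity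
  nlinarith

/-! ### The symbol of the Kac kernel -/

lemma Khat_eq : ∀ w, m.Khat w = ∑ k : m.Site, m.κ k * Real.cos (Real.pi * phase w (site m.ε k)) := by
  intro w
  have := m.eps_pos
  unfold Khat K
  refine Finset.sum_congr rfl fun k _ => ?_
  field_simp

lemma one_sub_Khat (h : m.mass ≠ 0) (w : Freq) : 1 - m.Khat w
    = ∑ k : m.Site, m.κ k * (1 - Real.cos (Real.pi * phase w (site m.ε k))) := by
  simp_rw [mul_sub, Finset.sum_sub_distrib, mul_one, sum_κ h, Khat_eq]

lemma abs_Khat_le_one (h𝔎 : IsKacProfile m.𝔎) (h : m.mass ≠ 0) (w : Freq) : |m.Khat w| ≤ 1 := by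
  rw [Khat_eq]
  refine (Finset.abs_sum_le_sum_abs _ _).trans ?_
  rw [← sum_κ h]
  refine Finset.sum_le_sum fun k _ => ?_
  rw [abs_mul, abs_of_nonneg (κ_nonneg h𝔎 k)]
  exact mul_le_of_le_one_right (κ_nonneg h𝔎 k) (Real.abs_cos_le_one _)

lemma Khat_zero (h : m.mass ≠ 0) : m.Khat 0 = 1 := by
  rw [Khat_eq]
  simp [sum_κ h]

/-- The quadratic growth of `1 - Khat` propagates from a frequency to its half. -/
lemma one_sub_Khat_two_smul_le (h𝔎 : IsKacProfile m.𝔎) (h : m.mass ≠ 0) (w : Freq) :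
    1 - m.Khat (w + w) ≤ 4 * (1 - m.Khat w) := by
  rw [one_sub_Khat h, one_sub_Khat h, Finset.mul_sum]
  refine Finset.sum_le_sum fun k _ => ?_
  rw [phase_add_left, mul_add, ← two_mul, Real.cos_two_mul]
  have h1 := κ_nonneg h𝔎 k
  set c := Real.cos (Real.pi * phase w (site m.ε k))
  have h2 : c ≤ 1 := Real.cos_le_one _
  have h3 : 0 ≤ m.κ k * (2 * (1 - c) ^ 2) := by positivity
  nlinarith

end Model

namespace Model

variable {m : Model} {𝔎 : Plane → ℝ}

/-! ### Symmetries of the kernel and expansion of its symbol -/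

lemma norm_site_sq {N : ℕ} (c : ℝ) (k : Lattice N) : ‖site c k‖ ^ 2
    = c ^ 2 * ((k 0).valMinAbs ^ 2 + (k 1).valMinAbs ^ 2 : ℝ) := by
  rw [norm_sq_eq]
  simp only [site]
  ring

lemma norm_site_congr {N : ℕ} (c : ℝ) {k l : Lattice N}
    (h : ((k 0).valMinAbs ^ 2 + (k 1).valMinAbs ^ 2 : ℝ)
      = (l 0).valMinAbs ^ 2 + (l 1).valMinAbs ^ 2) : ‖site c k‖ = ‖site c l‖ := by
  rw [← sq_eq_sq₀ (norm_nonneg _) (norm_nonneg _), norm_site_sq, norm_site_sq, h]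

lemma valMinAbs_neg_eq {N : ℕ} (a : ZMod (2 * N + 1)) : (-a).valMinAbs = -a.valMinAbs := by
  apply ZMod.valMinAbs_neg_of_ne_half
  intro h
  have hlt := ZMod.val_lt a
  omega

/-- By the symmetries of the square lattice, the quadratic form of the kernel is isotropic. -/
lemma sum_κ_phase_sq (h𝔎 : IsKacProfile m.𝔎) (w : Freq) (c : ℝ) :
    ∑ k : m.Site, m.κ k * phase w (site c k) ^ 2
      = ‖w.toPlane‖ ^ 2 / 2 * ∑ k : m.Site, m.κ k * ‖site c k‖ ^ 2 := by
  set A : Fin 2 → Fin 2 → ℝ := fun i j =>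
    ∑ k : m.Site, m.κ k * ((k i).valMinAbs * (k j).valMinAbs) with hA
  have hcross : A 0 1 = 0 := by
    set e : m.Site ≃ m.Site := Function.Involutive.toPerm (fun k => ![-k 0, k 1]) (by
      intro k; ext i; fin_cases i <;> simp) with he
    have he0 : ∀ k, (e k) 0 = -k 0 := fun k => rfl
    have he1 : ∀ k, (e k) 1 = k 1 := fun k => rfl
    have hκe : ∀ k, m.κ (e k) = m.κ k := by
      intro k
      have h1 : (e k = 0) ↔ k = 0 := by
        simp [funext_iff, Fin.forall_fin_two, he0, he1]
      rw [κ_eq, κ_eq]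
      simp only [h1]
      rw [h𝔎.radial (site m.γ (e k)) (site m.γ k) (norm_site_congr _ ?_)]
      rw [he0, he1, valMinAbs_neg_eq]
      push_cast
      ring
    have h2 := Equiv.sum_comp e fun k => m.κ k * ((k 0).valMinAbs * (k 1).valMinAbs : ℝ)
    have h3 : ∀ k, m.κ (e k) * (((e k) 0).valMinAbs * ((e k) 1).valMinAbs : ℝ)
        = -(m.κ k * ((k 0).valMinAbs * (k 1).valMinAbs)) := by
      intro k
      rw [hκe, he0, he1, valMinAbs_neg_eq]
      push_cast
      ring
    simp_rw [h3, Finset.sum_neg_distrib] at h2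
    simp only [hA]
    linarith
  have hdiag : A 1 1 = A 0 0 := by
    set e : m.Site ≃ m.Site := Function.Involutive.toPerm (fun k => ![k 1, k 0]) (by
      intro k; ext i; fin_cases i <;> simp) with he
    have he0 : ∀ k, (e k) 0 = k 1 := fun k => rfl
    have he1 : ∀ k, (e k) 1 = k 0 := fun k => rfl
    have hκe : ∀ k, m.κ (e k) = m.κ k := by
      intro k
      have h1 : (e k = 0) ↔ k = 0 := by
        simp [funext_iff, Fin.forall_fin_two, he0, he1, and_comm]
      rw [κ_eq, κ_eq]
      simp only [h1]
      rw [h𝔎.radial (site m.γ (e k)) (site m.γ k) (norm_site_congr _ ?_)]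
      rw [he0, he1, add_comm]
    have h2 := Equiv.sum_comp e fun k => m.κ k * ((k 0).valMinAbs * (k 0).valMinAbs : ℝ)
    simp_rw [hκe, he0] at h2
    exact h2
  have h1 : ∑ k : m.Site, m.κ k * phase w (site c k) ^ 2
      = c ^ 2 * ((w 0) ^ 2 * A 0 0 + 2 * (w 0) * (w 1) * A 0 1 + (w 1) ^ 2 * A 1 1) := by
    simp only [hA, Finset.mul_sum, ← Finset.sum_add_distrib]
    refine Finset.sum_congr rfl fun k _ => ?_
    simp only [phase, site, Fin.sum_univ_two]
    ring
  have h2 : ∑ k : m.Site, m.κ k * ‖site c k‖ ^ 2 = c ^ 2 * (A 0 0 + A 1 1) := by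
    simp only [hA, Finset.mul_sum, ← Finset.sum_add_distrib]
    refine Finset.sum_congr rfl fun k _ => ?_
    rw [norm_site_sq]
    ring
  rw [h1, h2, hcross, hdiag, norm_sq_eq]
  simp only [Freq.toPlane]
  ring

lemma norm_site_eps (h : 0 < m.γ) (k : m.Site) :
    ‖site m.ε k‖ = m.ε / m.γ * ‖site m.γ k‖ := by
  have := m.eps_pos
  rw [← sq_eq_sq₀ (norm_nonneg _) (by positivity), mul_pow, norm_site_sq, norm_site_sq]
  field_simp

/-- Scaling of the distance between lattice points, uniformly in the two regimes. -/
lemma abs_eps_ratio_sub_one_le (hγ : 0 < m.γ) (hγ1 : m.γ < 1 / 8) :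
    |m.ε / (m.γ * m.ρ) - 1| ≤ m.γ * m.ρ ∧ m.γ * m.ρ ≤ m.γ ∧ m.γ * m.ρ ≤ 1 / 8 := by
  have hρ1 := ρ_le hγ (by linarith)
  have hρ := ρ_pos hγ
  refine ⟨abs_eps_div_sub_one_le hγ (by linarith), ?_, ?_⟩ <;> nlinarith

/-- At low frequencies the symbol of the generator is close to that of the Laplacian. -/
lemma exists_abs_symbol_sub_le (h𝔎 : IsKacProfile 𝔎) :
    ∃ C, 0 ≤ C ∧ ∀ᶠ m in kacLimit 𝔎, ∀ w : Freq, m.ρ * ‖w.toPlane‖ ≤ 1 / 24 →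
      |m.α⁻¹ * (1 - m.Khat w) - Real.pi ^ 2 * ‖w.toPlane‖ ^ 2|
        ≤ C * (m.γ * ‖w.toPlane‖ ^ 2 + m.ρ ^ 2 * ‖w.toPlane‖ ^ 4) := by
  obtain ⟨C, hC, hmom⟩ := exists_abs_second_moment_sub_le h𝔎
  refine ⟨10 * (C + 3) + 10 ^ 6, by positivity, ?_⟩
  filter_upwards [eventually_kacLimit (show (0 : ℝ) < 1 / 8 by norm_num), hmom,
    eventually_half_le_mass h𝔎] with m hm hE2 hmass w hw
  obtain ⟨rfl, hγ, hγ1⟩ := hm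
  have hρ := ρ_pos hγ
  have hρ1 := ρ_le hγ (by linarith)
  have hmass0 : m.mass ≠ 0 := by linarith
  have hε := m.eps_pos
  set n := ‖w.toPlane‖ with hn
  have hn0 : 0 ≤ n := norm_nonneg _
  have hπ := Real.pi_pos
  have hπ4 := Real.pi_lt_d2
  set E := ∑ k, m.κ k * ‖site m.γ k‖ ^ 2 with hE
  set u := m.ε / (m.γ * m.ρ) with hu
  obtain ⟨hu1, hτ, hτ1⟩ := abs_eps_ratio_sub_one_le hγ hγ1
  rw [← hu] at hu1
  have hεγ : m.ε / m.γ = u * m.ρ := by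
    rw [hu]
    field_simp
  have hquad : ∑ k : m.Site, m.κ k * ((Real.pi * phase w (site m.ε k)) ^ 2 / 2)
      = m.α * (Real.pi ^ 2 * n ^ 2 / 4 * (u ^ 2 * E)) := by
    have h1 := sum_κ_phase_sq h𝔎 w m.ε
    have h2 : ∑ k : m.Site, m.κ k * ‖site m.ε k‖ ^ 2 = (u * m.ρ) ^ 2 * E := by
      rw [hE, Finset.mul_sum]
      refine Finset.sum_congr rfl fun k _ => ?_
      rw [norm_site_eps hγ, hεγ]
      ring
    rw [h2] at h1
    have h3 : ∑ k : m.Site, m.κ k * ((Real.pi * phase w (site m.ε k)) ^ 2 / 2)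
        = Real.pi ^ 2 / 2 * ∑ k : m.Site, m.κ k * phase w (site m.ε k) ^ 2 := by
      rw [Finset.mul_sum]
      exact Finset.sum_congr rfl fun k _ => by ring
    rw [h3, h1, α_eq]
    ring
  have hquart : |1 - m.Khat w - m.α * (Real.pi ^ 2 * n ^ 2 / 4 * (u ^ 2 * E))|
      ≤ 10 ^ 6 * (m.ρ * n) ^ 4 := by
    rw [one_sub_Khat hmass0, ← hquad, ← Finset.sum_sub_distrib]
    refine (Finset.abs_sum_le_sum_abs _ _).trans ?_
    have : ∀ k ∈ (Finset.univ : Finset m.Site),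
        |m.κ k * (1 - Real.cos (Real.pi * phase w (site m.ε k)))
          - m.κ k * ((Real.pi * phase w (site m.ε k)) ^ 2 / 2)|
        ≤ m.κ k * (10 ^ 6 * (m.ρ * n) ^ 4) := by
      intro k _
      rw [← mul_sub, abs_mul, abs_of_nonneg (κ_nonneg h𝔎 k)]
      by_cases hk : 3 < ‖site m.γ k‖
      · rw [κ_eq_zero h𝔎 hk, zero_mul, zero_mul]
      · refine mul_le_mul_of_nonneg_left ?_ (κ_nonneg h𝔎 k)
        set x := Real.pi * phase w (site m.ε k) with hx
        have hx1 : |x| ≤ 20 * (m.ρ * n) := by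
          rw [hx, abs_mul, abs_of_pos hπ]
          have h1 := abs_phase_le w (site m.ε k)
          rw [norm_site_eps hγ, hεγ] at h1
          have hu2 : u ≤ 2 := by
            have := (abs_le.1 hu1).2
            linarith
          have hu0 : 0 ≤ u := by positivity
          have h2 : u * m.ρ * ‖site m.γ k‖ ≤ 2 * m.ρ * 3 := by
            have := not_lt.1 hk
            gcongr
          calc Real.pi * |phase w (site m.ε k)| ≤ Real.pi * (n * (2 * m.ρ * 3)) := by
                refine mul_le_mul_of_nonneg_left (h1.trans ?_) hπ.le
                exact mul_le_mul_of_nonneg_left h2 hn0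
            _ = (6 * Real.pi) * (m.ρ * n) := by ring
            _ ≤ 20 * (m.ρ * n) := by gcongr; linarith
        have hx2 : |x| ≤ 1 := by linarith
        have h3 := Real.cos_bound hx2
        have h4 : 1 - Real.cos x - x ^ 2 / 2 = -(Real.cos x - (1 - x ^ 2 / 2)) := by ring
        rw [h4, abs_neg]
        refine h3.trans ?_
        have h5 : |x| ^ 4 ≤ (20 * (m.ρ * n)) ^ 4 := by gcongr
        have h6 : 0 ≤ (m.ρ * n) ^ 4 := by positivity
        rw [mul_pow] at h5
        linarith
    refine (Finset.sum_le_sum this).trans ?_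
    rw [← Finset.sum_mul, sum_κ hmass0, one_mul]
  have hα := α_pos hγ
  have hmain : m.α⁻¹ * (1 - m.Khat w) - Real.pi ^ 2 * n ^ 2
      = m.α⁻¹ * (1 - m.Khat w - m.α * (Real.pi ^ 2 * n ^ 2 / 4 * (u ^ 2 * E)))
        + Real.pi ^ 2 * n ^ 2 / 4 * (u ^ 2 * E - 4) := by
    field_simp
    ring
  have hcoef : |u ^ 2 * E - 4| ≤ 4 * (C + 3) * m.γ := by
    have h1 : |u ^ 2 - 1| ≤ 3 * m.γ := by
      have : u ^ 2 - 1 = (u - 1) * (u - 1 + 2) := by ring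
      rw [this, abs_mul]
      have h2 : |u - 1 + 2| ≤ 3 := by
        rw [abs_le] at hu1 ⊢
        constructor <;> linarith [hu1.1, hu1.2]
      calc |u - 1| * |u - 1 + 2| ≤ m.γ * 3 := by gcongr; linarith
        _ = 3 * m.γ := by ring
    have h2 : u ^ 2 * E - 4 = u ^ 2 * (E - 4) + 4 * (u ^ 2 - 1) := by ring
    have h3 : u ^ 2 ≤ 4 := by
      have := (abs_le.1 h1).2
      linarith
    rw [h2]
    refine (abs_add_le _ _).trans ?_
    rw [abs_mul, abs_mul, abs_of_nonneg (sq_nonneg u), abs_of_pos (by norm_num : (0 : ℝ) < 4)]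
    have h4 : u ^ 2 * |E - 4| ≤ 4 * (C * m.γ) := by gcongr
    linarith
  rw [hmain]
  refine (abs_add_le _ _).trans ?_
  rw [abs_mul, abs_mul, abs_of_pos (inv_pos.2 hα),
    abs_of_nonneg (show 0 ≤ Real.pi ^ 2 * n ^ 2 / 4 by positivity)]
  have h1 : m.α⁻¹ * |1 - m.Khat w - m.α * (Real.pi ^ 2 * n ^ 2 / 4 * (u ^ 2 * E))|
      ≤ 10 ^ 6 * (m.ρ ^ 2 * n ^ 4) := by
    rw [inv_mul_le_iff₀ hα]
    refine hquart.trans (le_of_eq ?_)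
    rw [α_eq]
    ring
  have h2 : Real.pi ^ 2 * n ^ 2 / 4 * |u ^ 2 * E - 4| ≤ 10 * (C + 3) * (m.γ * n ^ 2) := by
    have h3 : Real.pi ^ 2 ≤ 10 := (pow_le_pow_left₀ hπ.le hπ4.le 2).trans (by norm_num)
    calc Real.pi ^ 2 * n ^ 2 / 4 * |u ^ 2 * E - 4|
        ≤ 10 * n ^ 2 / 4 * (4 * (C + 3) * m.γ) := by gcongr
      _ = _ := by ring
  have h3 : 0 ≤ 10 ^ 6 * (m.γ * n ^ 2) := by positivity
  have h4 : 0 ≤ 10 * (C + 3) * (m.ρ ^ 2 * n ^ 4) := by positivity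
  refine (add_le_add h1 h2).trans ?_
  rw [mul_add, add_mul, add_mul]
  linarith

/-! ### Decay of the symbol and spectral gap -/

lemma exists_norm_le_two_mul_abs (w : Freq) : ∃ i, ‖w.toPlane‖ ≤ 2 * |(w i : ℝ)| := by
  have h : ‖w.toPlane‖ ^ 2 = (w 0 : ℝ) ^ 2 + (w 1 : ℝ) ^ 2 := by
    rw [norm_sq_eq]
    rfl
  rcases le_total |(w 0 : ℝ)| |(w 1 : ℝ)| with h1 | h1
  · refine ⟨1, ?_⟩
    have h2 := sq_le_sq.2 h1
    refine abs_le_of_sq_le_sq' (a := ‖w.toPlane‖) ?_ (by positivity) |>.2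
    rw [mul_pow, sq_abs, h]
    nlinarith [sq_nonneg (w 1 : ℝ)]
  · refine ⟨0, ?_⟩
    have h2 := sq_le_sq.2 h1
    refine abs_le_of_sq_le_sq' (a := ‖w.toPlane‖) ?_ (by positivity) |>.2
    rw [mul_pow, sq_abs, h]
    nlinarith [sq_nonneg (w 0 : ℝ)]

/-- The discrete derivative of the Kac profile along a coordinate direction. -/
lemma abs_profile_shift_sub_le {L : ℝ} (hL : 0 ≤ L) (h𝔎 : IsKacProfile m.𝔎)
    (hlip : ∀ x y, |m.𝔎 x - m.𝔎 y| ≤ L * ‖x - y‖)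
    (hγ : 0 < m.γ) (hγ1 : m.γ < 1 / 8) (i : Fin 2) (k : m.Site) :
    |m.𝔎 (site m.γ (k + Pi.single i 1)) - m.𝔎 (site m.γ k)|
      ≤ if ∀ j, m.γ * |((k j).valMinAbs : ℝ)| ≤ 4 then L * m.γ else 0 := by
  have hN := four_lt_N hγ hγ1
  have hvanish : ∀ (l : m.Site) (j : Fin 2), 3 < m.γ * |((l j).valMinAbs : ℝ)| →
      m.𝔎 (site m.γ l) = 0 := by
    intro l j hl
    refine h𝔎.supp _ (hl.trans_le ?_)
    have := abs_apply_le_norm (site m.γ l) j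
    simpa [site, abs_mul, abs_of_pos hγ] using this
  have hk := ZMod.valMinAbs_mem_Ioc (k i)
  rw [Set.mem_Ioc] at hk
  push_cast at hk
  by_cases hi : (k i).valMinAbs = m.N
  · -- the shift wraps around the torus, far from the support of the profile
    have h1 : m.𝔎 (site m.γ k) = 0 := by
      refine hvanish k i ?_
      rw [hi]
      simp only [Int.cast_natCast, Nat.abs_cast]
      linarith
    have h2 : m.𝔎 (site m.γ (k + Pi.single i 1)) = 0 := by
      refine hvanish _ i ?_
      have h3 : ((k + Pi.single i 1 : m.Site) i).valMinAbs = -(m.N : ℤ) := by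
        rw [ZMod.valMinAbs_spec]
        constructor
        · rw [Pi.add_apply, Pi.single_eq_same, ← ZMod.coe_valMinAbs (k i), hi]
          have : ((2 * m.N + 1 : ℕ) : ZMod (2 * m.N + 1)) = 0 := ZMod.natCast_self _
          push_cast at this ⊢
          linear_combination this
        · constructor <;> push_cast <;> linarith
      rw [h3]
      push_cast
      rw [abs_neg, Nat.abs_cast]
      linarith
    rw [h1, h2, sub_zero, abs_zero]
    split_ifs
    · positivity
    · exact le_rfl
  · have hshift : ∀ j, ((k + Pi.single i 1 : m.Site) j).valMinAbs
        = (k j).valMinAbs + if j = i then 1 else 0 := by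
      intro j
      by_cases hj : j = i
      · subst hj
        rw [if_pos rfl, ZMod.valMinAbs_spec]
        constructor
        · rw [Pi.add_apply, Pi.single_eq_same]
          push_cast
          simp
        · constructor
          · push_cast
            linarith
          · push_cast
            have : (k j).valMinAbs < m.N := by omega
            omega
      · rw [if_neg hj, Pi.add_apply, Pi.single_eq_of_ne hj, add_zero, add_zero]
    split_ifs with hsmall
    · refine (hlip _ _).trans (mul_le_mul_of_nonneg_left ?_ hL)
      refine abs_le_of_sq_le_sq' (a := ‖_‖) ?_ hγ.le |>.2
      rw [norm_sq_eq]
      simp only [site, PiLp.sub_apply, hshift]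
      push_cast
      fin_cases i <;> simp <;> ring_nf <;> exact le_rfl
    · push Not at hsmall
      obtain ⟨j, hj⟩ := hsmall
      rw [hvanish k j (by linarith), hvanish (k + Pi.single i 1) j, sub_zero, abs_zero]
      rw [hshift]
      have h1 : |((k j).valMinAbs : ℝ)| - 1 ≤
          |(((k j).valMinAbs + if j = i then 1 else 0 : ℤ) : ℝ)| := by
        have h2 : |((if j = i then 1 else 0 : ℤ) : ℝ)| ≤ 1 := by split_ifs <;> simp
        push_cast at h2 ⊢
        have := abs_sub_abs_le_abs_sub ((k j).valMinAbs : ℝ) (-(if j = i then 1 else 0 : ℝ))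
        rw [abs_neg, sub_neg_eq_add] at this
        linarith
      nlinarith

/-- The number of lattice points within the range of the kernel. -/
lemma card_small_le (hγ : 0 < m.γ) (hγ1 : m.γ < 1 / 8) :
    ((Finset.univ.filter fun k : m.Site => ∀ j, m.γ * |((k j).valMinAbs : ℝ)| ≤ 4).card : ℝ)
      ≤ 81 / m.γ ^ 2 := by
  set M := ⌊4 / m.γ⌋₊ with hM
  have h1 : (Finset.univ.filter fun k : m.Site => ∀ j, m.γ * |((k j).valMinAbs : ℝ)| ≤ 4).card
      ≤ (Fintype.piFinset fun _ : Fin 2 => Finset.Icc (-(M : ℤ)) M).card := by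
    refine Finset.card_le_card_of_injOn (fun k i => (k i).valMinAbs) ?_ ?_
    · intro k hk
      rw [Finset.mem_coe, Finset.mem_filter] at hk
      rw [Finset.mem_coe, Fintype.mem_piFinset]
      intro j
      rw [Finset.mem_Icc, ← abs_le]
      have h2 := hk.2 j
      rw [mul_comm, ← le_div_iff₀ hγ] at h2
      have h3 : ((k j).valMinAbs.natAbs : ℝ) ≤ 4 / m.γ := by
        rw [Nat.cast_natAbs]
        push_cast
        exact h2
      have h4 := Nat.le_floor h3
      rw [Int.abs_eq_natAbs]
      exact_mod_cast h4
    · intro k _ l _ hkl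
      ext i
      have := congrFun hkl i
      simp only at this
      rw [← ZMod.coe_valMinAbs (k i), this, ZMod.coe_valMinAbs]
  have h2 : (Fintype.piFinset fun _ : Fin 2 => Finset.Icc (-(M : ℤ)) M).card = (2 * M + 1) ^ 2 := by
    rw [Fintype.card_piFinset]
    simp only [Int.card_Icc, Finset.prod_const, Finset.card_univ, Fintype.card_fin]
    congr 1
    omega
  rw [h2] at h1
  have h3 : (M : ℝ) ≤ 4 / m.γ := Nat.floor_le (by positivity)
  have h4 : (2 * M + 1 : ℝ) ≤ 9 / m.γ := by
    rw [le_div_iff₀ hγ] at h3 ⊢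
    nlinarith
  calc _ ≤ (((2 * M + 1) ^ 2 : ℕ) : ℝ) := by exact_mod_cast h1
    _ = (2 * M + 1 : ℝ) ^ 2 := by push_cast; ring
    _ ≤ (9 / m.γ) ^ 2 := by gcongr
    _ = 81 / m.γ ^ 2 := by rw [div_pow]; norm_num

/-- Summation by parts: the discrete Fourier transform of the profile decays. -/
lemma abs_sum_profile_cos_le {L : ℝ} (hL : 0 ≤ L) (h𝔎 : IsKacProfile m.𝔎)
    (hlip : ∀ x y, |m.𝔎 x - m.𝔎 y| ≤ L * ‖x - y‖)
    (hγ : 0 < m.γ) (hγ1 : m.γ < 1 / 8) {w : Freq} (hw : w ∈ m.box) (i : Fin 2) :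
    2 * (m.ε * |(w i : ℝ)|) * |∑ k : m.Site, m.γ ^ 2 * m.𝔎 (site m.γ k) *
      Real.cos (Real.pi * phase w (site m.ε k))| ≤ 81 * L * m.γ := by
  have hN := four_lt_N hγ hγ1
  have hε := m.eps_pos
  set e : m.Site := Pi.single i 1 with he
  set g : m.Site → ℝ := fun k => m.γ ^ 2 * m.𝔎 (site m.γ k) with hg
  set φ : m.Site → ℝ := fun k => Real.pi * phase w (site m.ε k) with hφ
  set θ := Real.pi * (m.ε * w i) with hθ
  have hφe : φ e = θ := by
    have h1 : (1 : ZMod (2 * m.N + 1)).valMinAbs = 1 := by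
      rw [ZMod.valMinAbs_spec]
      refine ⟨by simp, ?_, ?_⟩
      · push_cast
        omega
      · have : (1 : ℝ) ≤ m.N := by
          have h : 0 < m.N := by
            by_contra h
            have h0 : m.N = 0 := by omega
            rw [h0] at hN
            norm_num at hN
          exact_mod_cast h
        have : 1 ≤ m.N := by exact_mod_cast this
        push_cast
        omega
    simp only [hφ, hθ, phase, site, he]
    congr 1
    rw [Finset.sum_eq_single i]
    · rw [Pi.single_eq_same, h1]
      push_cast
      ring
    · intro j _ hj
      rw [Pi.single_eq_of_ne hj]
      simp
    · simp
  have hs : ∀ k, 2 * Real.sin (θ / 2) * Real.cos (φ k)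
      = Real.sin (φ k + θ / 2) - Real.sin (φ (k - e) + θ / 2) := by
    intro k
    have h1 := cos_phase_site_add w (k - e) e (-(θ / 2) - Real.pi / 2)
    rw [sub_add_cancel] at h1
    change Real.cos (φ k + _) = Real.cos (φ (k - e) + φ e + _) at h1
    rw [hφe, show φ k + (-(θ / 2) - Real.pi / 2) = (φ k - θ / 2) - Real.pi / 2 by ring,
      show φ (k - e) + θ + (-(θ / 2) - Real.pi / 2) = (φ (k - e) + θ / 2) - Real.pi / 2 by ring,
      Real.cos_sub_pi_div_two, Real.cos_sub_pi_div_two] at h1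
    rw [← h1, Real.sin_add, Real.sin_sub]
    ring
  have hparts : 2 * Real.sin (θ / 2) * ∑ k, g k * Real.cos (φ k)
      = ∑ k, (g k - g (k + e)) * Real.sin (φ k + θ / 2) := by
    have h1 : ∑ k, g (k + e) * Real.sin (φ k + θ / 2)
        = ∑ k, g k * Real.sin (φ (k - e) + θ / 2) := by
      have := Equiv.sum_comp (Equiv.addRight e) fun k => g k * Real.sin (φ (k - e) + θ / 2)
      simpa using this
    simp_rw [sub_mul, Finset.sum_sub_distrib, h1]
    rw [← Finset.sum_sub_distrib, Finset.mul_sum]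
    refine Finset.sum_congr rfl fun k _ => ?_
    have := hs k
    linear_combination (g k) * this
  have hsin : m.ε * |(w i : ℝ)| ≤ |Real.sin (θ / 2)| := by
    have h1 : m.ε * |(w i : ℝ)| ≤ 1 := by
      have h2 : |(w i : ℝ)| ≤ m.N := by exact_mod_cast m.mem_box.1 hw i
      have h3 := m.eps_mul
      nlinarith
    have h2 : |θ / 2| = Real.pi / 2 * (m.ε * |(w i : ℝ)|) := by
      rw [hθ, abs_div, abs_mul, abs_mul, abs_of_pos Real.pi_pos, abs_of_pos hε,
        abs_of_pos (by norm_num : (0 : ℝ) < 2)]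
      ring
    have h3 : |θ / 2| ≤ Real.pi / 2 := by
      rw [h2]
      nlinarith [Real.pi_pos]
    have h4 := Real.mul_le_sin (abs_nonneg (θ / 2)) h3
    have h5 : Real.sin |θ / 2| ≤ |Real.sin (θ / 2)| := by
      rcases abs_cases (θ / 2) with h | h
      · rw [h.1]; exact le_abs_self _
      · rw [h.1, Real.sin_neg]; exact neg_le_abs _
    refine le_trans (le_of_eq ?_) (h4.trans h5)
    rw [h2]
    have := Real.pi_pos
    field_simp
  have hbound : |∑ k, (g k - g (k + e)) * Real.sin (φ k + θ / 2)| ≤ 81 * L * m.γ := by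
    refine (Finset.abs_sum_le_sum_abs _ _).trans ?_
    have h1 : ∀ k ∈ (Finset.univ : Finset m.Site), |(g k - g (k + e)) * Real.sin (φ k + θ / 2)|
        ≤ if ∀ j, m.γ * |((k j).valMinAbs : ℝ)| ≤ 4 then m.γ ^ 2 * (L * m.γ) else 0 := by
      intro k _
      rw [abs_mul]
      refine (mul_le_of_le_one_right (abs_nonneg _) (Real.abs_sin_le_one _)).trans ?_
      simp only [hg]
      rw [← mul_sub, abs_mul, abs_of_nonneg (sq_nonneg m.γ), abs_sub_comm]
      have := mul_le_mul_of_nonneg_left (abs_profile_shift_sub_le hL h𝔎 hlip hγ hγ1 i k)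
        (sq_nonneg m.γ)
      rw [mul_ite, mul_zero] at this
      exact this
    refine (Finset.sum_le_sum h1).trans ?_
    rw [← Finset.sum_filter, Finset.sum_const, nsmul_eq_mul]
    have h2 := mul_le_mul_of_nonneg_right (card_small_le hγ hγ1)
      (show 0 ≤ m.γ ^ 2 * (L * m.γ) by positivity)
    refine h2.trans (le_of_eq ?_)
    field_simp
  rw [← hparts, abs_mul, abs_mul, abs_of_pos (by norm_num : (0 : ℝ) < 2)] at hbound
  refine le_trans ?_ hbound
  gcongr

/-- At frequencies beyond a multiple of `ρ⁻¹` the symbol is at most `1 / 2`: a summation by parts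
moves a difference onto the kernel, which is Lipschitz on the scale `γ⁻¹`. -/
lemma exists_Khat_le_half (h𝔎 : IsKacProfile 𝔎) :
    ∃ C, 0 < C ∧ ∀ᶠ m in kacLimit 𝔎, ∀ w ∈ m.box, C ≤ m.ρ * ‖w.toPlane‖ → m.Khat w ≤ 1 / 2 := by
  obtain ⟨L, hL, hlip⟩ := h𝔎.lipschitz
  refine ⟨1296 * L + 1, by positivity, ?_⟩
  filter_upwards [eventually_kacLimit (show (0 : ℝ) < 1 / 8 by norm_num),
    eventually_half_le_mass h𝔎] with m hm hmass w hw hwC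
  obtain ⟨rfl, hγ, hγ1⟩ := hm
  have hρ := ρ_pos hγ
  obtain ⟨i, hi⟩ := exists_norm_le_two_mul_abs w
  have h1 := abs_sum_profile_cos_le hL h𝔎 hlip hγ hγ1 hw i
  set S := ∑ k : m.Site, m.γ ^ 2 * m.𝔎 (site m.γ k) *
      Real.cos (Real.pi * phase w (site m.ε k)) with hS
  have hK : m.Khat w = (S - m.γ ^ 2 * m.𝔎 0) / m.mass := by
    rw [Khat_eq, sum_κ_mul, hS, ← Finset.add_sum_erase _ _ (Finset.mem_univ (0 : m.Site)),
      site_zero, site_zero, phase_zero, mul_zero, Real.cos_zero]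
    ring
  have hε := le_eps hγ (by linarith)
  have h2 : m.γ * ((1296 * L + 1) / 2) * |S| ≤ 81 * L * m.γ := by
    refine le_trans ?_ h1
    refine mul_le_mul_of_nonneg_right ?_ (abs_nonneg S)
    calc m.γ * ((1296 * L + 1) / 2) ≤ m.γ * (m.ρ * ‖w.toPlane‖ / 2) := by gcongr
      _ ≤ m.γ * (m.ρ * (2 * |(w i : ℝ)|) / 2) := by gcongr
      _ = 2 * (m.γ * m.ρ / 2 * |(w i : ℝ)|) := by ring
      _ ≤ 2 * (m.ε * |(w i : ℝ)|) := by gcongr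
  have h3 : (1296 * L + 1) / 2 * |S| ≤ 81 * L := by
    have : m.γ * ((1296 * L + 1) / 2 * |S|) ≤ m.γ * (81 * L) := by linarith
    exact le_of_mul_le_mul_left this hγ
  have h4 : |S| ≤ 1 / 8 := by
    by_contra hcon
    push Not at hcon
    nlinarith
  rw [hK, div_le_iff₀ (by linarith)]
  have h5 := (h𝔎.mem_Icc 0).1
  have h6 := (le_abs_self S).trans h4
  nlinarith [mul_nonneg (sq_nonneg m.γ) h5]

lemma toPlane_add (w v : Freq) : (w + v).toPlane = w.toPlane + v.toPlane := by
  ext i; simp [Freq.toPlane]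

lemma toPlane_eq_zero {w : Freq} : w.toPlane = 0 ↔ w = 0 := by
  constructor
  · intro h
    ext i
    have := congrArg (fun z : Plane => z i) h
    simpa [Freq.toPlane] using this
  · rintro rfl
    ext i; simp [Freq.toPlane]

/-- The spectral gap: `1 - Khat` grows quadratically up to the scale of the interaction. A
frequency below that scale is doubled until it reaches the range where `Khat ≤ 1/2`. -/
lemma exists_spectral_gap (h𝔎 : IsKacProfile 𝔎) :
    ∃ c, 0 < c ∧ ∀ᶠ m in kacLimit 𝔎, ∀ w ∈ m.box,
      c * min ((m.ρ * ‖w.toPlane‖) ^ 2) 1 ≤ 1 - m.Khat w := by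
  obtain ⟨C, hC, hdecay⟩ := exists_Khat_le_half h𝔎
  refine ⟨min (1 / 2) (1 / (8 * C ^ 2)), by positivity, ?_⟩
  filter_upwards [eventually_kacLimit (show (0 : ℝ) < min (1 / 8) (1 / (2 * C + 1)) by positivity),
    eventually_half_le_mass h𝔎, hdecay] with m hm hmass hdecay' w hw
  clear hdecay
  obtain ⟨rfl, hγ, hγ1⟩ := hm
  have hmass0 : m.mass ≠ 0 := by linarith
  have hρ := ρ_pos hγ
  have hγ2 : m.γ < 1 / 8 := hγ1.trans_le (min_le_left _ _)
  have hγ3 : m.γ * (2 * C + 1) < 1 := by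
    have := hγ1.trans_le (min_le_right _ _)
    rwa [lt_div_iff₀ (by positivity)] at this
  have hρ1 := ρ_le hγ (by linarith)
  have hbox : ∀ v : Freq, m.ρ * ‖v.toPlane‖ ≤ 2 * C → v ∈ m.box := by
    intro v hv
    rw [mem_box]
    intro i
    have h1 : |(v i : ℝ)| ≤ ‖v.toPlane‖ := abs_apply_le_norm v.toPlane i
    have h2 := lt_N (m := m)
    rw [mul_inv] at h2
    have h3 : m.ρ * |(v i : ℝ)| ≤ 2 * C := (mul_le_mul_of_nonneg_left h1 hρ.le).trans hv
    have h4 : 2 * C + 1 < m.γ⁻¹ := by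
      rw [lt_inv_comm₀ (by positivity) hγ, lt_inv_comm₀ hγ (by positivity)]
      rw [← one_div, lt_div_iff₀ hγ]
      linarith
    have h5 : |(v i : ℝ)| < m.N := by
      have h6 : (2 * C + 1) * m.ρ⁻¹ ≤ m.γ⁻¹ * m.ρ⁻¹ := by gcongr
      have h7 : |(v i : ℝ)| ≤ 2 * C * m.ρ⁻¹ := by
        rw [← div_eq_mul_inv, le_div_iff₀ hρ]
        linarith
      have h8 : 1 ≤ m.ρ⁻¹ := by
        rw [one_le_inv₀ hρ]
        linarith
      linarith
    exact_mod_cast h5.le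
  have hind : ∀ n : ℕ, ∀ v : Freq, m.ρ * ‖v.toPlane‖ ≤ 2 * C → C ≤ 2 ^ n * (m.ρ * ‖v.toPlane‖) →
      1 / 2 * (m.ρ * ‖v.toPlane‖ / (2 * C)) ^ 2 ≤ 1 - m.Khat v := by
    have hbase : ∀ v : Freq, m.ρ * ‖v.toPlane‖ ≤ 2 * C → C ≤ m.ρ * ‖v.toPlane‖ →
        1 / 2 * (m.ρ * ‖v.toPlane‖ / (2 * C)) ^ 2 ≤ 1 - m.Khat v := by
      intro v hv hv'
      have h1 := hdecay' v (hbox v hv) hv'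
      have h2 : m.ρ * ‖v.toPlane‖ / (2 * C) ≤ 1 := by
        rw [div_le_one (by positivity)]
        exact hv
      have h3 : 0 ≤ m.ρ * ‖v.toPlane‖ / (2 * C) := by positivity
      nlinarith
    intro n
    induction n with
    | zero => intro v hv hv'; exact hbase v hv (by simpa using hv')
    | succ n ih =>
      intro v hv hv'
      rcases le_total C (m.ρ * ‖v.toPlane‖) with h | h
      · exact hbase v hv h
      · have hdouble : ‖(v + v).toPlane‖ = 2 * ‖v.toPlane‖ := by
          rw [toPlane_add, ← two_smul ℝ, norm_smul]
          norm_num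
        have h1 := ih (v + v) (by rw [hdouble]; linarith) (by
          rw [hdouble]
          rw [pow_succ] at hv'
          linarith)
        have h2 := one_sub_Khat_two_smul_le h𝔎 hmass0 v
        rw [hdouble] at h1
        have h3 : 1 / 2 * (m.ρ * (2 * ‖v.toPlane‖) / (2 * C)) ^ 2
            = 4 * (1 / 2 * (m.ρ * ‖v.toPlane‖ / (2 * C)) ^ 2) := by ring
        linarith
  rcases le_total C (m.ρ * ‖w.toPlane‖) with h | h
  · have h1 := hdecay' w hw h
    have h2 : min (1 / 2) (1 / (8 * C ^ 2)) * min ((m.ρ * ‖w.toPlane‖) ^ 2) 1 ≤ 1 / 2 * 1 := by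
      gcongr
      · exact min_le_left _ _
      · exact min_le_right _ _
    linarith
  · have h2 : min (1 / 2) (1 / (8 * C ^ 2)) * min ((m.ρ * ‖w.toPlane‖) ^ 2) 1
        ≤ 1 / (8 * C ^ 2) * (m.ρ * ‖w.toPlane‖) ^ 2 := by
      gcongr
      · exact min_le_right _ _
      · exact min_le_left _ _
    refine h2.trans ?_
    by_cases hw0 : w = 0
    · subst hw0
      have : (0 : Freq).toPlane = 0 := toPlane_eq_zero.2 rfl
      rw [this, Khat_zero hmass0]
      simp
    · have hpos : 0 < m.ρ * ‖w.toPlane‖ := by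
        have : 0 < ‖w.toPlane‖ := norm_pos_iff.2 fun h => hw0 (toPlane_eq_zero.1 h)
        positivity
      obtain ⟨n, hn⟩ := pow_unbounded_of_one_lt (C / (m.ρ * ‖w.toPlane‖)) (one_lt_two (α := ℝ))
      rw [div_lt_iff₀ hpos] at hn
      have h3 := hind n w (by linarith) hn.le
      refine le_trans (le_of_eq ?_) h3
      field_simp
      ring

/-- Parseval's identity bounds the square sum of the symbol. -/
lemma sum_Khat_sq_le (h𝔎 : IsKacProfile m.𝔎) (hγ : 0 < m.γ) (hγ1 : m.γ < 1 / 8)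
    (hmass : 1 / 2 ≤ m.mass) : ∑ w ∈ m.box, m.Khat w ^ 2 ≤ 32 * m.α⁻¹ := by
  have h1 := m.sum_ker_sq m.Khat_neg
  simp_rw [← m.K_eq_ker (m.κ_neg h𝔎.radial)] at h1
  have hε := m.eps_pos
  have hρ := ρ_pos hγ
  have h2 : ∑ k : m.Site, m.ε ^ 2 * m.K k ^ 2 ≤ (m.ε ^ 2)⁻¹ * (2 * m.γ ^ 2) := by
    have h3 : ∀ k ∈ (Finset.univ : Finset m.Site), m.ε ^ 2 * m.K k ^ 2
        ≤ (m.ε ^ 2)⁻¹ * (2 * m.γ ^ 2) * m.κ k := by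
      intro k _
      have h4 := κ_le h𝔎 hmass k
      have h5 := κ_nonneg h𝔎 k
      calc m.ε ^ 2 * m.K k ^ 2 = (m.ε ^ 2)⁻¹ * (m.κ k * m.κ k) := by
            unfold K
            field_simp
        _ ≤ (m.ε ^ 2)⁻¹ * (2 * m.γ ^ 2 * m.κ k) := by gcongr
        _ = _ := by ring
    refine (Finset.sum_le_sum h3).trans ?_
    rw [← Finset.mul_sum, sum_κ (by linarith), mul_one]
  have h6 : (m.ε ^ 2)⁻¹ * (2 * m.γ ^ 2) ≤ 8 * m.α⁻¹ := by
    have h7 := le_eps hγ (by linarith)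
    have h8 : (m.γ * m.ρ / 2) ^ 2 ≤ m.ε ^ 2 := by gcongr
    rw [α_eq, inv_mul_le_iff₀ (by positivity)]
    have h9 : 2 * m.γ ^ 2 = (m.γ * m.ρ / 2) ^ 2 * (8 * (m.ρ ^ 2)⁻¹) := by
      field_simp
      norm_num
    rw [h9]
    gcongr
  linarith

end Model

/-! ### Elementary estimates -/

lemma exp_neg_le_rpow_neg {x p : ℝ} (hx : 0 < x) (hp : 0 ≤ p) (hp1 : p ≤ 1) :
    Real.exp (-x) ≤ x ^ (-p) := by
  rw [Real.exp_neg, Real.rpow_neg hx.le]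
  have h1 : x ^ p ≤ Real.exp x := by
    rcases le_total x 1 with h | h
    · exact (Real.rpow_le_one hx.le h hp).trans (Real.one_le_exp hx.le)
    · calc x ^ p ≤ x ^ (1 : ℝ) := Real.rpow_le_rpow_of_exponent_le h hp1
        _ = x := Real.rpow_one x
        _ ≤ Real.exp x := by linarith [Real.add_one_le_exp x]
  have : 0 < x ^ p := Real.rpow_pos_of_pos hx p
  gcongr

lemma mul_exp_neg_le_rpow_neg {x p : ℝ} (hx : 0 < x) (hp : 0 ≤ p) (hp1 : p ≤ 1) :
    x * Real.exp (-x) ≤ 2 * x ^ (-p) := by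
  rw [Real.exp_neg, Real.rpow_neg hx.le, ← div_eq_mul_inv, ← div_eq_mul_inv,
    div_le_div_iff₀ (Real.exp_pos x) (Real.rpow_pos_of_pos hx p)]
  rcases le_total x 1 with h | h
  · have h1 : x ^ p ≤ 1 := Real.rpow_le_one hx.le h hp
    have h2 := Real.one_le_exp hx.le
    have h3 : 0 ≤ x ^ p := (Real.rpow_pos_of_pos hx p).le
    nlinarith
  · have h1 : x ^ p ≤ x := by
      calc x ^ p ≤ x ^ (1 : ℝ) := Real.rpow_le_rpow_of_exponent_le h hp1
        _ = x := Real.rpow_one x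
    have h2 := Real.quadratic_le_exp_of_nonneg hx.le
    nlinarith

lemma abs_exp_neg_sub_le {a b l : ℝ} (ha : l ≤ a) (hb : l ≤ b) :
    |Real.exp (-a) - Real.exp (-b)| ≤ |a - b| * Real.exp (-l) := by
  wlog h : a ≤ b generalizing a b
  · rw [abs_sub_comm, abs_sub_comm a]
    exact this hb ha (le_of_not_ge h)
  have h1 : Real.exp (-b) ≤ Real.exp (-a) := Real.exp_le_exp.2 (by linarith)
  rw [abs_of_nonneg (by linarith), abs_of_nonpos (by linarith)]
  have h2 : Real.exp (-b) = Real.exp (-a) * Real.exp (a - b) := by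
    rw [← Real.exp_add]
    ring_nf
  have h3 := Real.add_one_le_exp (a - b)
  have h4 : Real.exp (-a) ≤ Real.exp (-l) := Real.exp_le_exp.2 (by linarith)
  have h5 := Real.exp_pos (-a)
  calc Real.exp (-a) - Real.exp (-b) = Real.exp (-a) * (1 - Real.exp (a - b)) := by rw [h2]; ring
    _ ≤ Real.exp (-a) * (-(a - b)) := by gcongr; linarith
    _ ≤ Real.exp (-l) * (-(a - b)) := by gcongr; linarith
    _ = _ := by ring

lemma abs_exp_div_sub_le {a b l s p : ℝ} (hl : 0 < l) (ha : l ≤ a) (hb : l ≤ b) (hs : 0 < s)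
    (hp : 0 ≤ p) (hp1 : p ≤ 1) :
    |Real.exp (-(2 * s * a)) / a - Real.exp (-(2 * s * b)) / b|
      ≤ |a - b| * (l ^ 2)⁻¹ * (3 * (2 * s * l) ^ (-p)) := by
  have ha0 : 0 < a := hl.trans_le ha
  have hb0 : 0 < b := hl.trans_le hb
  have h1 : Real.exp (-(2 * s * a)) / a - Real.exp (-(2 * s * b)) / b
      = (Real.exp (-(2 * s * a)) - Real.exp (-(2 * s * b))) / a
        - Real.exp (-(2 * s * b)) * (a - b) / (a * b) := by
    field_simp
    ring
  have h2 : |(Real.exp (-(2 * s * a)) - Real.exp (-(2 * s * b))) / a|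
      ≤ |a - b| * (l ^ 2)⁻¹ * ((2 * s * l) * Real.exp (-(2 * s * l))) := by
    rw [abs_div, abs_of_pos ha0, div_le_iff₀ ha0]
    have h3 := abs_exp_neg_sub_le (l := 2 * s * l) (a := 2 * s * a) (b := 2 * s * b)
      (by gcongr) (by gcongr)
    rw [← mul_sub, abs_mul, abs_of_pos (by positivity : 0 < 2 * s)] at h3
    calc _ ≤ 2 * s * |a - b| * Real.exp (-(2 * s * l)) := h3
      _ = |a - b| * (l ^ 2)⁻¹ * ((2 * s * l) * Real.exp (-(2 * s * l))) * l := by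
        field_simp
      _ ≤ _ := by gcongr
  have h3 : |Real.exp (-(2 * s * b)) * (a - b) / (a * b)|
      ≤ |a - b| * (l ^ 2)⁻¹ * Real.exp (-(2 * s * l)) := by
    rw [abs_div, abs_mul, abs_of_pos (Real.exp_pos _), abs_of_pos (mul_pos ha0 hb0), sq,
      div_eq_mul_inv]
    calc Real.exp (-(2 * s * b)) * |a - b| * (a * b)⁻¹
        ≤ Real.exp (-(2 * s * l)) * |a - b| * (l * l)⁻¹ := by gcongr
      _ = _ := by ring
  have h4 := mul_exp_neg_le_rpow_neg (x := 2 * s * l) (by positivity) hp hp1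
  have h5 := exp_neg_le_rpow_neg (x := 2 * s * l) (by positivity) hp hp1
  rw [h1]
  refine (abs_sub _ _).trans ((add_le_add h2 h3).trans ?_)
  rw [← mul_add]
  gcongr
  linarith

/-! ### Lattice sums -/

lemma one_le_norm_toPlane {w : Freq} (hw : w ≠ 0) : 1 ≤ ‖w.toPlane‖ := by
  obtain ⟨i, hi⟩ : ∃ i, w i ≠ 0 := by
    by_contra h
    push Not at h
    exact hw (funext h)
  have h1 : |(w i : ℝ)| ≤ ‖w.toPlane‖ := abs_apply_le_norm w.toPlane i
  have h2 : (1 : ℝ) ≤ |(w i : ℝ)| := by exact_mod_cast Int.one_le_abs hi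
  exact h2.trans h1

lemma summable_norm_toPlane {k : ℝ} (hk : 2 < k) :
    Summable fun w : Freq => ‖w.toPlane‖ ^ (-k) := by
  refine (EisensteinSeries.summable_one_div_norm_rpow hk).of_nonneg_of_le
    (fun w => by positivity) fun w => ?_
  by_cases hw : w = 0
  · subst hw
    have : (0 : Freq).toPlane = 0 := Model.toPlane_eq_zero.2 rfl
    rw [this, norm_zero, norm_zero]
  · have h1 : 0 < ‖w‖ := norm_pos_iff.2 hw
    refine Real.rpow_le_rpow_of_nonpos h1 ?_ (by linarith)
    rw [pi_norm_le_iff_of_nonneg (norm_nonneg _)]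
    intro i
    have := abs_apply_le_norm w.toPlane i
    rw [Int.norm_eq_abs]
    exact this

lemma tsum_norm_toPlane_nonneg (k : ℝ) : 0 ≤ ∑' w : Freq, ‖w.toPlane‖ ^ (-k) :=
  tsum_nonneg fun w => by positivity

namespace Model

variable {m : Model} {𝔎 : Plane → ℝ}

lemma norm_le_of_mem_box {w : Freq} (hw : w ∈ m.box) : ‖w.toPlane‖ ≤ 2 * m.N := by
  obtain ⟨i, hi⟩ := exists_norm_le_two_mul_abs w
  have h2 : |(w i : ℝ)| ≤ m.N := by exact_mod_cast m.mem_box.1 hw i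
  linarith

lemma le_norm_of_notMem_box {w : Freq} (hw : w ∉ m.box) : (m.N : ℝ) + 1 ≤ ‖w.toPlane‖ := by
  rw [mem_box] at hw
  push Not at hw
  obtain ⟨i, hi⟩ := hw
  have h1 : |(w i : ℝ)| ≤ ‖w.toPlane‖ := abs_apply_le_norm w.toPlane i
  have h2 : (m.N : ℝ) + 1 ≤ |(w i : ℝ)| := by exact_mod_cast Int.add_one_le_of_lt hi
  linarith

lemma sq_le_ρ (h : 0 < m.γ) (h1 : m.γ < 1) : m.γ ^ 2 ≤ m.ρ := by
  unfold ρ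
  cases m.regime <;> simp only
  · nlinarith
  · exact le_rfl

lemma N_rpow_le (h : 0 < m.γ) (h1 : m.γ < 1) {η : ℝ} (hη : 0 ≤ η) :
    (m.N : ℝ) ^ η ≤ m.γ ^ (-(3 * η)) := by
  have h2 : (m.N : ℝ) ≤ (m.γ ^ (3 : ℝ))⁻¹ := by
    refine (N_le h).trans ?_
    have h3 := sq_le_ρ h h1
    have h4 : m.γ ^ (3 : ℝ) ≤ m.γ * m.ρ := by
      calc m.γ ^ (3 : ℝ) = m.γ * m.γ ^ 2 := by norm_cast; ring
        _ ≤ _ := by gcongr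
    have : 0 < m.γ ^ (3 : ℝ) := Real.rpow_pos_of_pos h _
    gcongr
  calc (m.N : ℝ) ^ η ≤ ((m.γ ^ (3 : ℝ))⁻¹) ^ η := by gcongr
    _ = m.γ ^ (-(3 * η)) := by
      rw [← Real.rpow_neg h.le, ← Real.rpow_mul h.le, neg_mul]

/-- The logarithmically divergent sum over the box. -/
lemma exists_sum_box_le (κ : ℝ) (hκ : 0 < κ) : ∃ C, 0 ≤ C ∧ ∀ m : Model, 0 < m.γ → m.γ < 1 →
    ∑ w ∈ m.box.erase 0, (‖w.toPlane‖ ^ 2)⁻¹ ≤ C * m.γ ^ (-κ) := by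
  set S := ∑' w : Freq, ‖w.toPlane‖ ^ (-(2 + κ / 3)) with hS
  have hS0 : 0 ≤ S := tsum_norm_toPlane_nonneg _
  have hsum := summable_norm_toPlane (k := 2 + κ / 3) (by linarith)
  refine ⟨2 ^ (κ / 3) * S, by positivity, fun m h h1 => ?_⟩
  have hterm : ∀ w ∈ m.box.erase 0, (‖w.toPlane‖ ^ 2)⁻¹
      ≤ (2 * (m.N : ℝ)) ^ (κ / 3) * ‖w.toPlane‖ ^ (-(2 + κ / 3)) := by
    intro w hw
    rw [Finset.mem_erase] at hw
    have h2 : 0 < ‖w.toPlane‖ := by linarith [one_le_norm_toPlane hw.1]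
    have h3 : (‖w.toPlane‖ ^ 2)⁻¹ = ‖w.toPlane‖ ^ (κ / 3) * ‖w.toPlane‖ ^ (-(2 + κ / 3)) := by
      rw [← Real.rpow_add h2, ← Real.rpow_natCast, ← Real.rpow_neg h2.le]
      congr 1
      push_cast
      ring
    rw [h3]
    gcongr
    exact norm_le_of_mem_box hw.2
  refine (Finset.sum_le_sum hterm).trans ?_
  rw [← Finset.mul_sum, Real.mul_rpow (by norm_num) (by positivity)]
  have h4 : ∑ w ∈ m.box.erase 0, ‖w.toPlane‖ ^ (-(2 + κ / 3)) ≤ S :=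
    hsum.sum_le_tsum _ fun w _ => by positivity
  have h5 := N_rpow_le h h1 (η := κ / 3) (by positivity)
  rw [show 3 * (κ / 3) = κ by ring] at h5
  have h6 : 0 ≤ ∑ w ∈ m.box.erase 0, ‖w.toPlane‖ ^ (-(2 + κ / 3)) :=
    Finset.sum_nonneg fun w _ => by positivity
  calc 2 ^ (κ / 3) * (m.N : ℝ) ^ (κ / 3) * ∑ w ∈ m.box.erase 0, ‖w.toPlane‖ ^ (-(2 + κ / 3))
      ≤ 2 ^ (κ / 3) * m.γ ^ (-κ) * S := by gcongr
    _ = _ := by ring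

/-- The symbol of the generator of the discrete heat semigroup. -/
noncomputable def gap (m : Model) (w : Freq) : ℝ := m.α⁻¹ * (1 - m.Khat w)

/-- The uniform properties of the symbol of the Kac kernel on which the comparison with the
Laplacian rests. -/
structure SymbolBounds (m : Model) (c C : ℝ) : Prop where
  γ_pos : 0 < m.γ
  γ_lt : m.γ < 1 / 8
  profile : IsKacProfile m.𝔎
  mass : 1 / 2 ≤ m.mass
  spectral_gap : ∀ w ∈ m.box, c * min ((m.ρ * ‖w.toPlane‖) ^ 2) 1 ≤ 1 - m.Khat w
  expansion : ∀ w : Freq, m.ρ * ‖w.toPlane‖ ≤ 1 / 24 →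
    |m.gap w - Real.pi ^ 2 * ‖w.toPlane‖ ^ 2|
      ≤ C * (m.γ * ‖w.toPlane‖ ^ 2 + m.ρ ^ 2 * ‖w.toPlane‖ ^ 4)

lemma exists_symbolBounds (h𝔎 : IsKacProfile 𝔎) : ∃ c C, 0 < c ∧ c ≤ 1 ∧ 0 ≤ C ∧
    ∀ᶠ m in kacLimit 𝔎, m.SymbolBounds c C := by
  obtain ⟨c, hc, h1⟩ := exists_spectral_gap h𝔎
  obtain ⟨C, hC, h2⟩ := exists_abs_symbol_sub_le h𝔎
  refine ⟨min c 1, C, by positivity, min_le_right _ _, hC, ?_⟩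
  filter_upwards [h1, h2, eventually_half_le_mass h𝔎,
    eventually_kacLimit (show (0 : ℝ) < 1 / 8 by norm_num)] with m h1 h2 h3 h4
  refine ⟨h4.2.1, h4.2.2, h4.1 ▸ h𝔎, h3, fun w hw => ?_, h2⟩
  refine le_trans ?_ (h1 w hw)
  gcongr
  exact min_le_left _ _

namespace SymbolBounds

variable {c C : ℝ}

lemma ρ_pos (h : m.SymbolBounds c C) : 0 < m.ρ := Model.ρ_pos h.γ_pos

lemma α_pos (h : m.SymbolBounds c C) : 0 < m.α := Model.α_pos h.γ_pos

lemma ρ_le (h : m.SymbolBounds c C) : m.ρ ≤ m.γ := Model.ρ_le h.γ_pos (by linarith [h.γ_lt])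

/-- Below the scale of the interaction the symbol dominates the Laplacian. -/
lemma le_gap_low (h : m.SymbolBounds c C) {w : Freq} (hw : w ∈ m.box)
    (hlow : m.ρ * ‖w.toPlane‖ ≤ 1) : c * ‖w.toPlane‖ ^ 2 ≤ m.gap w := by
  have h1 := h.spectral_gap w hw
  have hρ := h.ρ_pos
  rw [min_eq_left (pow_le_one₀ (by positivity) hlow)] at h1
  rw [gap, α_eq, ← div_eq_inv_mul, le_div_iff₀ (by positivity)]
  linarith

/-- Above the scale of the interaction the symbol is of order `α⁻¹`. -/
lemma le_gap_high (h : m.SymbolBounds c C) (hc : 0 < c) {w : Freq} (hw : w ∈ m.box)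
    (hhigh : 1 / 24 ≤ m.ρ * ‖w.toPlane‖) : c / 576 * m.α⁻¹ ≤ m.gap w := by
  have h1 := h.spectral_gap w hw
  have hα := h.α_pos
  have h2 : 1 / 576 ≤ min ((m.ρ * ‖w.toPlane‖) ^ 2) 1 := by
    refine le_min ?_ (by norm_num)
    have := pow_le_pow_left₀ (by norm_num) hhigh 2
    linarith
  have h3 : c / 576 ≤ 1 - m.Khat w := by
    have := mul_le_mul_of_nonneg_left h2 hc.le
    linarith
  rw [gap, mul_comm]
  gcongr

lemma gap_pos (h : m.SymbolBounds c C) (hc : 0 < c) {w : Freq} (hw : w ∈ m.box) (hw0 : w ≠ 0) :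
    0 < m.gap w := by
  have hα := h.α_pos
  have hn := one_le_norm_toPlane hw0
  rcases le_total (m.ρ * ‖w.toPlane‖) (1 / 24) with hl | hl
  · exact lt_of_lt_of_le (by positivity) (h.le_gap_low hw (by linarith))
  · exact lt_of_lt_of_le (by positivity) (h.le_gap_high hc hw hl)

lemma abs_Khat_le (h : m.SymbolBounds c C) (w : Freq) : |m.Khat w| ≤ 1 :=
  abs_Khat_le_one h.profile (by linarith [h.mass]) w

lemma sum_Khat_sq_le (h : m.SymbolBounds c C) : ∑ w ∈ m.box, m.Khat w ^ 2 ≤ 32 * m.α⁻¹ :=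
  Model.sum_Khat_sq_le h.profile h.γ_pos h.γ_lt h.mass

/-- Powers of the interaction scale: below that scale a factor `ρ²` is a small multiple of
`‖w‖⁻²`. -/
lemma sq_mul_rpow_le (h : m.SymbolBounds c C) {p n : ℝ} (hp1 : p ≤ 1) (hn : 0 < n)
    (hlow : m.ρ * n ≤ 1) : m.ρ ^ 2 * n ^ (-(2 * p)) ≤ m.ρ ^ (2 * p) * (n ^ 2)⁻¹ := by
  have hρ := h.ρ_pos
  have h1 : m.ρ ^ 2 * n ^ (-(2 * p)) = m.ρ ^ (2 * p) * (n ^ 2)⁻¹ * (m.ρ * n) ^ (2 - 2 * p) := by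
    rw [Real.mul_rpow hρ.le hn.le]
    have e1 : m.ρ ^ 2 = m.ρ ^ (2 * p) * m.ρ ^ (2 - 2 * p) := by
      rw [← Real.rpow_add hρ, ← Real.rpow_natCast]
      congr 1
      push_cast
      ring
    have e2 : n ^ (-(2 * p)) = (n ^ 2)⁻¹ * n ^ (2 - 2 * p) := by
      rw [← Real.rpow_natCast, ← Real.rpow_neg hn.le, ← Real.rpow_add hn]
      congr 1
      push_cast
      ring
    rw [e1, e2]
    ring
  rw [h1]
  refine mul_le_of_le_one_right (by positivity) ?_
  exact Real.rpow_le_one (by positivity) hlow (by linarith)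

lemma ρ_rpow_le (h : m.SymbolBounds c C) {p : ℝ} (hp : 0 ≤ p) :
    m.ρ ^ (2 * p) ≤ m.γ ^ (2 * p) := by
  have := h.ρ_pos
  have := h.ρ_le
  gcongr

/-- Comparison of the discrete and the continuous heat kernel at low frequencies. -/
lemma abs_term_sub_le_low (h : m.SymbolBounds c C) (hc : 0 < c) (hc1 : c ≤ 1) (hC : 0 ≤ C)
    {p s : ℝ} (hp : 0 ≤ p) (hp1 : p ≤ 1 / 2) (hs : 0 < s) {w : Freq} (hw : w ∈ m.box)
    (hw0 : w ≠ 0) (hlow : m.ρ * ‖w.toPlane‖ ≤ 1 / 24) :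
    |m.Khat w ^ 2 * Real.exp (-(2 * s * m.gap w)) / m.gap w
      - Real.exp (-(2 * s * (Real.pi ^ 2 * ‖w.toPlane‖ ^ 2))) / (Real.pi ^ 2 * ‖w.toPlane‖ ^ 2)|
      ≤ (2 + 6 * C * (c ^ 2)⁻¹) * (2 * c) ^ (-p) * s ^ (-p) * m.γ ^ (2 * p) *
        (‖w.toPlane‖ ^ 2)⁻¹ := by
  have hγ := h.γ_pos
  have hγ1 := h.γ_lt
  have hρ := h.ρ_pos
  have hα := h.α_pos
  have hn := one_le_norm_toPlane hw0
  have hgap := h.le_gap_low hw (by linarith)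
  have hgap0 := h.gap_pos hc hw hw0
  have hexp := h.expansion w hlow
  have hK := h.abs_Khat_le w
  have hρp := h.sq_mul_rpow_le (p := p) (n := ‖w.toPlane‖) (by linarith) (by linarith) (by linarith)
  have hργ := h.ρ_rpow_le hp
  set n := ‖w.toPlane‖
  set g := m.gap w with hg
  set μ := Real.pi ^ 2 * n ^ 2 with hμ
  have hn0 : 0 < n := by linarith
  have hl : 0 < c * n ^ 2 := by positivity
  have hμl : c * n ^ 2 ≤ μ := by
    have : 1 ≤ Real.pi ^ 2 := one_le_pow₀ (by linarith [Real.pi_gt_three])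
    exact mul_le_mul_of_nonneg_right (by linarith) (by positivity)
  have hsplit : (2 * s * (c * n ^ 2)) ^ (-p) = (2 * c) ^ (-p) * s ^ (-p) * n ^ (-(2 * p)) := by
    rw [show 2 * s * (c * n ^ 2) = (2 * c) * s * n ^ 2 by ring, Real.mul_rpow (by positivity)
      (by positivity), Real.mul_rpow (by positivity) (by positivity), ← Real.rpow_natCast n 2,
      ← Real.rpow_mul hn0.le]
    congr 2
    push_cast
    ring
  set A := (2 * c) ^ (-p) * s ^ (-p) with hA
  have hA0 : 0 ≤ A := by positivity
  have hG : m.ρ ^ 2 * n ^ (-(2 * p)) ≤ m.γ ^ (2 * p) * (n ^ 2)⁻¹ := by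
    refine hρp.trans ?_
    gcongr
  have h1 : |m.Khat w ^ 2 * Real.exp (-(2 * s * g)) / g - Real.exp (-(2 * s * g)) / g|
      ≤ 2 * A * (m.γ ^ (2 * p) * (n ^ 2)⁻¹) := by
    have h2 : m.Khat w ^ 2 * Real.exp (-(2 * s * g)) / g - Real.exp (-(2 * s * g)) / g
        = -((1 - m.Khat w) * (1 + m.Khat w) * Real.exp (-(2 * s * g)) / g) := by ring
    have h3 : 1 - m.Khat w = m.α * g := by
      rw [hg, gap]
      field_simp
    rw [abs_le] at hK
    have h4 : (1 - m.Khat w) * (1 + m.Khat w) * Real.exp (-(2 * s * g)) / g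
        = m.α * (1 + m.Khat w) * Real.exp (-(2 * s * g)) := by
      rw [h3]
      field_simp
    have h5 : Real.exp (-(2 * s * g)) ≤ (2 * s * (c * n ^ 2)) ^ (-p) := by
      refine (Real.exp_le_exp.2 ?_).trans
        (exp_neg_le_rpow_neg (x := 2 * s * (c * n ^ 2)) (by positivity) hp (by linarith))
      have : 2 * s * (c * n ^ 2) ≤ 2 * s * g := by gcongr
      linarith
    rw [h2, abs_neg, h4, abs_of_nonneg (mul_nonneg (mul_nonneg hα.le (by linarith [hK.1]))
      (Real.exp_pos _).le)]
    calc m.α * (1 + m.Khat w) * Real.exp (-(2 * s * g))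
        ≤ m.α * 2 * (2 * s * (c * n ^ 2)) ^ (-p) := by
          gcongr
          linarith [hK.2]
      _ = 2 * A * (m.ρ ^ 2 * n ^ (-(2 * p))) := by rw [hsplit, α_eq]; ring
      _ ≤ _ := by gcongr
  have h2 := abs_exp_div_sub_le hl hgap hμl hs hp (by linarith)
  have h3 : |g - μ| * ((c * n ^ 2) ^ 2)⁻¹ * (3 * (2 * s * (c * n ^ 2)) ^ (-p))
      ≤ 6 * C * (c ^ 2)⁻¹ * A * (m.γ ^ (2 * p) * (n ^ 2)⁻¹) := by
    rw [hsplit]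
    have h4 : m.γ * n ^ (-(2 * p)) * (n ^ 2)⁻¹ ≤ m.γ ^ (2 * p) * (n ^ 2)⁻¹ := by
      have h5 : n ^ (-(2 * p)) ≤ 1 := Real.rpow_le_one_of_one_le_of_nonpos hn (by linarith)
      have h6 : m.γ ≤ m.γ ^ (2 * p) := by
        calc m.γ = m.γ ^ (1 : ℝ) := (Real.rpow_one _).symm
          _ ≤ _ := Real.rpow_le_rpow_of_exponent_ge hγ (by linarith) (by linarith)
      gcongr
      calc m.γ * n ^ (-(2 * p)) ≤ m.γ * 1 := by gcongr
        _ ≤ _ := by linarith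
    calc |g - μ| * ((c * n ^ 2) ^ 2)⁻¹ * (3 * (A * n ^ (-(2 * p))))
        ≤ C * (m.γ * n ^ 2 + m.ρ ^ 2 * n ^ 4) * ((c * n ^ 2) ^ 2)⁻¹ * (3 * (A * n ^ (-(2 * p)))) := by
          gcongr
      _ = 3 * C * (c ^ 2)⁻¹ * A * (m.γ * n ^ (-(2 * p)) * (n ^ 2)⁻¹ + m.ρ ^ 2 * n ^ (-(2 * p))) := by
          field_simp
      _ ≤ 3 * C * (c ^ 2)⁻¹ * A * (m.γ ^ (2 * p) * (n ^ 2)⁻¹ + m.γ ^ (2 * p) * (n ^ 2)⁻¹) := by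
          gcongr
      _ = _ := by ring
  refine (abs_sub_le _ (Real.exp (-(2 * s * g)) / g) _).trans ((add_le_add h1 (h2.trans h3)).trans
    (le_of_eq ?_))
  ring

/-- The continuous heat kernel at any frequency. -/
lemma heat_term_le {p s n : ℝ} (hp : 0 ≤ p) (hp1 : p ≤ 1) (hs : 0 < s) (hn : 0 < n) :
    Real.exp (-(2 * s * (Real.pi ^ 2 * n ^ 2))) / (Real.pi ^ 2 * n ^ 2)
      ≤ s ^ (-p) * (n ^ (-(2 * p)) * (n ^ 2)⁻¹) := by
  have h1 : 1 ≤ Real.pi ^ 2 := one_le_pow₀ (by linarith [Real.pi_gt_three])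
  have h2 : s * n ^ 2 ≤ 2 * s * (Real.pi ^ 2 * n ^ 2) := by
    have : 0 < s * n ^ 2 := by positivity
    nlinarith
  have h3 : Real.exp (-(2 * s * (Real.pi ^ 2 * n ^ 2))) ≤ (s * n ^ 2) ^ (-p) :=
    (Real.exp_le_exp.2 (by linarith)).trans (exp_neg_le_rpow_neg (by positivity) hp hp1)
  have h4 : (s * n ^ 2) ^ (-p) = s ^ (-p) * n ^ (-(2 * p)) := by
    rw [Real.mul_rpow hs.le (by positivity), ← Real.rpow_natCast n 2, ← Real.rpow_mul hn.le]
    congr 2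
    push_cast
    ring
  rw [h4] at h3
  rw [div_eq_mul_inv, ← mul_assoc (s ^ (-p))]
  have h5 : (Real.pi ^ 2 * n ^ 2)⁻¹ ≤ (n ^ 2)⁻¹ := by
    gcongr
    exact le_mul_of_one_le_left (by positivity) h1
  exact mul_le_mul h3 h5 (by positivity) (by positivity)

/-- Comparison of the discrete and the continuous heat kernel at high frequencies, where both are
small. -/
lemma abs_term_sub_le_high (h : m.SymbolBounds c C) (hc : 0 < c)
    {p s : ℝ} (hp : 0 ≤ p) (hp1 : p ≤ 1 / 2) (hs : 0 < s) {w : Freq} (hw : w ∈ m.box)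
    (hw0 : w ≠ 0) (hhigh : 1 / 24 ≤ m.ρ * ‖w.toPlane‖) :
    |m.Khat w ^ 2 * Real.exp (-(2 * s * m.gap w)) / m.gap w
      - Real.exp (-(2 * s * (Real.pi ^ 2 * ‖w.toPlane‖ ^ 2))) / (Real.pi ^ 2 * ‖w.toPlane‖ ^ 2)|
      ≤ (c / 576)⁻¹ * (2 * (c / 576)) ^ (-p) * s ^ (-p) * m.γ ^ (2 * p) * (m.α * m.Khat w ^ 2)
        + 24 ^ (2 * p) * s ^ (-p) * m.γ ^ (2 * p) * (‖w.toPlane‖ ^ 2)⁻¹ := by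
  have hρ := h.ρ_pos
  have hα := h.α_pos
  have hn := one_le_norm_toPlane hw0
  have hgap := h.le_gap_high hc hw hhigh
  have hργ := h.ρ_rpow_le hp
  have hγ := h.γ_pos
  set n := ‖w.toPlane‖
  set g := m.gap w with hg
  have hn0 : 0 < n := by linarith
  set c' := c / 576 with hc'
  have hc'0 : 0 < c' := by positivity
  have hg0 : 0 < g := lt_of_lt_of_le (by positivity) hgap
  refine (abs_sub _ _).trans (add_le_add ?_ ?_)
  · rw [abs_of_nonneg (by positivity)]
    have h1 : Real.exp (-(2 * s * g)) ≤ (2 * s * (c' * m.α⁻¹)) ^ (-p) := by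
      refine (Real.exp_le_exp.2 ?_).trans
        (exp_neg_le_rpow_neg (x := 2 * s * (c' * m.α⁻¹)) (by positivity) hp (by linarith))
      have : 2 * s * (c' * m.α⁻¹) ≤ 2 * s * g := by gcongr
      linarith
    have h2 : (2 * s * (c' * m.α⁻¹)) ^ (-p) = (2 * c') ^ (-p) * s ^ (-p) * m.ρ ^ (2 * p) := by
      rw [show 2 * s * (c' * m.α⁻¹) = (2 * c') * s * m.α⁻¹ by ring, Real.mul_rpow (by positivity)
        (by positivity), Real.mul_rpow (by positivity) (by positivity), Real.inv_rpow hα.le,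
        Real.rpow_neg hα.le, inv_inv, α_eq, ← Real.rpow_natCast m.ρ 2, ← Real.rpow_mul hρ.le]
      norm_num
    rw [h2] at h1
    calc m.Khat w ^ 2 * Real.exp (-(2 * s * g)) / g
        ≤ m.Khat w ^ 2 * ((2 * c') ^ (-p) * s ^ (-p) * m.γ ^ (2 * p)) / (c' * m.α⁻¹) := by
          gcongr
          exact h1.trans (by gcongr)
      _ = _ := by
          field_simp
  · rw [abs_of_nonneg (by positivity)]
    refine (heat_term_le hp (by linarith) hs hn0).trans ?_
    have h3 : n ^ (-(2 * p)) ≤ 24 ^ (2 * p) * m.γ ^ (2 * p) := by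
      have h4 : n⁻¹ ≤ 24 * m.ρ := by
        rw [inv_le_iff_one_le_mul₀ hn0]
        linarith
      calc n ^ (-(2 * p)) = (n⁻¹) ^ (2 * p) := by
            rw [Real.rpow_neg hn0.le, Real.inv_rpow hn0.le]
        _ ≤ (24 * m.ρ) ^ (2 * p) := by gcongr
        _ = 24 ^ (2 * p) * m.ρ ^ (2 * p) := Real.mul_rpow (by norm_num) hρ.le
        _ ≤ _ := by gcongr
    calc s ^ (-p) * (n ^ (-(2 * p)) * (n ^ 2)⁻¹)
        ≤ s ^ (-p) * (24 ^ (2 * p) * m.γ ^ (2 * p) * (n ^ 2)⁻¹) := by gcongr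
      _ = _ := by ring

/-- The continuous heat kernel outside the box. -/
lemma heat_term_le_outside (h : m.SymbolBounds c C) {p s : ℝ} (hp : 0 ≤ p) (hp1 : p ≤ 1)
    (hs : 0 < s) {w : Freq} (hw : w ∉ m.box) :
    Real.exp (-(2 * s * (Real.pi ^ 2 * ‖w.toPlane‖ ^ 2))) / (Real.pi ^ 2 * ‖w.toPlane‖ ^ 2)
      ≤ s ^ (-p) * m.γ ^ (2 * p) * ‖w.toPlane‖ ^ (-(2 + p)) := by
  have hγ := h.γ_pos
  have hρ := h.ρ_pos
  have h1 : (m.γ * m.ρ)⁻¹ ≤ ‖w.toPlane‖ := (lt_N).le.trans (le_norm_of_notMem_box hw)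
  set n := ‖w.toPlane‖
  have hn0 : 0 < n := lt_of_lt_of_le (by positivity) h1
  refine (heat_term_le hp hp1 hs hn0).trans ?_
  have h2 : n ^ (-(2 * p)) * (n ^ 2)⁻¹ = n ^ (-p) * n ^ (-(2 + p)) := by
    rw [← Real.rpow_natCast n 2, ← Real.rpow_neg hn0.le, ← Real.rpow_add hn0, ← Real.rpow_add hn0]
    congr 1
    push_cast
    ring
  have h3 : n ^ (-p) ≤ m.γ ^ (2 * p) := by
    have h4 : n⁻¹ ≤ m.γ ^ 2 := by
      rw [inv_le_comm₀ (by positivity) (by positivity)] at h1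
      refine h1.trans ?_
      rw [sq]
      have := h.ρ_le
      gcongr
    calc n ^ (-p) = (n⁻¹) ^ p := by rw [Real.rpow_neg hn0.le, Real.inv_rpow hn0.le]
      _ ≤ (m.γ ^ 2) ^ p := by gcongr
      _ = m.γ ^ (2 * p) := by
        rw [← Real.rpow_natCast m.γ 2, ← Real.rpow_mul hγ.le]
        norm_num
  rw [h2, mul_assoc]
  gcongr

end SymbolBounds

end Model

/-! ### The renormalisation constants -/

/-- The heat kernel sum `∑_{ω ≠ 0} e^{-2sπ²|ω|²} / (π²|ω|²)` of the limiting equation. -/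
noncomputable def tailSum (s : ℝ) : ℝ := ∑' w : Freq, if w = 0 then 0 else
  Real.exp (-(2 * s * (Real.pi ^ 2 * ‖w.toPlane‖ ^ 2))) / (Real.pi ^ 2 * ‖w.toPlane‖ ^ 2)

lemma tailSum_term_nonneg (s : ℝ) (w : Freq) : 0 ≤ if w = 0 then 0 else
    Real.exp (-(2 * s * (Real.pi ^ 2 * ‖w.toPlane‖ ^ 2))) / (Real.pi ^ 2 * ‖w.toPlane‖ ^ 2) := by
  split_ifs <;> positivity

lemma summable_tailSum {s : ℝ} (hs : 0 < s) : Summable fun w : Freq => if w = 0 then 0 else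
    Real.exp (-(2 * s * (Real.pi ^ 2 * ‖w.toPlane‖ ^ 2))) / (Real.pi ^ 2 * ‖w.toPlane‖ ^ 2) := by
  refine ((summable_norm_toPlane (k := 4) (by norm_num)).mul_left (s ^ (-(1 : ℝ)))).of_nonneg_of_le
    (tailSum_term_nonneg s) fun w => ?_
  split_ifs with hw
  · positivity
  · have hn0 : 0 < ‖w.toPlane‖ := by linarith [one_le_norm_toPlane hw]
    refine (Model.SymbolBounds.heat_term_le zero_le_one le_rfl hs hn0).trans (le_of_eq ?_)
    congr 1
    rw [← Real.rpow_natCast ‖w.toPlane‖ 2, ← Real.rpow_neg hn0.le, ← Real.rpow_add hn0]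
    norm_num

lemma finite_norm_toPlane_lt (R : ℝ) : {w : Freq | ‖w.toPlane‖ < R}.Finite := by
  refine (Fintype.piFinset fun _ : Fin 2 => Finset.Icc (-⌈R⌉) ⌈R⌉).finite_toSet.subset ?_
  intro (w : Freq) hw
  rw [Finset.mem_coe, Fintype.mem_piFinset]
  intro i
  rw [Finset.mem_Icc, ← abs_le]
  have h1 : |(w i : ℝ)| ≤ ‖Freq.toPlane w‖ := abs_apply_le_norm (Freq.toPlane w) i
  have h2 : |(w i : ℝ)| ≤ ⌈R⌉ := h1.trans (le_of_lt (lt_of_lt_of_le hw (Int.le_ceil R)))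
  exact_mod_cast h2

/-- The time dependent constant of the limiting equation, in terms of the heat kernel sum. -/
lemma cBar_eq (βc : ℝ) {s : ℝ} (hs : 0 < s) :
    cBar βc s = s / (2 * βc) - (4 * βc)⁻¹ * tailSum s := by
  set f : ℝ → Freq → ℝ := fun ε w => if 0 < ‖w.toPlane‖ ∧ ‖w.toPlane‖ < ε⁻¹ then
    Real.exp (-(2 * s * (Real.pi ^ 2 * ‖w.toPlane‖ ^ 2))) / (Real.pi ^ 2 * ‖w.toPlane‖ ^ 2)
      else 0 with hf
  have hsumm : ∀ (ε : ℝ) (F : Freq → ℝ), Summable fun w : Freq =>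
      if 0 < ‖w.toPlane‖ ∧ ‖w.toPlane‖ < ε⁻¹ then F w else 0 := by
    intro ε F
    refine summable_of_hasFiniteSupport ((finite_norm_toPlane_lt ε⁻¹).subset ?_)
    intro w hw
    by_contra h
    refine hw ?_
    simp only
    rw [if_neg]
    exact fun h' => h h'.2
  have h1 : ∀ ε, cEpsTime βc ε s - cEps βc ε = s / (2 * βc) - (4 * βc)⁻¹ * ∑' w, f ε w := by
    intro ε
    unfold cEpsTime cEps
    rw [add_sub_assoc, ← mul_sub, ← (hsumm ε _).tsum_sub (hsumm ε _), sub_eq_add_neg (s / _)]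
    congr 1
    rw [← tsum_mul_left, ← tsum_mul_left, ← tsum_neg]
    refine tsum_congr fun w => ?_
    simp only [hf]
    split_ifs with h
    · have := Real.pi_pos
      have h0 := h.1
      rw [show -2 * s * Real.pi ^ 2 * ‖w.toPlane‖ ^ 2
        = -(2 * s * (Real.pi ^ 2 * ‖w.toPlane‖ ^ 2)) by ring]
      field_simp
      ring
    · simp
  have h2 : Tendsto (fun ε => ∑' w, f ε w) (𝓝[>] 0) (𝓝 (tailSum s)) := by
    refine tendsto_tsum_of_dominated_convergence (summable_tailSum hs) ?_ ?_
    · intro w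
      by_cases hw : w = 0
      · subst hw
        have : (0 : Freq).toPlane = 0 := Model.toPlane_eq_zero.2 rfl
        simp [hf, this]
      · rw [if_neg hw]
        refine tendsto_const_nhds.congr' ?_
        have h3 : 0 < ‖w.toPlane‖ := by linarith [one_le_norm_toPlane hw]
        have h4 : ∀ᶠ ε : ℝ in 𝓝[>] 0, ‖w.toPlane‖ < ε⁻¹ :=
          tendsto_inv_nhdsGT_zero.eventually_gt_atTop _
        filter_upwards [h4] with ε hε
        simp only [hf]
        rw [if_pos ⟨h3, hε⟩]
    · refine Eventually.of_forall fun ε w => ?_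
      have h5 := tailSum_term_nonneg s w
      by_cases hw : w = 0
      · subst hw
        have : (0 : Freq).toPlane = 0 := Model.toPlane_eq_zero.2 rfl
        simp [hf, this]
      · rw [if_neg hw] at h5 ⊢
        simp only [hf]
        split_ifs
        · rw [Real.norm_of_nonneg h5]
        · rwa [norm_zero]
  unfold cBar
  simp_rw [h1]
  exact (tendsto_const_nhds.sub (h2.const_mul _)).limUnder_eq

namespace Model

variable {m : Model} {𝔎 : Plane → ℝ}

lemma sum_eq_low_add_high {ι : Type*} {S : Finset ι} {f a b : ι → ℝ} {A B x y : ℝ}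
    (h : ∀ i ∈ S, f i ≤ A * a i + B * b i) (hA : 0 ≤ A) (hB : 0 ≤ B)
    (ha : ∑ i ∈ S, a i ≤ x) (hb : ∑ i ∈ S, b i ≤ y) : ∑ i ∈ S, f i ≤ A * x + B * y := by
  refine (Finset.sum_le_sum h).trans ?_
  rw [Finset.sum_add_distrib, ← Finset.mul_sum, ← Finset.mul_sum]
  gcongr

lemma SymbolBounds.sum_erase_Khat_sq_le {c C : ℝ} (h : m.SymbolBounds c C) :
    ∑ w ∈ m.box.erase 0, m.α * m.Khat w ^ 2 ≤ 32 := by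
  have hα := h.α_pos
  rw [← Finset.mul_sum]
  have h1 : ∑ w ∈ m.box.erase 0, m.Khat w ^ 2 ≤ ∑ w ∈ m.box, m.Khat w ^ 2 :=
    Finset.sum_le_sum_of_subset_of_nonneg (Finset.erase_subset _ _) fun w _ _ => sq_nonneg _
  calc m.α * ∑ w ∈ m.box.erase 0, m.Khat w ^ 2 ≤ m.α * (32 * m.α⁻¹) := by
        gcongr
        exact h1.trans h.sum_Khat_sq_le
    _ = 32 := by field_simp

/-- The sum over frequencies that defines the renormalisation constant, without its prefactor. -/
noncomputable def rawConst (m : Model) : ℝ := ∑ w ∈ m.box.erase 0, m.Khat w ^ 2 / m.gap w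

lemma c_eq : m.c = 1 / (4 * m.βc) * m.rawConst := by
  simp only [c, rawConst, gap, sq_abs]

lemma SymbolBounds.rawConst_nonneg {c C : ℝ} (h : m.SymbolBounds c C) (hc : 0 < c) :
    0 ≤ m.rawConst := by
  refine Finset.sum_nonneg fun w hw => ?_
  rw [Finset.mem_erase] at hw
  exact div_nonneg (sq_nonneg _) (h.gap_pos hc hw.2 hw.1).le

lemma exists_rawConst_le {c : ℝ} (hc : 0 < c) (C : ℝ) {κ : ℝ} (hκ : 0 < κ) :
    ∃ A, 0 ≤ A ∧ ∀ m : Model, m.SymbolBounds c C → m.rawConst ≤ A * m.γ ^ (-κ) := by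
  obtain ⟨B, hB, hbox⟩ := exists_sum_box_le κ hκ
  refine ⟨c⁻¹ * B + (c / 576)⁻¹ * 32, by positivity, fun m h => ?_⟩
  have hγ := h.γ_pos
  have hγ1 := h.γ_lt
  have hα := h.α_pos
  have hpt : ∀ w ∈ m.box.erase 0, m.Khat w ^ 2 / m.gap w
      ≤ c⁻¹ * (‖w.toPlane‖ ^ 2)⁻¹ + (c / 576)⁻¹ * (m.α * m.Khat w ^ 2) := by
    intro w hw
    rw [Finset.mem_erase] at hw
    have hn := one_le_norm_toPlane hw.1
    have hn0 : 0 < ‖w.toPlane‖ := by linarith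
    have hK : m.Khat w ^ 2 ≤ 1 := (sq_le_one_iff_abs_le_one _).2 (h.abs_Khat_le w)
    rcases le_total (m.ρ * ‖w.toPlane‖) (1 / 24) with hl | hl
    · have h1 := h.le_gap_low hw.2 (by linarith)
      refine le_add_of_le_of_nonneg ?_ (by positivity)
      rw [← mul_inv, ← one_div]
      gcongr
    · have h1 := h.le_gap_high hc hw.2 hl
      refine le_add_of_nonneg_of_le (by positivity) ?_
      calc m.Khat w ^ 2 / m.gap w ≤ m.Khat w ^ 2 / (c / 576 * m.α⁻¹) := by gcongr
        _ = _ := by field_simp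
  have h1 := sum_eq_low_add_high hpt (by positivity) (by positivity)
    (hbox m hγ (by linarith)) h.sum_erase_Khat_sq_le
  refine h1.trans ?_
  have h2 : 1 ≤ m.γ ^ (-κ) :=
    Real.one_le_rpow_of_pos_of_le_one_of_nonpos hγ (by linarith) (by linarith)
  have h3 : (c / 576)⁻¹ * 32 ≤ (c / 576)⁻¹ * 32 * m.γ ^ (-κ) :=
    le_mul_of_one_le_right (by positivity) h2
  rw [add_mul]
  linarith

/-- The sum over frequencies that governs the relaxation of the quadratic variation. -/
noncomputable def rawTail (m : Model) (s : ℝ) : ℝ :=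
  ∑ w ∈ m.box.erase 0, m.Khat w ^ 2 * Real.exp (-(2 * s * m.gap w)) / m.gap w

/-- The discrete heat kernel sum converges to the continuous one, with a rate that degenerates
as `s → 0`. -/
lemma exists_abs_rawTail_sub_tailSum_le {c C : ℝ} (hc : 0 < c) (hc1 : c ≤ 1) (hC : 0 ≤ C)
    {p κ : ℝ} (hp : 0 < p) (hp1 : p ≤ 1 / 2) (hκ : 0 < κ) :
    ∃ A, 0 ≤ A ∧ ∀ m : Model, m.SymbolBounds c C → ∀ s, 0 < s →
      |m.rawTail s - tailSum s| ≤ A * m.γ ^ (2 * p - κ) * s ^ (-p) := by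
  obtain ⟨B, hB, hbox⟩ := exists_sum_box_le κ hκ
  set S := ∑' w : Freq, ‖w.toPlane‖ ^ (-(2 + p)) with hS
  have hS0 : 0 ≤ S := tsum_norm_toPlane_nonneg _
  have hSs := summable_norm_toPlane (k := 2 + p) (by linarith)
  set A₁ := (2 + 6 * C * (c ^ 2)⁻¹) * (2 * c) ^ (-p) + 24 ^ (2 * p) with hA₁
  set A₂ := (c / 576)⁻¹ * (2 * (c / 576)) ^ (-p) with hA₂
  have hA₁0 : 0 ≤ A₁ := by positivity
  have hA₂0 : 0 ≤ A₂ := by positivity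
  refine ⟨A₁ * B + A₂ * 32 + S, by positivity, fun m h s hs => ?_⟩
  have hγ := h.γ_pos
  have hγ1 := h.γ_lt
  have hα := h.α_pos
  set g : Freq → ℝ := fun w => if w = 0 then 0 else
    Real.exp (-(2 * s * (Real.pi ^ 2 * ‖w.toPlane‖ ^ 2))) / (Real.pi ^ 2 * ‖w.toPlane‖ ^ 2) with hg
  have hgs : Summable g := summable_tailSum hs
  set D := s ^ (-p) * m.γ ^ (2 * p) with hD
  have hD0 : 0 ≤ D := by positivity
  have hpt : ∀ w ∈ m.box.erase 0,
      |m.Khat w ^ 2 * Real.exp (-(2 * s * m.gap w)) / m.gap w - g w|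
      ≤ (A₁ * D) * (‖w.toPlane‖ ^ 2)⁻¹ + (A₂ * D) * (m.α * m.Khat w ^ 2) := by
    intro w hw
    rw [Finset.mem_erase] at hw
    have hn := one_le_norm_toPlane hw.1
    have hn0 : 0 < ‖w.toPlane‖ := by linarith
    simp only [hg]
    rw [if_neg hw.1]
    rcases le_total (m.ρ * ‖w.toPlane‖) (1 / 24) with hl | hl
    · refine (h.abs_term_sub_le_low hc hc1 hC hp.le hp1 hs hw.2 hw.1 hl).trans ?_
      have e1 : 0 ≤ 24 ^ (2 * p) * D * (‖w.toPlane‖ ^ 2)⁻¹ := by positivity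
      have e2 : 0 ≤ A₂ * D * (m.α * m.Khat w ^ 2) := by positivity
      have e3 : (2 + 6 * C * (c ^ 2)⁻¹) * (2 * c) ^ (-p) * s ^ (-p) * m.γ ^ (2 * p) *
        (‖w.toPlane‖ ^ 2)⁻¹ = A₁ * D * (‖w.toPlane‖ ^ 2)⁻¹
          - 24 ^ (2 * p) * D * (‖w.toPlane‖ ^ 2)⁻¹ := by
        rw [hA₁, hD]
        ring
      linarith
    · refine (h.abs_term_sub_le_high hc hp.le hp1 hs hw.2 hw.1 hl).trans ?_
      have e1 : 0 ≤ (2 + 6 * C * (c ^ 2)⁻¹) * (2 * c) ^ (-p) * D * (‖w.toPlane‖ ^ 2)⁻¹ := by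
        positivity
      have e3 : (c / 576)⁻¹ * (2 * (c / 576)) ^ (-p) * s ^ (-p) * m.γ ^ (2 * p) *
          (m.α * m.Khat w ^ 2) + 24 ^ (2 * p) * s ^ (-p) * m.γ ^ (2 * p) * (‖w.toPlane‖ ^ 2)⁻¹
          = A₂ * D * (m.α * m.Khat w ^ 2) + A₁ * D * (‖w.toPlane‖ ^ 2)⁻¹
          - (2 + 6 * C * (c ^ 2)⁻¹) * (2 * c) ^ (-p) * D * (‖w.toPlane‖ ^ 2)⁻¹ := by
        rw [hA₁, hA₂, hD]
        ring
      linarith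
  have h1 := sum_eq_low_add_high hpt (by positivity) (by positivity)
    (hbox m hγ (by linarith)) h.sum_erase_Khat_sq_le
  have hsplit : tailSum s = ∑ w ∈ m.box.erase 0, g w + ∑' w, if w ∈ m.box then 0 else g w := by
    have e1 : ∀ w, g w = (if w ∈ m.box then g w else 0) + if w ∈ m.box then 0 else g w := by
      intro w
      split_ifs <;> simp
    have e2 : Summable fun w => if w ∈ m.box then g w else 0 :=
      summable_of_ne_finset_zero (s := m.box) fun w hw => if_neg hw
    have e3 : Summable fun w => if w ∈ m.box then 0 else g w := by
      refine hgs.of_nonneg_of_le (fun w => ?_) fun w => ?_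
      · split_ifs
        · exact le_rfl
        · exact tailSum_term_nonneg s w
      · split_ifs
        · exact tailSum_term_nonneg s w
        · exact le_rfl
    have e4 : tailSum s = ∑' w, ((if w ∈ m.box then g w else 0) + if w ∈ m.box then 0 else g w) :=
      tsum_congr e1
    rw [e4, e2.tsum_add e3, tsum_eq_sum (s := m.box) fun w hw => if_neg hw,
      ← Finset.add_sum_erase _ _ m.zero_mem_box]
    congr 1
    have : g 0 = 0 := if_pos rfl
    rw [if_pos m.zero_mem_box, this, zero_add]
    refine Finset.sum_congr rfl fun w hw => ?_
    rw [if_pos (Finset.mem_of_mem_erase hw)]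
  have hout : |∑' w, if w ∈ m.box then 0 else g w| ≤ D * S := by
    have e1 : ∀ w, 0 ≤ if w ∈ m.box then 0 else g w := by
      intro w
      split_ifs
      · exact le_rfl
      · exact tailSum_term_nonneg s w
    have e2 : ∀ w, (if w ∈ m.box then 0 else g w) ≤ D * ‖w.toPlane‖ ^ (-(2 + p)) := by
      intro w
      split_ifs with hw
      · positivity
      · have hw0 : w ≠ 0 := fun h0 => hw (h0 ▸ m.zero_mem_box)
        simp only [hg]
        rw [if_neg hw0]
        exact h.heat_term_le_outside hp.le (by linarith) hs hw
    rw [abs_of_nonneg (tsum_nonneg e1), hS, ← tsum_mul_left]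
    have e3 := hSs.mul_left D
    exact (e3.of_nonneg_of_le e1 e2).tsum_le_tsum e2 e3
  have h2 : |m.rawTail s - tailSum s| ≤ (A₁ * D) * (B * m.γ ^ (-κ)) + (A₂ * D) * 32 + D * S := by
    rw [hsplit, rawTail, ← sub_sub, ← Finset.sum_sub_distrib]
    exact (abs_sub _ _).trans (add_le_add ((Finset.abs_sum_le_sum_abs _ _).trans h1) hout)
  refine h2.trans ?_
  have h3 : 1 ≤ m.γ ^ (-κ) :=
    Real.one_le_rpow_of_pos_of_le_one_of_nonpos hγ (by linarith) (by linarith)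
  have h4 : m.γ ^ (2 * p - κ) = m.γ ^ (2 * p) * m.γ ^ (-κ) := by
    rw [← Real.rpow_add hγ]
    ring_nf
  have h5 : (A₂ * 32 + S) * D ≤ (A₂ * 32 + S) * D * m.γ ^ (-κ) :=
    le_mul_of_one_le_right (by positivity) h3
  have h6 : (A₁ * B + A₂ * 32 + S) * m.γ ^ (2 * p - κ) * s ^ (-p)
      = (A₁ * D) * (B * m.γ ^ (-κ)) + (A₂ * 32 + S) * D * m.γ ^ (-κ) := by
    rw [h4, hD]
    ring
  rw [h6]
  linarith

/-! ### The quadratic variation -/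

/-- The time integral of the squared `L²` norm of the smoothed kernel. -/
noncomputable def kernelEnergy (m : Model) (s : ℝ) : ℝ :=
  ∫ r in (0 : ℝ)..s, ∑ z : m.Site, m.ε ^ 2 * m.conv (m.heatLat (s - r)) m.K z ^ 2

lemma sum_conv_heatLat_K_sq (hκ : ∀ k, m.κ (-k) = m.κ k) (t : ℝ) :
    ∑ z : m.Site, m.ε ^ 2 * m.conv (m.heatLat t) m.K z ^ 2
      = 1 / 4 * ∑ w ∈ m.box, m.Khat w ^ 2 * Real.exp (-(2 * t * m.gap w)) := by
  simp_rw [m.conv_heatLat_K hκ]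
  rw [m.sum_ker_sq fun w => by simp only [Khat_neg]]
  congr 1
  refine Finset.sum_congr rfl fun w _ => ?_
  rw [mul_pow, ← Real.exp_nat_mul, mul_comm]
  congr 2
  unfold gap
  push_cast
  ring

lemma integral_const_mul_exp (K s : ℝ) {g : ℝ} (hg : g ≠ 0) :
    ∫ r in (0 : ℝ)..s, K * Real.exp (-(2 * (s - r) * g))
      = K * (1 / (2 * g)) - K * (Real.exp (-(2 * s * g)) / (2 * g)) := by
  have hd : ∀ r ∈ Set.uIcc 0 s, HasDerivAt
      (fun r => K * (Real.exp (-(2 * (s - r) * g)) / (2 * g)))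
      (K * Real.exp (-(2 * (s - r) * g))) r := by
    intro r _
    have h1 : HasDerivAt (fun r => -(2 * (s - r) * g)) (2 * g) r := by
      have h2 := ((((hasDerivAt_id r).const_sub s).const_mul 2).mul_const g).neg
      refine h2.congr_deriv ?_
      ring
    refine ((h1.exp.div_const (2 * g)).const_mul K).congr_deriv ?_
    field_simp
  rw [intervalIntegral.integral_eq_sub_of_hasDerivAt hd]
  · simp
  · apply Continuous.intervalIntegrable
    fun_prop

/-- Parseval and integration in time split the energy of the kernel up to time `s` into the zero
mode, the stationary renormalisation constant and a tail that is singular as `s → 0`. -/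
lemma SymbolBounds.kernelEnergy_eq {c C : ℝ} (h : m.SymbolBounds c C) (hc : 0 < c) (s : ℝ) :
    m.kernelEnergy s = s / 4 + 1 / 8 * (m.rawConst - m.rawTail s) := by
  have hκ := m.κ_neg h.profile.radial
  have hmass0 : m.mass ≠ 0 := by linarith [h.mass]
  unfold kernelEnergy
  simp_rw [sum_conv_heatLat_K_sq hκ]
  rw [intervalIntegral.integral_const_mul, intervalIntegral.integral_finsetSum]
  · rw [← Finset.add_sum_erase _ _ m.zero_mem_box, mul_add]
    congr 1
    · have : m.gap 0 = 0 := by simp [gap, Khat_zero hmass0]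
      simp only [Khat_zero hmass0, this]
      simp
      ring
    · unfold rawConst rawTail
      rw [← Finset.sum_sub_distrib, Finset.mul_sum, Finset.mul_sum]
      refine Finset.sum_congr rfl fun w hw => ?_
      rw [Finset.mem_erase] at hw
      have hg := h.gap_pos hc hw.2 hw.1
      rw [integral_const_mul_exp _ s hg.ne']
      generalize m.gap w = g at hg ⊢
      generalize Real.exp (-(2 * s * g)) = E
      generalize m.Khat w = K
      have hg' : g ≠ 0 := hg.ne'
      field_simp
      ring
  · intro w _
    apply Continuous.intervalIntegrable
    fun_prop

lemma jumpRate_mem (σ : ℝ → m.Config) (r : ℝ) (z : m.Site) :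
    m.jumpRate σ r z ∈ Set.Icc 0 4 := by
  have hpos : ∀ b, 0 ≤ m.rate (σ (r / m.α)) z b := fun b => by
    unfold rate
    have := m.normConst_pos (m.h (σ (r / m.α)) z)
    positivity
  constructor
  · exact Finset.sum_nonneg fun b _ => mul_nonneg (sq_nonneg _) (hpos b)
  · have h1 := m.sum_rate (σ (r / m.α)) z
    have hs : ∀ b : SignType, |(b : ℝ)| ≤ 1 := by
      intro b
      cases b <;> simp
    calc m.jumpRate σ r z ≤ ∑ b : SignType, 4 * m.rate (σ (r / m.α)) z b := by
          refine Finset.sum_le_sum fun b _ => mul_le_mul_of_nonneg_right ?_ (hpos b)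
          have h2 := abs_le.1 (hs b)
          have h3 := abs_le.1 (hs (σ (r / m.α) z))
          nlinarith
      _ = 4 := by rw [← Finset.mul_sum, h1, mul_one]

variable {σ : ℝ → m.Config}

lemma integral_conv_shift (s : ℝ) (k : m.Site) :
    ∫ r in (0 : ℝ)..s, ∑ z : m.Site, m.ε ^ 2 * m.conv (m.heatLat (s - r)) m.K (z - k) ^ 2
      = m.kernelEnergy s := by
  have h1 : ∀ (e : ℝ) (f : m.Site → ℝ), ∑ z, e * f (z - k) ^ 2 = ∑ z, e * f z ^ 2 := fun e f =>
    Fintype.sum_equiv (Equiv.subRight k) _ _ fun z => rfl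
  simp only [h1, kernelEnergy]

/-- The predictable quadratic variation in terms of the averaging error. -/
lemma predQuadVar_eq (hκ : ∀ k, m.κ (-k) = m.κ k) (s : ℝ) (k : m.Site) :
    m.predQuadVar σ s s k = (m.α⁻¹ * m.ε ^ 2 * (m.δ⁻¹) ^ 2) *
      (m.Etilde σ s s k + 2 / m.βc * m.kernelEnergy s) := by
  rw [Etilde, integral_conv_shift, sub_add_cancel, predQuadVar, ← intervalIntegral.integral_const_mul]
  congr 1
  ext r
  rw [Finset.mul_sum]
  refine Finset.sum_congr rfl fun z _ => ?_
  rw [jumpRate, Finset.mul_sum, Finset.mul_sum]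
  refine Finset.sum_congr rfl fun b _ => ?_
  have : m.conv (m.heatLat (s - r)) m.K (k - z) = m.conv (m.heatLat (s - r)) m.K (z - k) := by
    rw [m.conv_heatLat_K hκ, m.conv_heatLat_K hκ, ← neg_sub z k, ker_neg_site]
  rw [this]
  ring

lemma kernelEnergy_nonneg {s : ℝ} (hs : 0 ≤ s) : 0 ≤ m.kernelEnergy s := by
  refine intervalIntegral.integral_nonneg hs fun r _ => Finset.sum_nonneg fun z _ => ?_
  positivity

lemma abs_Etilde_le (hβ : 0 < m.βc) {s : ℝ} (hs : 0 ≤ s) (k : m.Site) :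
    |m.Etilde σ s s k| ≤ (4 + 2 / m.βc) * m.kernelEnergy s := by
  rw [Etilde, integral_conv_shift, add_mul]
  refine (abs_sub _ _).trans (add_le_add ?_ ?_)
  · rw [← integral_conv_shift s k, ← intervalIntegral.integral_const_mul, ← Real.norm_eq_abs]
    refine intervalIntegral.norm_integral_le_of_norm_le hs ?_ ?_
    · refine Eventually.of_forall fun r _ => ?_
      rw [Real.norm_eq_abs, Finset.mul_sum]
      refine (Finset.abs_sum_le_sum_abs _ _).trans (Finset.sum_le_sum fun z _ => ?_)
      have h1 := jumpRate_mem σ r z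
      rw [abs_of_nonneg (mul_nonneg (by positivity) h1.1), mul_comm]
      exact mul_le_mul_of_nonneg_right h1.2 (by positivity)
    · apply Continuous.intervalIntegrable
      unfold conv heatLat heat
      fun_prop
  · rw [abs_mul, abs_of_nonneg (kernelEnergy_nonneg hs), abs_of_pos (by positivity)]

end Model

/-! ### Littlewood-Paley blocks of lattice functions -/

lemma abs_le_supNorm {f : Plane → ℝ} (hf : ∃ M, ∀ x, |f x| ≤ M) (x : Plane) :
    |f x| ≤ supNorm f := by
  obtain ⟨M, hM⟩ := hf
  exact le_ciSup (f := fun x => |f x|) ⟨M, by rintro _ ⟨y, rfl⟩; exact hM y⟩ x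

lemma supNorm_nonneg (f : Plane → ℝ) : 0 ≤ supNorm f := Real.iSup_nonneg fun _ => abs_nonneg _

lemma toPlane_neg (w : Freq) : (-w).toPlane = -w.toPlane := by
  ext i
  simp [Freq.toPlane]

lemma abs_pow_succ_sub_pow_succ_le {a b M : ℝ} (ha : |a| ≤ M) (hb : |b| ≤ M) (p : ℕ) :
    |a ^ (p + 1) - b ^ (p + 1)| ≤ (p + 1) * M ^ p * |a - b| := by
  have hM : 0 ≤ M := (abs_nonneg a).trans ha
  have h := abs_pow_sub_pow_le a b (p + 1)
  refine h.trans ?_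
  rw [Nat.add_sub_cancel, mul_comm |a - b|, mul_assoc, mul_comm |a - b|, ← mul_assoc]
  push_cast
  gcongr
  exact max_le ha hb

namespace DyadicPartition

variable (D : DyadicPartition)

lemma cutoff_neg (j : ℕ) (w : Freq) : D.cutoff j (-w).toPlane = D.cutoff j w.toPlane := by
  rw [toPlane_neg]
  cases j with
  | zero => exact D.low_radial _ _ (norm_neg _)
  | succ k => exact D.ann_radial _ _ (by rw [smul_neg, norm_neg])

lemma norm_lt_of_cutoff_ne_zero {j : ℕ} {z : Plane} (h : D.cutoff j z ≠ 0) :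
    ‖z‖ < 8 / 3 * (2 : ℝ) ^ ((j : ℤ) - 1) := by
  by_contra! hz
  refine h ?_
  cases j with
  | zero =>
    refine D.low_supp z ?_
    norm_num at hz
    linarith
  | succ k =>
    refine D.ann_supp _ (Or.inr ?_)
    have h2 : (0 : ℝ) < 2 ^ k := by positivity
    have h3 : ((k + 1 : ℕ) : ℤ) - 1 = k := by push_cast; ring
    rw [h3, zpow_natCast] at hz
    rw [norm_smul, Real.norm_of_nonneg (by positivity), inv_mul_eq_div, le_div_iff₀ h2]
    exact hz

lemma finite_cutoff_ne_zero (j : ℕ) : {w : Freq | D.cutoff j w.toPlane ≠ 0}.Finite :=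
  (finite_norm_toPlane_lt _).subset fun _ hw => D.norm_lt_of_cutoff_ne_zero hw

/-- The Littlewood-Paley block of a Fourier multiplier is again a Fourier multiplier. -/
lemma block_mult (m : Model) (j : ℕ) (b : Freq → ℝ) (f : m.Site → ℝ) :
    D.block j (m.mult b f) = m.mult (fun w => D.cutoff j w.toPlane * b w) f := by
  ext x
  rw [← m.torusConv_mult (a := fun w => D.cutoff j w.toPlane) (D.cutoff_neg j)
    (D.finite_cutoff_ne_zero j).toFinset fun w _ hw => by simpa using hw]
  unfold block
  congr 1
  ext y
  congr 1
  refine tsum_eq_sum fun w hw => ?_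
  have : D.cutoff j w.toPlane = 0 := by simpa using hw
  rw [this, zero_mul]

lemma block_Ex (m : Model) (j : ℕ) (f : m.Site → ℝ) :
    D.block j (m.Ex f) = m.mult (fun w => D.cutoff j w.toPlane) f := by
  rw [m.Ex_eq_mult, block_mult]
  simp only [mul_one]

/-- The blocks beyond this index see no frequency of the box. -/
noncomputable def lastBlock (m : Model) : ℕ := Nat.clog 2 (4 * m.N)

lemma le_two_pow_lastBlock (m : Model) : 4 * (m.N : ℝ) ≤ 2 ^ lastBlock m := by
  have := Nat.le_pow_clog one_lt_two (4 * m.N)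
  exact_mod_cast this

lemma two_pow_lastBlock_le {m : Model} (h : 1 ≤ m.N) : (2 : ℝ) ^ lastBlock m ≤ 8 * m.N := by
  have h1 : 1 < 4 * m.N := by omega
  have h2 := Nat.pow_pred_clog_lt_self one_lt_two h1
  have h3 : lastBlock m = (Nat.clog 2 (4 * m.N)).pred + 1 :=
    (Nat.succ_pred_eq_of_pos (Nat.clog_pos one_lt_two h1)).symm
  rw [h3, pow_succ]
  have h4 : (2 : ℝ) ^ (Nat.clog 2 (4 * m.N)).pred ≤ 4 * m.N := by exact_mod_cast h2.le
  linarith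

lemma cutoff_eq_zero {m : Model} {w : Freq} (hw : w ∈ m.box) {j : ℕ} (hj : lastBlock m < j) :
    D.cutoff j w.toPlane = 0 := by
  obtain ⟨k, rfl⟩ : ∃ k, j = k + 1 := ⟨j - 1, by omega⟩
  refine D.ann_supp _ (Or.inl ?_)
  have h2 : (0 : ℝ) < 2 ^ k := by positivity
  have h3 : (2 : ℝ) ^ lastBlock m ≤ 2 ^ k := pow_le_pow_right₀ one_le_two (by omega)
  rw [norm_smul, Real.norm_of_nonneg (by positivity), inv_mul_eq_div, div_le_iff₀ h2]
  linarith [le_two_pow_lastBlock m, Model.norm_le_of_mem_box hw]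

lemma sum_cutoff {m : Model} {w : Freq} (hw : w ∈ m.box) :
    ∑ j ∈ Finset.range (lastBlock m + 1), D.cutoff j w.toPlane = 1 := by
  rw [Finset.sum_range_succ', add_comm, ← D.sum_eq_one w.toPlane]
  congr 1
  rw [tsum_eq_sum (s := Finset.range (lastBlock m))]
  · rfl
  · intro k hk
    rw [Finset.mem_range, not_lt] at hk
    exact D.cutoff_eq_zero hw (Nat.lt_succ_of_le hk)

lemma block_Ex_eq_zero {m : Model} {j : ℕ} (hj : lastBlock m < j) (f : m.Site → ℝ) :
    D.block j (m.Ex f) = 0 := by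
  ext x
  rw [block_Ex, Model.mult, Finset.sum_eq_zero, mul_zero, Pi.zero_apply]
  intro w hw
  rw [D.cutoff_eq_zero hw hj, zero_mul]

end DyadicPartition

namespace Model

variable {m : Model}

lemma mult_congr {a b : Freq → ℝ} (h : ∀ w ∈ m.box, a w = b w) (f : m.Site → ℝ) :
    m.mult a f = m.mult b f := by
  ext x
  unfold mult
  congr 1
  exact Finset.sum_congr rfl fun w hw => by rw [h w hw]

lemma mult_sum_left {ι : Type*} (s : Finset ι) (a : ι → Freq → ℝ) (f : m.Site → ℝ) (x : Plane) :
    m.mult (fun w => ∑ i ∈ s, a i w) f x = ∑ i ∈ s, m.mult (a i) f x := by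
  simp only [mult, Finset.sum_mul, ← Finset.mul_sum]
  rw [Finset.sum_comm]

lemma exists_abs_mult_le (a : Freq → ℝ) (f : m.Site → ℝ) : ∃ M, ∀ x, |m.mult a f x| ≤ M := by
  refine ⟨1 / 4 * ∑ w ∈ m.box, |a w| * ∑ k : m.Site, m.ε ^ 2 * |f k|, fun x => ?_⟩
  rw [mult, abs_mul, abs_of_pos (show (0 : ℝ) < 1 / 4 by norm_num)]
  refine mul_le_mul_of_nonneg_left ((Finset.abs_sum_le_sum_abs _ _).trans
    (Finset.sum_le_sum fun w _ => ?_)) (by norm_num)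
  rw [abs_mul]
  refine mul_le_mul_of_nonneg_left ((Finset.abs_sum_le_sum_abs _ _).trans
    (Finset.sum_le_sum fun k _ => ?_)) (abs_nonneg _)
  rw [abs_mul, abs_mul, abs_of_pos (pow_pos m.eps_pos 2), mul_assoc]
  refine mul_le_mul_of_nonneg_left ?_ (by positivity)
  exact mul_le_of_le_one_left (abs_nonneg _) (Real.abs_cos_le_one _)

end Model

namespace DyadicPartition

variable (D : DyadicPartition) {m : Model}

lemma exists_abs_block_le (j : ℕ) (f : m.Site → ℝ) : ∃ M, ∀ x, |D.block j (m.Ex f) x| ≤ M := by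
  rw [block_Ex]
  exact m.exists_abs_mult_le _ f

lemma abs_block_le (ν : ℝ) (j : ℕ) (f : m.Site → ℝ) (x : Plane) :
    |D.block j (m.Ex f) x| ≤ (2 : ℝ) ^ (ν * ((j : ℝ) - 1)) * D.besovNorm ν (m.Ex f) := by
  have hbdd : BddAbove (Set.range fun j : ℕ =>
      (2 : ℝ) ^ (-ν * ((j : ℝ) - 1)) * supNorm (D.block j (m.Ex f))) := by
    have hfin : (Set.range fun j : ℕ =>
        (2 : ℝ) ^ (-ν * ((j : ℝ) - 1)) * supNorm (D.block j (m.Ex f))).Finite := by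
      refine ((Set.finite_le_nat (lastBlock m)).image (fun j : ℕ =>
        (2 : ℝ) ^ (-ν * ((j : ℝ) - 1)) * supNorm (D.block j (m.Ex f))) |>.insert 0).subset ?_
      rintro _ ⟨j, rfl⟩
      rcases le_or_gt j (lastBlock m) with hj | hj
      · exact Or.inr ⟨j, hj, rfl⟩
      · left
        simp [D.block_Ex_eq_zero hj, supNorm]
    exact hfin.bddAbove
  have h1 := le_ciSup hbdd j
  have h2 := abs_le_supNorm (D.exists_abs_block_le j f) x
  refine h2.trans ?_
  rw [neg_mul, Real.rpow_neg zero_le_two, inv_mul_le_iff₀ (by positivity)] at h1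
  exact h1

lemma besovNorm_nonneg (ν : ℝ) (f : Plane → ℝ) : 0 ≤ D.besovNorm ν f :=
  Real.iSup_nonneg fun _ => mul_nonneg (by positivity) (supNorm_nonneg _)

lemma Ex_eq_sum_block (f : m.Site → ℝ) (x : Plane) :
    m.Ex f x = ∑ j ∈ Finset.range (lastBlock m + 1), D.block j (m.Ex f) x := by
  simp_rw [block_Ex]
  rw [← Model.mult_sum_left, Model.Ex_eq_mult]
  exact congrFun (Model.mult_congr (fun w hw => (D.sum_cutoff hw).symm) f) x

lemma high_Ex (f : m.Site → ℝ) (x : Plane) : D.high m.N (m.Ex f) x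
    = ∑ j ∈ (Finset.range (lastBlock m + 1)).filter
        (fun j : ℕ => (m.N : ℝ) / 20 ≤ (2 : ℝ) ^ ((j : ℤ) - 1)), D.block j (m.Ex f) x := by
  rw [high, tsum_eq_sum (s := Finset.range (lastBlock m + 1)), Finset.sum_filter]
  intro j hj
  rw [Finset.mem_range, not_lt] at hj
  rw [D.block_Ex_eq_zero hj]
  simp

/-- The low frequency part of a lattice function: the blocks that `DyadicPartition.high` leaves
out. -/
noncomputable def lowPart (f : m.Site → ℝ) (x : Plane) : ℝ :=
  ∑ j ∈ (Finset.range (lastBlock m + 1)).filter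
    (fun j : ℕ => ¬ (m.N : ℝ) / 20 ≤ (2 : ℝ) ^ ((j : ℤ) - 1)), D.block j (m.Ex f) x

lemma high_add_lowPart (f : m.Site → ℝ) (x : Plane) :
    D.high m.N (m.Ex f) x + D.lowPart f x = m.Ex f x := by
  rw [high_Ex, lowPart, Finset.sum_filter_add_sum_filter_not, ← Ex_eq_sum_block]

lemma exists_abs_high_le (f : m.Site → ℝ) : ∃ M, ∀ x, |D.high m.N (m.Ex f) x| ≤ M := by
  simp_rw [high_Ex, block_Ex, ← Model.mult_sum_left]
  exact m.exists_abs_mult_le _ f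

lemma lowPart_mem_trigPoly (f : m.Site → ℝ) :
    D.lowPart f ∈ Model.trigPoly (2 * m.N / 15) := by
  have h : D.lowPart f = m.mult (fun w => ∑ j ∈ (Finset.range (lastBlock m + 1)).filter
      (fun j : ℕ => ¬ (m.N : ℝ) / 20 ≤ (2 : ℝ) ^ ((j : ℤ) - 1)), D.cutoff j w.toPlane) f := by
    ext x
    rw [lowPart, Model.mult_sum_left]
    simp_rw [block_Ex]
  rw [h]
  refine m.mult_mem_trigPoly (fun w _ hw i => ?_) f
  obtain ⟨j, hj, hj0⟩ := Finset.exists_ne_zero_of_sum_ne_zero hw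
  rw [Finset.mem_filter, not_le] at hj
  have h1 := D.norm_lt_of_cutoff_ne_zero hj0
  have h2 : |(w i : ℝ)| ≤ ‖w.toPlane‖ := abs_apply_le_norm w.toPlane i
  have h3 : |(w i : ℝ)| * 15 < 2 * m.N := by linarith [hj.2]
  have h4 : |w i| * 15 < 2 * (m.N : ℤ) := by exact_mod_cast h3
  have h5 : |w i| ≤ (2 * (m.N : ℤ)) / 15 := by omega
  exact_mod_cast h5

/-- All partial sums of blocks are controlled by the Besov norm, at the price of a factor `N^ν`. -/
lemma exists_abs_sum_block_le {ν : ℝ} (hν : 0 < ν) : ∃ A, 0 ≤ A ∧ ∀ m : Model, 0 < m.γ →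
    m.γ < 1 / 8 → ∀ (f : m.Site → ℝ) (S : Finset ℕ), S ⊆ Finset.range (lastBlock m + 1) →
      ∀ x, |∑ j ∈ S, D.block j (m.Ex f) x|
        ≤ A * m.γ ^ (-(3 * ν)) * D.besovNorm ν (m.Ex f) := by
  have hq : (1 : ℝ) < 2 ^ ν := Real.one_lt_rpow one_lt_two hν
  have hq0 : (0 : ℝ) < 2 ^ ν - 1 := by linarith
  refine ⟨8 ^ ν / (2 ^ ν - 1), by positivity, fun m hγ hγ1 f S hS x => ?_⟩
  have hB := D.besovNorm_nonneg ν (m.Ex f)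
  have hN : 1 ≤ m.N := by
    have := m.four_lt_N hγ hγ1
    by_contra! h0
    have h1 : m.N = 0 := by omega
    rw [h1] at this
    norm_num at this
  have h1 : |∑ j ∈ S, D.block j (m.Ex f) x| ≤ ∑ j ∈ Finset.range (lastBlock m + 1),
      (2 : ℝ) ^ (ν * ((j : ℝ) - 1)) * D.besovNorm ν (m.Ex f) := by
    refine (Finset.abs_sum_le_sum_abs _ _).trans ((Finset.sum_le_sum fun j _ =>
      D.abs_block_le ν j f x).trans ?_)
    exact Finset.sum_le_sum_of_subset_of_nonneg hS fun j _ _ => by positivity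
  refine h1.trans ?_
  rw [← Finset.sum_mul]
  refine mul_le_mul_of_nonneg_right ?_ hB
  have h2 : ∀ j : ℕ, (2 : ℝ) ^ (ν * ((j : ℝ) - 1)) = (2 ^ ν)⁻¹ * ((2 : ℝ) ^ ν) ^ j := by
    intro j
    rw [mul_sub, mul_one, Real.rpow_sub zero_lt_two, Real.rpow_mul zero_le_two, Real.rpow_natCast]
    ring
  simp_rw [h2]
  rw [← Finset.mul_sum, geom_sum_eq hq.ne', pow_succ]
  have h3 : ((2 : ℝ) ^ ν) ^ lastBlock m ≤ 8 ^ ν * m.γ ^ (-(3 * ν)) := by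
    rw [← Real.rpow_natCast, ← Real.rpow_mul zero_le_two, mul_comm ν, Real.rpow_mul zero_le_two,
      Real.rpow_natCast]
    calc ((2 : ℝ) ^ lastBlock m) ^ ν ≤ (8 * m.N) ^ ν := by
          gcongr
          exact two_pow_lastBlock_le hN
      _ = 8 ^ ν * (m.N : ℝ) ^ ν := Real.mul_rpow (by norm_num) (by positivity)
      _ ≤ _ := by
          gcongr
          exact m.N_rpow_le hγ (by linarith) hν.le
  calc (2 ^ ν)⁻¹ * ((((2 : ℝ) ^ ν) ^ lastBlock m * 2 ^ ν - 1) / (2 ^ ν - 1))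
      ≤ (2 ^ ν)⁻¹ * ((((2 : ℝ) ^ ν) ^ lastBlock m * 2 ^ ν) / (2 ^ ν - 1)) := by
        gcongr
        linarith
    _ = ((2 : ℝ) ^ ν) ^ lastBlock m / (2 ^ ν - 1) := by field_simp
    _ ≤ 8 ^ ν * m.γ ^ (-(3 * ν)) / (2 ^ ν - 1) := by gcongr
    _ = _ := by ring

/-- Pointwise powers on the lattice and on the torus differ only through high frequencies: the
first seven powers of the low frequency part are trigonometric polynomials of degree at most `N`,
on which sampling at the lattice points and extending to the torus loses nothing. -/
lemma abs_Ex_pow_sub_pow_le {f : m.Site → ℝ} {L M : ℝ}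
    (hL : ∀ (g : m.Site → ℝ) (G : ℝ), (∀ k, |g k| ≤ G) → ∀ x, |m.Ex g x| ≤ L * G)
    (hM : ∀ x, |m.Ex f x| ≤ M) (hM' : ∀ x, |D.lowPart f x| ≤ M) {p : ℕ} (hp : p + 1 ≤ 7)
    (x : Plane) :
    |m.Ex (fun k => f k ^ (p + 1)) x - m.Ex f x ^ (p + 1)|
      ≤ (L + 1) * ((p + 1) * M ^ p * supNorm (D.high m.N (m.Ex f))) := by
  have hM0 : 0 ≤ M := (abs_nonneg _).trans (hM 0)
  set H := supNorm (D.high m.N (m.Ex f)) with hH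
  have hdiff : ∀ y, |m.Ex f y ^ (p + 1) - D.lowPart f y ^ (p + 1)| ≤ (p + 1) * M ^ p * H := by
    intro y
    refine (abs_pow_succ_sub_pow_succ_le (hM y) (hM' y) p).trans ?_
    rw [← D.high_add_lowPart f y, add_sub_cancel_right]
    gcongr
    exact abs_le_supNorm (D.exists_abs_high_le f) y
  have hd : (p + 1) * (2 * m.N / 15) ≤ m.N := by
    have h1 : (p + 1) * (2 * m.N / 15) ≤ 7 * (2 * m.N / 15) := Nat.mul_le_mul_right _ hp
    omega
  have hlow := congrFun
    (m.Ex_trigPoly hd (Model.pow_mem_trigPoly (D.lowPart_mem_trigPoly f) p)) x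
  simp only [Pi.pow_apply] at hlow
  have hsite : ∀ k, |f k ^ (p + 1) - D.lowPart f (site m.ε k) ^ (p + 1)| ≤ (p + 1) * M ^ p * H := by
    intro k
    have h4 := hdiff (site m.ε k)
    rwa [m.Ex_eq_mult, m.mult_one_site] at h4
  generalize hg : (fun k : m.Site => D.lowPart f (site m.ε k) ^ (p + 1)) = g at hlow
  have hg' : ∀ k, D.lowPart f (site m.ε k) ^ (p + 1) = g k := fun k => congrFun hg k
  simp only [hg'] at hsite
  have h3 := hL _ _ hsite x
  have hsplit : m.Ex (fun k => f k ^ (p + 1)) x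
      = m.Ex (fun k => f k ^ (p + 1) - g k) x + D.lowPart f x ^ (p + 1) := by
    rw [← hlow, m.Ex_eq_mult, m.Ex_eq_mult, m.Ex_eq_mult, ← m.mult_add]
    simp only [sub_add_cancel]
  have h5 := hdiff x
  rw [hsplit, add_mul, one_mul, add_sub_assoc]
  refine (abs_add_le _ _).trans (add_le_add h3 ?_)
  rwa [abs_sub_comm]

end DyadicPartition

/-! ### The Lebesgue constant of trigonometric interpolation -/

/-- The one dimensional Dirichlet kernel. -/
noncomputable def dirichlet (N : ℕ) (t : ℝ) : ℝ :=
  ∑ n ∈ Finset.Icc (-(N : ℤ)) N, Real.cos (Real.pi * n * t)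

lemma sum_Icc_neg_eq (N : ℕ) (F : ℤ → ℝ) : ∑ n ∈ Finset.Icc (-(N : ℤ)) N, F n
    = F 0 + ∑ n ∈ Finset.range N, (F (n + 1) + F (-(n + 1))) := by
  induction N with
  | zero => simp
  | succ N ih =>
    rw [Finset.sum_range_succ, ← add_assoc, ← ih]
    have h : Finset.Icc (-((N + 1 : ℕ) : ℤ)) ((N + 1 : ℕ) : ℤ)
        = insert ((N : ℤ) + 1) (insert (-((N : ℤ) + 1)) (Finset.Icc (-(N : ℤ)) N)) := by
      ext n
      simp only [Finset.mem_insert, Finset.mem_Icc]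
      push_cast
      omega
    rw [h, Finset.sum_insert, Finset.sum_insert]
    · ring
    · simp
    · simp only [Finset.mem_insert, Finset.mem_Icc]
      omega

lemma dirichlet_mul_sin (N : ℕ) (t : ℝ) : dirichlet N t * Real.sin (Real.pi * t / 2)
    = Real.sin ((2 * N + 1) * (Real.pi * t / 2)) := by
  unfold dirichlet
  rw [sum_Icc_neg_eq]
  induction N with
  | zero => simp
  | succ N ih =>
    rw [Finset.sum_range_succ, ← add_assoc, add_mul, ih]
    have h1 : Real.cos (Real.pi * ((-(N + 1) : ℤ) : ℝ) * t)
        = Real.cos (Real.pi * ((N + 1 : ℤ) : ℝ) * t) := by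
      rw [← Real.cos_neg]
      congr 1
      push_cast
      ring
    have h2 := Real.sin_sub_sin ((2 * ((N + 1 : ℕ) : ℝ) + 1) * (Real.pi * t / 2))
      ((2 * (N : ℝ) + 1) * (Real.pi * t / 2))
    have h3 : ((2 * ((N + 1 : ℕ) : ℝ) + 1) * (Real.pi * t / 2)
        - (2 * (N : ℝ) + 1) * (Real.pi * t / 2)) / 2 = Real.pi * t / 2 := by
      push_cast
      ring
    have h4 : ((2 * ((N + 1 : ℕ) : ℝ) + 1) * (Real.pi * t / 2)
        + (2 * (N : ℝ) + 1) * (Real.pi * t / 2)) / 2 = Real.pi * ((N + 1 : ℤ) : ℝ) * t := by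
      push_cast
      ring
    rw [h3, h4] at h2
    rw [h1]
    linarith

lemma abs_dirichlet_le (N : ℕ) (t : ℝ) : |dirichlet N t| ≤ 2 * N + 1 := by
  refine (Finset.abs_sum_le_sum_abs _ _).trans
    ((Finset.sum_le_card_nsmul _ _ 1 fun n _ => Real.abs_cos_le_one _).trans ?_)
  rw [Int.card_Icc, nsmul_eq_mul, mul_one]
  have : ((N : ℤ) + 1 - -(N : ℤ)).toNat = 2 * N + 1 := by omega
  rw [this]
  push_cast
  exact le_rfl

/-- The decay of the Dirichlet kernel away from the origin. -/
lemma abs_dirichlet_mul_abs_le (N : ℕ) {t : ℝ} (ht : |t| ≤ 1) : |dirichlet N t| * |t| ≤ 1 := by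
  have h1 : |t| ≤ |Real.sin (Real.pi * t / 2)| := by
    have h2 := Real.mul_abs_le_abs_sin (x := Real.pi * t / 2) (by
      rw [abs_div, abs_mul, abs_of_pos Real.pi_pos, abs_of_pos (zero_lt_two' ℝ)]
      have := Real.pi_pos
      nlinarith)
    refine le_trans (le_of_eq ?_) h2
    rw [abs_div, abs_mul, abs_of_pos Real.pi_pos, abs_of_pos (zero_lt_two' ℝ)]
    have := Real.pi_pos
    field_simp
  calc |dirichlet N t| * |t| ≤ |dirichlet N t| * |Real.sin (Real.pi * t / 2)| := by gcongr
    _ = |Real.sin ((2 * N + 1) * (Real.pi * t / 2))| := by rw [← abs_mul, dirichlet_mul_sin]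
    _ ≤ 1 := Real.abs_sin_le_one _

lemma dirichlet_add_two_mul (N : ℕ) (t : ℝ) (j : ℤ) : dirichlet N (t + 2 * j) = dirichlet N t := by
  unfold dirichlet
  refine Finset.sum_congr rfl fun n _ => ?_
  have : Real.pi * n * (t + 2 * j) = Real.pi * n * t + (n * j : ℤ) * (2 * Real.pi) := by
    push_cast
    ring
  rw [this, Real.cos_add_int_mul_two_pi]

namespace Model

variable (m : Model)

lemma sum_box_cos_phase (y : Plane) : ∑ w ∈ m.box, Real.cos (Real.pi * phase w y)
    = dirichlet m.N (y 0) * dirichlet m.N (y 1) := by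
  have hsin : ∀ t : ℝ, ∑ n ∈ Finset.Icc (-(m.N : ℤ)) m.N, Real.sin (Real.pi * n * t) = 0 := by
    intro t
    rw [sum_Icc_neg_eq, Finset.sum_eq_zero]
    · simp
    · intro n _
      have : Real.pi * ((-(n + 1) : ℤ) : ℝ) * t = -(Real.pi * ((n + 1 : ℤ) : ℝ) * t) := by
        push_cast
        ring
      rw [this, Real.sin_neg, add_neg_cancel]
  have h : ∀ a b : ℤ, Real.cos (Real.pi * phase ![a, b] y)
      = Real.cos (Real.pi * a * y 0) * Real.cos (Real.pi * b * y 1)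
        - Real.sin (Real.pi * a * y 0) * Real.sin (Real.pi * b * y 1) := by
    intro a b
    rw [← Real.cos_add]
    congr 1
    simp [phase]
    ring
  rw [box, sum_piFinset_two]
  simp_rw [h, Finset.sum_sub_distrib, ← Finset.mul_sum, hsin, mul_zero, Finset.sum_const_zero,
    sub_zero]
  rw [← Finset.sum_mul]
  rfl

/-- The decay of the Dirichlet kernel along the lattice shifted by its point nearest to `t`. -/
lemma abs_dirichlet_shift_le (t : ℝ) {n : ℤ} (hn : |n| ≤ m.N) :
    |dirichlet m.N (t - m.ε * (n + round (t / m.ε)))| ≤ 2 / m.ε * (max 1 |(n : ℝ)|)⁻¹ := by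
  have hε := m.eps_pos
  have hmul := m.eps_mul
  have hr := abs_sub_round (t / m.ε)
  set r := (round (t / m.ε) : ℝ)
  rcases eq_or_ne n 0 with rfl | h0
  · refine (abs_dirichlet_le _ _).trans (le_of_eq ?_)
    rw [Int.cast_zero, abs_zero, max_eq_left zero_le_one, inv_one, mul_one, eq_div_iff hε.ne',
      mul_comm, hmul]
  · have h1 : (1 : ℝ) ≤ |(n : ℝ)| := by exact_mod_cast Int.one_le_abs h0
    have h2 : |(n : ℝ)| ≤ m.N := by exact_mod_cast hn
    have h3 : t - m.ε * (n + r) = m.ε * ((t / m.ε - r) - n) := by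
      field_simp
      ring
    rw [max_eq_right h1, h3]
    have h4 : |t / m.ε - r - n| ≤ m.N + 1 / 2 := by
      refine (abs_sub _ _).trans ?_
      linarith
    have h5 : |(n : ℝ)| / 2 ≤ |t / m.ε - r - n| := by
      have := abs_sub_abs_le_abs_sub (n : ℝ) (t / m.ε - r)
      rw [abs_sub_comm (n : ℝ)] at this
      linarith
    have h6 : |m.ε * (t / m.ε - r - n)| ≤ 1 := by
      rw [abs_mul, abs_of_pos hε]
      nlinarith
    have h7 := abs_dirichlet_mul_abs_le m.N h6
    generalize dirichlet m.N (m.ε * (t / m.ε - r - n)) = d at h7 ⊢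
    rw [abs_mul, abs_of_pos hε] at h7
    rw [← div_eq_mul_inv, div_div, le_div_iff₀ (by positivity)]
    have h8 := mul_le_mul_of_nonneg_left h5 (show 0 ≤ |d| * m.ε by positivity)
    linarith

lemma exists_sum_inv_max_le {η : ℝ} (hη : 0 < η) : ∃ A, 0 ≤ A ∧ ∀ N : ℕ, 1 ≤ N →
    ∑ n ∈ Finset.Icc (-(N : ℤ)) N, (max 1 |(n : ℝ)|)⁻¹ ≤ A * (N : ℝ) ^ η := by
  have hs := Real.summable_abs_int_rpow (b := 1 + η) (by linarith)
  set S := ∑' n : ℤ, |(n : ℝ)| ^ (-(1 + η)) with hS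
  have hS0 : 0 ≤ S := tsum_nonneg fun n => by positivity
  refine ⟨1 + S, by positivity, fun N hN => ?_⟩
  have hN1 : (1 : ℝ) ≤ N := by exact_mod_cast hN
  have hpt : ∀ n ∈ Finset.Icc (-(N : ℤ)) N, (max 1 |(n : ℝ)|)⁻¹
      ≤ (if n = 0 then 1 else 0) + (N : ℝ) ^ η * |(n : ℝ)| ^ (-(1 + η)) := by
    intro n hn
    split_ifs with h0
    · subst h0
      simp
      positivity
    · have h1 : (1 : ℝ) ≤ |(n : ℝ)| := by exact_mod_cast Int.one_le_abs h0
      have h2 : |(n : ℝ)| ≤ N := by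
        rw [Finset.mem_Icc, ← abs_le] at hn
        exact_mod_cast hn
      have h3 : 0 < |(n : ℝ)| := by linarith
      rw [max_eq_right h1, zero_add, neg_add, Real.rpow_add h3, Real.rpow_neg_one,
        Real.rpow_neg h3.le]
      have h4 : |(n : ℝ)| ^ η ≤ (N : ℝ) ^ η := by gcongr
      have h5 : 0 < |(n : ℝ)| ^ η := by positivity
      calc |(n : ℝ)|⁻¹ = |(n : ℝ)| ^ η * (|(n : ℝ)|⁻¹ * (|(n : ℝ)| ^ η)⁻¹) := by field_simp
        _ ≤ _ := by gcongr
  refine (Finset.sum_le_sum hpt).trans ?_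
  rw [Finset.sum_add_distrib, ← Finset.mul_sum, Finset.sum_ite_eq',
    if_pos (by rw [Finset.mem_Icc]; omega), add_mul, one_mul, mul_comm S]
  refine add_le_add (Real.one_le_rpow hN1 hη.le) ?_
  gcongr
  exact hs.sum_le_tsum _ fun n _ => by positivity

/-- The Lebesgue function of the extension. By periodicity the lattice may be centred at the point
of the lattice closest to `x`, from which the two one-dimensional kernels decay. -/
lemma sum_abs_dirichlet_le (x : Plane) :
    ∑ k : m.Site, |∑ w ∈ m.box, Real.cos (Real.pi * phase w (x - site m.ε k))|
      ≤ (2 / m.ε * ∑ n ∈ Finset.Icc (-(m.N : ℤ)) m.N, (max 1 |(n : ℝ)|)⁻¹) ^ 2 := by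
  set l : Fin 2 → ℤ := fun i => round (x i / m.ε) with hl
  have hper : ∀ (k : m.Site) (i : Fin 2),
      dirichlet m.N ((x - site m.ε (k + fun i => (l i : ZMod (2 * m.N + 1)))) i)
        = dirichlet m.N (x i - m.ε * ((k i).valMinAbs + l i)) := by
    intro k i
    have h1 : (((k i + (l i : ZMod (2 * m.N + 1))).valMinAbs : ℤ) : ZMod (2 * m.N + 1))
        = (((k i).valMinAbs + l i : ℤ) : ZMod (2 * m.N + 1)) := by
      push_cast
      simp
    rw [ZMod.intCast_eq_intCast_iff_dvd_sub] at h1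
    obtain ⟨j, hj⟩ := h1
    have h2 : ((k i).valMinAbs + l i : ℝ)
        = ((k i + (l i : ZMod (2 * m.N + 1))).valMinAbs : ℝ) + (2 * m.N + 1) * j := by
      have : ((k i).valMinAbs + l i : ℤ)
        = (k i + (l i : ZMod (2 * m.N + 1))).valMinAbs + (2 * m.N + 1 : ℕ) * j := by linarith
      exact_mod_cast this
    have h3 : (x - site m.ε (k + fun i => (l i : ZMod (2 * m.N + 1)))) i
        = x i - m.ε * ((k i).valMinAbs + l i) + 2 * j := by
      have h4 := m.eps_mul
      rw [h2]
      simp only [site, PiLp.sub_apply, Pi.add_apply]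
      linear_combination j * h4
    rw [h3, dirichlet_add_two_mul]
  have hshift : ∑ k : m.Site, |∑ w ∈ m.box, Real.cos (Real.pi * phase w (x - site m.ε k))|
      = ∑ w ∈ m.box, |dirichlet m.N (x 0 - m.ε * (w 0 + l 0))|
          * |dirichlet m.N (x 1 - m.ε * (w 1 + l 1))| := by
    rw [sum_box]
    simp_rw [sum_box_cos_phase, abs_mul]
    rw [← Equiv.sum_comp (Equiv.addRight (fun i => (l i : ZMod (2 * m.N + 1)) : m.Site))]
    refine Finset.sum_congr rfl fun k _ => ?_
    rw [Equiv.coe_addRight, hper, hper]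
  rw [hshift]
  set b : ℤ → ℝ := fun n => 2 / m.ε * (max 1 |(n : ℝ)|)⁻¹ with hb
  have hε := m.eps_pos
  calc _ ≤ ∑ w ∈ m.box, b (w 0) * b (w 1) := by
        refine Finset.sum_le_sum fun w hw => ?_
        have h := m.mem_box.1 hw
        exact mul_le_mul (m.abs_dirichlet_shift_le (x 0) (h 0))
          (m.abs_dirichlet_shift_le (x 1) (h 1)) (abs_nonneg _) (by positivity)
    _ = _ := by
        rw [box, sum_piFinset_two]
        simp only [Matrix.cons_val_zero, Matrix.cons_val_one, ← Finset.mul_sum, ← Finset.sum_mul]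
        rw [hb, ← Finset.mul_sum, sq]

/-- The extension of lattice functions to trigonometric polynomials is bounded in the supremum
norm up to an arbitrarily small power. -/
lemma exists_abs_Ex_le {κ : ℝ} (hκ : 0 < κ) : ∃ A, 0 ≤ A ∧ ∀ m : Model, 0 < m.γ → m.γ < 1 / 8 →
    ∀ (g : m.Site → ℝ) (G : ℝ), (∀ k, |g k| ≤ G) → ∀ x, |m.Ex g x| ≤ A * m.γ ^ (-κ) * G := by
  obtain ⟨A, hA, h⟩ := exists_sum_inv_max_le (η := κ / 6) (by linarith)
  refine ⟨A ^ 2, by positivity, fun m hγ hγ1 g G hG x => ?_⟩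
  have hε := m.eps_pos
  have hG0 : 0 ≤ G := (abs_nonneg _).trans (hG 0)
  have hN : 1 ≤ m.N := by
    have := m.four_lt_N hγ hγ1
    by_contra! h0
    have h1 : m.N = 0 := by omega
    rw [h1] at this
    norm_num at this
  have h1 : m.Ex g x = m.ε ^ 2 / 4 * ∑ k : m.Site,
      (∑ w ∈ m.box, Real.cos (Real.pi * phase w (x - site m.ε k))) * g k := by
    unfold Ex
    rw [Finset.sum_comm, Finset.mul_sum, Finset.mul_sum]
    refine Finset.sum_congr rfl fun k _ => ?_
    rw [Finset.sum_mul, Finset.mul_sum, Finset.mul_sum]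
    refine Finset.sum_congr rfl fun w _ => ?_
    ring
  have h2 : |m.Ex g x| ≤ m.ε ^ 2 / 4 * ((2 / m.ε *
      ∑ n ∈ Finset.Icc (-(m.N : ℤ)) m.N, (max 1 |(n : ℝ)|)⁻¹) ^ 2 * G) := by
    rw [h1, abs_mul, abs_of_pos (by positivity : 0 < m.ε ^ 2 / 4)]
    refine mul_le_mul_of_nonneg_left ?_ (by positivity)
    refine (Finset.abs_sum_le_sum_abs _ _).trans ?_
    refine le_trans ?_ (mul_le_mul_of_nonneg_right (m.sum_abs_dirichlet_le x) hG0)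
    rw [Finset.sum_mul]
    refine Finset.sum_le_sum fun k _ => ?_
    rw [abs_mul]
    exact mul_le_mul_of_nonneg_left (hG k) (abs_nonneg _)
  have h3 := h m.N hN
  have h4 : (m.N : ℝ) ^ (κ / 6) ≤ m.γ ^ (-(κ / 2)) := by
    have := m.N_rpow_le hγ (by linarith) (η := κ / 6) (by linarith)
    rwa [show 3 * (κ / 6) = κ / 2 by ring] at this
  have h5 : 0 ≤ ∑ n ∈ Finset.Icc (-(m.N : ℤ)) m.N, (max 1 |(n : ℝ)|)⁻¹ :=
    Finset.sum_nonneg fun n _ => by positivity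
  generalize ∑ n ∈ Finset.Icc (-(m.N : ℤ)) m.N, (max 1 |(n : ℝ)|)⁻¹ = S at h2 h3 h5
  have h6 : m.γ ^ (-κ) = (m.γ ^ (-(κ / 2))) ^ 2 := by
    rw [← Real.rpow_natCast, ← Real.rpow_mul hγ.le]
    congr 1
    push_cast
    ring
  have h7 : S ≤ A * m.γ ^ (-(κ / 2)) := h3.trans (by gcongr)
  calc |m.Ex g x| ≤ S ^ 2 * G := by
        refine h2.trans (le_of_eq ?_)
        field_simp
        norm_num
    _ ≤ (A * m.γ ^ (-(κ / 2))) ^ 2 * G := by gcongr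
    _ = _ := by rw [mul_pow, ← h6]

end Model

/-! ### The Taylor expansion of the response -/

lemma abs_exp_sub_sum_le (v : ℝ) (n : ℕ) :
    |Real.exp v - ∑ i ∈ Finset.range n, v ^ i / (i.factorial : ℝ)| ≤ |v| ^ n * Real.exp |v| := by
  have h := Complex.norm_exp_sub_sum_le_norm_mul_exp (v : ℂ) n
  rw [Complex.norm_real, Real.norm_eq_abs] at h
  rw [← Real.norm_eq_abs, ← Complex.norm_real]
  push_cast
  exact h

/-- The coefficient of `v` in the expansion of `2a sinh v / (1 + 2a cosh v)` at `v = 0`. -/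
noncomputable def coeffOne (a : ℝ) : ℝ := 2 * a / (1 + 2 * a)

/-- The coefficient of `v³` in the expansion of `2a sinh v / (1 + 2a cosh v)`, in the recursive
form obtained by clearing the denominator. -/
noncomputable def coeffThree (a : ℝ) : ℝ := (a / 3 - a * coeffOne a) / (1 + 2 * a)

/-- The coefficient of `v⁵` in the expansion of `2a sinh v / (1 + 2a cosh v)`, in the recursive
form obtained by clearing the denominator. -/
noncomputable def coeffFive (a : ℝ) : ℝ :=
  (a / 60 - a * coeffThree a - a / 12 * coeffOne a) / (1 + 2 * a)

/-- The Taylor remainder of `sinh`, inherited from that of `exp`; `e` stands for the odd part of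
the truncated exponential series. -/
lemma abs_sinh_sub_le (v : ℝ) {e : ℝ → ℝ} {n : ℕ} {E : ℝ}
    (he : ∀ u, (∑ i ∈ Finset.range n, u ^ i / (i.factorial : ℝ)) -
      (∑ i ∈ Finset.range n, (-u) ^ i / (i.factorial : ℝ)) = 2 * e u) (hE : Real.exp |v| ≤ E) :
    |Real.sinh v - e v| ≤ E * |v| ^ n := by
  have h1 := abs_exp_sub_sum_le v n
  have h2 := abs_exp_sub_sum_le (-v) n
  rw [abs_neg] at h2
  have h3 : Real.sinh v - e v = (1 / 2) * ((Real.exp v - ∑ i ∈ Finset.range n, v ^ i / (i.factorial : ℝ))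
      - (Real.exp (-v) - ∑ i ∈ Finset.range n, (-v) ^ i / (i.factorial : ℝ))) := by
    rw [Real.sinh_eq]
    linarith [he v]
  have h4 : |v| ^ n * Real.exp |v| ≤ E * |v| ^ n := by
    rw [mul_comm]
    gcongr
  rw [h3, abs_mul, abs_of_pos (by norm_num : (0 : ℝ) < 1 / 2)]
  have h5 := abs_sub (Real.exp v - ∑ i ∈ Finset.range n, v ^ i / (i.factorial : ℝ))
    (Real.exp (-v) - ∑ i ∈ Finset.range n, (-v) ^ i / (i.factorial : ℝ))
  linarith

/-- The Taylor remainder of `cosh`; `e` stands for the even part of the truncated exponential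
series. -/
lemma abs_cosh_sub_le (v : ℝ) {e : ℝ → ℝ} {n : ℕ} {E : ℝ}
    (he : ∀ u, (∑ i ∈ Finset.range n, u ^ i / (i.factorial : ℝ)) +
      (∑ i ∈ Finset.range n, (-u) ^ i / (i.factorial : ℝ)) = 2 * e u) (hE : Real.exp |v| ≤ E) :
    |Real.cosh v - e v| ≤ E * |v| ^ n := by
  have h1 := abs_exp_sub_sum_le v n
  have h2 := abs_exp_sub_sum_le (-v) n
  rw [abs_neg] at h2
  have h3 : Real.cosh v - e v = (1 / 2) * ((Real.exp v - ∑ i ∈ Finset.range n, v ^ i / (i.factorial : ℝ))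
      + (Real.exp (-v) - ∑ i ∈ Finset.range n, (-v) ^ i / (i.factorial : ℝ))) := by
    rw [Real.cosh_eq]
    linarith [he v]
  have h4 : |v| ^ n * Real.exp |v| ≤ E * |v| ^ n := by
    rw [mul_comm]
    gcongr
  rw [h3, abs_mul, abs_of_pos (by norm_num : (0 : ℝ) < 1 / 2)]
  have h5 := abs_add_le (Real.exp v - ∑ i ∈ Finset.range n, v ^ i / (i.factorial : ℝ))
    (Real.exp (-v) - ∑ i ∈ Finset.range n, (-v) ^ i / (i.factorial : ℝ))
  linarith

lemma abs_coeffOne_le {a : ℝ} (ha : 0 < a) : |coeffOne a| ≤ 1 := by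
  unfold coeffOne
  rw [abs_of_pos (by positivity), div_le_one (by positivity)]
  linarith

lemma abs_coeffThree_le {a : ℝ} (ha : 0 < a) : |coeffThree a| ≤ 1 := by
  have h1 := abs_le.1 (abs_coeffOne_le ha)
  unfold coeffThree
  rw [abs_div, abs_of_pos (show 0 < 1 + 2 * a by positivity), div_le_one (by positivity), abs_le]
  constructor <;> nlinarith

lemma abs_coeffFive_le {a : ℝ} (ha : 0 < a) : |coeffFive a| ≤ 1 := by
  have h1 := abs_le.1 (abs_coeffOne_le ha)
  have h3 := abs_le.1 (abs_coeffThree_le ha)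
  unfold coeffFive
  rw [abs_div, abs_of_pos (show 0 < 1 + 2 * a by positivity), div_le_one (by positivity), abs_le]
  constructor <;> nlinarith

lemma abs_div_le_of_one_le {x y C : ℝ} (hy : 1 ≤ y) (hx : |x| ≤ C) : |x / y| ≤ C := by
  rw [abs_div, abs_of_pos (by linarith : 0 < y)]
  exact (div_le_self (abs_nonneg _) hy).trans hx

lemma exists_abs_response_sub_le_five (A V : ℝ) : ∃ C, 0 ≤ C ∧ ∀ a v : ℝ, 0 < a → a ≤ A →
    |v| ≤ V → |2 * a * Real.sinh v / (1 + 2 * a * Real.cosh v)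
      - (coeffOne a * v + coeffThree a * v ^ 3)| ≤ C * |v| ^ 5 := by
  refine ⟨|A| * (1 + 2 * Real.exp V + 2 * Real.exp V * (1 + V ^ 2)), by positivity,
    fun a v ha haA hv => ?_⟩
  have hA : 0 < A := by linarith
  have hV : 0 ≤ V := (abs_nonneg v).trans hv
  rw [abs_of_pos hA]
  have hE : Real.exp |v| ≤ Real.exp V := Real.exp_le_exp.2 hv
  have hs := abs_sinh_sub_le v (e := fun u => u + u ^ 3 / 6) (n := 5) (fun u => by
    simp [Finset.sum_range_succ, Nat.factorial]
    ring) hE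
  have hc := abs_cosh_sub_le v (e := fun u => 1 + u ^ 2 / 2) (n := 4) (fun u => by
    simp [Finset.sum_range_succ, Nat.factorial]
    ring) hE
  have hden : 1 ≤ 1 + 2 * a * Real.cosh v := by
    have := Real.cosh_pos v
    have : 0 < a * Real.cosh v := by positivity
    linarith
  set p := coeffOne a with hp
  set q := coeffThree a with hq
  have hp1 : |p| ≤ 1 := abs_coeffOne_le ha
  have hq1 : |q| ≤ 1 := abs_coeffThree_le ha
  have hpe : p * (1 + 2 * a) = 2 * a := by
    rw [hp, coeffOne]
    field_simp
  have hqe : q * (1 + 2 * a) = a / 3 - a * p := by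
    rw [hq, coeffThree, ← hp]
    field_simp
  obtain ⟨r, hr⟩ : ∃ r, r = Real.sinh v - (v + v ^ 3 / 6) := ⟨_, rfl⟩
  obtain ⟨c, hc'⟩ : ∃ c, c = Real.cosh v - (1 + v ^ 2 / 2) := ⟨_, rfl⟩
  rw [← hr] at hs
  rw [← hc'] at hc
  have hnum : 2 * a * Real.sinh v / (1 + 2 * a * Real.cosh v) - (p * v + q * v ^ 3)
      = (-(a * q * v ^ 5) + 2 * a * r - 2 * a * c * (p * v + q * v ^ 3))
        / (1 + 2 * a * Real.cosh v) := by
    rw [eq_div_iff (by linarith), sub_mul, div_mul_cancel₀ _ (by linarith), hr, hc']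
    linear_combination (-v) * hpe - v ^ 3 * hqe
  rw [hnum]
  refine abs_div_le_of_one_le hden ?_
  have h1 : |a * q * v ^ 5| ≤ A * 1 * |v| ^ 5 := by
    rw [abs_mul, abs_mul, abs_of_pos ha, abs_pow]
    gcongr
  have h2 : |2 * a * r| ≤ 2 * A * (Real.exp V * |v| ^ 5) := by
    rw [abs_mul, abs_mul, abs_of_pos ha, abs_two]
    gcongr
  have h3 : |p * v + q * v ^ 3| ≤ 1 * |v| + 1 * (V ^ 2 * |v|) := by
    refine (abs_add_le _ _).trans ?_
    rw [abs_mul, abs_mul, abs_pow, pow_succ]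
    gcongr
  have h4 : |2 * a * c * (p * v + q * v ^ 3)|
      ≤ 2 * A * (Real.exp V * |v| ^ 4) * (1 * |v| + 1 * (V ^ 2 * |v|)) := by
    rw [abs_mul, abs_mul, abs_mul, abs_of_pos ha, abs_two]
    gcongr
  refine (abs_sub _ _).trans ((add_le_add (abs_add_le _ _) le_rfl).trans ?_)
  rw [abs_neg]
  refine (add_le_add (add_le_add h1 h2) h4).trans (le_of_eq ?_)
  ring

lemma exists_abs_response_sub_le_seven (A V : ℝ) : ∃ C, 0 ≤ C ∧ ∀ a v : ℝ, 0 < a → a ≤ A →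
    |v| ≤ V → |2 * a * Real.sinh v / (1 + 2 * a * Real.cosh v)
      - (coeffOne a * v + coeffThree a * v ^ 3 + coeffFive a * v ^ 5)| ≤ C * |v| ^ 7 := by
  refine ⟨|A| * ((1 + 1 + V ^ 2) + 2 * Real.exp V + 2 * Real.exp V * (1 + V ^ 2 + V ^ 4)),
    by positivity, fun a v ha haA hv => ?_⟩
  have hA : 0 < A := by linarith
  have hV : 0 ≤ V := (abs_nonneg v).trans hv
  rw [abs_of_pos hA]
  have hE : Real.exp |v| ≤ Real.exp V := Real.exp_le_exp.2 hv
  have hs := abs_sinh_sub_le v (e := fun u => u + u ^ 3 / 6 + u ^ 5 / 120) (n := 7) (fun u => by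
    simp [Finset.sum_range_succ, Nat.factorial]
    ring) hE
  have hc := abs_cosh_sub_le v (e := fun u => 1 + u ^ 2 / 2 + u ^ 4 / 24) (n := 6) (fun u => by
    simp [Finset.sum_range_succ, Nat.factorial]
    ring) hE
  have hden : 1 ≤ 1 + 2 * a * Real.cosh v := by
    have := Real.cosh_pos v
    have : 0 < a * Real.cosh v := by positivity
    linarith
  set p := coeffOne a with hp
  set q := coeffThree a with hq
  set w := coeffFive a with hw
  have hp1 : |p| ≤ 1 := abs_coeffOne_le ha
  have hq1 : |q| ≤ 1 := abs_coeffThree_le ha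
  have hw1 : |w| ≤ 1 := abs_coeffFive_le ha
  have hpe : p * (1 + 2 * a) = 2 * a := by
    rw [hp, coeffOne]
    field_simp
  have hqe : q * (1 + 2 * a) = a / 3 - a * p := by
    rw [hq, coeffThree, ← hp]
    field_simp
  have hwe : w * (1 + 2 * a) = a / 60 - a * q - a / 12 * p := by
    rw [hw, coeffFive, ← hp, ← hq]
    field_simp
  obtain ⟨r, hr⟩ : ∃ r, r = Real.sinh v - (v + v ^ 3 / 6 + v ^ 5 / 120) := ⟨_, rfl⟩
  obtain ⟨c, hc'⟩ : ∃ c, c = Real.cosh v - (1 + v ^ 2 / 2 + v ^ 4 / 24) := ⟨_, rfl⟩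
  rw [← hr] at hs
  rw [← hc'] at hc
  have hnum : 2 * a * Real.sinh v / (1 + 2 * a * Real.cosh v) - (p * v + q * v ^ 3 + w * v ^ 5)
      = (-(a * (q / 12 + w + w / 12 * v ^ 2) * v ^ 7) + 2 * a * r
          - 2 * a * c * (p * v + q * v ^ 3 + w * v ^ 5))
        / (1 + 2 * a * Real.cosh v) := by
    rw [eq_div_iff (by linarith), sub_mul, div_mul_cancel₀ _ (by linarith), hr, hc']
    linear_combination (-v) * hpe - v ^ 3 * hqe - v ^ 5 * hwe
  rw [hnum]
  refine abs_div_le_of_one_le hden ?_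
  have h0 : |q / 12 + w + w / 12 * v ^ 2| ≤ 1 + 1 + V ^ 2 := by
    refine (abs_add_le _ _).trans (add_le_add ((abs_add_le _ _).trans (add_le_add ?_ hw1)) ?_)
    · rw [abs_div, abs_of_pos (by norm_num : (0 : ℝ) < 12)]
      linarith
    · rw [abs_mul, abs_div, abs_of_pos (by norm_num : (0 : ℝ) < 12), abs_pow]
      calc |w| / 12 * |v| ^ 2 ≤ 1 * V ^ 2 := by
            gcongr
            linarith
        _ = V ^ 2 := one_mul _
  have h1 : |a * (q / 12 + w + w / 12 * v ^ 2) * v ^ 7| ≤ A * (1 + 1 + V ^ 2) * |v| ^ 7 := by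
    rw [abs_mul, abs_mul, abs_of_pos ha, abs_pow]
    gcongr
  have h2 : |2 * a * r| ≤ 2 * A * (Real.exp V * |v| ^ 7) := by
    rw [abs_mul, abs_mul, abs_of_pos ha, abs_two]
    gcongr
  have h3 : |p * v + q * v ^ 3 + w * v ^ 5| ≤ 1 * |v| + 1 * (V ^ 2 * |v|) + 1 * (V ^ 4 * |v|) := by
    refine (abs_add_le _ _).trans (add_le_add ((abs_add_le _ _).trans ?_) ?_)
    · rw [abs_mul, abs_mul, abs_pow, pow_succ |v|]
      gcongr
    · rw [abs_mul, abs_pow, pow_succ |v|]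
      gcongr
  have h4 : |2 * a * c * (p * v + q * v ^ 3 + w * v ^ 5)|
      ≤ 2 * A * (Real.exp V * |v| ^ 6) * (1 * |v| + 1 * (V ^ 2 * |v|) + 1 * (V ^ 4 * |v|)) := by
    rw [abs_mul, abs_mul, abs_mul, abs_of_pos ha, abs_two]
    gcongr
  refine (abs_sub _ _).trans ((add_le_add (abs_add_le _ _) le_rfl).trans ?_)
  rw [abs_neg]
  refine (add_le_add (add_le_add h1 h2) h4).trans (le_of_eq ?_)
  ring

namespace Model

variable {m : Model}

lemma response_eq (u : ℝ) : m.response u = 2 * Real.exp m.θ * Real.sinh (m.β * u)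
    / (1 + 2 * Real.exp m.θ * Real.cosh (m.β * u)) := by
  unfold response normConst
  rw [Real.sinh_eq, Real.cosh_eq, Real.exp_add, Real.exp_add, neg_mul]
  congr 1 <;> ring

lemma abs_h_le (h𝔎 : IsKacProfile m.𝔎) (h : m.mass ≠ 0) (η : m.Config) (k : m.Site) :
    |m.h η k| ≤ 1 := by
  unfold Model.h
  have hs : ∀ b : SignType, |(b : ℝ)| ≤ 1 := by
    intro b
    cases b <;> simp
  calc |∑ j, m.κ (k - j) * (η j : ℝ)| ≤ ∑ j, m.κ (k - j) := by
        refine (Finset.abs_sum_le_sum_abs _ _).trans (Finset.sum_le_sum fun j _ => ?_)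
        rw [abs_mul, abs_of_nonneg (κ_nonneg h𝔎 _)]
        exact mul_le_of_le_one_right (κ_nonneg h𝔎 _) (hs _)
    _ = 1 := by
        rw [← sum_κ h]
        exact Fintype.sum_equiv (Equiv.subLeft k) _ _ fun j => rfl

variable {σ : ℝ → m.Config}

lemma h_eq_mul_X (hγ : m.γ ≠ 0) (s : ℝ) (k : m.Site) : m.h (σ (s / m.α)) k = m.γ * m.X σ s k := by
  unfold X δ
  field_simp

/-- The cubic expansion of the drift. -/
lemma exists_abs_drift_sub_le_five (A V : ℝ) : ∃ C, 0 ≤ C ∧ ∀ m : Model, 0 < m.γ →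
    Real.exp m.θ ≤ A → |m.β| ≤ V → m.mass ≠ 0 → IsKacProfile m.𝔎 → ∀ (σ : ℝ → m.Config) s k,
      |m.drift (σ (s / m.α)) k - (m.α⁻¹ * (coeffOne (Real.exp m.θ) * m.β - 1) * m.X σ s k
        + m.α⁻¹ * m.γ ^ 2 * (coeffThree (Real.exp m.θ) * m.β ^ 3) * m.X σ s k ^ 3)|
        ≤ C * (m.α⁻¹ * m.γ ^ 4) * |m.X σ s k| ^ 5 := by
  obtain ⟨C, hC, h⟩ := exists_abs_response_sub_le_five A V
  refine ⟨C * |V| ^ 5, by positivity, fun m hγ hA hV hm hK σ s k => ?_⟩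
  have hα := m.α_pos hγ
  have hh := m.abs_h_le hK hm (σ (s / m.α)) k
  have hβh : |m.β * m.h (σ (s / m.α)) k| ≤ V := by
    rw [abs_mul]
    exact (mul_le_of_le_one_right (abs_nonneg _) hh).trans hV
  have h1 := h (Real.exp m.θ) _ (Real.exp_pos _) hA hβh
  rw [← m.response_eq, h_eq_mul_X hγ.ne'] at h1
  unfold drift
  rw [h_eq_mul_X hγ.ne']
  generalize m.X σ s k = X at h1 ⊢
  have h2 : (m.δ * m.α)⁻¹ * (m.response (m.γ * X) - m.γ * X)
      - (m.α⁻¹ * (coeffOne (Real.exp m.θ) * m.β - 1) * X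
        + m.α⁻¹ * m.γ ^ 2 * (coeffThree (Real.exp m.θ) * m.β ^ 3) * X ^ 3)
      = (m.γ * m.α)⁻¹ * (m.response (m.γ * X) - (coeffOne (Real.exp m.θ) * (m.β * (m.γ * X))
        + coeffThree (Real.exp m.θ) * (m.β * (m.γ * X)) ^ 3)) := by
    unfold δ
    field_simp
    ring
  rw [h2, abs_mul, abs_of_pos (by positivity : 0 < (m.γ * m.α)⁻¹)]
  have h3 : |m.β * (m.γ * X)| ^ 5 ≤ |V| ^ 5 * (m.γ ^ 5 * |X| ^ 5) := by
    rw [abs_mul, abs_mul, abs_of_pos hγ, mul_pow, mul_pow]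
    exact mul_le_mul_of_nonneg_right
      (pow_le_pow_left₀ (abs_nonneg _) (hV.trans (le_abs_self V)) _) (by positivity)
  calc _ ≤ (m.γ * m.α)⁻¹ * (C * (|V| ^ 5 * (m.γ ^ 5 * |X| ^ 5))) := by
        gcongr
        exact h1.trans (by gcongr)
    _ = _ := by
        field_simp

/-- The quintic expansion of the drift. -/
lemma exists_abs_drift_sub_le_seven (A V : ℝ) : ∃ C, 0 ≤ C ∧ ∀ m : Model, 0 < m.γ →
    Real.exp m.θ ≤ A → |m.β| ≤ V → m.mass ≠ 0 → IsKacProfile m.𝔎 → ∀ (σ : ℝ → m.Config) s k,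
      |m.drift (σ (s / m.α)) k - (m.α⁻¹ * (coeffOne (Real.exp m.θ) * m.β - 1) * m.X σ s k
        + m.α⁻¹ * m.γ ^ 2 * (coeffThree (Real.exp m.θ) * m.β ^ 3) * m.X σ s k ^ 3
        + m.α⁻¹ * m.γ ^ 4 * (coeffFive (Real.exp m.θ) * m.β ^ 5) * m.X σ s k ^ 5)|
        ≤ C * (m.α⁻¹ * m.γ ^ 6) * |m.X σ s k| ^ 7 := by
  obtain ⟨C, hC, h⟩ := exists_abs_response_sub_le_seven A V
  refine ⟨C * |V| ^ 7, by positivity, fun m hγ hA hV hm hK σ s k => ?_⟩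
  have hα := m.α_pos hγ
  have hh := m.abs_h_le hK hm (σ (s / m.α)) k
  have hβh : |m.β * m.h (σ (s / m.α)) k| ≤ V := by
    rw [abs_mul]
    exact (mul_le_of_le_one_right (abs_nonneg _) hh).trans hV
  have h1 := h (Real.exp m.θ) _ (Real.exp_pos _) hA hβh
  rw [← m.response_eq, h_eq_mul_X hγ.ne'] at h1
  unfold drift
  rw [h_eq_mul_X hγ.ne']
  generalize m.X σ s k = X at h1 ⊢
  have h2 : (m.δ * m.α)⁻¹ * (m.response (m.γ * X) - m.γ * X)
      - (m.α⁻¹ * (coeffOne (Real.exp m.θ) * m.β - 1) * X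
        + m.α⁻¹ * m.γ ^ 2 * (coeffThree (Real.exp m.θ) * m.β ^ 3) * X ^ 3
        + m.α⁻¹ * m.γ ^ 4 * (coeffFive (Real.exp m.θ) * m.β ^ 5) * X ^ 5)
      = (m.γ * m.α)⁻¹ * (m.response (m.γ * X) - (coeffOne (Real.exp m.θ) * (m.β * (m.γ * X))
        + coeffThree (Real.exp m.θ) * (m.β * (m.γ * X)) ^ 3
        + coeffFive (Real.exp m.θ) * (m.β * (m.γ * X)) ^ 5)) := by
    unfold δ
    field_simp
    ring
  rw [h2, abs_mul, abs_of_pos (by positivity : 0 < (m.γ * m.α)⁻¹)]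
  have h3 : |m.β * (m.γ * X)| ^ 7 ≤ |V| ^ 7 * (m.γ ^ 7 * |X| ^ 7) := by
    rw [abs_mul, abs_mul, abs_of_pos hγ, mul_pow, mul_pow]
    exact mul_le_mul_of_nonneg_right
      (pow_le_pow_left₀ (abs_nonneg _) (hV.trans (le_abs_self V)) _) (by positivity)
  calc _ ≤ (m.γ * m.α)⁻¹ * (C * (|V| ^ 7 * (m.γ ^ 7 * |X| ^ 7))) := by
        gcongr
        exact h1.trans (by gcongr)
    _ = _ := by
        field_simp

end Model

/-! ### The coefficients near criticality -/

lemma isBigO_comp_sub {Φ : ℝ × ℝ → ℝ} {x₀ y₀ : ℝ} (hΦ : DifferentiableAt ℝ Φ (x₀, y₀))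
    {x y : ℝ → ℝ} (hx : (fun γ => x γ - x₀) =O[𝓝[>] 0] fun γ => γ)
    (hy : (fun γ => y γ - y₀) =O[𝓝[>] 0] fun γ => γ) :
    (fun γ => Φ (x γ, y γ) - Φ (x₀, y₀)) =O[𝓝[>] 0] fun γ => γ := by
  have hid : Tendsto (fun γ : ℝ => γ) (𝓝[>] 0) (𝓝 0) := tendsto_nhdsWithin_of_tendsto_nhds tendsto_id
  have hx' : Tendsto x (𝓝[>] 0) (𝓝 x₀) := by
    have := (hx.trans_tendsto hid).add_const x₀
    simpa using this
  have hy' : Tendsto y (𝓝[>] 0) (𝓝 y₀) := by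
    have := (hy.trans_tendsto hid).add_const y₀
    simpa using this
  have hxy : Tendsto (fun γ => (x γ, y γ)) (𝓝[>] 0) (𝓝 (x₀, y₀)) := hx'.prodMk_nhds hy'
  refine (hΦ.isBigO_sub.comp_tendsto hxy).trans ?_
  exact hx.prod_left hy

lemma IsBigO.exists_eventually_le {f : ℝ → ℝ} {e : ℝ → ℝ} (h : f =O[𝓝[>] 0] e)
    (he : ∀ γ, 0 < γ → 0 ≤ e γ) : ∃ K, 0 ≤ K ∧ ∀ᶠ γ in 𝓝[>] 0, |f γ| ≤ K * e γ := by
  obtain ⟨K, hK, h⟩ := h.exists_nonneg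
  refine ⟨K, hK, ?_⟩
  filter_upwards [h.bound, self_mem_nhdsWithin] with γ hγ hγ0
  rwa [Real.norm_eq_abs, Real.norm_of_nonneg (he γ hγ0)] at hγ

lemma differentiableAt_coeffOne {a : ℝ} (ha : 0 < a) : DifferentiableAt ℝ coeffOne a := by
  unfold coeffOne
  have : 1 + 2 * a ≠ 0 := by positivity
  fun_prop (disch := assumption)

lemma differentiableAt_coeffThree {a : ℝ} (ha : 0 < a) : DifferentiableAt ℝ coeffThree a := by
  have h1 := differentiableAt_coeffOne ha
  unfold coeffThree
  have : 1 + 2 * a ≠ 0 := by positivity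
  fun_prop (disch := assumption)

lemma differentiableAt_coeffFive {a : ℝ} (ha : 0 < a) : DifferentiableAt ℝ coeffFive a := by
  have h1 := differentiableAt_coeffOne ha
  have h3 := differentiableAt_coeffThree ha
  unfold coeffFive
  have : 1 + 2 * a ≠ 0 := by positivity
  fun_prop (disch := assumption)

lemma isBigO_sq_id : (fun γ : ℝ => γ ^ 2) =O[𝓝[>] 0] fun γ => γ := by
  refine IsBigO.of_bound 1 ?_
  filter_upwards [Ioo_mem_nhdsGT zero_lt_one] with γ hγ
  rw [norm_pow, one_mul, Real.norm_of_nonneg hγ.1.le]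
  nlinarith [hγ.1, hγ.2]

/-- Near the critical line the cubic coefficient converges. -/
lemma exists_cubic_coeff_le {ac βc 𝔞 : ℝ} {a β c : ℝ → ℝ} (hac : 0 < ac)
    (hcrit : 2 * ac / (2 * ac + 1) * βc - 1 = 0) (ha : ∀ γ, 0 < a γ)
    (ha' : (fun γ => a γ - ac) =O[𝓝[>] 0] fun γ => γ ^ 2)
    (hβ : ∀ᶠ γ in 𝓝[>] 0, 2 * a γ / (2 * a γ + 1) * β γ - 1
      = γ ^ 2 * (ac * (4 * ac - 1) / (2 * ac + 1) ^ 2 * βc ^ 3 * c γ + 𝔞))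
    (hc : (fun γ => γ * c γ) =O[𝓝[>] 0] fun _ => (1 : ℝ)) :
    ∃ K, 0 ≤ K ∧ ∀ᶠ γ in 𝓝[>] 0, a γ ≤ K ∧ |β γ| ≤ K ∧
      |coeffThree (a γ) * β γ ^ 3 - -(ac * (4 * ac - 1) * βc ^ 3) / (3 * (2 * ac + 1) ^ 2)|
        ≤ K * γ := by
  set b := ac * (4 * ac - 1) / (2 * ac + 1) ^ 2 * βc ^ 3
  set x : ℝ → ℝ := fun γ => γ ^ 2 * (b * c γ + 𝔞) with hx
  have hid : Tendsto (fun γ : ℝ => γ) (𝓝[>] 0) (𝓝 0) := tendsto_nhdsWithin_of_tendsto_nhds tendsto_id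
  have hx1 : (fun γ => x γ - 0) =O[𝓝[>] 0] fun γ => γ := by
    have h1 : (fun γ : ℝ => γ * (b * (γ * c γ))) =O[𝓝[>] 0] fun γ => γ * 1 :=
      (isBigO_refl _ _).mul (hc.const_mul_left b)
    have h2 := isBigO_sq_id.const_mul_left 𝔞
    have h3 : (fun γ => x γ - 0) = fun γ => γ * (b * (γ * c γ)) + 𝔞 * γ ^ 2 := by
      ext γ
      simp only [hx]
      ring
    rw [h3]
    simp only [mul_one] at h1
    exact h1.add h2
  have ha1 := ha'.trans isBigO_sq_id
  have hβc : βc = (2 * ac + 1) / (2 * ac) := by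
    field_simp at hcrit ⊢
    linarith
  have hβ' : ∀ᶠ γ in 𝓝[>] 0, β γ = (1 + x γ) * (2 * a γ + 1) / (2 * a γ) := by
    filter_upwards [hβ] with γ hγ
    have h1 := ha γ
    have h2 : 1 + x γ = 2 * a γ / (2 * a γ + 1) * β γ := by
      simp only [hx]
      linarith
    rw [h2]
    field_simp
  have hac' : 2 * ac ≠ 0 := by positivity
  have hd3 := differentiableAt_coeffThree hac
  have hΨ : DifferentiableAt ℝ (fun p : ℝ × ℝ => (1 + p.1) * (2 * p.2 + 1) / (2 * p.2)) (0, ac) := by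
    fun_prop (disch := assumption)
  have hΦ : DifferentiableAt ℝ (fun p : ℝ × ℝ => coeffThree p.2 *
      ((1 + p.1) * (2 * p.2 + 1) / (2 * p.2)) ^ 3) (0, ac) := by
    have : DifferentiableAt ℝ (fun p : ℝ × ℝ => coeffThree p.2) (0, ac) :=
      DifferentiableAt.comp (𝕜 := ℝ) (f := fun p : ℝ × ℝ => p.2) (g := coeffThree) (0, ac) hd3
        differentiableAt_snd
    fun_prop (disch := assumption)
  obtain ⟨K₁, hK₁, h1⟩ := IsBigO.exists_eventually_le (isBigO_comp_sub hΦ hx1 ha1) fun γ h => h.le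
  obtain ⟨K₂, hK₂, h2⟩ := IsBigO.exists_eventually_le (isBigO_comp_sub hΨ hx1 ha1) fun γ h => h.le
  obtain ⟨K₃, hK₃, h3⟩ := IsBigO.exists_eventually_le ha1 fun γ h => h.le
  refine ⟨K₁ + (K₂ + |βc|) + (K₃ + |ac|), by positivity, ?_⟩
  filter_upwards [h1, h2, h3, hβ', Ioo_mem_nhdsGT zero_lt_one] with γ h1 h2 h3 h4 h5
  have e0 : (1 + 0) * (2 * ac + 1) / (2 * ac) = βc := by rw [hβc, add_zero, one_mul]
  have e1 : coeffThree ac * βc ^ 3 = -(ac * (4 * ac - 1) * βc ^ 3) / (3 * (2 * ac + 1) ^ 2) := by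
    unfold coeffThree coeffOne
    field_simp
    ring
  have h6 := h5.1
  have h7 := h5.2
  simp only [e0, ← h4, e1] at h1 h2
  have k1 : K₂ * γ ≤ K₂ * 1 := by gcongr
  have k2 : K₃ * γ ≤ K₃ * 1 := by gcongr
  refine ⟨?_, ?_, ?_⟩
  · have := (abs_le.1 h3).2
    linarith [le_abs_self ac, abs_nonneg βc]
  · have := abs_sub_abs_le_abs_sub (β γ) βc
    linarith [abs_nonneg ac]
  · refine h1.trans ?_
    gcongr
    linarith [abs_nonneg ac, abs_nonneg βc]

lemma exists_bound_of_continuous {n : ℕ} {F : (Fin n → ℝ) → ℝ} (hF : Continuous F) (K : ℝ) :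
    ∃ C, 0 ≤ C ∧ ∀ x, (∀ i, |x i| ≤ K) → |F x| ≤ C := by
  obtain ⟨C, hC⟩ := (isCompact_univ_pi fun _ : Fin n => isCompact_Icc (a := -K) (b := K))
    |>.exists_bound_of_continuousOn hF.continuousOn
  refine ⟨|C|, abs_nonneg _, fun x hx => ?_⟩
  exact (hC x fun i _ => abs_le.1 (hx i)).trans (le_abs_self C)

/-- The expansion of the linear and of the cubic coefficient at the tricritical point. The
variables `t`, `g` of order `η` stand for `γ² 𝔠` and `γ²`. After division of `t`, `g` by `η` and of
the remainders by `η³`, and with `(1 + 2a)⁻¹` as a further variable, each difference is a power of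
`η` times a polynomial in bounded variables: the expansions of `a` and `β` are such that all lower
orders cancel. -/
lemma exists_tricritical_expansion (𝔞₁ 𝔞₃ K : ℝ) (hK : 1 ≤ K) : ∃ C, 0 ≤ C ∧
    ∀ η t g ra rb a β : ℝ, 0 < η → η ≤ 1 → |t| ≤ K * η → |g| ≤ K * η → |ra| ≤ K * η ^ 3 →
      |rb| ≤ K * η ^ 3 → 0 < a →
      a = 1 / 4 - (9 / 8 * t + 𝔞₃ / 4 * g)
        + 5 / 48 * (81 * t ^ 2 + 36 * t * g * 𝔞₃ + 4 * g ^ 2 * 𝔞₃ ^ 2) + ra →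
      β = 3 + (9 * t + 2 * 𝔞₃ * g) + (-(189 / 4) * t ^ 2 + 3 * 𝔞₁ * g ^ 2 - 21 * t * g * 𝔞₃
        - 4 / 3 * 𝔞₃ ^ 2 * g ^ 2) + rb →
      |coeffOne a * β - 1 - (-27 / 4 * t ^ 2 - 3 * 𝔞₃ * t * g + 𝔞₁ * g ^ 2)| ≤ C * η ^ 3 ∧
      |coeffThree a * β ^ 3 - (9 / 2 * t + 𝔞₃ * g)| ≤ C * η ^ 2 ∧
      |a - 1 / 4| ≤ C * η ∧ |β - 3| ≤ C * η := by
  set a₁ : (Fin 6 → ℝ) → ℝ := fun x => -(9 / 8 * x 1 + 𝔞₃ / 4 * x 2) with ha₁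
  set a₂ : (Fin 6 → ℝ) → ℝ := fun x =>
    5 / 48 * (81 * x 1 ^ 2 + 36 * x 1 * x 2 * 𝔞₃ + 4 * x 2 ^ 2 * 𝔞₃ ^ 2) with ha₂
  set b₁ : (Fin 6 → ℝ) → ℝ := fun x => 9 * x 1 + 2 * 𝔞₃ * x 2 with hb₁
  set b₂ : (Fin 6 → ℝ) → ℝ := fun x => -(189 / 4) * x 1 ^ 2 + 3 * 𝔞₁ * x 2 ^ 2
    - 21 * x 1 * x 2 * 𝔞₃ - 4 / 3 * 𝔞₃ ^ 2 * x 2 ^ 2 with hb₂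
  set c₂ : (Fin 6 → ℝ) → ℝ := fun x =>
    -27 / 4 * x 1 ^ 2 - 3 * 𝔞₃ * x 1 * x 2 + 𝔞₁ * x 2 ^ 2 with hc₂
  set c₁ : (Fin 6 → ℝ) → ℝ := fun x => 9 / 2 * x 1 + 𝔞₃ * x 2 with hc₁
  set u : (Fin 6 → ℝ) → ℝ := fun x => a₁ x + x 0 * a₂ x + x 0 ^ 2 * x 3 with hu
  set v : (Fin 6 → ℝ) → ℝ := fun x => b₁ x + x 0 * b₂ x + x 0 ^ 2 * x 4 with hv
  -- the quotients of the first two differences by `η ^ 3` and by `η ^ 2`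
  have hF : Continuous fun x : Fin 6 → ℝ => x 5 * (2 * (1 / 4 * x 4 + a₁ x * (b₂ x + x 0 * x 4)
      + a₂ x * v x + x 3 * (2 + x 0 * v x)) - c₂ x * (2 * u x)) := by fun_prop
  have hG : Continuous fun x : Fin 6 → ℝ => x 5 ^ 2 * (c₁ x * (1 / 4 * (27 * v x
      + 9 * x 0 * v x ^ 2 + x 0 ^ 2 * v x ^ 3) / 3 + u x * (3 + x 0 * v x) ^ 3 / 3 - 6 * u x
      - 4 * x 0 * u x ^ 2) - 4 * (a₂ x + x 0 * x 3) * (1 / 4 + x 0 * u x)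
        * (3 + x 0 * v x) ^ 3 / 3) := by fun_prop
  obtain ⟨C₁, hC₁, h1⟩ := exists_bound_of_continuous hF K
  obtain ⟨C₂, hC₂, h2⟩ := exists_bound_of_continuous hG K
  have hu' : Continuous u := by fun_prop
  have hv' : Continuous v := by fun_prop
  obtain ⟨C₃, hC₃, h3⟩ := exists_bound_of_continuous hu' K
  obtain ⟨C₄, hC₄, h4⟩ := exists_bound_of_continuous hv' K
  refine ⟨C₁ + C₂ + C₃ + C₄, by positivity, ?_⟩
  intro η t g ra rb a β hη hη1 ht hg hra hrb ha hae hβe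
  set d := (1 + 2 * a)⁻¹ with hd
  have hd0 : d * (1 + 2 * a) = 1 := by
    rw [hd]
    field_simp
  have hd1 : |d| ≤ 1 := by
    rw [hd, abs_of_pos (by positivity)]
    exact inv_le_one_of_one_le₀ (by linarith)
  obtain ⟨T, hT⟩ : ∃ T, t = η * T := ⟨t / η, by field_simp⟩
  obtain ⟨G, hG'⟩ : ∃ G, g = η * G := ⟨g / η, by field_simp⟩
  obtain ⟨A, hA⟩ : ∃ A, ra = η ^ 3 * A := ⟨ra / η ^ 3, by field_simp⟩
  obtain ⟨B, hB⟩ : ∃ B, rb = η ^ 3 * B := ⟨rb / η ^ 3, by field_simp⟩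
  have hcancel : ∀ {n : ℕ} {y : ℝ}, |η ^ n * y| ≤ K * η ^ n → |y| ≤ K := by
    intro n y h
    rw [abs_mul, abs_of_pos (by positivity : 0 < η ^ n), mul_comm] at h
    exact le_of_mul_le_mul_right h (by positivity)
  have hx : ∀ i, |(![η, T, G, A, B, d] : Fin 6 → ℝ) i| ≤ K := by
    intro i
    fin_cases i
    · change |η| ≤ K
      rw [abs_of_pos hη]
      linarith
    · exact hcancel (n := 1) (y := T) (by rwa [pow_one, ← hT])
    · exact hcancel (n := 1) (y := G) (by rwa [pow_one, ← hG'])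
    · exact hcancel (y := A) (by rwa [← hA])
    · exact hcancel (y := B) (by rwa [← hB])
    · exact hd1.trans hK
  have h1' := h1 _ hx
  have h2' := h2 _ hx
  have h3' := h3 _ hx
  have h4' := h4 _ hx
  have i0 : (![η, T, G, A, B, d] : Fin 6 → ℝ) 0 = η := rfl
  have i1 : (![η, T, G, A, B, d] : Fin 6 → ℝ) 1 = T := rfl
  have i2 : (![η, T, G, A, B, d] : Fin 6 → ℝ) 2 = G := rfl
  have i3 : (![η, T, G, A, B, d] : Fin 6 → ℝ) 3 = A := rfl
  have i4 : (![η, T, G, A, B, d] : Fin 6 → ℝ) 4 = B := rfl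
  have i5 : (![η, T, G, A, B, d] : Fin 6 → ℝ) 5 = d := rfl
  simp only [i0, i1, i2, i3, i4, i5, ha₁, ha₂, hb₁, hb₂, hc₁, hc₂, hu, hv] at h1' h2' h3' h4'
  obtain ⟨U, hU⟩ : ∃ U, U = -(9 / 8 * T + 𝔞₃ / 4 * G) + η * (5 / 48 * (81 * T ^ 2
    + 36 * T * G * 𝔞₃ + 4 * G ^ 2 * 𝔞₃ ^ 2)) + η ^ 2 * A := ⟨_, rfl⟩
  obtain ⟨V, hV⟩ : ∃ V, V = 9 * T + 2 * 𝔞₃ * G + η * (-(189 / 4) * T ^ 2 + 3 * 𝔞₁ * G ^ 2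
    - 21 * T * G * 𝔞₃ - 4 / 3 * 𝔞₃ ^ 2 * G ^ 2) + η ^ 2 * B := ⟨_, rfl⟩
  rw [← hU, ← hV] at h1' h2'
  rw [← hU] at h3'
  rw [← hV] at h4'
  have hae' : a = 1 / 4 + η * U := by
    rw [hae, hU, hT, hG', hA]
    ring
  have hβe' : β = 3 + η * V := by
    rw [hβe, hV, hT, hG', hB]
    ring
  have hp1 : coeffOne a = 2 * a * d := by rw [coeffOne, div_eq_mul_inv]
  have hp3 : coeffThree a = a * (1 - 4 * a) / 3 * d ^ 2 := by
    rw [coeffThree, hp1, div_eq_mul_inv, ← hd]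
    linear_combination (-(a / 3) * d) * hd0
  refine ⟨?_, ?_, ?_, ?_⟩
  · have e : coeffOne a * β - 1 - (-27 / 4 * t ^ 2 - 3 * 𝔞₃ * t * g + 𝔞₁ * g ^ 2)
        = η ^ 3 * (d * (2 * (1 / 4 * B + -(9 / 8 * T + 𝔞₃ / 4 * G) * (-(189 / 4) * T ^ 2
          + 3 * 𝔞₁ * G ^ 2 - 21 * T * G * 𝔞₃ - 4 / 3 * 𝔞₃ ^ 2 * G ^ 2 + η * B)
          + 5 / 48 * (81 * T ^ 2 + 36 * T * G * 𝔞₃ + 4 * G ^ 2 * 𝔞₃ ^ 2) * V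
          + A * (2 + η * V)) - (-27 / 4 * T ^ 2 - 3 * 𝔞₃ * T * G + 𝔞₁ * G ^ 2) * (2 * U))) := by
      have e1 : coeffOne a * β - 1 - (-27 / 4 * t ^ 2 - 3 * 𝔞₃ * t * g + 𝔞₁ * g ^ 2)
          = d * (2 * a * (β - 1) - 1
            - (-27 / 4 * t ^ 2 - 3 * 𝔞₃ * t * g + 𝔞₁ * g ^ 2) * (1 + 2 * a)) := by
        rw [hp1]
        linear_combination
          (1 + (-27 / 4 * t ^ 2 - 3 * 𝔞₃ * t * g + 𝔞₁ * g ^ 2)) * hd0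
      rw [e1, hae', hβe', hT, hG', hU, hV]
      ring
    rw [e, abs_mul, abs_of_pos (by positivity : 0 < η ^ 3), mul_comm]
    gcongr
    linarith
  · have e1 : coeffThree a * β ^ 3 - (9 / 2 * t + 𝔞₃ * g)
        = d ^ 2 * (a * (1 - 4 * a) * β ^ 3 / 3 - (9 / 2 * t + 𝔞₃ * g) * (1 + 2 * a) ^ 2) := by
      rw [hp3]
      linear_combination ((9 / 2 * t + 𝔞₃ * g) * (1 + d * (1 + 2 * a))) * hd0
    have e2 : 1 - 4 * a = η * (9 / 2 * T + 𝔞₃ * G) - 4 * η ^ 2 * (5 / 48 * (81 * T ^ 2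
        + 36 * T * G * 𝔞₃ + 4 * G ^ 2 * 𝔞₃ ^ 2) + η * A) := by
      rw [hae', hU]
      ring
    have e3 : coeffThree a * β ^ 3 - (9 / 2 * t + 𝔞₃ * g)
        = η ^ 2 * (d ^ 2 * ((9 / 2 * T + 𝔞₃ * G) * (1 / 4 * (27 * V + 9 * η * V ^ 2
          + η ^ 2 * V ^ 3) / 3 + U * (3 + η * V) ^ 3 / 3 - 6 * U - 4 * η * U ^ 2)
          - 4 * (5 / 48 * (81 * T ^ 2 + 36 * T * G * 𝔞₃ + 4 * G ^ 2 * 𝔞₃ ^ 2) + η * A)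
            * (1 / 4 + η * U) * (3 + η * V) ^ 3 / 3)) := by
      rw [e1, e2, hae', hβe', hT, hG']
      ring
    rw [e3, abs_mul, abs_of_pos (by positivity : 0 < η ^ 2), mul_comm]
    gcongr
    linarith
  · rw [hae', add_sub_cancel_left, abs_mul, abs_of_pos hη, mul_comm]
    gcongr
    linarith
  · rw [hβe', add_sub_cancel_left, abs_mul, abs_of_pos hη, mul_comm]
    gcongr
    linarith

/-- Near the tricritical point the three coefficients converge after renormalisation. -/
lemma exists_quintic_coeff_le {𝔞₁ 𝔞₃ : ℝ} {a β c : ℝ → ℝ} (ha : ∀ γ, 0 < a γ)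
    (ha' : (fun γ => a γ - (1 / 4 - γ ^ 2 * (9 / 8 * c γ + 𝔞₃ / 4)
      + 5 / 48 * γ ^ 4 * (81 * c γ ^ 2 + 36 * c γ * 𝔞₃ + 4 * 𝔞₃ ^ 2)))
        =O[𝓝[>] 0] fun γ => γ ^ 5)
    (hβ : (fun γ => β γ - (3 + γ ^ 2 * (9 * c γ + 2 * 𝔞₃) + γ ^ 4 * (-(189 / 4) * c γ ^ 2 + 3 * 𝔞₁
      - 21 * c γ * 𝔞₃ - 4 / 3 * 𝔞₃ ^ 2))) =O[𝓝[>] 0] fun γ => γ ^ 5)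
    (hc : ∃ K, 0 ≤ K ∧ ∀ᶠ γ in 𝓝[>] 0, |c γ| ≤ K * γ ^ (-(1 / 3) : ℝ)) :
    ∃ K, 0 ≤ K ∧ ∀ᶠ γ in 𝓝[>] 0, a γ ≤ K ∧ |β γ| ≤ K ∧
      |(γ ^ 4)⁻¹ * (coeffOne (a γ) * β γ - 1) - (-27 / 4 * c γ ^ 2 - 3 * 𝔞₃ * c γ + 𝔞₁)|
        ≤ K * γ ∧
      |(γ ^ 4)⁻¹ * γ ^ 2 * (coeffThree (a γ) * β γ ^ 3) - (9 / 2 * c γ + 𝔞₃)| ≤ K * γ ∧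
      |coeffFive (a γ) * β γ ^ 5 - -9 / 20| ≤ K * γ := by
  obtain ⟨Kc, hKc, hc⟩ := hc
  obtain ⟨Ka, hKa, ha'⟩ := IsBigO.exists_eventually_le ha' fun γ h => by positivity
  obtain ⟨Kb, hKb, hβ⟩ := IsBigO.exists_eventually_le hβ fun γ h => by positivity
  set K := 1 + Ka + Kb + Kc with hK
  obtain ⟨C, hC, hexp⟩ := exists_tricritical_expansion 𝔞₁ 𝔞₃ K (by linarith)
  -- the small parameter `γ ^ (5 / 3)` leaves room for the divergence of `c`
  have hmain : ∀ᶠ γ in 𝓝[>] 0, 0 < γ ∧ γ < 1 ∧ |γ ^ 2 * c γ| ≤ K * γ ^ (5 / 3 : ℝ) ∧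
      |γ ^ 2| ≤ K * γ ^ (5 / 3 : ℝ) ∧ γ ^ (5 / 3 : ℝ) ≤ γ ∧ γ ^ 5 = (γ ^ (5 / 3 : ℝ)) ^ 3 ∧
      (γ ^ (5 / 3 : ℝ)) ^ 2 ≤ γ ^ 3 := by
    filter_upwards [hc, Ioo_mem_nhdsGT zero_lt_one] with γ h1 h2
    have h0 := h2.1
    have hpow : γ ^ 2 * γ ^ (-(1 / 3) : ℝ) = γ ^ (5 / 3 : ℝ) := by
      rw [← Real.rpow_natCast, ← Real.rpow_add h0]
      norm_num
    have hge : γ ^ 2 ≤ γ ^ (5 / 3 : ℝ) := by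
      rw [← Real.rpow_natCast]
      exact Real.rpow_le_rpow_of_exponent_ge h0 h2.2.le (by norm_num)
    refine ⟨h0, h2.2, ?_, ?_, ?_, ?_, ?_⟩
    · rw [abs_mul, abs_of_pos (by positivity : 0 < γ ^ 2), ← hpow]
      calc γ ^ 2 * |c γ| ≤ γ ^ 2 * (Kc * γ ^ (-(1 / 3) : ℝ)) := by gcongr
        _ = Kc * (γ ^ 2 * γ ^ (-(1 / 3) : ℝ)) := by ring
        _ ≤ K * (γ ^ 2 * γ ^ (-(1 / 3) : ℝ)) := by
            gcongr
            linarith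
    · rw [abs_of_pos (by positivity : 0 < γ ^ 2)]
      have : 0 ≤ γ ^ (5 / 3 : ℝ) := by positivity
      nlinarith
    · calc γ ^ (5 / 3 : ℝ) ≤ γ ^ (1 : ℝ) :=
            Real.rpow_le_rpow_of_exponent_ge h0 h2.2.le (by norm_num)
        _ = γ := Real.rpow_one γ
    · rw [← Real.rpow_natCast, ← Real.rpow_natCast, ← Real.rpow_mul h0.le]
      norm_num
    · rw [← Real.rpow_natCast, ← Real.rpow_natCast, ← Real.rpow_mul h0.le]
      exact Real.rpow_le_rpow_of_exponent_ge h0 h2.2.le (by norm_num)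
  have hexp' : ∀ᶠ γ in 𝓝[>] 0,
      |coeffOne (a γ) * β γ - 1 - (-27 / 4 * (γ ^ 2 * c γ) ^ 2 - 3 * 𝔞₃ * (γ ^ 2 * c γ) * γ ^ 2
        + 𝔞₁ * (γ ^ 2) ^ 2)| ≤ C * γ ^ 5 ∧
      |coeffThree (a γ) * β γ ^ 3 - (9 / 2 * (γ ^ 2 * c γ) + 𝔞₃ * γ ^ 2)| ≤ C * γ ^ 3 ∧
      |a γ - 1 / 4| ≤ C * γ ∧ |β γ - 3| ≤ C * γ := by
    filter_upwards [ha', hβ, hmain] with γ h1 h2 ⟨h0, h01, h3, h4, h5, h6, h7⟩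
    have hη : 0 < γ ^ (5 / 3 : ℝ) := by positivity
    rw [h6] at h1 h2
    have h8 := hexp (γ ^ (5 / 3 : ℝ)) (γ ^ 2 * c γ) (γ ^ 2) _ _ (a γ) (β γ) hη (by linarith) h3 h4
      (h1.trans (by gcongr; linarith)) (h2.trans (by gcongr; linarith)) (ha γ) (by ring) (by ring)
    rw [h6]
    exact ⟨h8.1, h8.2.1.trans (by gcongr), h8.2.2.1.trans (by gcongr), h8.2.2.2.trans (by gcongr)⟩
  have hOa : (fun γ => a γ - 1 / 4) =O[𝓝[>] 0] fun γ => γ := by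
    refine IsBigO.of_bound C ?_
    filter_upwards [hexp', self_mem_nhdsWithin] with γ h h0
    rw [Real.norm_eq_abs, Real.norm_of_nonneg (Set.mem_Ioi.1 h0).le]
    exact h.2.2.1
  have hOβ : (fun γ => β γ - 3) =O[𝓝[>] 0] fun γ => γ := by
    refine IsBigO.of_bound C ?_
    filter_upwards [hexp', self_mem_nhdsWithin] with γ h h0
    rw [Real.norm_eq_abs, Real.norm_of_nonneg (Set.mem_Ioi.1 h0).le]
    exact h.2.2.2
  have hΦ : DifferentiableAt ℝ (fun p : ℝ × ℝ => coeffFive p.1 * p.2 ^ 5) (1 / 4, 3) := by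
    have : DifferentiableAt ℝ (fun p : ℝ × ℝ => coeffFive p.1) (1 / 4, 3) :=
      DifferentiableAt.comp (𝕜 := ℝ) (f := fun p : ℝ × ℝ => p.1) (g := coeffFive) (1 / 4, 3)
        (differentiableAt_coeffFive (by norm_num)) differentiableAt_fst
    fun_prop
  obtain ⟨K₅, hK₅, h5⟩ := IsBigO.exists_eventually_le (isBigO_comp_sub hΦ hOa hOβ) fun γ h => h.le
  have hfive : coeffFive (1 / 4) * 3 ^ 5 = -9 / 20 := by
    norm_num [coeffFive, coeffThree, coeffOne]
  refine ⟨C + K₅ + 3, by positivity, ?_⟩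
  filter_upwards [h5, hexp', Ioo_mem_nhdsGT zero_lt_one] with γ h5 ⟨e1, e3, ea, eb⟩ hγ
  have h0 := hγ.1
  have hC1 : C * γ ≤ C * 1 := by
    gcongr
    exact hγ.2.le
  have hCK : C * γ ≤ (C + K₅ + 3) * γ := by
    gcongr
    linarith
  refine ⟨?_, ?_, ?_, ?_, ?_⟩
  · linarith [(abs_le.1 ea).2]
  · have := abs_sub_abs_le_abs_sub (β γ) 3
    rw [abs_of_pos (zero_lt_three' ℝ)] at this
    linarith
  · have e : (γ ^ 4)⁻¹ * (coeffOne (a γ) * β γ - 1) - (-27 / 4 * c γ ^ 2 - 3 * 𝔞₃ * c γ + 𝔞₁)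
        = (γ ^ 4)⁻¹ * (coeffOne (a γ) * β γ - 1 - (-27 / 4 * (γ ^ 2 * c γ) ^ 2
          - 3 * 𝔞₃ * (γ ^ 2 * c γ) * γ ^ 2 + 𝔞₁ * (γ ^ 2) ^ 2)) := by
      field_simp
    rw [e, abs_mul, abs_of_pos (by positivity : 0 < (γ ^ 4)⁻¹)]
    refine le_trans ?_ hCK
    calc (γ ^ 4)⁻¹ * _ ≤ (γ ^ 4)⁻¹ * (C * γ ^ 5) := by gcongr
      _ = C * γ := by field_simp
  · have e : (γ ^ 4)⁻¹ * γ ^ 2 * (coeffThree (a γ) * β γ ^ 3) - (9 / 2 * c γ + 𝔞₃)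
        = (γ ^ 2)⁻¹ * (coeffThree (a γ) * β γ ^ 3 - (9 / 2 * (γ ^ 2 * c γ) + 𝔞₃ * γ ^ 2)) := by
      field_simp
    rw [e, abs_mul, abs_of_pos (by positivity : 0 < (γ ^ 2)⁻¹)]
    refine le_trans ?_ hCK
    calc (γ ^ 2)⁻¹ * _ ≤ (γ ^ 2)⁻¹ * (C * γ ^ 3) := by gcongr
      _ = C * γ := by field_simp
  · rw [hfive] at h5
    refine h5.trans ?_
    gcongr
    linarith

namespace Model

variable {m : Model}

/-! ### The time dependent renormalisation constant -/

lemma Ex_const (r : ℝ) (x : Plane) : m.Ex (fun _ => r) x = r := by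
  have h := m.mult_cos (a := fun _ => 1) (fun _ => rfl) m.zero_mem_box 0 x
  simp only [phase_zero_left, mul_zero, zero_add, Real.cos_zero, mul_one] at h
  have h2 := m.mult_const_mul (fun _ => 1) r (fun _ => 1) x
  rw [h, mul_one] at h2
  rw [Ex_eq_mult]
  exact h2

lemma Ex_add (f g : m.Site → ℝ) (x : Plane) :
    m.Ex (fun k => f k + g k) x = m.Ex f x + m.Ex g x := by
  simp only [Ex_eq_mult, mult_add]

lemma Ex_const_mul (r : ℝ) (f : m.Site → ℝ) (x : Plane) :
    m.Ex (fun k => r * f k) x = r * m.Ex f x := by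
  simp only [Ex_eq_mult, mult_const_mul]

lemma rawTail_nonneg {c C : ℝ} (h : m.SymbolBounds c C) (hc : 0 < c) (s : ℝ) :
    0 ≤ m.rawTail s := by
  refine Finset.sum_nonneg fun w hw => ?_
  rw [Finset.mem_erase] at hw
  have := h.gap_pos hc hw.2 hw.1
  positivity

lemma exists_kernelEnergy_le {c : ℝ} (hc : 0 < c) (C T : ℝ) {κ : ℝ} (hκ : 0 < κ) :
    ∃ A, 0 ≤ A ∧ ∀ m : Model, m.SymbolBounds c C → ∀ s, 0 < s → s ≤ T →
      m.kernelEnergy s ≤ A * m.γ ^ (-κ) := by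
  obtain ⟨A, hA, h⟩ := exists_rawConst_le hc C hκ
  refine ⟨|T| + A, by positivity, fun m hm s hs hsT => ?_⟩
  have h1 : 1 ≤ m.γ ^ (-κ) := Real.one_le_rpow_of_pos_of_le_one_of_nonpos hm.γ_pos
    (by linarith [hm.γ_lt]) (by linarith)
  have h2 : |T| ≤ |T| * m.γ ^ (-κ) := le_mul_of_one_le_right (abs_nonneg T) h1
  rw [hm.kernelEnergy_eq hc, add_mul]
  have h3 := h m hm
  have h4 := rawTail_nonneg hm hc s
  have h5 := hm.rawConst_nonneg hc
  linarith [le_abs_self T]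

lemma abs_Q_le_QNorm (σ : ℝ → m.Config) (s : ℝ) (k : m.Site) : |m.Q σ s s k| ≤ m.QNorm σ s :=
  le_ciSup (f := fun k => |m.Q σ s s k|) (Set.finite_range _).bddAbove k

lemma QNorm_nonneg (σ : ℝ → m.Config) (s : ℝ) : 0 ≤ m.QNorm σ s :=
  Real.iSup_nonneg fun _ => abs_nonneg _

/-- The deviation of the time dependent constant from its limit, in terms of the quadratic
variation, the averaging error and the heat kernel sums. -/
lemma cTime_sub {c C : ℝ} (h : m.SymbolBounds c C) (hc : 0 < c)
    (σ : ℝ → m.Config) {s : ℝ} (hs : 0 < s) (x : Plane) :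
    m.cTime σ s x - m.c - cBar m.βc s = m.Ex (m.Q σ s s) x
      + (m.ε / (m.γ * m.ρ)) ^ 2 * m.EtildeT σ s x
      + ((m.ε / (m.γ * m.ρ)) ^ 2 - 1) * (2 / m.βc * m.kernelEnergy s)
      + (4 * m.βc)⁻¹ * (tailSum s - m.rawTail s) := by
  have hκ := m.κ_neg h.profile.radial
  set r := m.α⁻¹ * m.ε ^ 2 * (m.δ⁻¹) ^ 2 with hr
  -- the prefactor of the jumps, which tends to one
  have hr' : r = (m.ε / (m.γ * m.ρ)) ^ 2 := by
    rw [hr, m.α_eq, δ, div_pow, mul_pow]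
    have := h.ρ_pos
    have := h.γ_pos
    field_simp
  have h1 : (fun k => quadVar (fun r => m.R σ s r k) s) = fun k => m.Q σ s s k
      + (r * m.Etilde σ s s k + r * (2 / m.βc * m.kernelEnergy s)) := by
    ext k
    rw [← mul_add, ← predQuadVar_eq hκ, Q, sub_add_cancel]
  rw [cTime, h1, Ex_add, Ex_add, Ex_const_mul, Ex_const, cBar_eq _ hs, c_eq,
    h.kernelEnergy_eq hc, EtildeT, ← hr']
  ring

/-- The constants may be exchanged. The exponent `p` trades smallness in `γ` against the singularity
of the heat kernel sums as `s → 0`. -/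
lemma exists_abs_cTime_sub_le {c C βc : ℝ} (hc : 0 < c) (hc1 : c ≤ 1) (hC : 0 ≤ C) (hβ : 0 < βc)
    (T : ℝ) {p κ : ℝ} (hp : 0 < p) (hp1 : p ≤ 1 / 2) (hκ : 0 < κ) :
    ∃ A, 0 ≤ A ∧ ∀ m : Model, m.SymbolBounds c C → m.βc = βc → ∀ (σ : ℝ → m.Config) s, 0 < s →
      s ≤ T → ∀ x, |m.cTime σ s x - m.c - cBar m.βc s|
        ≤ A * m.γ ^ (-κ) * (m.QNorm σ s + |m.EtildeT σ s x| + m.γ ^ (2 * p) * s ^ (-p)) := by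
  obtain ⟨A₁, hA₁, h1⟩ := exists_abs_Ex_le hκ
  obtain ⟨A₂, hA₂, h2⟩ := exists_kernelEnergy_le hc C T hκ
  obtain ⟨A₃, hA₃, h3⟩ := exists_abs_rawTail_sub_tailSum_le hc hc1 hC hp hp1 hκ
  refine ⟨A₁ + 4 + 3 * (2 / βc * A₂) * |T| ^ p + (4 * βc)⁻¹ * A₃, by positivity, ?_⟩
  intro m hm hmβ σ s hs hsT x
  have hγ := hm.γ_pos
  have hγ1 := hm.γ_lt
  have hP1 : 1 ≤ m.γ ^ (-κ) := Real.one_le_rpow_of_pos_of_le_one_of_nonpos hγ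
    (by linarith) (by linarith)
  set P := m.γ ^ (-κ) with hP
  rw [cTime_sub hm hc σ hs, hmβ]
  set w := m.ε / (m.γ * m.ρ) with hw
  have hwb : |w - 1| ≤ m.γ := by
    refine (m.abs_eps_div_sub_one_le hγ (by linarith)).trans ?_
    have := hm.ρ_le
    have := hm.ρ_pos
    nlinarith
  have hw0 := abs_le.1 hwb
  have hw2 : w ^ 2 ≤ 4 := by nlinarith
  have hw3 : |w ^ 2 - 1| ≤ 3 * m.γ := by
    rw [show w ^ 2 - 1 = (w + 1) * (w - 1) by ring, abs_mul]
    have : |w + 1| ≤ 3 := by rw [abs_le]; constructor <;> linarith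
    gcongr
  have hT : 0 < T := by linarith
  have hγp : m.γ ≤ |T| ^ p * (m.γ ^ (2 * p) * s ^ (-p)) := by
    have e1 : m.γ ≤ m.γ ^ (2 * p) := by
      calc m.γ = m.γ ^ (1 : ℝ) := (Real.rpow_one _).symm
        _ ≤ _ := Real.rpow_le_rpow_of_exponent_ge hγ (by linarith) (by linarith)
    have e2 : 1 ≤ |T| ^ p * s ^ (-p) := by
      rw [Real.rpow_neg hs.le, ← div_eq_mul_inv, le_div_iff₀ (by positivity), one_mul,
        abs_of_pos hT]
      gcongr
    have e3 : 0 ≤ m.γ ^ (2 * p) := by positivity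
    nlinarith
  have hq := m.QNorm_nonneg σ s
  have hS0 : 0 ≤ m.γ ^ (2 * p) * s ^ (-p) := by positivity
  set S := m.γ ^ (2 * p) * s ^ (-p) with hS
  set q := m.QNorm σ s
  set E := |m.EtildeT σ s x| with hE
  have hE0 : 0 ≤ E := abs_nonneg _
  have t1 : |m.Ex (m.Q σ s s) x| ≤ A₁ * P * q := h1 m hγ hγ1 _ _ (m.abs_Q_le_QNorm σ s) x
  have t2 : |w ^ 2 * m.EtildeT σ s x| ≤ 4 * P * E := by
    rw [abs_mul, abs_of_nonneg (sq_nonneg w)]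
    have : 4 ≤ 4 * P := by linarith
    gcongr
    linarith
  have t3 : |(w ^ 2 - 1) * (2 / βc * m.kernelEnergy s)|
      ≤ 3 * (2 / βc * A₂) * |T| ^ p * P * S := by
    have e0 := kernelEnergy_nonneg (m := m) hs.le
    rw [abs_mul, abs_of_nonneg (by positivity : 0 ≤ 2 / βc * m.kernelEnergy s)]
    have e1 := h2 m hm s hs hsT
    calc |w ^ 2 - 1| * (2 / βc * m.kernelEnergy s)
        ≤ (3 * (|T| ^ p * S)) * (2 / βc * (A₂ * P)) := by
          gcongr
          exact hw3.trans (by gcongr)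
      _ = _ := by ring
  have t4 : |(4 * βc)⁻¹ * (tailSum s - m.rawTail s)| ≤ (4 * βc)⁻¹ * A₃ * P * S := by
    rw [abs_mul, abs_of_pos (by positivity : 0 < (4 * βc)⁻¹), abs_sub_comm]
    have e1 := h3 m hm s hs
    rw [show m.γ ^ (2 * p - κ) = m.γ ^ (2 * p) * P by
      rw [hP, ← Real.rpow_add hγ]
      ring_nf] at e1
    calc (4 * βc)⁻¹ * |m.rawTail s - tailSum s|
        ≤ (4 * βc)⁻¹ * (A₃ * (m.γ ^ (2 * p) * P) * s ^ (-p)) := by gcongr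
      _ = _ := by
        rw [hS]
        ring
  have hsum : |m.Ex (m.Q σ s s) x + w ^ 2 * m.EtildeT σ s x
      + (w ^ 2 - 1) * (2 / βc * m.kernelEnergy s) + (4 * βc)⁻¹ * (tailSum s - m.rawTail s)|
      ≤ A₁ * P * q + 4 * P * E + 3 * (2 / βc * A₂) * |T| ^ p * P * S
        + (4 * βc)⁻¹ * A₃ * P * S :=
    (abs_add_le _ _).trans (add_le_add ((abs_add_le _ _).trans
      (add_le_add ((abs_add_le _ _).trans (add_le_add t1 t2)) t3)) t4)
  refine hsum.trans ?_
  have k1 : 0 ≤ 3 * (2 / βc * A₂) * |T| ^ p := by positivity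
  have k2 : 0 ≤ (4 * βc)⁻¹ * A₃ := by positivity
  generalize 3 * (2 / βc * A₂) * |T| ^ p = a₁ at k1 ⊢
  generalize (4 * βc)⁻¹ * A₃ = a₂ at k2 ⊢
  have hP0 : 0 ≤ P := by linarith
  have j1 : 0 ≤ A₁ * P * (E + S) := by positivity
  have j2 : 0 ≤ P * (q + S) := by positivity
  have j3 : 0 ≤ (a₁ + a₂) * P * (q + E) := by positivity
  linarith

lemma exists_abs_EtildeT_le {c C βc : ℝ} (hc : 0 < c) (hβ : 0 < βc) (T : ℝ) {κ : ℝ}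
    (hκ : 0 < κ) : ∃ A, 0 ≤ A ∧ ∀ m : Model, m.SymbolBounds c C → m.βc = βc →
      ∀ (σ : ℝ → m.Config) s, 0 < s → s ≤ T → ∀ x, |m.EtildeT σ s x| ≤ A * m.γ ^ (-κ) := by
  obtain ⟨A₁, hA₁, h1⟩ := exists_abs_Ex_le (half_pos hκ)
  obtain ⟨A₂, hA₂, h2⟩ := exists_kernelEnergy_le hc C T (half_pos hκ)
  refine ⟨A₁ * ((4 + 2 / βc) * A₂), by positivity, fun m hm hmβ σ s hs hsT x => ?_⟩
  have hγ := hm.γ_pos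
  have h3 := h1 m hγ hm.γ_lt (m.Etilde σ s s) ((4 + 2 / βc) * (A₂ * m.γ ^ (-(κ / 2)))) (fun k => by
    refine (m.abs_Etilde_le (hmβ ▸ hβ) hs.le k).trans ?_
    rw [hmβ]
    have := h2 m hm s hs hsT
    gcongr) x
  refine h3.trans (le_of_eq ?_)
  have h4 : m.γ ^ (-κ) = m.γ ^ (-(κ / 2)) * m.γ ^ (-(κ / 2)) := by
    rw [← Real.rpow_add hγ]
    ring_nf
  rw [h4]
  ring

/-- The square of the difference of the constants enters the quintic drift. It is estimated with the
exponent `p = 1 / 6`, whose square is the exponent `1 / 3` of the linear case; the factor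
`max 1 q` absorbs the square of the quadratic variation. -/
lemma exists_abs_cTime_sub_sq_le {c C βc : ℝ} (hc : 0 < c) (hc1 : c ≤ 1) (hC : 0 ≤ C)
    (hβ : 0 < βc) (T : ℝ) {κ : ℝ} (hκ : 0 < κ) :
    ∃ A, 0 ≤ A ∧ ∀ m : Model, m.SymbolBounds c C → m.βc = βc → ∀ (σ : ℝ → m.Config) s, 0 < s →
      s ≤ T → ∀ x, (m.cTime σ s x - m.c - cBar m.βc s) ^ 2
        ≤ A * m.γ ^ (-κ) * (m.γ ^ (2 / 3 : ℝ) * s ^ (-1 / 3 : ℝ)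
          + m.QNorm σ s * max 1 (m.QNorm σ s) + |m.EtildeT σ s x|) := by
  obtain ⟨A₁, hA₁, h1⟩ := exists_abs_cTime_sub_le hc hc1 hC hβ T (p := 1 / 6) (by norm_num)
    (by norm_num) (show 0 < κ / 3 by linarith)
  obtain ⟨A₂, hA₂, h2⟩ := exists_abs_EtildeT_le (C := C) hc hβ T (show 0 < κ / 3 by linarith)
  refine ⟨3 * A₁ ^ 2 * (1 + A₂), by positivity, fun m hm hmβ σ s hs hsT x => ?_⟩
  have hγ := hm.γ_pos
  have hγ1 := hm.γ_lt
  have e1 := h1 m hm hmβ σ s hs hsT x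
  have e2 := h2 m hm hmβ σ s hs hsT x
  have hP1 : 1 ≤ m.γ ^ (-(κ / 3)) := Real.one_le_rpow_of_pos_of_le_one_of_nonpos hγ
    (by linarith) (by linarith)
  have hP3 : m.γ ^ (-κ) = (m.γ ^ (-(κ / 3))) ^ 3 := by
    rw [← Real.rpow_natCast, ← Real.rpow_mul hγ.le]
    congr 1
    push_cast
    ring
  have hS : m.γ ^ (2 / 3 : ℝ) * s ^ (-1 / 3 : ℝ)
      = (m.γ ^ (2 * (1 / 6) : ℝ) * s ^ (-(1 / 6) : ℝ)) ^ 2 := by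
    rw [mul_pow, ← Real.rpow_natCast, ← Real.rpow_natCast, ← Real.rpow_mul hγ.le,
      ← Real.rpow_mul hs.le]
    norm_num
  rw [hP3, hS]
  have hS0 : 0 ≤ m.γ ^ (2 * (1 / 6) : ℝ) * s ^ (-(1 / 6) : ℝ) := by positivity
  have hq := m.QNorm_nonneg σ s
  have hE := abs_nonneg (m.EtildeT σ s x)
  generalize m.γ ^ (2 * (1 / 6) : ℝ) * s ^ (-(1 / 6) : ℝ) = S at *
  generalize m.γ ^ (-(κ / 3)) = P at *
  generalize m.QNorm σ s = q at *
  generalize |m.EtildeT σ s x| = E at *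
  generalize m.cTime σ s x - m.c - cBar m.βc s = e at *
  have f1 : e ^ 2 ≤ (A₁ * P * (q + E + S)) ^ 2 := by
    rw [← sq_abs e]
    gcongr
  have f2 : (q + E + S) ^ 2 ≤ 3 * (q ^ 2 + E ^ 2 + S ^ 2) := by
    nlinarith [sq_nonneg (q - E), sq_nonneg (E - S), sq_nonneg (q - S)]
  have f3 : q ^ 2 ≤ q * max 1 q := by
    rw [sq]
    exact mul_le_mul_of_nonneg_left (le_max_right _ _) hq
  have f4 : E ^ 2 ≤ A₂ * P * E := by
    rw [sq]
    gcongr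
  have f5 : 0 ≤ q * max 1 q := le_trans (sq_nonneg q) f3
  have hP0 : 0 ≤ P := by linarith
  have f6 : q ^ 2 + E ^ 2 + S ^ 2 ≤ (1 + A₂) * P * (S ^ 2 + q * max 1 q + E) := by
    have g1 : 1 ≤ (1 + A₂) * P := by nlinarith
    have g2 : A₂ * P ≤ (1 + A₂) * P := by linarith
    have g3 : S ^ 2 ≤ (1 + A₂) * P * S ^ 2 := le_mul_of_one_le_left (sq_nonneg S) g1
    have g4 : q * max 1 q ≤ (1 + A₂) * P * (q * max 1 q) := le_mul_of_one_le_left f5 g1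
    have g5 : A₂ * P * E ≤ (1 + A₂) * P * E := by gcongr
    linarith
  calc e ^ 2 ≤ (A₁ * P * (q + E + S)) ^ 2 := f1
    _ = A₁ ^ 2 * P ^ 2 * (q + E + S) ^ 2 := by ring
    _ ≤ A₁ ^ 2 * P ^ 2 * (3 * ((1 + A₂) * P * (S ^ 2 + q * max 1 q + E))) := by
        gcongr
        exact f2.trans (by gcongr)
    _ = _ := by ring

end Model

/-! ### Bounds at a point of space-time -/

/-- The bounds on the field, on its extension and on the renormalisation constant at a point of
space-time from which the error terms are estimated: `P` is a small negative power of `γ`, and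
`U` is the Besov norm times a small negative power of `γ`. -/
structure FieldBounds (D : DyadicPartition) (m : Model) (σ : ℝ → m.Config) (s : ℝ) (x : Plane)
    (A P U : ℝ) : Prop where
  Ex_le : ∀ (g : m.Site → ℝ) (G : ℝ), (∀ k, |g k| ≤ G) → |m.Ex g x| ≤ A * P * G
  X_le : ∀ k, |m.X σ s k| ≤ A * U
  XT_le : |m.XT σ s x| ≤ A * U
  cube : |m.Ex (fun k => m.X σ s k ^ 3) x - m.XT σ s x ^ 3|
    ≤ A * P * ((A * U) ^ 2 * supNorm (D.high m.N (m.XT σ s)))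
  fifth : |m.Ex (fun k => m.X σ s k ^ 5) x - m.XT σ s x ^ 5|
    ≤ A * P * ((A * U) ^ 4 * supNorm (D.high m.N (m.XT σ s)))
  cTime_le : |m.cTime σ s x - m.c - cBar m.βc s|
    ≤ A * P * (m.γ ^ (2 / 3 : ℝ) * s ^ (-1 / 3 : ℝ) + m.QNorm σ s + |m.EtildeT σ s x|)
  cTime_sq_le : (m.cTime σ s x - m.c - cBar m.βc s) ^ 2
    ≤ A * P * (m.γ ^ (2 / 3 : ℝ) * s ^ (-1 / 3 : ℝ)
      + m.QNorm σ s * max 1 (m.QNorm σ s) + |m.EtildeT σ s x|)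
  c_le : |m.c| ≤ A * P
  γ_le : m.γ ≤ A * (m.γ ^ (2 / 3 : ℝ) * s ^ (-1 / 3 : ℝ))

lemma exists_fieldBounds (D : DyadicPartition) {c C βc : ℝ} (hc : 0 < c) (hc1 : c ≤ 1)
    (hC : 0 ≤ C) (hβ : 0 < βc) (T : ℝ) {ν κ : ℝ} (hν : 0 < ν) (hκ : 0 < κ) :
    ∃ A, 1 ≤ A ∧ ∀ m : Model, m.SymbolBounds c C → m.βc = βc → ∀ (σ : ℝ → m.Config) s, 0 < s →
      s ≤ T → ∀ x, FieldBounds D m σ s x A (m.γ ^ (-κ))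
        (m.γ ^ (-(3 * ν)) * D.besovNorm ν (m.XT σ s)) := by
  obtain ⟨A₁, hA₁, h1⟩ := Model.exists_abs_Ex_le hκ
  obtain ⟨A₂, hA₂, h2⟩ := D.exists_abs_sum_block_le hν
  obtain ⟨A₃, hA₃, h3⟩ := Model.exists_abs_cTime_sub_le hc hc1 hC hβ T (p := 1 / 3) (by norm_num)
    (by norm_num) hκ
  obtain ⟨A₄, hA₄, h4⟩ := Model.exists_abs_cTime_sub_sq_le hc hc1 hC hβ T hκ
  obtain ⟨A₅, hA₅, h5⟩ := Model.exists_rawConst_le hc C hκ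
  obtain ⟨A, hA⟩ : ∃ A, A = 1 + 5 * (A₁ + 1) + A₂ + A₃ + A₄ + 1 / (4 * βc) * A₅
    + |T| ^ (1 / 3 : ℝ) := ⟨_, rfl⟩
  have hT0 : 0 ≤ |T| ^ (1 / 3 : ℝ) := by positivity
  have hA₅' : 0 ≤ 1 / (4 * βc) * A₅ := by positivity
  have hA1 : 1 ≤ A := by linarith
  refine ⟨A, hA1, fun m hm hmβ σ s hs hsT x => ?_⟩
  have hγ := hm.γ_pos
  have hγ1 := hm.γ_lt
  have hP1 : 1 ≤ m.γ ^ (-κ) := Real.one_le_rpow_of_pos_of_le_one_of_nonpos hγ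
    (by linarith) (by linarith)
  have hB := D.besovNorm_nonneg ν (m.XT σ s)
  have hS0 : 0 ≤ m.γ ^ (2 / 3 : ℝ) * s ^ (-1 / 3 : ℝ) := by positivity
  have hU0 : 0 ≤ m.γ ^ (-(3 * ν)) * D.besovNorm ν (m.XT σ s) := by positivity
  have hq := m.QNorm_nonneg σ s
  have hq2 : 0 ≤ m.QNorm σ s * max 1 (m.QNorm σ s) := by positivity
  have hblock : ∀ S ⊆ Finset.range (DyadicPartition.lastBlock m + 1), ∀ y,
      |∑ j ∈ S, D.block j (m.XT σ s) y| ≤ A * (m.γ ^ (-(3 * ν)) * D.besovNorm ν (m.XT σ s)) := by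
    intro S hS y
    refine (h2 m hγ hγ1 (m.X σ s) S hS y).trans ?_
    rw [mul_assoc]
    exact mul_le_mul_of_nonneg_right (by linarith) hU0
  have hXT : ∀ y, |m.XT σ s y| ≤ A * (m.γ ^ (-(3 * ν)) * D.besovNorm ν (m.XT σ s)) := by
    intro y
    have := hblock _ subset_rfl y
    rwa [Model.XT, ← D.Ex_eq_sum_block, ← Model.XT] at this
  have hlow : ∀ y, |D.lowPart (m.X σ s) y|
      ≤ A * (m.γ ^ (-(3 * ν)) * D.besovNorm ν (m.XT σ s)) :=
    fun y => hblock _ (Finset.filter_subset _ _) y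
  have hEx : ∀ (g : m.Site → ℝ) (G : ℝ), (∀ k, |g k| ≤ G) → ∀ x,
      |m.Ex g x| ≤ A₁ * m.γ ^ (-κ) * G := h1 m hγ hγ1
  have hpow : ∀ p : ℕ, p + 1 ≤ 5 → |m.Ex (fun k => m.X σ s k ^ (p + 1)) x - m.XT σ s x ^ (p + 1)|
      ≤ A * m.γ ^ (-κ) * ((A * (m.γ ^ (-(3 * ν)) * D.besovNorm ν (m.XT σ s))) ^ p
        * supNorm (D.high m.N (m.XT σ s))) := by
    intro p hp
    refine (D.abs_Ex_pow_sub_pow_le hEx hXT hlow (show p + 1 ≤ 7 by omega) x).trans ?_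
    have hp' : (p : ℝ) + 1 ≤ 5 := by exact_mod_cast hp
    have hH := supNorm_nonneg (D.high m.N (m.XT σ s))
    rw [← Model.XT]
    have e1 : (A₁ * m.γ ^ (-κ) + 1) * ((p : ℝ) + 1) ≤ A * m.γ ^ (-κ) := by
      calc (A₁ * m.γ ^ (-κ) + 1) * ((p : ℝ) + 1)
          ≤ (A₁ * m.γ ^ (-κ) + m.γ ^ (-κ)) * 5 := by gcongr
        _ = (5 * (A₁ + 1)) * m.γ ^ (-κ) := by ring
        _ ≤ A * m.γ ^ (-κ) := by
            gcongr
            linarith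
    have e2 : 0 ≤ (A * (m.γ ^ (-(3 * ν)) * D.besovNorm ν (m.XT σ s))) ^ p
        * supNorm (D.high m.N (m.XT σ s)) := by positivity
    have e3 := mul_le_mul_of_nonneg_right e1 e2
    refine le_trans (le_of_eq ?_) e3
    ring
  refine ⟨fun g G hg => ?_, fun k => ?_, hXT x, hpow 2 (by norm_num), hpow 4 (by norm_num), ?_, ?_,
    ?_, ?_⟩
  · have hG : 0 ≤ G := (abs_nonneg _).trans (hg 0)
    refine (hEx g G hg x).trans ?_
    gcongr
    linarith
  · have := hXT (site m.ε k)
    rwa [Model.XT, m.Ex_eq_mult, m.mult_one_site, ← m.Ex_eq_mult, ← Model.XT] at this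
  · have e1 := h3 m hm hmβ σ s hs hsT x
    rw [show (2 * (1 / 3) : ℝ) = 2 / 3 by norm_num, show (-(1 / 3) : ℝ) = -1 / 3 by norm_num] at e1
    have e2 : 0 ≤ m.γ ^ (2 / 3 : ℝ) * s ^ (-1 / 3 : ℝ) + m.QNorm σ s + |m.EtildeT σ s x| := by
      positivity
    refine e1.trans (le_trans (le_of_eq ?_) (mul_le_mul_of_nonneg_right
      (mul_le_mul_of_nonneg_right (show A₃ ≤ A by linarith) (by linarith)) e2))
    ring
  · have e2 : 0 ≤ m.γ ^ (2 / 3 : ℝ) * s ^ (-1 / 3 : ℝ)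
      + m.QNorm σ s * max 1 (m.QNorm σ s) + |m.EtildeT σ s x| := by positivity
    exact (h4 m hm hmβ σ s hs hsT x).trans (mul_le_mul_of_nonneg_right
      (mul_le_mul_of_nonneg_right (show A₄ ≤ A by linarith) (by linarith)) e2)
  · have e1 := hm.rawConst_nonneg hc
    rw [m.c_eq, hmβ, abs_of_nonneg (by positivity)]
    calc 1 / (4 * βc) * m.rawConst ≤ 1 / (4 * βc) * (A₅ * m.γ ^ (-κ)) := by
          gcongr
          exact h5 m hm
      _ = (1 / (4 * βc) * A₅) * m.γ ^ (-κ) := by ring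
      _ ≤ A * m.γ ^ (-κ) := by
          gcongr
          linarith
  · have hT : 0 < T := by linarith
    have e1 : m.γ ≤ m.γ ^ (2 / 3 : ℝ) := by
      calc m.γ = m.γ ^ (1 : ℝ) := (Real.rpow_one _).symm
        _ ≤ _ := Real.rpow_le_rpow_of_exponent_ge hγ (by linarith) (by norm_num)
    have e2 : 1 ≤ |T| ^ (1 / 3 : ℝ) * s ^ (-1 / 3 : ℝ) := by
      rw [show (-1 / 3 : ℝ) = -(1 / 3) by norm_num, Real.rpow_neg hs.le, ← div_eq_mul_inv,
        le_div_iff₀ (by positivity), one_mul, abs_of_pos hT]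
      gcongr
    have e3 : 0 ≤ m.γ ^ (2 / 3 : ℝ) := by positivity
    calc m.γ ≤ m.γ ^ (2 / 3 : ℝ) * 1 := by linarith
      _ ≤ m.γ ^ (2 / 3 : ℝ) * (|T| ^ (1 / 3 : ℝ) * s ^ (-1 / 3 : ℝ)) := by gcongr
      _ = |T| ^ (1 / 3 : ℝ) * (m.γ ^ (2 / 3 : ℝ) * s ^ (-1 / 3 : ℝ)) := by ring
      _ ≤ _ := by
          gcongr
          linarith

/-! ### The error terms -/

/-- A single term of the error against the common form of the bound. -/
lemma mul_mul_mul_le {c p w g P W G : ℝ} (hc : 0 ≤ c) (hp : 0 ≤ p) (hw : 0 ≤ w) (hg : 0 ≤ g)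
    (hpP : p ≤ P) (hwW : w ≤ W) (hgG : g ≤ G) : c * p * w * g ≤ c * (P * W * G) := by
  rw [mul_assoc, mul_assoc, mul_assoc P]
  have hP : 0 ≤ P := hp.trans hpP
  have hW : 0 ≤ W := hw.trans hwW
  gcongr

namespace FieldBounds

variable {D : DyadicPartition} {m : Model} {σ : ℝ → m.Config} {s : ℝ} {x : Plane} {A P U : ℝ}

/-- The error of the cubic drift. Replacing powers on the lattice by powers on the torus costs the
high frequencies, and the exchange of the renormalisation constants costs `cTime_le`. -/
lemma abs_sub_cubicDrift_le (h : FieldBounds D m σ s x A P U) (hA : 1 ≤ A) (hP : 1 ≤ P)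
    (hU : 0 ≤ U) (hγ : 0 < m.γ) (hγ1 : m.γ < 1) (hs : 0 < s) {W : ℝ} (hW : ∀ j ≤ 7, U ^ j ≤ W)
    {f : m.Site → ℝ} {ac 𝔞₁ b a₃ C K : ℝ} (hC : 0 ≤ C) (hK : 0 ≤ K)
    (hb : -(ac * (4 * ac - 1) * m.βc ^ 3) / (3 * (2 * ac + 1) ^ 2) = -b)
    (hb' : ac * (4 * ac - 1) * m.βc ^ 3 / (2 * ac + 1) ^ 2 = 3 * b)
    (hf : ∀ k, |f k - ((3 * b * m.c + 𝔞₁) * m.X σ s k + a₃ * m.X σ s k ^ 3)|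
      ≤ C * m.γ ^ 2 * |m.X σ s k| ^ 5)
    (ha₃ : |a₃ - -b| ≤ K * m.γ) :
    |m.Ex f x - m.cubicDrift σ ac 𝔞₁ s x|
      ≤ (A ^ 7 * C + (|b| + K) * A ^ 3 + K * A ^ 4 + 3 * |b| * A ^ 2)
        * (P ^ 4 * W * (m.γ ^ (2 / 3 : ℝ) * s ^ (-1 / 3 : ℝ)
          + supNorm (D.high m.N (m.XT σ s)) + m.QNorm σ s + |m.EtildeT σ s x|)) := by
  have hS : 0 ≤ m.γ ^ (2 / 3 : ℝ) * s ^ (-1 / 3 : ℝ) := by positivity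
  have hH := supNorm_nonneg (D.high m.N (m.XT σ s))
  have hq := m.QNorm_nonneg σ s
  have hE := abs_nonneg (m.EtildeT σ s x)
  have hγS := h.γ_le
  have hrem : |m.Ex (fun k => f k - ((3 * b * m.c + 𝔞₁) * m.X σ s k + a₃ * m.X σ s k ^ 3)) x|
      ≤ A * P * (C * m.γ ^ 2 * (A * U) ^ 5) := by
    refine h.Ex_le _ _ fun k => (hf k).trans ?_
    have := h.X_le k
    gcongr
  have hsplit : m.Ex f x
      = m.Ex (fun k => f k - ((3 * b * m.c + 𝔞₁) * m.X σ s k + a₃ * m.X σ s k ^ 3)) x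
        + ((3 * b * m.c + 𝔞₁) * m.XT σ s x + a₃ * m.Ex (fun k => m.X σ s k ^ 3) x) := by
    rw [Model.XT, ← m.Ex_const_mul, ← m.Ex_const_mul, ← m.Ex_add, ← m.Ex_add]
    simp only [sub_add_cancel]
  have herr : m.Ex f x - m.cubicDrift σ ac 𝔞₁ s x
      = m.Ex (fun k => f k - ((3 * b * m.c + 𝔞₁) * m.X σ s k + a₃ * m.X σ s k ^ 3)) x
        + a₃ * (m.Ex (fun k => m.X σ s k ^ 3) x - m.XT σ s x ^ 3)
        + (a₃ - -b) * m.XT σ s x ^ 3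
        + -(3 * b) * (m.cTime σ s x - m.c - cBar m.βc s) * m.XT σ s x := by
    rw [hsplit, Model.cubicDrift, hb, hb']
    ring
  have hcube := h.cube
  have hc := h.cTime_le
  have hXT := h.XT_le
  rw [herr]
  clear herr hsplit
  generalize m.Ex (fun k => f k - ((3 * b * m.c + 𝔞₁) * m.X σ s k + a₃ * m.X σ s k ^ 3)) x = r
    at hrem ⊢
  generalize m.Ex (fun k => m.X σ s k ^ 3) x = X3 at hcube ⊢
  generalize supNorm (D.high m.N (m.XT σ s)) = H at hcube hH ⊢
  generalize m.XT σ s x = X at hcube hXT ⊢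
  generalize m.cTime σ s x - m.c - cBar m.βc s = e at hc ⊢
  generalize m.QNorm σ s = q at hc hq ⊢
  generalize |m.EtildeT σ s x| = E at hc hE ⊢
  generalize m.γ ^ (2 / 3 : ℝ) * s ^ (-1 / 3 : ℝ) = S at hc hγS hS ⊢
  generalize m.γ = γ at hγ hγ1 hrem ha₃ hγS ⊢
  have hA0 : 0 ≤ A := by linarith
  have hP0 : 0 ≤ P := by linarith
  have hP4 : P ≤ P ^ 4 := le_self_pow₀ hP (by norm_num)
  have hP41 : 1 ≤ P ^ 4 := one_le_pow₀ hP
  have hγ2 : γ ^ 2 ≤ A * S := by nlinarith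
  set G := S + H + q + E with hG
  have b₁ : |r| ≤ A ^ 7 * C * (P ^ 4 * W * G) := by
    refine le_trans ?_ (mul_mul_mul_le (p := P) (w := U ^ 5) (g := S) (by positivity) hP0
      (by positivity) hS hP4 (hW 5 (by norm_num)) (by linarith))
    calc |r| ≤ A * P * (C * γ ^ 2 * (A * U) ^ 5) := hrem
      _ ≤ A * P * (C * (A * S) * (A * U) ^ 5) := by gcongr
      _ = _ := by ring
  have hb3 : |a₃| ≤ |b| + K := by
    have e1 := abs_sub_abs_le_abs_sub a₃ (-b)
    rw [abs_neg] at e1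
    have e2 : K * γ ≤ K * 1 := by gcongr
    linarith
  have b₂ : |a₃ * (X3 - X ^ 3)| ≤ (|b| + K) * A ^ 3 * (P ^ 4 * W * G) := by
    refine le_trans ?_ (mul_mul_mul_le (p := P) (w := U ^ 2) (g := H) (by positivity) hP0
      (by positivity) hH hP4 (hW 2 (by norm_num)) (by linarith))
    rw [abs_mul]
    calc |a₃| * |X3 - X ^ 3| ≤ (|b| + K) * (A * P * ((A * U) ^ 2 * H)) := by gcongr
      _ = _ := by ring
  have b₃ : |(a₃ - -b) * X ^ 3| ≤ K * A ^ 4 * (P ^ 4 * W * G) := by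
    refine le_trans ?_ (mul_mul_mul_le (p := 1) (w := U ^ 3) (g := S) (by positivity) zero_le_one
      (by positivity) hS hP41 (hW 3 (by norm_num)) (by linarith))
    rw [abs_mul, abs_pow]
    calc |a₃ - -b| * |X| ^ 3 ≤ (K * (A * S)) * (A * U) ^ 3 := by
          gcongr
          exact ha₃.trans (by gcongr)
      _ = _ := by ring
  have b₄ : |-(3 * b) * e * X| ≤ 3 * |b| * A ^ 2 * (P ^ 4 * W * G) := by
    refine le_trans ?_ (mul_mul_mul_le (p := P) (w := U ^ 1) (g := S + q + E) (by positivity) hP0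
      (by positivity) (by positivity) hP4 (hW 1 (by norm_num)) (by linarith))
    rw [abs_mul, abs_mul, abs_neg, abs_mul, abs_of_pos (zero_lt_three' ℝ)]
    calc 3 * |b| * |e| * |X| ≤ 3 * |b| * (A * P * (S + q + E)) * (A * U) := by gcongr
      _ = _ := by ring
  refine ((abs_add_le _ _).trans (add_le_add ((abs_add_le _ _).trans (add_le_add
    ((abs_add_le _ _).trans (add_le_add b₁ b₂)) b₃)) b₄)).trans (le_of_eq ?_)
  ring

/-- The error of the quintic drift. Here the square of the difference of the constants enters as
well, through `cTime_sq_le`. -/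
lemma abs_sub_quinticDrift_le (h : FieldBounds D m σ s x A P U) (hA : 1 ≤ A) (hP : 1 ≤ P)
    (hU : 0 ≤ U) (hγ : 0 < m.γ) (hγ1 : m.γ < 1) (hs : 0 < s) {W : ℝ} (hW : ∀ j ≤ 7, U ^ j ≤ W)
    {f : m.Site → ℝ} {𝔞₁ 𝔞₃ a₁ a₃ a₅ C K : ℝ} (hC : 0 ≤ C) (hK : 0 ≤ K)
    (hf : ∀ k, |f k - (a₁ * m.X σ s k + a₃ * m.X σ s k ^ 3 + a₅ * m.X σ s k ^ 5)|
      ≤ C * m.γ ^ 2 * |m.X σ s k| ^ 7)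
    (ha₁ : |a₁ - (-27 / 4 * m.c ^ 2 - 3 * 𝔞₃ * m.c + 𝔞₁)| ≤ K * m.γ)
    (ha₃ : |a₃ - (9 / 2 * m.c + 𝔞₃)| ≤ K * m.γ)
    (ha₅ : |a₅ - -9 / 20| ≤ K * m.γ) :
    |m.Ex f x - m.quinticDrift σ 𝔞₁ 𝔞₃ s x|
      ≤ (A ^ 9 * C + K * A ^ 2 + (K + 9 / 2 * A + |𝔞₃|) * A ^ 3 + K * A ^ 4 + (1 + K) * A ^ 5
          + K * A ^ 6 + 9 / 2 * A ^ 4 + (27 / 2 * A + 3 * |𝔞₃|) * A ^ 2 + 27 / 4 * A ^ 2)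
        * (P ^ 4 * W * (m.γ ^ (2 / 3 : ℝ) * s ^ (-1 / 3 : ℝ)
          + supNorm (D.high m.N (m.XT σ s)) + m.QNorm σ s * max 1 (m.QNorm σ s)
          + |m.EtildeT σ s x|)) := by
  have hS : 0 ≤ m.γ ^ (2 / 3 : ℝ) * s ^ (-1 / 3 : ℝ) := by positivity
  have hH := supNorm_nonneg (D.high m.N (m.XT σ s))
  have hq := m.QNorm_nonneg σ s
  have hE := abs_nonneg (m.EtildeT σ s x)
  have hγS := h.γ_le
  set g := fun k => f k - (a₁ * m.X σ s k + a₃ * m.X σ s k ^ 3 + a₅ * m.X σ s k ^ 5) with hg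
  have hrem : |m.Ex g x| ≤ A * P * (C * m.γ ^ 2 * (A * U) ^ 7) := by
    refine h.Ex_le _ _ fun k => (hf k).trans ?_
    have := h.X_le k
    gcongr
  have hsplit : m.Ex f x = m.Ex g x + (a₁ * m.XT σ s x + a₃ * m.Ex (fun k => m.X σ s k ^ 3) x
      + a₅ * m.Ex (fun k => m.X σ s k ^ 5) x) := by
    rw [Model.XT, ← m.Ex_const_mul, ← m.Ex_const_mul, ← m.Ex_const_mul, ← m.Ex_add, ← m.Ex_add,
      ← m.Ex_add]
    simp only [hg, sub_add_cancel]
  have herr : m.Ex f x - m.quinticDrift σ 𝔞₁ 𝔞₃ s x = m.Ex g x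
        + (a₁ - (-27 / 4 * m.c ^ 2 - 3 * 𝔞₃ * m.c + 𝔞₁)) * m.XT σ s x
        + a₃ * (m.Ex (fun k => m.X σ s k ^ 3) x - m.XT σ s x ^ 3)
        + (a₃ - (9 / 2 * m.c + 𝔞₃)) * m.XT σ s x ^ 3
        + a₅ * (m.Ex (fun k => m.X σ s k ^ 5) x - m.XT σ s x ^ 5)
        + (a₅ - -9 / 20) * m.XT σ s x ^ 5
        + -(9 / 2) * (m.cTime σ s x - m.c - cBar m.βc s) * m.XT σ s x ^ 3
        + (m.cTime σ s x - m.c - cBar m.βc s) * (27 / 2 * m.c + 3 * 𝔞₃) * m.XT σ s x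
        + 27 / 4 * (m.cTime σ s x - m.c - cBar m.βc s) ^ 2 * m.XT σ s x := by
    rw [hsplit, Model.quinticDrift]
    ring
  have hcube := h.cube
  have hfifth := h.fifth
  have hc := h.cTime_le
  have hc2 := h.cTime_sq_le
  have hc' := h.c_le
  have hXT := h.XT_le
  rw [herr]
  clear herr hsplit
  generalize m.Ex g x = r at hrem ⊢
  generalize m.Ex (fun k => m.X σ s k ^ 3) x = X3 at hcube ⊢
  generalize m.Ex (fun k => m.X σ s k ^ 5) x = X5 at hfifth ⊢
  generalize supNorm (D.high m.N (m.XT σ s)) = H at hcube hfifth hH ⊢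
  generalize m.XT σ s x = X at hcube hfifth hXT ⊢
  generalize m.cTime σ s x - m.c - cBar m.βc s = e at hc hc2 ⊢
  have hqq : m.QNorm σ s ≤ m.QNorm σ s * max 1 (m.QNorm σ s) :=
    le_mul_of_one_le_right hq (le_max_left _ _)
  generalize m.QNorm σ s * max 1 (m.QNorm σ s) = q₂ at hc2 hqq ⊢
  generalize m.QNorm σ s = q at hc hq hqq ⊢
  generalize |m.EtildeT σ s x| = E at hc hc2 hE ⊢
  generalize m.γ ^ (2 / 3 : ℝ) * s ^ (-1 / 3 : ℝ) = S at hc hc2 hγS hS ⊢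
  generalize m.γ = γ at hγ hγ1 hrem ha₁ ha₃ ha₅ hγS ⊢
  generalize m.c = c at hc' ha₁ ha₃ ⊢
  have hA0 : 0 ≤ A := by linarith
  have hP0 : 0 ≤ P := by linarith
  have hP4 : P ≤ P ^ 4 := le_self_pow₀ hP (by norm_num)
  have hP24 : P ^ 2 ≤ P ^ 4 := pow_le_pow_right₀ hP (by norm_num)
  have hP41 : 1 ≤ P ^ 4 := one_le_pow₀ hP
  have hγ2 : γ ^ 2 ≤ A * S := by nlinarith
  have hKγ : K * γ ≤ K * 1 := by gcongr
  have hKS : K * γ ≤ K * (A * S) := by gcongr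
  set G := S + H + q₂ + E with hG
  have b₁ : |r| ≤ A ^ 9 * C * (P ^ 4 * W * G) := by
    refine le_trans ?_ (mul_mul_mul_le (p := P) (w := U ^ 7) (g := S) (by positivity) hP0
      (by positivity) hS hP4 (hW 7 (by norm_num)) (by linarith))
    calc |r| ≤ A * P * (C * γ ^ 2 * (A * U) ^ 7) := hrem
      _ ≤ A * P * (C * (A * S) * (A * U) ^ 7) := by gcongr
      _ = _ := by ring
  have b₂ : |(a₁ - (-27 / 4 * c ^ 2 - 3 * 𝔞₃ * c + 𝔞₁)) * X| ≤ K * A ^ 2 * (P ^ 4 * W * G) := by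
    refine le_trans ?_ (mul_mul_mul_le (p := 1) (w := U ^ 1) (g := S) (by positivity) zero_le_one
      (by positivity) hS hP41 (hW 1 (by norm_num)) (by linarith))
    rw [abs_mul]
    calc _ ≤ (K * (A * S)) * (A * U) := mul_le_mul (ha₁.trans hKS) hXT (abs_nonneg _) (by positivity)
      _ = _ := by ring
  have hb3 : |a₃| ≤ (K + 9 / 2 * A + |𝔞₃|) * P := by
    have e1 := abs_sub_abs_le_abs_sub a₃ (9 / 2 * c + 𝔞₃)
    have e2 := abs_add_le (9 / 2 * c) 𝔞₃
    rw [abs_mul, abs_of_pos (by norm_num : (0 : ℝ) < 9 / 2)] at e2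
    have e3 : K * 1 ≤ K * P := by gcongr
    have e4 : |𝔞₃| * 1 ≤ |𝔞₃| * P := by gcongr
    linarith
  have b₃ : |a₃ * (X3 - X ^ 3)| ≤ (K + 9 / 2 * A + |𝔞₃|) * A ^ 3 * (P ^ 4 * W * G) := by
    refine le_trans ?_ (mul_mul_mul_le (p := P ^ 2) (w := U ^ 2) (g := H) (by positivity)
      (by positivity) (by positivity) hH hP24 (hW 2 (by norm_num)) (by linarith))
    rw [abs_mul]
    calc |a₃| * |X3 - X ^ 3| ≤ ((K + 9 / 2 * A + |𝔞₃|) * P) * (A * P * ((A * U) ^ 2 * H)) := by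
          gcongr
      _ = _ := by ring
  have b₄ : |(a₃ - (9 / 2 * c + 𝔞₃)) * X ^ 3| ≤ K * A ^ 4 * (P ^ 4 * W * G) := by
    refine le_trans ?_ (mul_mul_mul_le (p := 1) (w := U ^ 3) (g := S) (by positivity) zero_le_one
      (by positivity) hS hP41 (hW 3 (by norm_num)) (by linarith))
    rw [abs_mul, abs_pow]
    calc _ ≤ (K * (A * S)) * (A * U) ^ 3 := mul_le_mul (ha₃.trans hKS)
          (pow_le_pow_left₀ (abs_nonneg _) hXT 3) (by positivity) (by positivity)
      _ = _ := by ring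
  have hb5 : |a₅| ≤ 1 + K := by
    have e1 := abs_sub_abs_le_abs_sub a₅ (-9 / 20)
    have e2 : |(-9 / 20 : ℝ)| = 9 / 20 := by norm_num [abs_div]
    linarith
  have b₅ : |a₅ * (X5 - X ^ 5)| ≤ (1 + K) * A ^ 5 * (P ^ 4 * W * G) := by
    refine le_trans ?_ (mul_mul_mul_le (p := P) (w := U ^ 4) (g := H) (by positivity) hP0
      (by positivity) hH hP4 (hW 4 (by norm_num)) (by linarith))
    rw [abs_mul]
    calc |a₅| * |X5 - X ^ 5| ≤ (1 + K) * (A * P * ((A * U) ^ 4 * H)) := by gcongr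
      _ = _ := by ring
  have b₆ : |(a₅ - -9 / 20) * X ^ 5| ≤ K * A ^ 6 * (P ^ 4 * W * G) := by
    refine le_trans ?_ (mul_mul_mul_le (p := 1) (w := U ^ 5) (g := S) (by positivity) zero_le_one
      (by positivity) hS hP41 (hW 5 (by norm_num)) (by linarith))
    rw [abs_mul, abs_pow]
    calc _ ≤ (K * (A * S)) * (A * U) ^ 5 := mul_le_mul (ha₅.trans hKS)
          (pow_le_pow_left₀ (abs_nonneg _) hXT 5) (by positivity) (by positivity)
      _ = _ := by ring
  have b₇ : |-(9 / 2) * e * X ^ 3| ≤ 9 / 2 * A ^ 4 * (P ^ 4 * W * G) := by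
    refine le_trans ?_ (mul_mul_mul_le (p := P) (w := U ^ 3) (g := S + q + E) (by positivity) hP0
      (by positivity) (by positivity) hP4 (hW 3 (by norm_num)) (by linarith))
    rw [abs_mul, abs_mul, abs_neg, abs_of_pos (by norm_num : (0 : ℝ) < 9 / 2), abs_pow]
    calc 9 / 2 * |e| * |X| ^ 3 ≤ 9 / 2 * (A * P * (S + q + E)) * (A * U) ^ 3 := by gcongr
      _ = _ := by ring
  have hb8 : |27 / 2 * c + 3 * 𝔞₃| ≤ (27 / 2 * A + 3 * |𝔞₃|) * P := by
    have e2 := abs_add_le (27 / 2 * c) (3 * 𝔞₃)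
    rw [abs_mul, abs_mul, abs_of_pos (by norm_num : (0 : ℝ) < 27 / 2),
      abs_of_pos (zero_lt_three' ℝ)] at e2
    have e4 : |𝔞₃| * 1 ≤ |𝔞₃| * P := by gcongr
    linarith
  have b₈ : |e * (27 / 2 * c + 3 * 𝔞₃) * X|
      ≤ (27 / 2 * A + 3 * |𝔞₃|) * A ^ 2 * (P ^ 4 * W * G) := by
    refine le_trans ?_ (mul_mul_mul_le (p := P ^ 2) (w := U ^ 1) (g := S + q + E) (by positivity)
      (by positivity) (by positivity) (by positivity) hP24 (hW 1 (by norm_num)) (by linarith))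
    rw [abs_mul, abs_mul]
    calc |e| * |27 / 2 * c + 3 * 𝔞₃| * |X|
        ≤ (A * P * (S + q + E)) * ((27 / 2 * A + 3 * |𝔞₃|) * P) * (A * U) := by gcongr
      _ = _ := by ring
  have hq₂ : 0 ≤ q₂ := hq.trans hqq
  have b₉ : |27 / 4 * e ^ 2 * X| ≤ 27 / 4 * A ^ 2 * (P ^ 4 * W * G) := by
    refine le_trans ?_ (mul_mul_mul_le (p := P) (w := U ^ 1) (g := S + q₂ + E) (by positivity) hP0
      (by positivity) (by positivity) hP4 (hW 1 (by norm_num)) (by linarith))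
    rw [abs_mul, abs_of_nonneg (by positivity : 0 ≤ 27 / 4 * e ^ 2)]
    calc 27 / 4 * e ^ 2 * |X| ≤ 27 / 4 * (A * P * (S + q₂ + E)) * (A * U) := by gcongr
      _ = _ := by ring
  have hsum := (abs_add_le _ _).trans (add_le_add ((abs_add_le _ _).trans (add_le_add
    ((abs_add_le _ _).trans (add_le_add ((abs_add_le _ _).trans (add_le_add
    ((abs_add_le _ _).trans (add_le_add ((abs_add_le _ _).trans (add_le_add
    ((abs_add_le _ _).trans (add_le_add ((abs_add_le _ _).trans (add_le_add b₁ b₂)) b₃)) b₄)) b₅))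
    b₆)) b₇)) b₈)) b₉)
  refine hsum.trans (le_of_eq ?_)
  ring

end FieldBounds

/-! ### Passage to the limit along a family of models -/

lemma tendsto_kacLimit {𝔎 : Plane → ℝ} {m : ℝ → Model} (h𝔎 : ∀ γ, (m γ).𝔎 = 𝔎)
    (hγ : ∀ γ, (m γ).γ = γ) : Tendsto m (𝓝[>] 0) (kacLimit 𝔎) := by
  refine tendsto_inf.2 ⟨tendsto_comap_iff.2 ?_, tendsto_principal.2 (Eventually.of_forall h𝔎)⟩
  have : Model.γ ∘ m = id := funext hγ
  rw [this]
  exact tendsto_id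

lemma exists_forall_of_eventually {p : ℝ → Prop} (h : ∀ᶠ γ in 𝓝[>] 0, p γ) :
    ∃ γ₀ : ℝ, 0 < γ₀ ∧ ∀ γ, 0 < γ → γ < γ₀ → p γ := by
  obtain ⟨u, hu, h⟩ := mem_nhdsGT_iff_exists_Ioo_subset.1 h
  exact ⟨u, hu, fun γ h0 h1 => h ⟨h0, h1⟩⟩

/-- Every power of the field that occurs is at most the seventh, which costs
`γ ^ (-21ν) ≤ γ ^ (-30ν)`. -/
lemma pow_mul_rpow_le {γ ν B : ℝ} (hγ : 0 < γ) (hγ1 : γ < 1) (hν : 0 < ν) (hB : 0 ≤ B) {j : ℕ}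
    (hj : j ≤ 7) : (γ ^ (-(3 * ν)) * B) ^ j ≤ γ ^ (-30 * ν) * (B ^ 7 + 1) := by
  rw [mul_pow, ← Real.rpow_natCast, ← Real.rpow_mul hγ.le]
  have hj' : (j : ℝ) ≤ 7 := by exact_mod_cast hj
  gcongr ?_ * ?_
  · exact Real.rpow_le_rpow_of_exponent_ge hγ hγ1.le (by nlinarith)
  · rcases le_total B 1 with h | h
    · have h1 := pow_le_one₀ hB h (n := j)
      have : 0 ≤ B ^ 7 := by positivity
      linarith
    · have := pow_le_pow_right₀ h hj
      linarith

lemma IsPeriodic.comp₂ {f g : Plane → ℝ} (hf : IsPeriodic f) (hg : IsPeriodic g)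
    (Φ : ℝ → ℝ → ℝ) : IsPeriodic fun x => Φ (f x) (g x) := by
  intro x w
  simp only [hf x w, hg x w]

namespace Model

variable (m : Model)

lemma continuous_Ex (f : m.Site → ℝ) : Continuous (m.Ex f) := by
  rw [Ex_eq_mult]
  exact m.continuous_mult _ f

lemma isPeriodic_Ex (f : m.Site → ℝ) : IsPeriodic (m.Ex f) := by
  rw [Ex_eq_mult]
  exact m.isPeriodic_mult _ f

variable (σ : ℝ → m.Config)

lemma continuous_cubicDrift (ac 𝔞₁ s : ℝ) : Continuous (m.cubicDrift σ ac 𝔞₁ s) := by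
  have h1 : Continuous (m.XT σ s) := m.continuous_Ex _
  have h2 : Continuous (m.cTime σ s) := m.continuous_Ex _
  unfold cubicDrift
  fun_prop

lemma isPeriodic_cubicDrift (ac 𝔞₁ s : ℝ) : IsPeriodic (m.cubicDrift σ ac 𝔞₁ s) :=
  IsPeriodic.comp₂ (m.isPeriodic_Ex _ : IsPeriodic (m.XT σ s)) (m.isPeriodic_Ex _)
    fun X c => (-(ac * (4 * ac - 1) * m.βc ^ 3) / (3 * (2 * ac + 1) ^ 2)) * (X ^ 3 - 3 * c * X)
      + (𝔞₁ - ac * (4 * ac - 1) * m.βc ^ 3 / (2 * ac + 1) ^ 2 * cBar m.βc s) * X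

lemma continuous_quinticDrift (𝔞₁ 𝔞₃ s : ℝ) : Continuous (m.quinticDrift σ 𝔞₁ 𝔞₃ s) := by
  have h1 : Continuous (m.XT σ s) := m.continuous_Ex _
  have h2 : Continuous (m.cTime σ s) := m.continuous_Ex _
  unfold quinticDrift
  fun_prop

lemma isPeriodic_quinticDrift (𝔞₁ 𝔞₃ s : ℝ) : IsPeriodic (m.quinticDrift σ 𝔞₁ 𝔞₃ s) :=
  IsPeriodic.comp₂ (m.isPeriodic_Ex _ : IsPeriodic (m.XT σ s)) (m.isPeriodic_Ex _)
    fun X c => (-9 / 20) * (X ^ 5 - 10 * c * X ^ 3 + 15 * c ^ 2 * X)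
      + (𝔞₃ - 9 / 2 * cBar m.βc s) * (X ^ 3 - 3 * c * X)
      + (𝔞₁ + 3 * 𝔞₃ * cBar m.βc s - 27 / 4 * cBar m.βc s ^ 2) * X

end Model

/-- The renormalisation constant diverges slower than any power. -/
lemma exists_abs_c_le {𝔎 : Plane → ℝ} (h𝔎 : IsKacProfile 𝔎) {βc : ℝ} (hβ : 0 < βc) {m : ℝ → Model}
    (hm𝔎 : ∀ γ, (m γ).𝔎 = 𝔎) (hmγ : ∀ γ, (m γ).γ = γ) (hmβ : ∀ γ, (m γ).βc = βc) {κ : ℝ}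
    (hκ : 0 < κ) : ∃ K, 0 ≤ K ∧ ∀ᶠ γ in 𝓝[>] 0, |(m γ).c| ≤ K * γ ^ (-κ) := by
  obtain ⟨c, C, hc, hc1, hC, h⟩ := Model.exists_symbolBounds h𝔎
  obtain ⟨A, hA, h1⟩ := Model.exists_rawConst_le hc C hκ
  refine ⟨1 / (4 * βc) * A, by positivity, ?_⟩
  filter_upwards [(tendsto_kacLimit hm𝔎 hmγ).eventually h] with γ hγ
  have e1 := hγ.rawConst_nonneg hc
  have e2 := h1 _ hγ
  rw [hmγ] at e2
  rw [Model.c_eq, hmβ, abs_of_nonneg (by positivity), mul_assoc]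
  gcongr

/-! ### The two scaling regimes -/

lemma exists_fieldBounds_eventually (D : DyadicPartition) {𝔎 : Plane → ℝ} (h𝔎 : IsKacProfile 𝔎)
    {βc : ℝ} (hβ : 0 < βc) {m : ℝ → Model} (hm𝔎 : ∀ γ, (m γ).𝔎 = 𝔎) (hmγ : ∀ γ, (m γ).γ = γ)
    (hmβ : ∀ γ, (m γ).βc = βc) {ν κ T : ℝ} (hν : 0 < ν) (hκ : 0 < κ) :
    ∃ A, 1 ≤ A ∧ ∀ᶠ γ in 𝓝[>] 0, γ < 1 ∧ (m γ).mass ≠ 0 ∧ ∀ (σ : ℝ → (m γ).Config) s, 0 < s →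
      s ≤ T → ∀ x, FieldBounds D (m γ) σ s x A (γ ^ (-κ))
        (γ ^ (-(3 * ν)) * D.besovNorm ν ((m γ).XT σ s)) := by
  obtain ⟨c, C, hc, hc1, hC, h⟩ := Model.exists_symbolBounds h𝔎
  obtain ⟨A, hA, h1⟩ := exists_fieldBounds D hc hc1 hC hβ T hν hκ
  refine ⟨A, hA, ?_⟩
  filter_upwards [(tendsto_kacLimit hm𝔎 hmγ).eventually h] with γ hγ
  have h2 := hγ.γ_lt
  have h3 := h1 (m γ) hγ (hmβ γ)
  rw [hmγ] at h2 h3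
  exact ⟨by linarith, by linarith [hγ.mass], h3⟩

/-- The extended drift of the local field minus the cubic nonlinearity obeys the error bound in the
first scaling regime. -/
theorem exists_cubic_error (𝔎 : Plane → ℝ) (h𝔎 : IsKacProfile 𝔎) (D : DyadicPartition)
    (ac βc 𝔞₁ : ℝ) (β θ : ℝ → ℝ) (m : ℝ → Model)
    (hm : ∀ γ, m γ = ⟨.first, 𝔎, βc, γ, β γ, θ γ⟩) (hac : 0 < ac)
    (hcrit : 2 * ac / (2 * ac + 1) * βc - 1 = 0)
    (ha : (fun γ => Real.exp (θ γ) - ac) =O[𝓝[>] 0] (fun γ => γ ^ 2))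
    (hβ : ∀ᶠ γ in 𝓝[>] 0, 2 * Real.exp (θ γ) / (2 * Real.exp (θ γ) + 1) * β γ - 1
      = γ ^ 2 * (ac * (4 * ac - 1) / (2 * ac + 1) ^ 2 * βc ^ 3 * (m γ).c + 𝔞₁))
    {ν κ : ℝ} (T : ℝ) (hν : 0 < ν) (hκ : 0 < κ) : ∃ C γ₀ : ℝ, 0 < γ₀ ∧ ∀ γ, 0 < γ → γ < γ₀ →
      ∀ (σ : ℝ → (m γ).Config) s, 0 < s → s ≤ T → ∀ x,
        |(m γ).Ex ((m γ).drift (σ (s / (m γ).α))) x - (m γ).cubicDrift σ ac 𝔞₁ s x| ≤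
          C * γ ^ (-30 * ν - κ) * (D.besovNorm ν ((m γ).XT σ s) ^ 7 + 1)
            * (γ ^ (2 / 3 : ℝ) * s ^ (-1 / 3 : ℝ)
              + supNorm (D.high (m γ).N ((m γ).XT σ s)) + (m γ).QNorm σ s
              + |(m γ).EtildeT σ s x|) := by
  have hm𝔎 : ∀ γ, (m γ).𝔎 = 𝔎 := fun γ => by rw [hm]
  have hmγ : ∀ γ, (m γ).γ = γ := fun γ => by rw [hm]
  have hmβc : ∀ γ, (m γ).βc = βc := fun γ => by rw [hm]
  have hmβ : ∀ γ, (m γ).β = β γ := fun γ => by rw [hm]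
  have hmθ : ∀ γ, (m γ).θ = θ γ := fun γ => by rw [hm]
  have hmα : ∀ γ, (m γ).α = γ ^ 2 := fun γ => by rw [hm]; rfl
  have hβc : 0 < βc := by
    have h1 : 0 < 2 * ac / (2 * ac + 1) := by positivity
    by_contra! h
    have := mul_nonpos_of_nonneg_of_nonpos h1.le h
    linarith
  have hc : (fun γ => γ * (m γ).c) =O[𝓝[>] 0] fun _ => (1 : ℝ) := by
    obtain ⟨K, hK, h⟩ := exists_abs_c_le h𝔎 hβc hm𝔎 hmγ hmβc zero_lt_one
    refine IsBigO.of_bound K ?_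
    filter_upwards [h, self_mem_nhdsWithin] with γ hγ h0
    have h0' : 0 < γ := h0
    rw [Real.rpow_neg_one] at hγ
    rw [norm_one, mul_one, norm_mul, Real.norm_of_nonneg h0'.le, Real.norm_eq_abs]
    calc γ * |(m γ).c| ≤ γ * (K * γ⁻¹) := by gcongr
      _ = K := by field_simp
  obtain ⟨K, hK, hcoeff⟩ := exists_cubic_coeff_le hac hcrit (fun γ => Real.exp_pos (θ γ)) ha hβ hc
  obtain ⟨C, hC, htaylor⟩ := Model.exists_abs_drift_sub_le_five K K
  obtain ⟨A, hA, hfield⟩ := exists_fieldBounds_eventually D h𝔎 hβc hm𝔎 hmγ hmβc (T := T) hν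
    (show 0 < κ / 4 by linarith)
  obtain ⟨γ₀, hγ₀, hall⟩ := exists_forall_of_eventually (hcoeff.and (hfield.and hβ))
  set b := ac * (4 * ac - 1) * βc ^ 3 / (3 * (2 * ac + 1) ^ 2) with hb
  refine ⟨A ^ 7 * C + (|b| + K) * A ^ 3 + K * A ^ 4 + 3 * |b| * A ^ 2, γ₀, hγ₀, ?_⟩
  intro γ hγ hγlt σ s hs hsT x
  obtain ⟨⟨haK, hβK, ha₃⟩, ⟨hγ1, hmass, hF⟩, hβγ⟩ := hall γ hγ hγlt
  have hP1 : 1 ≤ γ ^ (-(κ / 4)) :=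
    Real.one_le_rpow_of_pos_of_le_one_of_nonpos hγ hγ1.le (by linarith)
  have hB := D.besovNorm_nonneg ν ((m γ).XT σ s)
  have hdrift := htaylor (m γ) (by rw [hmγ]; exact hγ) (by rw [hmθ]; exact haK)
    (by rw [hmβ]; exact hβK) hmass (by rw [hm𝔎]; exact h𝔎) σ s
  have hlin : (γ ^ 2)⁻¹ * (coeffOne (Real.exp (θ γ)) * β γ - 1) = 3 * b * (m γ).c + 𝔞₁ := by
    have e1 : coeffOne (Real.exp (θ γ)) * β γ - 1
        = γ ^ 2 * (ac * (4 * ac - 1) / (2 * ac + 1) ^ 2 * βc ^ 3 * (m γ).c + 𝔞₁) := by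
      rw [← hβγ, coeffOne, add_comm (1 : ℝ)]
    rw [e1, hb]
    field_simp
  have hf : ∀ k, |(m γ).drift (σ (s / (m γ).α)) k - ((3 * b * (m γ).c + 𝔞₁) * (m γ).X σ s k
      + coeffThree (Real.exp (θ γ)) * β γ ^ 3 * (m γ).X σ s k ^ 3)|
      ≤ C * (m γ).γ ^ 2 * |(m γ).X σ s k| ^ 5 := by
    intro k
    have e1 := hdrift k
    have e2 : (γ ^ 2)⁻¹ * γ ^ 2 = 1 := by field_simp
    have e3 : (γ ^ 2)⁻¹ * γ ^ 4 = γ ^ 2 := by field_simp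
    have e4 : ((m γ).α)⁻¹ = (γ ^ 2)⁻¹ := by rw [hmα]
    rw [e4, hmγ, hmθ, hmβ, e2, e3, hlin, one_mul] at e1
    rw [hmγ]
    exact e1
  have hmain := (hF σ s hs hsT x).abs_sub_cubicDrift_le hA hP1 (by positivity)
    (by rw [hmγ]; exact hγ) (by rw [hmγ]; exact hγ1) hs
    (W := γ ^ (-30 * ν) * (D.besovNorm ν ((m γ).XT σ s) ^ 7 + 1))
    (fun j hj => pow_mul_rpow_le hγ hγ1 hν hB hj) (ac := ac) (b := b) hC hK
    (by rw [hmβc, hb, neg_div]) (by rw [hmβc, hb]; field_simp) hf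
    (by
      rw [hmγ, hb, ← neg_div]
      exact ha₃)
  refine hmain.trans (le_of_eq ?_)
  have e5 : γ ^ (-30 * ν - κ) = (γ ^ (-(κ / 4))) ^ 4 * γ ^ (-30 * ν) := by
    rw [← Real.rpow_natCast, ← Real.rpow_mul hγ.le, ← Real.rpow_add hγ]
    congr 1
    push_cast
    ring
  rw [e5, hmγ]
  ring

/-- The extended drift of the local field minus the quintic nonlinearity obeys the error bound in
the second scaling regime. -/
theorem exists_quintic_error (𝔎 : Plane → ℝ) (h𝔎 : IsKacProfile 𝔎) (D : DyadicPartition)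
    (𝔞₁ 𝔞₃ : ℝ) (β θ : ℝ → ℝ) (m : ℝ → Model)
    (hm : ∀ γ, m γ = ⟨.second, 𝔎, 3, γ, β γ, θ γ⟩)
    (ha : (fun γ => Real.exp (θ γ) -
      (1 / 4 - γ ^ 2 * (9 / 8 * (m γ).c + 𝔞₃ / 4)
        + 5 / 48 * γ ^ 4 * (81 * (m γ).c ^ 2 + 36 * (m γ).c * 𝔞₃ + 4 * 𝔞₃ ^ 2)))
      =O[𝓝[>] 0] (fun γ => γ ^ 5))
    (hβ : (fun γ => β γ -
      (3 + γ ^ 2 * (9 * (m γ).c + 2 * 𝔞₃)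
        + γ ^ 4 * (-(189 / 4) * (m γ).c ^ 2 + 3 * 𝔞₁ - 21 * (m γ).c * 𝔞₃ - 4 / 3 * 𝔞₃ ^ 2)))
      =O[𝓝[>] 0] (fun γ => γ ^ 5))
    {ν κ : ℝ} (T : ℝ) (hν : 0 < ν) (hκ : 0 < κ) : ∃ C γ₀ : ℝ, 0 < γ₀ ∧ ∀ γ, 0 < γ → γ < γ₀ →
      ∀ (σ : ℝ → (m γ).Config) s, 0 < s → s ≤ T → ∀ x,
        |(m γ).Ex ((m γ).drift (σ (s / (m γ).α))) x - (m γ).quinticDrift σ 𝔞₁ 𝔞₃ s x| ≤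
          C * γ ^ (-30 * ν - κ) * (D.besovNorm ν ((m γ).XT σ s) ^ 7 + 1)
            * (γ ^ (2 / 3 : ℝ) * s ^ (-1 / 3 : ℝ)
              + supNorm (D.high (m γ).N ((m γ).XT σ s))
              + (m γ).QNorm σ s * max 1 ((m γ).QNorm σ s)
              + |(m γ).EtildeT σ s x|) := by
  have hm𝔎 : ∀ γ, (m γ).𝔎 = 𝔎 := fun γ => by rw [hm]
  have hmγ : ∀ γ, (m γ).γ = γ := fun γ => by rw [hm]
  have hmβc : ∀ γ, (m γ).βc = 3 := fun γ => by rw [hm]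
  have hmβ : ∀ γ, (m γ).β = β γ := fun γ => by rw [hm]
  have hmθ : ∀ γ, (m γ).θ = θ γ := fun γ => by rw [hm]
  have hmα : ∀ γ, (m γ).α = γ ^ 4 := fun γ => by rw [hm]; rfl
  obtain ⟨K, hK, hcoeff⟩ := exists_quintic_coeff_le (fun γ => Real.exp_pos (θ γ)) ha hβ
    (exists_abs_c_le h𝔎 zero_lt_three hm𝔎 hmγ hmβc (κ := 1 / 3) (by norm_num))
  obtain ⟨C, hC, htaylor⟩ := Model.exists_abs_drift_sub_le_seven K K
  obtain ⟨A, hA, hfield⟩ := exists_fieldBounds_eventually D h𝔎 zero_lt_three hm𝔎 hmγ hmβc (T := T)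
    hν (show 0 < κ / 4 by linarith)
  obtain ⟨γ₀, hγ₀, hall⟩ := exists_forall_of_eventually (hcoeff.and hfield)
  refine ⟨A ^ 9 * C + K * A ^ 2 + (K + 9 / 2 * A + |𝔞₃|) * A ^ 3 + K * A ^ 4 + (1 + K) * A ^ 5
    + K * A ^ 6 + 9 / 2 * A ^ 4 + (27 / 2 * A + 3 * |𝔞₃|) * A ^ 2 + 27 / 4 * A ^ 2, γ₀, hγ₀, ?_⟩
  intro γ hγ hγlt σ s hs hsT x
  obtain ⟨⟨haK, hβK, ha₁, ha₃, ha₅⟩, hγ1, hmass, hF⟩ := hall γ hγ hγlt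
  have hP1 : 1 ≤ γ ^ (-(κ / 4)) :=
    Real.one_le_rpow_of_pos_of_le_one_of_nonpos hγ hγ1.le (by linarith)
  have hB := D.besovNorm_nonneg ν ((m γ).XT σ s)
  have hdrift := htaylor (m γ) (by rw [hmγ]; exact hγ) (by rw [hmθ]; exact haK)
    (by rw [hmβ]; exact hβK) hmass (by rw [hm𝔎]; exact h𝔎) σ s
  have hf : ∀ k, |(m γ).drift (σ (s / (m γ).α)) k
      - ((γ ^ 4)⁻¹ * (coeffOne (Real.exp (θ γ)) * β γ - 1) * (m γ).X σ s k
        + (γ ^ 4)⁻¹ * γ ^ 2 * (coeffThree (Real.exp (θ γ)) * β γ ^ 3) * (m γ).X σ s k ^ 3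
        + coeffFive (Real.exp (θ γ)) * β γ ^ 5 * (m γ).X σ s k ^ 5)|
      ≤ C * (m γ).γ ^ 2 * |(m γ).X σ s k| ^ 7 := by
    intro k
    have e1 := hdrift k
    have e2 : (γ ^ 4)⁻¹ * γ ^ 4 = 1 := by field_simp
    have e3 : (γ ^ 4)⁻¹ * γ ^ 6 = γ ^ 2 := by field_simp
    have e4 : ((m γ).α)⁻¹ = (γ ^ 4)⁻¹ := by rw [hmα]
    rw [e4, hmγ, hmθ, hmβ, e2, e3, one_mul] at e1
    rw [hmγ]
    exact e1
  have hmain := (hF σ s hs hsT x).abs_sub_quinticDrift_le hA hP1 (by positivity)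
    (by rw [hmγ]; exact hγ) (by rw [hmγ]; exact hγ1) hs
    (W := γ ^ (-30 * ν) * (D.besovNorm ν ((m γ).XT σ s) ^ 7 + 1))
    (fun j hj => pow_mul_rpow_le hγ hγ1 hν hB hj) hC hK hf
    (by rw [hmγ]; exact ha₁) (by rw [hmγ]; exact ha₃) (by rw [hmγ]; exact ha₅)
  refine hmain.trans (le_of_eq ?_)
  have e5 : γ ^ (-30 * ν - κ) = (γ ^ (-(κ / 4))) ^ 4 * γ ^ (-30 * ν) := by
    rw [← Real.rpow_natCast, ← Real.rpow_mul hγ.le, ← Real.rpow_add hγ]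
    congr 1
    push_cast
    ring
  rw [e5, hmγ]
  ring

end BlumeCapel

theorem lemma4p6 (𝔎 : BlumeCapel.Plane → ℝ) (h𝔎 : BlumeCapel.IsKacProfile 𝔎)
    (D : BlumeCapel.DyadicPartition) :
    -- first scaling regime
    (∀ (ac βc 𝔞₁ : ℝ) (β θ : ℝ → ℝ) (m : ℝ → BlumeCapel.Model),
      (∀ γ, m γ = ⟨.first, 𝔎, βc, γ, β γ, θ γ⟩) →
      0 < ac → 2 * ac / (2 * ac + 1) * βc - 1 = 0 →
      (fun γ => Real.exp (θ γ) - ac) =O[𝓝[>] 0] (fun γ => γ ^ 2) →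
      (∀ᶠ γ in 𝓝[>] 0, 2 * Real.exp (θ γ) / (2 * Real.exp (θ γ) + 1) * β γ - 1
        = γ ^ 2 * (ac * (4 * ac - 1) / (2 * ac + 1) ^ 2 * βc ^ 3 * (m γ).c + 𝔞₁)) →
      ∃ Err : (γ : ℝ) → (ℝ → (m γ).Config) → ℝ → BlumeCapel.Plane → ℝ,
        (∀ γ, 0 < γ → γ < 1 / 3 →
          ∀ (Ω : Type*) [MeasurableSpace Ω] (P : Measure Ω) [IsProbabilityMeasure P]
            (σ : ℝ → Ω → (m γ).Config), (m γ).IsGlauber P σ → ∀ ω,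
            (m γ).MildEquation (fun t => σ t ω)
              ((m γ).cubicDrift (fun t => σ t ω) ac 𝔞₁)
              (Err γ (fun t => σ t ω))) ∧
        ∀ ν κ T : ℝ, 0 < ν → ν < 1 / 2 → 0 < κ → 0 < T → ∃ C γ₀ : ℝ, 0 < γ₀ ∧
          ∀ γ, 0 < γ → γ < γ₀ →
          ∀ (Ω : Type*) [MeasurableSpace Ω] (P : Measure Ω) [IsProbabilityMeasure P]
            (σ : ℝ → Ω → (m γ).Config), (m γ).IsGlauber P σ → ∀ ω,
          ∀ s, 0 < s → s ≤ T → ∀ x,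
            |Err γ (fun t => σ t ω) s x| ≤
              C * γ ^ (-30 * ν - κ) * (D.besovNorm ν ((m γ).XT (fun t => σ t ω) s) ^ 7 + 1)
              * (γ ^ (2 / 3 : ℝ) * s ^ (-1 / 3 : ℝ)
                + BlumeCapel.supNorm (D.high (m γ).N ((m γ).XT (fun t => σ t ω) s))
                + (m γ).QNorm (fun t => σ t ω) s
                + |(m γ).EtildeT (fun t => σ t ω) s x|)) ∧
    -- second scaling regime
    (∀ (𝔞₁ 𝔞₃ : ℝ) (β θ : ℝ → ℝ) (m : ℝ → BlumeCapel.Model),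
      (∀ γ, m γ = ⟨.second, 𝔎, 3, γ, β γ, θ γ⟩) →
      (fun γ => Real.exp (θ γ) -
          (1 / 4 - γ ^ 2 * (9 / 8 * (m γ).c + 𝔞₃ / 4)
            + 5 / 48 * γ ^ 4 * (81 * (m γ).c ^ 2 + 36 * (m γ).c * 𝔞₃ + 4 * 𝔞₃ ^ 2)))
        =O[𝓝[>] 0] (fun γ => γ ^ 5) →
      (fun γ => β γ -
          (3 + γ ^ 2 * (9 * (m γ).c + 2 * 𝔞₃)
            + γ ^ 4 * (-(189 / 4) * (m γ).c ^ 2 + 3 * 𝔞₁ - 21 * (m γ).c * 𝔞₃ - 4 / 3 * 𝔞₃ ^ 2)))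
        =O[𝓝[>] 0] (fun γ => γ ^ 5) →
      ∃ Err : (γ : ℝ) → (ℝ → (m γ).Config) → ℝ → BlumeCapel.Plane → ℝ,
        (∀ γ, 0 < γ → γ < 1 / 3 →
          ∀ (Ω : Type*) [MeasurableSpace Ω] (P : Measure Ω) [IsProbabilityMeasure P]
            (σ : ℝ → Ω → (m γ).Config), (m γ).IsGlauber P σ → ∀ ω,
            (m γ).MildEquation (fun t => σ t ω)
              ((m γ).quinticDrift (fun t => σ t ω) 𝔞₁ 𝔞₃)
              (Err γ (fun t => σ t ω))) ∧
        ∀ ν κ T : ℝ, 0 < ν → ν < 1 / 2 → 0 < κ → 0 < T → ∃ C γ₀ : ℝ, 0 < γ₀ ∧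
          ∀ γ, 0 < γ → γ < γ₀ →
          ∀ (Ω : Type*) [MeasurableSpace Ω] (P : Measure Ω) [IsProbabilityMeasure P]
            (σ : ℝ → Ω → (m γ).Config), (m γ).IsGlauber P σ → ∀ ω,
          ∀ s, 0 < s → s ≤ T → ∀ x,
            |Err γ (fun t => σ t ω) s x| ≤
              C * γ ^ (-30 * ν - κ) * (D.besovNorm ν ((m γ).XT (fun t => σ t ω) s) ^ 7 + 1)
              * (γ ^ (2 / 3 : ℝ) * s ^ (-1 / 3 : ℝ)
                + BlumeCapel.supNorm (D.high (m γ).N ((m γ).XT (fun t => σ t ω) s))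
                + (m γ).QNorm (fun t => σ t ω) s * max 1 ((m γ).QNorm (fun t => σ t ω) s)
                + |(m γ).EtildeT (fun t => σ t ω) s x|)) := by
  have hκ : ∀ m : BlumeCapel.Model, m.𝔎 = 𝔎 → ∀ k, m.κ (-k) = m.κ k := by
    intro m hm
    exact m.κ_neg (hm ▸ h𝔎.radial)
  constructor
  · intro ac βc 𝔞₁ β θ m hm hac hcrit ha hβ
    have hm𝔎 : ∀ γ, (m γ).𝔎 = 𝔎 := fun γ => by rw [hm]
    have hmγ : ∀ γ, (m γ).γ = γ := fun γ => by rw [hm]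
    refine ⟨fun γ σ s x => (m γ).Ex ((m γ).drift (σ (s / (m γ).α))) x
      - (m γ).cubicDrift σ ac 𝔞₁ s x, ?_, ?_⟩
    · intro γ hγ _ Ω _ P _ σ hσ ω
      exact BlumeCapel.Model.mildEquation (hσ.isStepPath ω)
        (BlumeCapel.Model.α_pos (by rw [hmγ]; exact hγ)) (hκ _ (hm𝔎 γ))
        (fun s => (m γ).continuous_cubicDrift _ ac 𝔞₁ s)
        (fun s => (m γ).isPeriodic_cubicDrift _ ac 𝔞₁ s)
    · intro ν κ T hν _ hκ _
      obtain ⟨C, γ₀, hγ₀, h⟩ := BlumeCapel.exists_cubic_error 𝔎 h𝔎 D ac βc 𝔞₁ β θ m hm hac hcrit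
        ha hβ T hν hκ
      exact ⟨C, γ₀, hγ₀, fun γ h0 h1 Ω _ P _ σ _ ω => h γ h0 h1 fun t => σ t ω⟩
  · intro 𝔞₁ 𝔞₃ β θ m hm ha hβ
    have hm𝔎 : ∀ γ, (m γ).𝔎 = 𝔎 := fun γ => by rw [hm]
    have hmγ : ∀ γ, (m γ).γ = γ := fun γ => by rw [hm]
    refine ⟨fun γ σ s x => (m γ).Ex ((m γ).drift (σ (s / (m γ).α))) x
      - (m γ).quinticDrift σ 𝔞₁ 𝔞₃ s x, ?_, ?_⟩
    · intro γ hγ _ Ω _ P _ σ hσ ω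
      exact BlumeCapel.Model.mildEquation (hσ.isStepPath ω)
        (BlumeCapel.Model.α_pos (by rw [hmγ]; exact hγ)) (hκ _ (hm𝔎 γ))
        (fun s => (m γ).continuous_quinticDrift _ 𝔞₁ 𝔞₃ s)
        (fun s => (m γ).isPeriodic_quinticDrift _ 𝔞₁ 𝔞₃ s)
    · intro ν κ T hν _ hκ _
      obtain ⟨C, γ₀, hγ₀, h⟩ := BlumeCapel.exists_quintic_error 𝔎 h𝔎 D 𝔞₁ 𝔞₃ β θ m hm ha hβ T
        hν hκ
      exact ⟨C, γ₀, hγ₀, fun γ h0 h1 Ω _ P _ σ _ ω => h γ h0 h1 fun t => σ t ω⟩
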